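/- **Notation.** For $|q|,|r|<1$ put $(x;q)=\prod_{j\ge0}(1-xq^j)$ and $(x;q,r)=\prod_{j,k\ge0}(1-xq^jr^k)$, and extend these to $|q|\neq1\neq|r|$ by $(x;q^{-1})=1/(qx;q)$, $(x;q^{-1},r)=1/(qx;q,r)$, $(x;q,r^{-1})=1/(rx;q,r)$. With $x=e^{2\pi iz}$, $q=e^{2\pi i\tau}$, $r=e^{2\pi i\sigma}$ and $\tau,\sigma\in\mathbb C\setminus\mathbb R$ let $\theta_0(z,\tau)=(x;q)(q/x;q)$ and $\Gamma(z,\tau,\sigma)=(qr/x;q,r)/(x;q,r)$. Let $G=SL(3,\mathbb Z)\ltimes\mathbb Z^3$ act on $X=\mathbb C\times\mathbb C^3$ by $(A,\vec n)(z,\vec x)=(z+\vec n\cdot\vec x,A\vec x)$. Let $e_{i,j}\in SL(3,\mathbb Z)$ ($i\ne j$) be the elementary matrices and $t_i$ the standard generators of $\mathbb Z^3$. An invertible analytic function on $X$ is a class of pairs $(f,D)$ with $D\subset X$ dense and open and $f$ holomorphic and nowhere zero on $D$, where $(f_1,D_1)\sim(f_2,D_2)$ if $f_1=f_2$ on $D_1\cap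 D_2$. Let $N$ be the group of those that satisfy $f(\lambda z,\lambda\vec x)=f(z,\vec x)$ for all $\lambda\in\mathbb C\setminus\{0\}$, and $M\subset N$ the subgroup of the functions $\exp(2\pi if)$ with $f\in\mathbb Q(x_1/x_3,x_2/x_3)[z/x_3]$. The group $G$ acts on $M\subset N$ by $(\rho(g)f)(y)=f(g^{-1}y)$. There is a unique 1-cocycle $u:G\to N/M$ whose values on the generators are the classes of $$u(e_{1,2})=\Gamma\Big(\tfrac{z-x_2}{x_3},\tfrac{x_1-x_2}{x_3},-\tfrac{x_1}{x_3}\Big)^{-1},\quad u(e_{3,2})=\Gamma\Big(\tfrac z{x_1},\tfrac{x_2-x_3}{x_1},\tfrac{x_3}{x_1}\Big),\quad u(t_2)=\theta_0\Big(\tfrac{z-x_2}{x_1},\tfrac{x_3}{x_1}\Big),$$ $u(e_{i,j})=1$ and $u(t_j)=1$ for $j\ne2$. Let $[\phi]=\delta_*[u]\in H^2(G,M)$ be the class of $\phi(g,h)=\tilde u(g)\,\rho(g)\tilde u(h)/\tilde u(gh)$, where $\tilde u:G\to N$ is a lift of $u$. Let $E$ be the group generated by $\hat e_{i,j}$ ($i\neq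 j$), $\hat t_i$ and the elements of $M$, with the following relations: the product of elements of $M$ in $E$ is their product in $M$; $\hat e_{i,j}m=\rho(e_{i,j})(m)\hat e_{i,j}$ and $\hat t_im=\rho(t_i)(m)\hat t_i$ for $m\in M$; $$\hat e_{i,j}\hat e_{k,l}=\phi_{i,j}^{k,l}\hat e_{k,l}\hat e_{i,j}\ (j\ne k,\ i\ne l),\quad \hat e_{i,j}\hat e_{j,k}=\phi_{i,j}^{j,k}\hat e_{i,k}\hat e_{j,k}\hat e_{i,j}\ (i\ne k),\quad(\hat e_{1,3}\hat e_{3,1}^{-1}\hat e_{1,3})^4=1,$$ $$\hat t_i\hat t_j=\phi_i^j\hat t_j\hat t_i,\qquad\hat e_{i,j}\hat t_k=\phi_{i,j}^k\hat t_k\hat e_{i,j}\ (i\ne k),\qquad\hat t_j\hat e_{i,j}\hat t_i=\phi_{i,j}^i\hat t_i\hat e_{i,j},$$ where $\phi_\cdot^\cdot=\exp(i\pi L_\cdot^\cdot)$ with $$L_{1,2}^2=\tfrac{x_2(6z^2-6(x_3+2x_2)z+x_2x_1-x_1^2+6x_2^2+6x_2x_3+x_3^2)}{6x_3x_1(x_2-x_1)},\quad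 L_{1,2}^1=\tfrac{-6z^2+6(x_1+x_3+2x_2)z-x_3^2-6x_2x_1-3x_1x_3-6x_2x_3-6x_2^2-x_1^2}{6x_1x_3},$$ $$L_{1,3}^2=\tfrac{6z^2-6(x_3+2x_2)z+6x_2x_3-x_1^2+6x_2^2+x_3^2+x_1x_3}{6(x_3-x_1)x_1},\qquad L_3^2=-L_2^3=\tfrac{2z-2x_2-2x_3+x_1}{x_1},$$ $$L_{1,3}^{3,2}=\tfrac{(2z-x_2)(2z^2-2zx_2-x_1^2+x_1x_3-x_3^2+x_2x_1)}{12(x_3-x_1)x_3(x_2-x_1)},\quad L_{3,1}^{1,2}=\tfrac{(2z-x_2)(2z^2-2zx_2+x_2x_3-x_1^2+x_1x_3-x_3^2)}{12x_1(x_2-x_3)(x_3-x_1)},$$ $$L_{1,2}^{3,2}=-L_{3,2}^{1,2}=\tfrac{x_2(2z-x_2)(2z^2-2zx_2+x_2x_3-x_3^2-x_1^2+x_2x_1)}{12x_1(x_2-x_1)x_3(x_2-x_3)},$$ and all other $L_\cdot^\cdot$ are zero. Let $E\to G$ be the homomorphism $\hat e_{i,j}\mapsto e_{i,j}$, $\hat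 t_i\mapsto t_i$, $M\ni m\mapsto1$. Let $i:D_4\hookrightarrow SL(3,\mathbb Z)\subset G$ be the subgroup generated by $a=(e_{2,1}^{-1}e_{1,2}e_{2,1}^{-1})^2$ and $b=e_{3,1}e_{1,3}^{-1}e_{3,1}$. It is a dihedral group of order $8$, and $a^2=b^4=1$, $bab=a$. Let $\hat D_4\subset E$ be the inverse image of $D_4$. **Proposition.** 1. $1\to M\to\hat D_4\to D_4\to1$ is an extension of the $D_4$-module $M$, and its characteristic class in $H^2(D_4,M)$ is the pull-back $i^*[\phi]$. 2. The elements $$\hat a=e^{\frac{\pi i}2\left(\frac{z^2}{x_1x_3}-\frac{2z}{x_3}+1+\frac{x_1}{6x_3}+\frac{x_3}{6x_1}\right)}(\hat e_{2,1}^{-1}\hat e_{1,2}\hat e_{2,1}^{-1})^2,\qquad\hat b=\hat e_{3,1}\hat e_{1,3}^{-1}\hat e_{3,1}$$ of $\hat D_4$ are lifts of $a$ and $b$ and satisfy $\hat a^2=\hat b^4=1$, $\hat b\hat a\hat b=\mathrm i\,\hat a$, where $\mathrm i=e^{2\pi i/4}\in M$. Together with the product of $M$ and $\hat am=\rho(a)(m)\hat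 a$, $\hat bm=\rho(b)(m)\hat b$ ($m\in M$), these relations present $\hat D_4$ on the generators $\hat a,\hat b$ and the elements of $M$. 3. $i^*[\phi]\neq0$ in $H^2(D_4,M)$. In particular the restriction of $[\phi]$ to $H^2(SL(3,\mathbb Z),M)$ is non-zero. -/

import Mathlib

open groupCohomology

namespace EllipticGamma

noncomputable section

/-! ### Theta function and elliptic gamma function -/

/-- `(x; q)`: the product `∏_j (1 - x q^j)` for `|q| < 1`, extended to `|q| > 1` by
`(x; q⁻¹) = 1 / (q x; q)`. -/
def qPoch (x q : ℂ) : ℂ :=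
  if ‖q‖ < 1 then ∏' j : ℕ, (1 - x * q ^ j)
  else (∏' j : ℕ, (1 - q⁻¹ * x * q⁻¹ ^ j))⁻¹

/-- The double product `∏_{j,k} (1 - x q^j r^k)`, used for `|q|, |r| < 1`. -/
def doubleProd (x q r : ℂ) : ℂ := ∏' jk : ℕ × ℕ, (1 - x * q ^ jk.1 * r ^ jk.2)

/-- `(x; q, r)`: the double product for `|q|, |r| < 1`, extended to `|q| ≠ 1 ≠ |r|` by
`(x; q⁻¹, r) = 1 / (q x; q, r)` and `(x; q, r⁻¹) = 1 / (r x; q, r)`. -/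
def qPoch₂ (x q r : ℂ) : ℂ :=
  if ‖q‖ < 1 then
    if ‖r‖ < 1 then doubleProd x q r else (doubleProd (r⁻¹ * x) q r⁻¹)⁻¹
  else
    if ‖r‖ < 1 then (doubleProd (q⁻¹ * x) q⁻¹ r)⁻¹ else doubleProd (q⁻¹ * (r⁻¹ * x)) q⁻¹ r⁻¹

/-- `e^{2πi t}`. -/
def cexp2 (t : ℂ) : ℂ := Complex.exp (2 * Real.pi * Complex.I * t)

/-- The theta function `θ₀(z, τ)`, for `τ ∉ ℝ`. -/
def theta0 (z τ : ℂ) : ℂ :=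
  qPoch (cexp2 z) (cexp2 τ) * qPoch (cexp2 τ / cexp2 z) (cexp2 τ)

/-- The elliptic gamma function `Γ(z, τ, σ)`, for `τ, σ ∉ ℝ`. -/
def ellGamma (z τ σ : ℂ) : ℂ :=
  qPoch₂ (cexp2 τ * cexp2 σ / cexp2 z) (cexp2 τ) (cexp2 σ) / qPoch₂ (cexp2 z) (cexp2 τ) (cexp2 σ)

/-! ### The group `G = SL(3, ℤ) ⋉ ℤ³` acting on `X = ℂ × ℂ³` -/

/-- `X = ℂ × ℂ³`, with points `(z, x)`. -/
abbrev X : Type := ℂ × (Fin 3 → ℂ)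

/-- Elements `(A, n)` of `SL(3, ℤ) ⋉ ℤ³`; the product is the one for which
`(A, n) (z, x) = (z + n ⬝ x, A x)` is a left action. -/
@[ext]
structure G : Type where
  A : Matrix.SpecialLinearGroup (Fin 3) ℤ
  n : Fin 3 → ℤ

namespace G

theorem eq_iff (g h : G) : g = h ↔ g.A.1 = h.A.1 ∧ g.n = h.n :=
  G.ext_iff.trans (and_congr_left' Subtype.ext_iff)

instance : DecidableEq G := fun g h => decidable_of_iff _ (eq_iff g h).symm

instance : Mul G := ⟨fun g h => ⟨g.A * h.A, h.n + Matrix.vecMul g.n h.A.1⟩⟩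
instance : One G := ⟨⟨1, 0⟩⟩
instance : Inv G := ⟨fun g => ⟨g.A⁻¹, -Matrix.vecMul g.n (g.A⁻¹).1⟩⟩

theorem mul_def (g h : G) : g * h = ⟨g.A * h.A, h.n + Matrix.vecMul g.n h.A.1⟩ := rfl
theorem one_def : (1 : G) = ⟨1, 0⟩ := rfl
theorem inv_def (g : G) : g⁻¹ = ⟨g.A⁻¹, -Matrix.vecMul g.n (g.A⁻¹).1⟩ := rfl

instance : Group G :=
  Group.ofLeftAxioms
    (fun a b c => by
      ext1
      · simp [mul_def, mul_assoc]
      · simp [mul_def, Matrix.add_vecMul, add_assoc])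
    (fun a => by
      ext1
      · simp [mul_def, one_def]
      · simp [mul_def, one_def])
    (fun a => by
      ext1
      · simp [mul_def, one_def, inv_def]
      · have h : ((a.A⁻¹).1 * a.A.1 : Matrix (Fin 3) (Fin 3) ℤ) = 1 := by
          rw [← Matrix.SpecialLinearGroup.coe_mul, inv_mul_cancel,
            Matrix.SpecialLinearGroup.coe_one]
        simp only [mul_def, one_def, inv_def, Matrix.neg_vecMul, Matrix.vecMul_vecMul, h]
        simp)

instance : MulAction G X where
  smul g p := (p.1 + ∑ i, (g.n i : ℂ) * p.2 i, fun i => ∑ j, ((g.A.1 i j : ℤ) : ℂ) * p.2 j)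
  one_smul p := by
    refine Prod.ext ?_ ?_
    · change p.1 + ∑ i, (((0 : Fin 3 → ℤ) i : ℤ) : ℂ) * p.2 i = p.1
      simp
    · funext i
      change ∑ j, (((1 : Matrix (Fin 3) (Fin 3) ℤ) i j : ℤ) : ℂ) * p.2 j = p.2 i
      simp [Matrix.one_apply]
  mul_smul g h p := by
    refine Prod.ext ?_ ?_
    · change p.1 + ∑ i, (((h.n + Matrix.vecMul g.n h.A.1) i : ℤ) : ℂ) * p.2 i =
        (p.1 + ∑ i, (h.n i : ℂ) * p.2 i)
          + ∑ i, (g.n i : ℂ) * ∑ j, ((h.A.1 i j : ℤ) : ℂ) * p.2 j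
      simp only [Fin.sum_univ_three, Pi.add_apply, Matrix.vecMul, dotProduct]
      push_cast
      ring
    · funext i
      change ∑ j, (((g.A.1 * h.A.1) i j : ℤ) : ℂ) * p.2 j =
        ∑ j, ((g.A.1 i j : ℤ) : ℂ) * ∑ k, ((h.A.1 j k : ℤ) : ℂ) * p.2 k
      simp only [Fin.sum_univ_three, Matrix.mul_apply]
      push_cast
      ring

theorem smul_def (g : G) (p : X) :
    g • p = (p.1 + ∑ i, (g.n i : ℂ) * p.2 i,
      fun i => ∑ j, ((g.A.1 i j : ℤ) : ℂ) * p.2 j) := rfl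

/-- The inclusion `SL(3, ℤ) → G`. -/
def ofSL : Matrix.SpecialLinearGroup (Fin 3) ℤ →* G where
  toFun A := ⟨A, 0⟩
  map_one' := rfl
  map_mul' A B := by ext1 <;> simp [mul_def]

/-- The subgroup `SL(3, ℤ) ⊂ G`. -/
def SL3 : Subgroup G := ofSL.range

/-- The elementary matrix `e_{i,j}`, as an element of `G`. -/
def e (i j : Fin 3) (h : i ≠ j) : G :=
  ofSL ⟨Matrix.transvection i j 1, Matrix.det_transvection_of_ne i j h 1⟩

/-- The canonical generators `t_i` of `ℤ³ ⊂ G`. -/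
def t (i : Fin 3) : G := ⟨1, Pi.single i 1⟩

/-- `a = (e₂₁⁻¹ e₁₂ e₂₁⁻¹)²`. -/
def a : G := ((e 1 0 (by decide))⁻¹ * e 0 1 (by decide) * (e 1 0 (by decide))⁻¹) ^ 2

/-- `b = e₃₁ e₁₃⁻¹ e₃₁`. -/
def b : G := e 2 0 (by decide) * (e 0 2 (by decide))⁻¹ * e 2 0 (by decide)

/-- The subgroup `D₄ ⊂ SL(3, ℤ) ⊂ G` generated by `a` and `b`. -/
def D4 : Subgroup G := Subgroup.closure {a, b}

end G

/-! ### Invertible analytic functions -/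

/-- A pair `(f, D)`: `D` a dense open subset of `X`, `f` holomorphic without zeros on `D` (the
values of `f` outside `D` play no role). -/
structure InvPair : Type where
  f : X → ℂ
  D : Set X
  isOpen : IsOpen D
  dense : Dense D
  holo : DifferentiableOn ℂ f D
  ne_zero : ∀ p ∈ D, f p ≠ 0

namespace InvPair

/-- Two pairs are equivalent if the functions agree on the intersection of the domains. -/
instance setoid : Setoid InvPair where
  r r s := Set.EqOn r.f s.f (r.D ∩ s.D)
  iseqv :=
    { refl := fun _ _ _ => rfl
      symm := fun h p hp => (h ⟨hp.2, hp.1⟩).symm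
      trans := by
        intro r s u h₁ h₂ p hp
        have hU : IsOpen (r.D ∩ u.D) := r.isOpen.inter u.isOpen
        have h : Set.EqOn r.f u.f (closure (r.D ∩ u.D ∩ s.D) ∩ (r.D ∩ u.D)) := by
          intro q hq
          have hr : ContinuousAt r.f q :=
            (r.holo.differentiableAt (r.isOpen.mem_nhds hq.2.1)).continuousAt
          have hu : ContinuousAt u.f q :=
            (u.holo.differentiableAt (u.isOpen.mem_nhds hq.2.2)).continuousAt
          have : (nhdsWithin q (r.D ∩ u.D ∩ s.D)).NeBot := mem_closure_iff_nhdsWithin_neBot.1 hq.1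
          refine tendsto_nhds_unique (l := nhdsWithin q (r.D ∩ u.D ∩ s.D)) (hr.tendsto.mono_left nhdsWithin_le_nhds)
            ((hu.tendsto.mono_left nhdsWithin_le_nhds).congr' ?_)
          filter_upwards [self_mem_nhdsWithin] with w hw
          exact ((h₁ ⟨hw.1.1, hw.2⟩).trans (h₂ ⟨hw.2, hw.1.2⟩)).symm
        refine h ⟨?_, hp⟩
        exact s.dense.open_subset_closure_inter hU hp }

theorem equiv_def {r s : InvPair} : r ≈ s ↔ Set.EqOn r.f s.f (r.D ∩ s.D) := Iff.rfl

def one : InvPair := ⟨fun _ => 1, Set.univ, isOpen_univ, dense_univ,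
  differentiableOn_const _, fun _ _ => one_ne_zero⟩

def mul (r s : InvPair) : InvPair :=
  ⟨fun p => r.f p * s.f p, r.D ∩ s.D, r.isOpen.inter s.isOpen,
    r.dense.inter_of_isOpen_left s.dense r.isOpen,
    (r.holo.mono Set.inter_subset_left).mul (s.holo.mono Set.inter_subset_right),
    fun p hp => mul_ne_zero (r.ne_zero p hp.1) (s.ne_zero p hp.2)⟩

def inv (r : InvPair) : InvPair :=
  ⟨fun p => (r.f p)⁻¹, r.D, r.isOpen, r.dense, r.holo.inv r.ne_zero,
    fun p hp => inv_ne_zero (r.ne_zero p hp)⟩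

end InvPair

/-- Invertible analytic functions on `X`: classes of pairs `(f, D)`. -/
def InvFun : Type := Quotient InvPair.setoid

namespace InvFun

/-- The class of a pair. -/
def mk (r : InvPair) : InvFun := Quotient.mk _ r

theorem mk_eq {r s : InvPair} : mk r = mk s ↔ Set.EqOn r.f s.f (r.D ∩ s.D) := Quotient.eq

instance : Mul InvFun := ⟨Quotient.map₂ InvPair.mul (by
  intro r r' h s s' h' p hp
  exact congrArg₂ (· * ·) (h ⟨hp.1.1, hp.2.1⟩) (h' ⟨hp.1.2, hp.2.2⟩))⟩
instance : One InvFun := ⟨mk InvPair.one⟩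
instance : Inv InvFun := ⟨Quotient.map InvPair.inv (by
  intro r r' h p hp
  exact congrArg (·⁻¹) (h hp))⟩

theorem mk_mul (r s : InvPair) : mk r * mk s = mk (r.mul s) := rfl
theorem mk_inv (r : InvPair) : (mk r)⁻¹ = mk r.inv := rfl
theorem one_eq : (1 : InvFun) = mk InvPair.one := rfl

/-- The group of invertible analytic functions, under pointwise product. -/
instance : CommGroup InvFun :=
  { Group.ofLeftAxioms (G := InvFun)
      (by
        rintro ⟨r⟩ ⟨s⟩ ⟨u⟩
        exact mk_eq.2 fun p _ => mul_assoc _ _ _)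
      (by
        rintro ⟨r⟩
        exact mk_eq.2 fun p _ => one_mul _)
      (by
        rintro ⟨r⟩
        exact mk_eq.2 fun p hp => inv_mul_cancel₀ (r.ne_zero p hp.1.1)) with
    mul_comm := by
      rintro ⟨r⟩ ⟨s⟩
      exact mk_eq.2 fun p _ => mul_comm _ _ }

end InvFun

/-- An action on `X` by holomorphic maps. -/
class HolAction (H : Type) [Group H] [MulAction H X] : Prop where
  differentiable : ∀ h : H, Differentiable ℂ (fun p : X => h • p)

instance : HolAction G where
  differentiable g := by
    simp only [G.smul_def]
    fun_prop

instance : HolAction ℂˣ where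
  differentiable c := by
    simp only [Units.smul_def]
    fun_prop

section Action

variable {H : Type} [Group H] [MulAction H X] [HolAction H]

/-- `h` maps `(f, D)` to `(p ↦ f (h⁻¹ p), h D)`. -/
def InvPair.act (h : H) (r : InvPair) : InvPair where
  f p := r.f (h⁻¹ • p)
  D := {p | h⁻¹ • p ∈ r.D}
  isOpen := r.isOpen.preimage (HolAction.differentiable h⁻¹).continuous
  dense := by
    have hs : Function.Surjective (fun p : X => h • p) := MulAction.surjective h
    have := hs.denseRange.dense_image (HolAction.differentiable h).continuous r.dense
    refine this.mono ?_
    rintro _ ⟨p, hp, rfl⟩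
    simpa using hp
  holo := r.holo.comp (HolAction.differentiable h⁻¹).differentiableOn fun _ hp => hp
  ne_zero p hp := r.ne_zero _ hp

/-- `H` acts on invertible analytic functions by `(h • f)(p) = f(h⁻¹ p)`. -/
instance : MulDistribMulAction H InvFun where
  smul h := Quotient.map (InvPair.act h) (by
    intro r s hrs p hp
    exact hrs hp)
  one_smul := by
    rintro ⟨r⟩
    refine InvFun.mk_eq.2 fun p _ => ?_
    simp [InvPair.act]
  mul_smul := by
    rintro g h ⟨r⟩
    refine InvFun.mk_eq.2 fun p _ => ?_
    simp [InvPair.act, mul_smul]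
  smul_mul := by
    rintro g ⟨r⟩ ⟨s⟩
    exact InvFun.mk_eq.2 fun p _ => rfl
  smul_one := by
    intro g
    exact InvFun.mk_eq.2 fun p _ => rfl

theorem InvFun.smul_mk (h : H) (r : InvPair) : h • InvFun.mk r = InvFun.mk (r.act h) := rfl

end Action

/-- The invertible analytic function `n` is given by the formula `F`: it is represented by a pair
`(f, D)` with `f = F` on `D`. -/
def Represents (n : InvFun) (F : X → ℂ) : Prop :=
  ∃ r : InvPair, InvFun.mk r = n ∧ Set.EqOn r.f F r.D

/-! ### The `G`-modules `M ⊂ N` -/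

theorem smul_comm_scale (g : G) (c : ℂˣ) (p : X) : g • (c • p) = c • (g • p) := by
  refine Prod.ext ?_ ?_
  · simp only [G.smul_def, Units.smul_def, Prod.smul_fst, Prod.smul_snd, Pi.smul_apply,
      smul_eq_mul, mul_add, Finset.mul_sum]
    congr 1
    exact Finset.sum_congr rfl fun i _ => by ring
  · funext i
    simp only [G.smul_def, Units.smul_def, Prod.smul_snd, Pi.smul_apply, smul_eq_mul,
      Finset.mul_sum]
    exact Finset.sum_congr rfl fun j _ => by ring

theorem smul_comm_invFun (g : G) (c : ℂˣ) (q : InvFun) : c • (g • q) = g • (c • q) := by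
  obtain ⟨r⟩ := q
  refine InvFun.mk_eq.2 fun p _ => ?_
  simp only [InvPair.act, smul_comm_scale]

/-- `N`: the invertible analytic functions with `f(λ z, λ x) = f(z, x)` for all `λ ≠ 0`. -/
def N : Subgroup InvFun where
  carrier := {q | ∀ c : ℂˣ, c • q = q}
  mul_mem' ha hb c := by rw [smul_mul', ha c, hb c]
  one_mem' c := smul_one c
  inv_mem' ha c := by rw [smul_inv', ha c]

instance : MulDistribMulAction G N where
  smul g q := ⟨g • q.1, fun c => by rw [smul_comm_invFun, q.2 c]⟩
  one_smul q := Subtype.ext (one_smul G q.1)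
  mul_smul g h q := Subtype.ext (mul_smul g h q.1)
  smul_mul g q r := Subtype.ext (smul_mul' g q.1 r.1)
  smul_one g := Subtype.ext (smul_one g)

theorem N.coe_smul (g : G) (q : N) : ((g • q : N) : InvFun) = g • (q : InvFun) := rfl

/-- The coordinates of a point: `none ↦ z`, `some i ↦ x_i`. -/
def coord (p : X) : Option (Fin 3) → ℂ
  | none => p.1
  | some i => p.2 i

/-- `q = exp(2πi P(z,x)/Q(x))` for rational polynomials `P` and `Q ≠ 0` homogeneous of the same
degree. -/
def IsRatPhase (q : InvFun) : Prop :=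
  ∃ (P : MvPolynomial (Option (Fin 3)) ℚ) (Q : MvPolynomial (Fin 3) ℚ) (d : ℕ) (r : InvPair),
    P.IsHomogeneous d ∧ Q.IsHomogeneous d ∧ Q ≠ 0 ∧ InvFun.mk r = q ∧
    ∀ p ∈ r.D, MvPolynomial.aeval p.2 Q ≠ 0 ∧
      r.f p = cexp2 (MvPolynomial.aeval (coord p) P / MvPolynomial.aeval p.2 Q)

theorem IsRatPhase.mul {q q' : InvFun} (h : IsRatPhase q) (h' : IsRatPhase q') :
    IsRatPhase (q * q') := by
  obtain ⟨P, Q, d, r, hP, hQ, hQ0, rfl, hr⟩ := h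
  obtain ⟨P', Q', d', r', hP', hQ', hQ0', rfl, hr'⟩ := h'
  have hren : ∀ (R : MvPolynomial (Fin 3) ℚ) (p : X),
      MvPolynomial.aeval (coord p) (MvPolynomial.rename some R) = MvPolynomial.aeval p.2 R := by
    intro R p
    rw [MvPolynomial.aeval_rename]
    rfl
  refine ⟨P * MvPolynomial.rename some Q' + P' * MvPolynomial.rename some Q, Q * Q', d + d',
    r.mul r', ?_, hQ.mul hQ', mul_ne_zero hQ0 hQ0', InvFun.mk_mul _ _, ?_⟩
  · refine (hP.mul hQ'.rename_isHomogeneous).add ?_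
    rw [add_comm d d']
    exact hP'.mul hQ.rename_isHomogeneous
  · intro p hp
    obtain ⟨h1, h2⟩ := hr p hp.1
    obtain ⟨h1', h2'⟩ := hr' p hp.2
    refine ⟨by simpa using ⟨h1, h1'⟩, ?_⟩
    change r.f p * r'.f p = _
    rw [h2, h2', cexp2, cexp2, cexp2, ← Complex.exp_add]
    simp only [map_add, map_mul, hren]
    congr 1
    field_simp

theorem IsRatPhase.one : IsRatPhase 1 :=
  ⟨0, 1, 0, InvPair.one, MvPolynomial.isHomogeneous_zero _ _ _, MvPolynomial.isHomogeneous_one _ _,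
    one_ne_zero, rfl, fun p _ => by simp [InvPair.one, cexp2]⟩

theorem IsRatPhase.inv {q : InvFun} (h : IsRatPhase q) : IsRatPhase q⁻¹ := by
  obtain ⟨P, Q, d, r, hP, hQ, hQ0, rfl, hr⟩ := h
  refine ⟨-P, Q, d, r.inv, hP.neg, hQ, hQ0, rfl, fun p hp => ⟨(hr p hp).1, ?_⟩⟩
  change (r.f p)⁻¹ = _
  rw [(hr p hp).2, cexp2, cexp2, ← Complex.exp_neg]
  simp [neg_div]

theorem IsRatPhase.smul {q : InvFun} (h : IsRatPhase q) (g : G) : IsRatPhase (g • q) := by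
  obtain ⟨P, Q, d, r, hP, hQ, hQ0, rfl, hr⟩ := h
  set k := g⁻¹ with hk
  let σ : Fin 3 → MvPolynomial (Fin 3) ℚ :=
    fun i => ∑ j, MvPolynomial.C (k.A.1 i j : ℚ) * MvPolynomial.X j
  let σ' : Option (Fin 3) → MvPolynomial (Option (Fin 3)) ℚ := fun o => o.elim
    (MvPolynomial.X none + ∑ i, MvPolynomial.C (k.n i : ℚ) * MvPolynomial.X (some i))
    (fun i => ∑ j, MvPolynomial.C (k.A.1 i j : ℚ) * MvPolynomial.X (some j))
  have hσ : ∀ i, (σ i).IsHomogeneous 1 := fun i =>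
    MvPolynomial.IsHomogeneous.sum _ _ _ fun j _ => MvPolynomial.isHomogeneous_C_mul_X _ _
  have hσ' : ∀ i, (σ' i).IsHomogeneous 1 := by
    rintro (_ | i)
    · exact (MvPolynomial.isHomogeneous_X _ _).add
        (MvPolynomial.IsHomogeneous.sum _ _ _ fun j _ => MvPolynomial.isHomogeneous_C_mul_X _ _)
    · exact MvPolynomial.IsHomogeneous.sum _ _ _ fun j _ => MvPolynomial.isHomogeneous_C_mul_X _ _
  have eQ : ∀ p : X, MvPolynomial.aeval p.2 (MvPolynomial.aeval σ Q) =
      MvPolynomial.aeval (k • p).2 Q := by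
    intro p
    rw [← AlgHom.comp_apply, MvPolynomial.comp_aeval]
    congr 2
    funext i
    simp [σ, G.smul_def]
  have eP : ∀ p : X, MvPolynomial.aeval (coord p) (MvPolynomial.aeval σ' P) =
      MvPolynomial.aeval (coord (k • p)) P := by
    intro p
    rw [← AlgHom.comp_apply, MvPolynomial.comp_aeval]
    congr 2
    funext i
    cases i <;> simp [σ', G.smul_def, coord]
  have key : ∀ p ∈ (r.act g).D, MvPolynomial.aeval p.2 (MvPolynomial.aeval σ Q) ≠ 0 ∧
      (r.act g).f p = cexp2 (MvPolynomial.aeval (coord p) (MvPolynomial.aeval σ' P) /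
        MvPolynomial.aeval p.2 (MvPolynomial.aeval σ Q)) := by
    intro p hp
    rw [eP, eQ]
    exact hr (k • p) hp
  refine ⟨MvPolynomial.aeval σ' P, MvPolynomial.aeval σ Q, d, r.act g, by simpa using hP.aeval σ' hσ',
    by simpa using hQ.aeval σ hσ, ?_, rfl, key⟩
  intro h0
  obtain ⟨p, hp⟩ := (r.act g).dense.nonempty
  exact (key p hp).1 (by rw [h0, map_zero])

/-- `M ⊂ N`: the functions `exp(2πi f)` with `f ∈ ℚ(x₁/x₃, x₂/x₃)[z/x₃]`. This ring consists of the
quotients `P(z, x)/Q(x)` with `P`, `Q` homogeneous of the same degree and rational coefficients. -/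
def M : Subgroup N where
  carrier := {q | IsRatPhase q.1}
  mul_mem' ha hb := ha.mul hb
  one_mem' := IsRatPhase.one
  inv_mem' ha := ha.inv

instance : MulDistribMulAction G M where
  smul g q := ⟨g • q.1, IsRatPhase.smul (q := q.1.1) q.2 g⟩
  one_smul q := Subtype.ext (one_smul G q.1)
  mul_smul g h q := Subtype.ext (mul_smul g h q.1)
  smul_mul g q r := Subtype.ext (smul_mul' g q.1 r.1)
  smul_one g := Subtype.ext (smul_one g)

theorem M.coe_smul (g : G) (q : M) : ((g • q : M) : N) = g • (q : N) := rfl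

/-- The induced action of `G` on `N / M`. -/
instance : MulDistribMulAction G (N ⧸ M) where
  smul g := QuotientGroup.map M M (MulDistribMulAction.toMonoidHom N g)
    fun q hq => (g • (⟨q, hq⟩ : M)).2
  one_smul := by
    rintro ⟨q⟩
    exact congrArg (QuotientGroup.mk (s := M)) (one_smul G q)
  mul_smul := by
    rintro g h ⟨q⟩
    exact congrArg (QuotientGroup.mk (s := M)) (mul_smul g h q)
  smul_mul g q r := map_mul _ q r
  smul_one g := map_one _

theorem smul_mk (g : G) (q : N) : g • (q : N ⧸ M) = ((g • q : N) : N ⧸ M) := rfl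

/-! ### Second cohomology, connecting homomorphism, restriction, extensions -/

/-- The class in `H²(H, A)` of a 2-cocycle. -/
def classOf {H A : Type} [Group H] [CommGroup A] [MulDistribMulAction H A] {φ : H × H → A}
    (hφ : IsMulCocycle₂ φ) : H2 (Rep.ofMulDistribMulAction H A) :=
  (H2π (Rep.ofMulDistribMulAction H A)).hom (cocyclesOfIsMulCocycle₂ hφ)

/-- The restriction map `H²(H, A) → H²(K, A)` for a subgroup `K` of `H`. -/
def restrict {H A : Type} [Group H] [CommGroup A] [MulDistribMulAction H A] (K : Subgroup H) :
    H2 (Rep.ofMulDistribMulAction H A) → H2 (Rep.ofMulDistribMulAction K A) :=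
  (groupCohomology.map (A := Rep.ofMulDistribMulAction H A)
    (B := Rep.ofMulDistribMulAction K A) K.subtype
    (CategoryTheory.CategoryStruct.id (Rep.res K.subtype (Rep.ofMulDistribMulAction H A))) 2).hom

section Connecting

variable (u : G → N ⧸ M)

/-- A lift of `u : G → N / M` to a cochain with values in `N`. -/
def lift (g : G) : N := (u g).out

theorem mk_lift (g : G) : (lift u g : N ⧸ M) = u g := Quotient.out_eq' (u g)

variable {u}

theorem coboundary_mem (hu : IsMulCocycle₁ u) (g h : G) :
    lift u g * g • lift u h * (lift u (g * h))⁻¹ ∈ M := by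
  rw [← QuotientGroup.eq_one_iff]
  rw [QuotientGroup.mk_mul, QuotientGroup.mk_mul, QuotientGroup.mk_inv, ← smul_mk, mk_lift,
    mk_lift, mk_lift, hu g h, mul_comm (u g), mul_inv_cancel]

/-- The 2-cocycle `φ(g, h) = ũ(g) (g ũ(h)) / ũ(gh)` with values in `M`, for the lift `ũ` of a
1-cocycle `u : G → N / M`. -/
def coboundaryOfLift (hu : IsMulCocycle₁ u) (gh : G × G) : M :=
  ⟨lift u gh.1 * gh.1 • lift u gh.2 * (lift u (gh.1 * gh.2))⁻¹, coboundary_mem hu gh.1 gh.2⟩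

theorem isMulCocycle₂_coboundaryOfLift (hu : IsMulCocycle₁ u) :
    IsMulCocycle₂ (coboundaryOfLift hu) := by
  intro g h j
  apply Subtype.ext
  simp only [Subgroup.coe_mul, M.coe_smul, coboundaryOfLift, smul_mul', smul_inv', mul_smul,
    mul_assoc g h j]
  generalize g • h • lift u j = A
  generalize g • lift u h = B
  generalize g • lift u (h * j) = C
  generalize lift u (g * (h * j)) = D
  generalize lift u (g * h) = E
  refine Subtype.ext ?_
  simp only [Subgroup.coe_mul, InvMemClass.coe_inv]
  have key : ∀ A B C D E F : InvFun,
      E * A * D⁻¹ * (F * B * E⁻¹) = B * A * C⁻¹ * (F * C * D⁻¹) := by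
    intro A B C D E F
    calc E * A * D⁻¹ * (F * B * E⁻¹) = (E * E⁻¹) * (F * D⁻¹ * (B * A)) := by
          simp only [mul_comm, mul_left_comm, mul_assoc]
      _ = (C * C⁻¹) * (F * D⁻¹ * (B * A)) := by rw [mul_inv_cancel, mul_inv_cancel]
      _ = _ := by simp only [mul_comm, mul_left_comm, mul_assoc]
  exact key _ _ _ _ _ _

/-- The image `δ_*[u] ∈ H²(G, M)` under the connecting homomorphism `H¹(G, N/M) → H²(G, M)` of the
class of a 1-cocycle `u`. -/
def connecting (hu : IsMulCocycle₁ u) : H2 (Rep.ofMulDistribMulAction G M) :=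
  classOf (isMulCocycle₂_coboundaryOfLift hu)

end Connecting

section Extension

variable {A E Q : Type} [CommGroup A] [Group E] [Group Q]

/-- An extension `1 → A → E → Q → 1` is an extension of the `Q`-module `A` if conjugation in `E`
induces the given action of `Q` on `A`. -/
def IsModuleExtension [MulDistribMulAction Q A] (S : GroupExtension A E Q) : Prop :=
  ∀ (x : E) (m : A), S.inl (S.rightHom x • m) = x * S.inl m * x⁻¹

/-- A set-theoretic section. -/
def extSection (S : GroupExtension A E Q) : Q → E := Function.surjInv S.rightHom_surjective

theorem rightHom_extSection (S : GroupExtension A E Q) (q : Q) :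
    S.rightHom (extSection S q) = q := Function.surjInv_eq _ q

theorem exists_factor (S : GroupExtension A E Q) (gh : Q × Q) :
    ∃ m : A, extSection S gh.1 * extSection S gh.2 = S.inl m * extSection S (gh.1 * gh.2) := by
  have : extSection S gh.1 * extSection S gh.2 * (extSection S (gh.1 * gh.2))⁻¹ ∈ S.inl.range := by
    rw [S.range_inl_eq_ker_rightHom, MonoidHom.mem_ker]
    simp [rightHom_extSection]
  obtain ⟨m, hm⟩ := this
  exact ⟨m, by rw [hm]; group⟩

/-- The factor set `φ` of the section `s`: `s(g) s(h) = φ(g, h) s(gh)`. -/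
def factorSet (S : GroupExtension A E Q) (gh : Q × Q) : A := (exists_factor S gh).choose

theorem factorSet_spec (S : GroupExtension A E Q) (g h : Q) :
    extSection S g * extSection S h = S.inl (factorSet S (g, h)) * extSection S (g * h) :=
  (exists_factor S (g, h)).choose_spec

theorem isMulCocycle₂_factorSet [MulDistribMulAction Q A] (S : GroupExtension A E Q) (hS : IsModuleExtension S) :
    IsMulCocycle₂ (factorSet S) := by
  intro g h j
  apply S.inl_injective
  have h1 := factorSet_spec S (g * h) j
  have h2 := factorSet_spec S g h
  have h3 := factorSet_spec S h j
  have h4 := factorSet_spec S g (h * j)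
  have h5 := hS (extSection S g) (factorSet S (h, j))
  rw [rightHom_extSection] at h5
  apply mul_right_cancel (b := extSection S (g * (h * j)))
  rw [mul_comm (factorSet S (g * h, j)), map_mul, map_mul, h5, mul_assoc, mul_assoc _ _
    (extSection S (g * (h * j))), ← h4]
  rw [← mul_assoc g h j, ← h1, ← mul_assoc, ← h2, mul_assoc, h3]
  group

/-- The characteristic class in `H²(Q, A)` of an extension of the `Q`-module `A`. -/
def charClass [MulDistribMulAction Q A] (S : GroupExtension A E Q) (hS : IsModuleExtension S) :
    H2 (Rep.ofMulDistribMulAction Q A) :=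
  classOf (isMulCocycle₂_factorSet S hS)

end Extension

/-! ### The cocycle `u` -/

/-- `u : G → N / M` is a 1-cocycle with the prescribed values on the generators. -/
structure IsGammaCocycle (u : G → N ⧸ M) : Prop where
  cocycle : IsMulCocycle₁ u
  e12 : ∃ n : N, u (G.e 0 1 (by decide)) = n ∧ Represents n fun p =>
    (ellGamma ((p.1 - p.2 1) / p.2 2) ((p.2 0 - p.2 1) / p.2 2) (-(p.2 0) / p.2 2))⁻¹
  e32 : ∃ n : N, u (G.e 2 1 (by decide)) = n ∧ Represents n fun p =>
    ellGamma (p.1 / p.2 0) ((p.2 1 - p.2 2) / p.2 0) (p.2 2 / p.2 0)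
  e_eq_one : ∀ (i j : Fin 3) (h : i ≠ j), j ≠ 1 → u (G.e i j h) = 1
  t2 : ∃ n : N, u (G.t 1) = n ∧ Represents n fun p =>
    theta0 ((p.1 - p.2 1) / p.2 0) (p.2 2 / p.2 0)
  t_eq_one : ∀ j : Fin 3, j ≠ 1 → u (G.t j) = 1

/-! ### The extension `E` by generators and relations -/

/-- `L_{1,2}^{3,2}`. -/
def L1232 (z x₁ x₂ x₃ : ℂ) : ℂ :=
  x₂ * (2 * z - x₂) * (2 * z ^ 2 - 2 * z * x₂ + x₂ * x₃ - x₃ ^ 2 - x₁ ^ 2 + x₂ * x₁) /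
    (12 * x₁ * (x₂ - x₁) * x₃ * (x₂ - x₃))

/-- `L_{i,j}^{k,l}` (indices shifted by one). -/
def Lee (i j k l : Fin 3) (p : X) : ℂ :=
  let z := p.1
  let x₁ := p.2 0
  let x₂ := p.2 1
  let x₃ := p.2 2
  if (i, j, k, l) = (0, 2, 2, 1) then
    (2 * z - x₂) * (2 * z ^ 2 - 2 * z * x₂ - x₁ ^ 2 + x₁ * x₃ - x₃ ^ 2 + x₂ * x₁) /
      (12 * (x₃ - x₁) * x₃ * (x₂ - x₁))
  else if (i, j, k, l) = (2, 0, 0, 1) then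
    (2 * z - x₂) * (2 * z ^ 2 - 2 * z * x₂ + x₂ * x₃ - x₁ ^ 2 + x₁ * x₃ - x₃ ^ 2) /
      (12 * x₁ * (x₂ - x₃) * (x₃ - x₁))
  else if (i, j, k, l) = (0, 1, 2, 1) then L1232 z x₁ x₂ x₃
  else if (i, j, k, l) = (2, 1, 0, 1) then -L1232 z x₁ x₂ x₃
  else 0

/-- `L_{i,j}^{k}` (indices shifted by one). -/
def Let (i j k : Fin 3) (p : X) : ℂ :=
  let z := p.1
  let x₁ := p.2 0
  let x₂ := p.2 1
  let x₃ := p.2 2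
  if (i, j, k) = (0, 1, 1) then
    x₂ * (6 * z ^ 2 - 6 * (x₃ + 2 * x₂) * z + x₂ * x₁ - x₁ ^ 2 + 6 * x₂ ^ 2 + 6 * x₂ * x₃
      + x₃ ^ 2) / (6 * x₃ * x₁ * (x₂ - x₁))
  else if (i, j, k) = (0, 1, 0) then
    (-6 * z ^ 2 + 6 * (x₁ + x₃ + 2 * x₂) * z - x₃ ^ 2 - 6 * x₂ * x₁ - 3 * x₁ * x₃ - 6 * x₂ * x₃
      - 6 * x₂ ^ 2 - x₁ ^ 2) / (6 * x₁ * x₃)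
  else if (i, j, k) = (0, 2, 1) then
    (6 * z ^ 2 - 6 * (x₃ + 2 * x₂) * z + 6 * x₂ * x₃ - x₁ ^ 2 + 6 * x₂ ^ 2 + x₃ ^ 2 + x₁ * x₃) /
      (6 * (x₃ - x₁) * x₁)
  else 0

/-- `L_i^j` (indices shifted by one). -/
def Ltt (i j : Fin 3) (p : X) : ℂ :=
  let z := p.1
  let x₁ := p.2 0
  let x₂ := p.2 1
  let x₃ := p.2 2
  if (i, j) = (2, 1) then (2 * z - 2 * x₂ - 2 * x₃ + x₁) / x₁
  else if (i, j) = (1, 2) then -((2 * z - 2 * x₂ - 2 * x₃ + x₁) / x₁)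
  else 0

/-- `φ = exp(πi L)` for an element `φ` of `M`. -/
def IsPhase (φ : M) (L : X → ℂ) : Prop :=
  Represents (φ : N) fun p => Complex.exp (Real.pi * Complex.I * L p)

/-- The generators of `E`: `ê_{i,j}`, `t̂_i` and the elements of `M`. -/
inductive EGen : Type
  | e (i j : Fin 3) (h : i ≠ j)
  | t (i : Fin 3)
  | m (φ : M)

namespace EGen

/-- The generators as elements of the free group. -/
abbrev fe (i j : Fin 3) (h : i ≠ j) : FreeGroup EGen := FreeGroup.of (.e i j h)
abbrev ft (i : Fin 3) : FreeGroup EGen := FreeGroup.of (.t i)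
abbrev fm (φ : M) : FreeGroup EGen := FreeGroup.of (.m φ)

/-- The defining relations of `E`: `IsRel l r` stands for the relation `l = r`. -/
inductive IsRel : FreeGroup EGen → FreeGroup EGen → Prop
  | mul (φ ψ : M) : IsRel (fm φ * fm ψ) (fm (φ * ψ))
  | em (i j : Fin 3) (h : i ≠ j) (φ : M) : IsRel (fe i j h * fm φ) (fm (G.e i j h • φ) * fe i j h)
  | tm (i : Fin 3) (φ : M) : IsRel (ft i * fm φ) (fm (G.t i • φ) * ft i)
  | ee_comm (i j k l : Fin 3) (hij : i ≠ j) (hkl : k ≠ l) (hjk : j ≠ k) (hil : i ≠ l) (φ : M)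
      (hφ : IsPhase φ (Lee i j k l)) :
      IsRel (fe i j hij * fe k l hkl) (fm φ * fe k l hkl * fe i j hij)
  | ee (i j k : Fin 3) (hij : i ≠ j) (hjk : j ≠ k) (hik : i ≠ k) (φ : M)
      (hφ : IsPhase φ (Lee i j j k)) :
      IsRel (fe i j hij * fe j k hjk) (fm φ * fe i k hik * fe j k hjk * fe i j hij)
  | w : IsRel ((fe 0 2 (by decide) * (fe 2 0 (by decide))⁻¹ * fe 0 2 (by decide)) ^ 4) 1
  | tt (i j : Fin 3) (φ : M) (hφ : IsPhase φ (Ltt i j)) :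
      IsRel (ft i * ft j) (fm φ * ft j * ft i)
  | et_comm (i j k : Fin 3) (hij : i ≠ j) (hik : i ≠ k) (φ : M) (hφ : IsPhase φ (Let i j k)) :
      IsRel (fe i j hij * ft k) (fm φ * ft k * fe i j hij)
  | et (i j : Fin 3) (hij : i ≠ j) (φ : M) (hφ : IsPhase φ (Let i j i)) :
      IsRel (ft j * fe i j hij * ft i) (fm φ * ft i * fe i j hij)

/-- The set of relators `l r⁻¹`. -/
def rels : Set (FreeGroup EGen) := {x | ∃ l r, IsRel l r ∧ x = l * r⁻¹}

/-- The images of the generators in `G`. -/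
def toG : EGen → G
  | e i j h => G.e i j h
  | t i => G.t i
  | m _ => 1

theorem toG_rel {l r : FreeGroup EGen} (h : IsRel l r) :
    FreeGroup.lift toG l = FreeGroup.lift toG r := by
  cases h with
  | mul φ ψ => simp [toG]
  | em i j h φ => simp [toG]
  | tm i φ => simp [toG]
  | ee_comm i j k l hij hkl hjk hil φ hφ =>
    simp only [map_mul, FreeGroup.lift_apply_of, toG, one_mul]
    clear hφ
    revert i j k l
    decide +kernel
  | ee i j k hij hjk hik φ hφ =>
    simp only [map_mul, FreeGroup.lift_apply_of, toG, one_mul]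
    clear hφ
    revert i j k
    decide +kernel
  | w =>
    simp only [map_mul, map_pow, map_inv, map_one, FreeGroup.lift_apply_of, toG]
    decide +kernel
  | tt i j φ hφ =>
    simp only [map_mul, FreeGroup.lift_apply_of, toG, one_mul]
    clear hφ
    revert i j
    decide +kernel
  | et_comm i j k hij hik φ hφ =>
    simp only [map_mul, FreeGroup.lift_apply_of, toG, one_mul]
    clear hφ
    revert i j k
    decide +kernel
  | et i j hij φ hφ =>
    simp only [map_mul, FreeGroup.lift_apply_of, toG, one_mul]
    clear hφ
    revert i j
    decide +kernel

theorem toG_rels : ∀ x ∈ rels, FreeGroup.lift toG x = 1 := by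
  rintro _ ⟨l, r, h, rfl⟩
  rw [map_mul, map_inv, toG_rel h, mul_inv_cancel]

end EGen

/-- The group `E` with the generators `EGen` and the relations `EGen.rels`. -/
abbrev E : Type := PresentedGroup EGen.rels

namespace E

def e (i j : Fin 3) (h : i ≠ j) : E := PresentedGroup.of (.e i j h)
def t (i : Fin 3) : E := PresentedGroup.of (.t i)

/-- The natural homomorphism `M → E`. -/
def ofM : M →* E where
  toFun φ := PresentedGroup.of (.m φ)
  map_one' := by
    have h : (PresentedGroup.of (.m 1) : E) * PresentedGroup.of (.m 1)
        = PresentedGroup.of (.m 1) := by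
      have := PresentedGroup.mk_eq_mk_of_mul_inv_mem (rels := EGen.rels)
        ⟨_, _, EGen.IsRel.mul 1 1, rfl⟩
      simpa [PresentedGroup.of] using this
    simpa using h
  map_mul' φ ψ := by
    have := PresentedGroup.mk_eq_mk_of_mul_inv_mem (rels := EGen.rels)
      ⟨_, _, EGen.IsRel.mul φ ψ, rfl⟩
    simpa [PresentedGroup.of] using this.symm


/-- The projection `E → G`, `ê_{i,j} ↦ e_{i,j}`, `t̂_i ↦ t_i`, `M ↦ 1`. -/
def proj : E →* G := PresentedGroup.toGroup (f := EGen.toG) EGen.toG_rels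

theorem proj_ofM (φ : M) : proj (ofM φ) = 1 := PresentedGroup.toGroup.of _

end E

/-- `D̂₄`: the inverse image of `D₄` under `E → G`. -/
def D4hat : Subgroup E := G.D4.comap E.proj

namespace D4hat

/-- The homomorphism `M → D̂₄`. -/
def ofM : M →* D4hat :=
  E.ofM.codRestrict D4hat fun φ => by
    rw [D4hat, Subgroup.mem_comap, E.proj_ofM]
    exact one_mem _

/-- The projection `D̂₄ → D₄`. -/
def proj : D4hat →* G.D4 := E.proj.subgroupComap G.D4

end D4hat

/-- Generators for a presentation of `D̂₄`: two letters and the elements of `M`. -/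
inductive DGen : Type
  | a
  | b
  | m (φ : M)

namespace DGen

abbrev fa : FreeGroup DGen := FreeGroup.of .a
abbrev fb : FreeGroup DGen := FreeGroup.of .b
abbrev fm (φ : M) : FreeGroup DGen := FreeGroup.of (.m φ)

/-- The relations of `D̂₄`, for the element `ι` of `M`: multiplication in `M`, the action on `M`,
and `â² = b̂⁴ = 1`, `b̂ â b̂ = ι â`. -/
inductive IsRel (ι : M) : FreeGroup DGen → FreeGroup DGen → Prop
  | mul (φ ψ : M) : IsRel ι (fm φ * fm ψ) (fm (φ * ψ))
  | am (φ : M) : IsRel ι (fa * fm φ) (fm (G.a • φ) * fa)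
  | bm (φ : M) : IsRel ι (fb * fm φ) (fm (G.b • φ) * fb)
  | a_sq : IsRel ι (fa ^ 2) 1
  | b_pow : IsRel ι (fb ^ 4) 1
  | bab : IsRel ι (fb * fa * fb) (fm ι * fa)

/-- The set of relators `l r⁻¹`. -/
def rels (ι : M) : Set (FreeGroup DGen) := {x | ∃ l r, IsRel ι l r ∧ x = l * r⁻¹}

/-- The assignment of elements of `D̂₄` to the generators. -/
def toHat (α β : D4hat) : DGen → D4hat
  | a => α
  | b => β
  | m φ => D4hat.ofM φ

end DGen

end

end EllipticGamma

open EllipticGamma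

/-! The group `E` has the generators and relations of a presentation of `G`, with each relation
twisted by a phase in `M`. The theorem rests on two facts about `M → E → G`, and on one parity
argument.

Exactness in the middle. Modulo the image of `M` the relations of `E` are the Steinberg relations of
rank three, the relation `w₁₃⁴ = 1`, and the relations of a semidirect product with `ℤ³`. They
present `G` (`exists_SL3_hom`, `exists_G_hom`), so `E.ker_proj` holds. The presentations of `SL(2,
ℤ)` and `SL(3, ℤ)` are proved by orbit and stabiliser: to every vector in the orbit of the first
basis vector a coset of the abstract stabiliser is attached by the Euclidean algorithm, the
assignment is shown to be equivariant, and an element acting trivially then lies in the stabiliser,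
where it is read off from a normal form.

Injectivity of `M → E`. The prescribed values of `u` on the generators satisfy the twisted relations
exactly, as functions. This follows from the shift equations of `θ₀` and `Γ` and from their modular
properties (`theta0_modular`, `GenTriple.ellGamma_modular`). Hence there is a homomorphism `E → N ⋊
G` that is the inclusion on `M`. Its first component `E.val` gives the cocycle `u` modulo `M`, and
the factor sets of `E` are coboundaries of lifts of `u`, so the class of `E` is `δ_*[u]`
(`D4hat.restrict_connecting`). Moreover an element of `E` is determined by its image in `G` and its
value (`E.ext_val`), so every relation in `E` becomes an identity between functions.

The lifts. The value of `b̂` is 1 and that of `(ê₂₁⁻¹ê₁₂ê₂₁⁻¹)²` is `θ₀(z/x₃, x₁/x₃)`. The relation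
`â² = 1` is the inversion formula of `θ₀`; the relation `b̂âb̂ = iâ` is its modular property, the
factor `i` coming from the constant term 1/2 of the exponent. The presentation follows from the
normal forms `φ bʲ` and `φ a bʲ`.

Non-triviality. A splitting over `D₄` consists of corrections `f`, `h` in `M` of `â`, `b̂` with the
relations of `D₄`. Logarithms `F`, `H` turn these into two statements that certain quotients of
entire functions take integer values; such quotients are constant. Summing the second over the four
powers of `b`, `F` telescopes, the terms in `H` give two copies of the first, and the fourfold phase
of `i` adds 1, so `4K = 2L + 1` with integers `K`, `L`.

Identities of functions are checked only at generic points, which are dense by Baire's theorem and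
stable under `G`; there no denominator, zero, pole or real period interferes. -/

namespace EllipticGamma
noncomputable section

/-! ### A presentation of `SL(2, ℤ)` -/

/-- A partial assignment on generators extends to a homomorphism if the subgroup of `Q × H`
generated by its graph projects injectively to `Q`. -/
theorem exists_hom_of_graph {ι Q H : Type*} [Group Q] [Group H] (g : ι → Q) (h : ι → H)
    (hg : Subgroup.closure (Set.range g) = ⊤)
    (hinj : Function.Injective ((MonoidHom.fst Q H).comp
      (Subgroup.closure (Set.range fun i => (g i, h i))).subtype)) :
    ∃ f : Q →* H, ∀ i, f (g i) = h i := by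
  set K := Subgroup.closure (Set.range fun i => (g i, h i))
  set p := (MonoidHom.fst Q H).comp K.subtype
  have hmem : ∀ i, (g i, h i) ∈ K := fun i => Subgroup.subset_closure ⟨i, rfl⟩
  have hsurj : Function.Surjective p := by
    rw [← MonoidHom.range_eq_top, eq_top_iff, ← hg, Subgroup.closure_le]
    rintro _ ⟨i, rfl⟩
    exact ⟨⟨_, hmem i⟩, rfl⟩
  let e := MulEquiv.ofBijective p ⟨hinj, hsurj⟩
  refine ⟨((MonoidHom.snd Q H).comp K.subtype).comp e.symm.toMonoidHom, fun i => ?_⟩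
  have : e.symm (g i) = ⟨_, hmem i⟩ := by
    rw [MulEquiv.symm_apply_eq]; rfl
  simp [this]

/-- The closure of a family, as a group generated by that family. -/
theorem closure_range_subtype_eq_top {ι Q : Type*} [Group Q] (g : ι → Q) :
    Subgroup.closure (Set.range fun i => (⟨g i, Subgroup.subset_closure ⟨i, rfl⟩⟩ :
      Subgroup.closure (Set.range g))) = ⊤ := by
  have h := Subgroup.closure_closure_coe_preimage (k := Set.range g)
  rw [eq_top_iff, ← h]
  apply Subgroup.closure_mono
  rintro ⟨_, _⟩ ⟨i, rfl⟩
  exact ⟨i, rfl⟩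

theorem range_fin_two {K : Type*} (F : Fin 2 → K) : Set.range F = {F 0, F 1} := by
  ext k
  simp [Fin.exists_fin_two, eq_comm]

namespace SL2Pres

variable {B : Type*} [Group B] (x y : B)

/-- The lift of the Weyl element. -/
def w : B := x * y⁻¹ * x

theorem natAbs_fmod_lt (a : ℤ) {b : ℤ} (hb : b ≠ 0) : (a.fmod b).natAbs < b.natAbs := by
  have main : ∀ a b : ℤ, 0 < b → (a.fmod b).natAbs < b.natAbs := by
    intro a b h
    have h1 := Int.fmod_nonneg_of_pos a h
    have h2 := Int.fmod_lt_of_pos a h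
    omega
  rcases lt_or_gt_of_ne hb with h | h
  · have := main (-a) (-b) (by omega)
    rwa [Int.neg_fmod_neg, Int.natAbs_neg, Int.natAbs_neg] at this
  · exact main a b h

/-- A coset with image the vector `(a, b)`, found by the Euclidean algorithm. -/
def cos (a b : ℤ) : B ⧸ Subgroup.zpowers x :=
  -- The recursion mirrors `(a, b) = T^q (r, b)` and `(r, b) = w (-b, r)`, where `q`, `r` are
  -- quotient and remainder and `w = (0 1; -1 0)`. Non-primitive vectors are allowed: every positive
  -- multiple of the first basis vector gets the coset of 1, every negative one that of `w²`, and
  -- `(0, 0)` a value of no significance.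
  if hb : b = 0 then (if 0 < a then ((1 : B) : B ⧸ Subgroup.zpowers x) else ((w x y) ^ 2 : B))
  else x ^ (a.fdiv b) • w x y • cos (-b) (a.fmod b)
termination_by b.natAbs
decreasing_by exact natAbs_fmod_lt a hb

variable {x y} (braid : x * y⁻¹ * x = y⁻¹ * x * y⁻¹) (w4 : (x * y⁻¹ * x) ^ 4 = 1)

include braid in
theorem w_mul_x : w x y * x = y⁻¹ * w x y := by
  simp only [w]
  nth_rw 1 [braid]
  simp only [mul_assoc]

include braid in
theorem w_mul_y : w x y * y⁻¹ = x * w x y := by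
  simp only [w]
  nth_rw 2 [braid]
  simp only [mul_assoc]

include braid in
theorem y_eq : y = (w x y)⁻¹ * x⁻¹ * w x y := by
  have h := w_mul_y braid
  rw [mul_assoc, eq_inv_mul_iff_mul_eq, eq_inv_mul_iff_mul_eq, ← mul_assoc, ← h]
  group

-- This is the relation needed in the one case of `cos_w` that the recursion defining `cos` does not
-- settle.
include braid in
theorem w_xinv_w : w x y * x⁻¹ * w x y = x * w x y * x := by
  have h : w x y * x⁻¹ * w x y = w x y * y⁻¹ * x := by
    simp only [w]; group
  rw [h, w_mul_y braid]

include braid in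
theorem w_sq_comm_x : (w x y) ^ 2 * x = x * (w x y) ^ 2 := by
  rw [pow_two, mul_assoc, w_mul_x braid, ← mul_assoc, w_mul_y braid, mul_assoc]

theorem cos_zero (a : ℤ) : cos x y a 0 =
    if 0 < a then ((1 : B) : B ⧸ Subgroup.zpowers x) else ((w x y) ^ 2 : B) := by
  rw [cos]; simp

theorem cos_ne (a : ℤ) {b : ℤ} (hb : b ≠ 0) : cos x y a b =
    x ^ (a.fdiv b) • w x y • cos x y (-b) (a.fmod b) := by
  rw [cos]; simp [hb]

theorem x_smul_one : x • ((1 : B) : B ⧸ Subgroup.zpowers x) = ((1 : B) : B ⧸ Subgroup.zpowers x) := by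
  rw [MulAction.Quotient.smul_coe, QuotientGroup.eq]
  simp

-- Replacing `a` by `a + b` raises the quotient by one and keeps the remainder. For `b = 0` both
-- base cosets are fixed by `x`, because `w²` commutes with `x`.
include braid in
theorem cos_add (a b : ℤ) : cos x y (a + b) b = x • cos x y a b := by
  by_cases hb : b = 0
  · subst hb
    rw [add_zero, cos_zero]
    split_ifs
    · rw [x_smul_one]
    · have : ((w x y ^ 2 : B) : B ⧸ Subgroup.zpowers x) = (w x y ^ 2) • ((1 : B) : B ⧸ Subgroup.zpowers x) := by
        rw [MulAction.Quotient.smul_coe]; simp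
      rw [this, smul_smul, ← w_sq_comm_x braid, mul_smul, x_smul_one]
  · rw [cos_ne _ hb, cos_ne _ hb, smul_smul x, ← zpow_one_add, Int.add_fmod_right,
      Int.add_fdiv_of_dvd_right (dvd_refl b), Int.fdiv_self hb, add_comm]

-- `w²` plays the role of `-1`. It commutes with `x` and `w`, so it passes through the recursion;
-- only the base case uses `w⁴ = 1`.
include braid w4 in
theorem cos_neg (a b : ℤ) (h : a ≠ 0 ∨ b ≠ 0) : cos x y (-a) (-b) = (w x y) ^ 2 • cos x y a b := by
  induction hn : b.natAbs using Nat.strong_induction_on generalizing a b with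
  | _ n ih =>
  by_cases hb : b = 0
  · subst hb
    have ha : a ≠ 0 := by simpa using h
    rw [neg_zero, cos_zero, cos_zero]
    rcases lt_or_gt_of_ne ha with h | h
    · rw [if_pos (by omega), if_neg (by omega), MulAction.Quotient.smul_coe, smul_eq_mul, ← pow_add]
      rw [show w x y ^ (2 + 2) = 1 from w4]
    · rw [if_neg (by omega), if_pos (by omega), MulAction.Quotient.smul_coe, smul_eq_mul, mul_one]
  · rw [cos_ne _ hb, cos_ne _ (neg_ne_zero.2 hb), Int.neg_fdiv_neg, Int.neg_fmod_neg]
    rw [ih _ _ (-b) (a.fmod b) (by left; omega) rfl]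
    · have hc : Commute (w x y ^ 2) (x ^ (a.fdiv b)) :=
        Commute.zpow_right (w_sq_comm_x braid) _
      simp only [smul_smul]
      congr 1
      rw [← mul_assoc (w x y ^ 2), hc.eq, mul_assoc, ← pow_succ', ← pow_succ]
    · exact hn ▸ natAbs_fmod_lt a hb

-- Equivariance under `w` at one vector implies it at the other vectors of its orbit under rotation
-- by `w` (`F1`, `F2`, both from `cos_neg`). It therefore suffices to treat the quarter plane `0 <
-- b`, `-b ≤ a < b`. For `0 ≤ a` the recursion defining `cos` is the claim itself; for `a < 0` there
-- is an induction on `|a| + |b|`.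
include braid w4 in
theorem cos_w (a b : ℤ) (h : a ≠ 0 ∨ b ≠ 0) : cos x y b (-a) = w x y • cos x y a b := by
  have F1 : ∀ a b : ℤ, (a ≠ 0 ∨ b ≠ 0) → cos x y b (-a) = w x y • cos x y a b →
      cos x y (-a) (-b) = w x y • cos x y b (-a) := by
    intro a b h h1
    rw [h1, cos_neg braid w4 a b h, smul_smul, pow_two]
  have F2 : ∀ a b : ℤ, (a ≠ 0 ∨ b ≠ 0) → cos x y b (-a) = w x y • cos x y a b →
      cos x y (-b) (- -a) = w x y • cos x y (-a) (-b) := by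
    intro a b h h1
    rw [cos_neg braid w4 b (-a) (by omega), h1, cos_neg braid w4 a b h, smul_smul, smul_smul,
      ← pow_succ, ← pow_succ']
  induction hn : a.natAbs + b.natAbs using Nat.strong_induction_on generalizing a b with
  | _ n ih =>
  have main : ∀ a b : ℤ, a.natAbs + b.natAbs = n → 0 < b → -b ≤ a → a < b →
      cos x y b (-a) = w x y • cos x y a b := by
    intro a b hn hb h1 h2
    have hlow : ∀ a b : ℤ, 0 ≤ a → a < b → cos x y a b = w x y • cos x y (-b) a := by
      intro a b ha hab
      rw [cos_ne a (by omega : b ≠ 0), Int.fmod_eq_of_lt ha hab, Int.fdiv_eq_zero_of_lt ha hab,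
        zpow_zero, one_smul]
    rcases le_or_gt 0 a with ha | ha
    · have := F1 (-b) a (by omega) (by rw [neg_neg]; exact hlow a b ha h2)
      simpa using this
    -- With `κ` the coset of `(-b, a + b)`, equivariance under `x` and the induction hypothesis at
    -- `(-a, -(a + b))`, whose size is `b`, express the two sides as `x w x κ` and `w x⁻¹ w κ`.
    · have e1 : cos x y a b = x⁻¹ • cos x y (a + b) b := by
        rw [cos_add braid, inv_smul_smul]
      have e2 := hlow (a + b) b (by omega) (by omega)
      have e3 : cos x y a (a + b) = x • cos x y (-b) (a + b) := by
        rw [← cos_add braid]; congr 1; ring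
      have e4 := ih _ (by omega) (-a) (-(a + b)) (by omega) rfl
      have e5 := F2 (-a) (-(a+b)) (by omega) e4
      rw [neg_neg, neg_neg, neg_neg] at e5
      have e6 := cos_add (x := x) (y := y) braid (a + b) (-a)
      rw [show a + b + -a = b by ring] at e6
      rw [e6, e5, e3, e1, e2]
      simp only [smul_smul]
      rw [← mul_assoc x, ← w_xinv_w braid, mul_assoc]
  have hcov : (0 < b ∧ -b ≤ a ∧ a < b) ∨ (0 < -b ∧ -(-b) ≤ -a ∧ -a < -b) ∨
      (0 < -a ∧ -(-a) ≤ b ∧ b < -a) ∨ (0 < - -a ∧ -(- -a) ≤ -b ∧ -b < - -a) := by omega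
  rcases hcov with ⟨h1, h2, h3⟩ | ⟨h1, h2, h3⟩ | ⟨h1, h2, h3⟩ | ⟨h1, h2, h3⟩
  · exact main a b hn h1 h2 h3
  · have := F2 _ _ (by omega) (main (-a) (-b) (by omega) h1 h2 h3)
    simpa using this
  · have := F2 _ _ (by omega) (F1 _ _ (by omega) (main b (-a) (by omega) h1 h2 h3))
    simpa using this
  · have := F1 _ _ (by omega) (main (-b) (- -a) (by omega) h1 h2 h3)
    simpa using this

/-- The upper elementary matrix of size two. -/
def T : Matrix.SpecialLinearGroup (Fin 2) ℤ := ⟨!![1, 1; 0, 1], by simp [Matrix.det_fin_two]⟩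
/-- The lower elementary matrix of size two. -/
def L : Matrix.SpecialLinearGroup (Fin 2) ℤ := ⟨!![1, 0; 1, 1], by simp [Matrix.det_fin_two]⟩

theorem T_zpow (k : ℤ) : (T ^ k).1 = !![1, k; 0, 1] := by
  have h : T = ModularGroup.T := rfl
  rw [h]
  exact ModularGroup.coe_T_zpow k

theorem closure_T_L : Subgroup.closure {T, L} = ⊤ := by
  rw [eq_top_iff, ← SpecialLinearGroup.SL2Z_generators, Subgroup.closure_le]
  have hT : T ∈ Subgroup.closure {T, L} := Subgroup.subset_closure (by simp)
  have hL : L ∈ Subgroup.closure {T, L} := Subgroup.subset_closure (by simp)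
  have hS : ModularGroup.S = T⁻¹ * L * T⁻¹ := by decide
  rintro g (rfl | rfl)
  · rw [hS]
    exact mul_mem (mul_mem (inv_mem hT) hL) (inv_mem hT)
  · exact hT

-- Once the coset attached to a non-zero vector moves equivariantly under all of `B`, an element of
-- the kernel fixes the coset of 1, which belongs to `(1, 0)`. It is then a power of `x`, and `T`
-- has infinite order.
include braid w4 in
theorem injective (hgen : Subgroup.closure {x, y} = ⊤)
    (π : B →* Matrix.SpecialLinearGroup (Fin 2) ℤ) (hx : π x = T) (hy : π y = L) :
    Function.Injective π := by
  let vec (g : B) (v : Fin 2 → ℤ) : Fin 2 → ℤ := (π g).1.mulVec v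
  have key : ∀ g : B, ∀ v : Fin 2 → ℤ, v ≠ 0 → cos x y (vec g v 0) (vec g v 1) =
      g • cos x y (v 0) (v 1) := by
    have hv : ∀ v : Fin 2 → ℤ, v ≠ 0 → v 0 ≠ 0 ∨ v 1 ≠ 0 := by
      intro v hv
      by_contra! h
      exact hv (funext fun i => by fin_cases i <;> simp [h])
    have hvec : ∀ g h v, vec (g * h) v = vec g (vec h v) := by
      intro g h v
      simp only [vec, map_mul, Matrix.SpecialLinearGroup.coe_mul, Matrix.mulVec_mulVec]
    have hvec1 : ∀ v, vec 1 v = v := by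
      intro v
      simp only [vec, map_one, Matrix.SpecialLinearGroup.coe_one, Matrix.one_mulVec]
    have hne : ∀ g v, v ≠ 0 → vec g v ≠ 0 := by
      intro g v hv h0
      apply hv
      rw [← hvec1 v, ← inv_mul_cancel g, hvec, h0]
      exact Matrix.mulVec_zero _
    have hinv : ∀ g, (∀ v : Fin 2 → ℤ, v ≠ 0 → cos x y (vec g v 0) (vec g v 1) =
        g • cos x y (v 0) (v 1)) → ∀ v : Fin 2 → ℤ, v ≠ 0 →
        cos x y (vec g⁻¹ v 0) (vec g⁻¹ v 1) = g⁻¹ • cos x y (v 0) (v 1) := by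
      intro g hg v hv
      rw [eq_inv_smul_iff, ← hg _ (hne _ _ hv), ← hvec, mul_inv_cancel, hvec1]
    have hmul : ∀ g h, (∀ v : Fin 2 → ℤ, v ≠ 0 → cos x y (vec g v 0) (vec g v 1) =
        g • cos x y (v 0) (v 1)) → (∀ v : Fin 2 → ℤ, v ≠ 0 → cos x y (vec h v 0) (vec h v 1) =
        h • cos x y (v 0) (v 1)) → (∀ v : Fin 2 → ℤ, v ≠ 0 →
        cos x y (vec (g * h) v 0) (vec (g * h) v 1) = (g * h) • cos x y (v 0) (v 1)) := by
      intro g h hg hh v hv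
      rw [hvec, hg _ (hne _ _ hv), hh _ hv, smul_smul]
    have kx : ∀ v : Fin 2 → ℤ, v ≠ 0 → cos x y (vec x v 0) (vec x v 1) =
        x • cos x y (v 0) (v 1) := by
      intro v hv
      rw [← cos_add braid]
      simp [vec, hx, T]
    have kw : ∀ v : Fin 2 → ℤ, v ≠ 0 → cos x y (vec (w x y) v 0) (vec (w x y) v 1) =
        w x y • cos x y (v 0) (v 1) := by
      intro v hv'
      have hw : π (w x y) = ⟨!![0, 1; -1, 0], by simp [Matrix.det_fin_two]⟩ := by
        rw [w, map_mul, map_mul, map_inv, hx, hy]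
        exact Subtype.ext (by decide)
      rw [← cos_w braid w4 _ _ (hv v hv')]
      simp [vec, hw]
    intro g
    have hg : g ∈ Subgroup.closure {x, y} := by rw [hgen]; trivial
    induction hg using Subgroup.closure_induction with
    | mem g hg =>
      rcases hg with rfl | rfl
      · exact kx
      · have h := hmul _ _ (hmul _ _ (hinv _ kw) (hinv _ kx)) kw
        rwa [← y_eq braid] at h
    | one => intro v _; rw [hvec1, one_smul]
    | mul a b _ _ ha hb => exact hmul _ _ ha hb
    | inv a _ ha => exact hinv _ ha
  rw [injective_iff_map_eq_one]
  intro g hg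
  have h := key g ![1, 0] (by decide)
  have h' : vec g ![1, 0] = ![1, 0] := by simp [vec, hg]
  rw [h'] at h
  simp only [Matrix.cons_val_zero, Matrix.cons_val_one, cos_zero, zero_lt_one, if_true] at h
  rw [MulAction.Quotient.smul_coe, QuotientGroup.eq, inv_one, one_mul, smul_eq_mul, mul_one] at h
  obtain ⟨k, rfl⟩ := Subgroup.mem_zpowers_iff.1 h
  rw [map_zpow, hx] at hg
  have := congrArg (fun A => A.1 0 1) hg
  simp only [T_zpow] at this
  have hk : k = 0 := by simpa using this
  rw [hk, zpow_zero]

end SL2Pres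

/-- The presentation of `SL(2, ℤ)` by the two elementary matrices. -/
theorem exists_SL2_hom {H : Type*} [Group H] (x y : H)
    (braid : x * y⁻¹ * x = y⁻¹ * x * y⁻¹) (w4 : (x * y⁻¹ * x) ^ 4 = 1) :
    ∃ f : Matrix.SpecialLinearGroup (Fin 2) ℤ →* H, f SL2Pres.T = x ∧ f SL2Pres.L = y := by
  obtain ⟨f, hf⟩ := exists_hom_of_graph ![SL2Pres.T, SL2Pres.L] ![x, y]
    (by rw [← SL2Pres.closure_T_L, range_fin_two]; rfl)
    (by
      have hcl := closure_range_subtype_eq_top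
        (fun i => (![SL2Pres.T, SL2Pres.L] i, ![x, y] i))
      replace hcl := (congrArg Subgroup.closure (range_fin_two _)).symm.trans hcl
      -- The group generated by the graph satisfies the two relations because each of its components
      -- does.
      refine SL2Pres.injective ?_ ?_ hcl _ rfl rfl
      · refine Subtype.ext (Prod.ext ?_ ?_)
        · change SL2Pres.T * SL2Pres.L⁻¹ * SL2Pres.T = SL2Pres.L⁻¹ * SL2Pres.T * SL2Pres.L⁻¹
          decide
        · exact braid
      · refine Subtype.ext (Prod.ext ?_ ?_)
        · change (SL2Pres.T * SL2Pres.L⁻¹ * SL2Pres.T) ^ 4 = 1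
          decide
        · exact w4)
  exact ⟨f, hf 0, hf 1⟩

end
end EllipticGamma

namespace EllipticGamma
noncomputable section

/-! ### A presentation of `SL(3, ℤ)` -/

/-- `SL(2, ℤ)`. -/
abbrev SL2 : Type := Matrix.SpecialLinearGroup (Fin 2) ℤ

/-- The Steinberg relations of rank three, with the additional relation `w₁₃⁴ = 1`. -/
structure IsSteinberg {S : Type*} [Group S] (e : Fin 3 → Fin 3 → S) : Prop where
  comm : ∀ i j k l, i ≠ j → k ≠ l → j ≠ k → i ≠ l → e i j * e k l = e k l * e i j
  tri : ∀ i j k, i ≠ j → j ≠ k → i ≠ k → e i j * e j k = e i k * e j k * e i j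
  w4 : (e 0 2 * (e 2 0)⁻¹ * e 0 2) ^ 4 = 1

namespace IsSteinberg

variable {S : Type*} [Group S] {e : Fin 3 → Fin 3 → S} (hS : IsSteinberg e)

section Weyl
variable {i j k : Fin 3} (hij : i ≠ j) (hjk : j ≠ k) (hik : i ≠ k)

-- The elements `wt e i j` permute the root elements up to sign under conjugation. This and the next
-- two lemmas compute the conjugates directly from the commutator relations, by moving `e i k`, `e k
-- j` or `e k i` through the three factors of `wt e i j`.
include hS hij hjk hik in
theorem col_T (n : ℤ) : e i j * e j k ^ n = e i k ^ n * e j k ^ n * e i j := by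
  have h1 : e i j * e j k * (e i j)⁻¹ = e i k * e j k := by
    rw [mul_inv_eq_iff_eq_mul, hS.tri i j k hij hjk hik]
  have hc : Commute (e i k) (e j k) := hS.comm i k j k hik hjk hjk.symm hik
  rw [← mul_inv_eq_iff_eq_mul, ← conj_zpow, h1, hc.mul_zpow]

end Weyl

/-- The signed permutation elements of the Steinberg group. -/
def wt (e : Fin 3 → Fin 3 → S) (i j : Fin 3) : S := e i j * (e j i)⁻¹ * e i j

section Weyl2
variable {i j k : Fin 3} (hij : i ≠ j) (hjk : j ≠ k) (hik : i ≠ k)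

include hS hij hjk hik in
theorem w_ik : wt e i j * e i k = (e j k)⁻¹ * wt e i j := by
  have h1 := hS.tri i j k hij hjk hik
  have h2 := hS.tri j i k hij.symm hik hjk
  have h3 := hS.comm i j i k hij hik hij.symm hik
  have hc := hS.comm i k j k hik hjk hjk.symm hik
  have h4 : (e j i)⁻¹ * e i k = (e j k)⁻¹ * e i k * (e j i)⁻¹ := by
    have h5 : e j k * (e j i)⁻¹ = (e j i)⁻¹ * e j k := by
      have := hS.comm j i j k hij.symm hjk hij hjk
      rw [mul_inv_eq_iff_eq_mul, mul_assoc, ← this, inv_mul_cancel_left]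
    calc (e j i)⁻¹ * e i k = (e j k)⁻¹ * (e j k * (e j i)⁻¹) * e i k := by group
      _ = (e j k)⁻¹ * (e j i)⁻¹ * (e j k * e i k * e j i) * (e j i)⁻¹ := by rw [h5]; group
      _ = _ := by rw [← h2]; group
  have h6 : e i j * (e j k)⁻¹ = (e j k)⁻¹ * (e i k)⁻¹ * e i j := by
    rw [mul_inv_eq_iff_eq_mul, mul_assoc, h1]; group
  calc wt e i j * e i k = e i j * (e j i)⁻¹ * (e i j * e i k) := by rw [wt]; group
    _ = e i j * ((e j i)⁻¹ * e i k) * e i j := by rw [h3]; group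
    _ = (e i j * (e j k)⁻¹) * e i k * (e j i)⁻¹ * e i j := by rw [h4]; group
    _ = (e j k)⁻¹ * (e i k)⁻¹ * (e i j * e i k) * (e j i)⁻¹ * e i j := by rw [h6]; group
    _ = (e j k)⁻¹ * wt e i j := by rw [h3, wt]; group

include hS hij hjk hik in
theorem w_kj : wt e i j * e k j = e k i * wt e i j := by
  have h1 := hS.tri k i j hik.symm hij hjk.symm
  have h2 := hS.tri k j i hjk.symm hij.symm hik.symm
  have h3 := hS.comm i j k j hij hjk.symm hjk hij
  have hc := hS.comm k i k j hik.symm hjk.symm hik hjk.symm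
  have h3' : e k i * (e j i)⁻¹ = (e j i)⁻¹ * e k i := by
    have := hS.comm k i j i hik.symm hij.symm hij hik.symm
    rw [mul_inv_eq_iff_eq_mul, mul_assoc, this, inv_mul_cancel_left]
  have h4 : (e j i)⁻¹ * e k j = e k i * e k j * (e j i)⁻¹ := by
    rw [eq_mul_inv_iff_mul_eq, mul_assoc, h2, ← mul_assoc, ← mul_assoc, ← h3']
    group
  have h5 : e i j * e k i * e k j = e k i * e i j := by
    rw [mul_assoc, hc, ← mul_assoc, h3, ← h1]
  calc wt e i j * e k j = e i j * (e j i)⁻¹ * (e i j * e k j) := by rw [wt]; group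
    _ = e i j * ((e j i)⁻¹ * e k j) * e i j := by rw [h3]; group
    _ = (e i j * e k i * e k j) * (e j i)⁻¹ * e i j := by rw [h4]; group
    _ = e k i * wt e i j := by rw [h5, wt]; group

include hS hij hjk hik in
theorem w_ki : wt e i j * e k i = (e k j)⁻¹ * wt e i j := by
  have h1 := hS.tri k i j hik.symm hij hjk.symm
  have h2 := hS.tri k j i hjk.symm hij.symm hik.symm
  have h3 := hS.comm i j k j hij hjk.symm hjk hij
  have hc := hS.comm k i k j hik.symm hjk.symm hik hjk.symm
  have h3' : e k i * (e j i)⁻¹ = (e j i)⁻¹ * e k i := by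
    have := hS.comm k i j i hik.symm hij.symm hij hik.symm
    rw [mul_inv_eq_iff_eq_mul, mul_assoc, this, inv_mul_cancel_left]
  have h5 : e i j * e k i = (e k j)⁻¹ * e k i * e i j := by
    rw [mul_assoc, h1, mul_assoc, inv_mul_cancel_left]
  have h6 : (e j i)⁻¹ * (e k j)⁻¹ * e k i = (e k j)⁻¹ * (e j i)⁻¹ := by
    rw [← mul_inv_rev, h2]; group
  have h7 : e i j * (e k j)⁻¹ = (e k j)⁻¹ * e i j := by
    rw [mul_inv_eq_iff_eq_mul, mul_assoc, h3, inv_mul_cancel_left]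
  calc wt e i j * e k i = e i j * (e j i)⁻¹ * (e i j * e k i) := by rw [wt]; group
    _ = e i j * ((e j i)⁻¹ * (e k j)⁻¹ * e k i) * e i j := by rw [h5]; group
    _ = (e i j * (e k j)⁻¹) * (e j i)⁻¹ * e i j := by rw [h6]; group
    _ = (e k j)⁻¹ * wt e i j := by rw [h7, wt]; group

-- The braid relation says that conjugation by `wt e i j` maps `e i j` to `(e j i)⁻¹`. Since `e i j`
-- is the commutator of `e i k` and `e k j`, its conjugate is the commutator of `(e j k)⁻¹` and `e k
-- i`, which is `(e j i)⁻¹`.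
include hS hij hjk hik in
theorem braid : e i j * (e j i)⁻¹ * e i j = (e j i)⁻¹ * e i j * (e j i)⁻¹ := by
  have t1 := hS.tri i k j hik hjk.symm hij
  have t2 := hS.tri j k i hjk hik.symm hij.symm
  have hc := hS.comm i j k j hij hjk.symm hjk hij
  have hc' := hS.comm i j i k hij hik hij.symm hik
  have e1 : e i j = e i k * e k j * (e i k)⁻¹ * (e k j)⁻¹ := by
    rw [t1]; group
  have e2 : (e j i)⁻¹ = (e j k)⁻¹ * e k i * e j k * (e k i)⁻¹ := by
    have hc2 := hS.comm j i k i hij.symm hik.symm hik hij.symm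
    have hc3 := hS.comm j i j k hij.symm hjk hij hjk
    rw [inv_eq_iff_mul_eq_one]
    calc e j i * ((e j k)⁻¹ * e k i * e j k * (e k i)⁻¹)
        = (e j i * (e j k)⁻¹) * (e k i * e j k) * (e k i)⁻¹ := by group
      _ = ((e j k)⁻¹ * e j i) * (e k i * e j k) * (e k i)⁻¹ := by
        congr 2
        rw [mul_inv_eq_iff_eq_mul, mul_assoc, hc3, inv_mul_cancel_left]
      _ = (e j k)⁻¹ * (e j i * e k i * e j k) * (e k i)⁻¹ := by group
      _ = 1 := by rw [← t2]; group
  have wik := hS.w_ik hij hjk hik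
  have wkj := hS.w_kj hij hjk hik
  have key : wt e i j * e i j * (wt e i j)⁻¹ = (e j i)⁻¹ := by
    have a1 : wt e i j * e i k * (wt e i j)⁻¹ = (e j k)⁻¹ := by rw [wik]; group
    have a2 : wt e i j * e k j * (wt e i j)⁻¹ = e k i := by rw [wkj]; group
    have : wt e i j * (e i k * e k j * (e i k)⁻¹ * (e k j)⁻¹) * (wt e i j)⁻¹ =
        (wt e i j * e i k * (wt e i j)⁻¹) * (wt e i j * e k j * (wt e i j)⁻¹) *
        (wt e i j * e i k * (wt e i j)⁻¹)⁻¹ * (wt e i j * e k j * (wt e i j)⁻¹)⁻¹ := by group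
    rw [← e1, a1, a2, inv_inv] at this
    rw [this, e2]
  rw [mul_inv_eq_iff_eq_mul, wt] at key
  apply mul_right_cancel (b := e i j)
  rw [key]; group

-- Conjugation by `wt e i k` maps `wt e i j` to the inverse of `wt e k j`. In this way the single
-- relation `w₁₃⁴ = 1` spreads to all pairs of indices.
include hS hij hjk hik in
theorem w4_left (h : wt e i j ^ 4 = 1) : wt e k j ^ 4 = 1 := by
  have h1 := hS.w_ik hik hjk.symm hij
  have h2 := hS.w_ki hik hjk.symm hij
  have a1 : wt e i k * e i j * (wt e i k)⁻¹ = (e k j)⁻¹ := by rw [h1]; group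
  have a2 : wt e i k * e j i * (wt e i k)⁻¹ = (e j k)⁻¹ := by rw [h2]; group
  have h3 : wt e i k * wt e i j * (wt e i k)⁻¹ = (wt e k j)⁻¹ := by
    calc wt e i k * wt e i j * (wt e i k)⁻¹ = (wt e i k * e i j * (wt e i k)⁻¹) *
          (wt e i k * e j i * (wt e i k)⁻¹)⁻¹ * (wt e i k * e i j * (wt e i k)⁻¹) := by
          simp only [wt]; group
      _ = _ := by rw [a1, a2, wt]; group
  have h4 := conj_pow (i := 4) (a := wt e i k) (b := wt e i j)
  rw [h3, h, inv_pow] at h4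
  simpa using h4

include hS hij hjk hik in
theorem w4_right (h : wt e i j ^ 4 = 1) : wt e i k ^ 4 = 1 := by
  have h1 := hS.w_ki hjk hik.symm hij.symm
  have h2 := hS.w_ik hjk hik.symm hij.symm
  have a1 : wt e j k * e i j * (wt e j k)⁻¹ = (e i k)⁻¹ := by rw [h1]; group
  have a2 : wt e j k * e j i * (wt e j k)⁻¹ = (e k i)⁻¹ := by rw [h2]; group
  have h3 : wt e j k * wt e i j * (wt e j k)⁻¹ = (wt e i k)⁻¹ := by
    calc wt e j k * wt e i j * (wt e j k)⁻¹ = (wt e j k * e i j * (wt e j k)⁻¹) *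
          (wt e j k * e j i * (wt e j k)⁻¹)⁻¹ * (wt e j k * e i j * (wt e j k)⁻¹) := by
          simp only [wt]; group
      _ = _ := by rw [a1, a2, wt]; group
  have h4 := conj_pow (i := 4) (a := wt e j k) (b := wt e i j)
  rw [h3, h, inv_pow] at h4
  simpa using h4

end Weyl2

include hS in
theorem w4_all : ∀ i j : Fin 3, i ≠ j → wt e i j ^ 4 = 1 := by
  have h02 : wt e 0 2 ^ 4 = 1 := hS.w4
  have h12 := hS.w4_left (i := 0) (j := 2) (k := 1) (by decide) (by decide) (by decide) h02
  have h01 := hS.w4_right (i := 0) (j := 2) (k := 1) (by decide) (by decide) (by decide) h02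
  have h21 := hS.w4_left (i := 0) (j := 1) (k := 2) (by decide) (by decide) (by decide) h01
  have h10 := hS.w4_right (i := 1) (j := 2) (k := 0) (by decide) (by decide) (by decide) h12
  have h20 := hS.w4_right (i := 2) (j := 1) (k := 0) (by decide) (by decide) (by decide) h21
  intro i j h
  fin_cases i <;> fin_cases j <;> first | exact absurd rfl h | assumption

include hS in
theorem exists_α (i j : Fin 3) (h : i ≠ j) :
    ∃ f : SL2 →* S, f SL2Pres.T = e i j ∧ f SL2Pres.L = e j i := by
  obtain ⟨k, hk⟩ : ∃ k : Fin 3, j ≠ k ∧ i ≠ k := by revert i j; decide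
  exact exists_SL2_hom _ _ (hS.braid h hk.1 hk.2) (hS.w4_all i j h)

open Classical in
/-- The homomorphism from `SL(2, ℤ)` belonging to the pair of indices `i ≠ j`. -/
def α (e : Fin 3 → Fin 3 → S) (i j : Fin 3) : SL2 →* S :=
  if h : ∃ f : SL2 →* S, f SL2Pres.T = e i j ∧ f SL2Pres.L = e j i then h.choose else 1

end IsSteinberg
end
end EllipticGamma

/-! ### Cosets of the abstract stabiliser attached to primitive vectors. -/

namespace EllipticGamma
noncomputable section

theorem SL2_induction {p : SL2 → Prop} (hT : p SL2Pres.T) (hL : p SL2Pres.L)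
    (one : p 1) (mul : ∀ a b, p a → p b → p (a * b)) (inv : ∀ a, p a → p a⁻¹) (A : SL2) : p A := by
  have hA : A ∈ Subgroup.closure {SL2Pres.T, SL2Pres.L} := by rw [SL2Pres.closure_T_L]; trivial
  induction hA using Subgroup.closure_induction with
  | mem g hg => rcases hg with rfl | rfl <;> assumption
  | one => exact one
  | mul a b _ _ ha hb => exact mul a b ha hb
  | inv a _ ha => exact inv a ha

theorem exists_SL2_col {a b : ℤ} (h : IsCoprime a b) : ∃ A : SL2, A.1 0 0 = a ∧ A.1 1 0 = b := by
  obtain ⟨u, v, h⟩ := h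
  refine ⟨⟨!![a, -v; b, u], by rw [Matrix.det_fin_two_of]; linarith⟩, by simp, by simp⟩

theorem SL2_eq_mul_T_zpow {A A' : SL2} (h0 : A'.1 0 0 = A.1 0 0) (h1 : A'.1 1 0 = A.1 1 0) :
    ∃ n : ℤ, A' = A * SL2Pres.T ^ n := by
  have d := A.2
  have d' := A'.2
  rw [Matrix.det_fin_two] at d d'
  rw [h0, h1] at d'
  -- The upper right entry of `A⁻¹ A'`.
  refine ⟨A.1 1 1 * A'.1 0 1 - A.1 0 1 * A'.1 1 1, ?_⟩
  apply Subtype.ext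
  rw [Matrix.SpecialLinearGroup.coe_mul, SL2Pres.T_zpow]
  ext i j
  fin_cases i <;> fin_cases j <;>
    simp [Matrix.mul_apply, Fin.sum_univ_two, h0, h1]
  · linear_combination (-A'.1 0 1) * d + (A.1 0 1) * d'
  · linear_combination (-A'.1 1 1) * d + (A.1 1 1) * d'

theorem SL2_coprime (A : SL2) : IsCoprime (A.1 0 0) (A.1 1 0) := by
  have d := A.2
  rw [Matrix.det_fin_two] at d
  exact ⟨A.1 1 1, -A.1 0 1, by linarith⟩

/-- The elementary operation on vectors. -/
def tv (i j : Fin 3) (n : ℤ) (v : Fin 3 → ℤ) : Fin 3 → ℤ := Function.update v i (v i + n * v j)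

namespace IsSteinberg

variable {S : Type*} [Group S] {e : Fin 3 → Fin 3 → S} (hS : IsSteinberg e)

include hS in
theorem α_T {i j : Fin 3} (h : i ≠ j) : α e i j SL2Pres.T = e i j := by
  rw [α, dif_pos (hS.exists_α i j h)]
  exact (hS.exists_α i j h).choose_spec.1

include hS in
theorem α_L {i j : Fin 3} (h : i ≠ j) : α e i j SL2Pres.L = e j i := by
  rw [α, dif_pos (hS.exists_α i j h)]
  exact (hS.exists_α i j h).choose_spec.2

section
variable {i j k : Fin 3} (hij : i ≠ j) (hjk : j ≠ k) (hik : i ≠ k)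

/-- The elements of the abelian subgroup generated by `e i k` and `e j k`. -/
def colE (e : Fin 3 → Fin 3 → S) (i j k : Fin 3) (u : Fin 2 → ℤ) : S := e i k ^ u 0 * e j k ^ u 1

/-- The elements of the abelian subgroup generated by `e k i` and `e k j`. -/
def rowE (e : Fin 3 → Fin 3 → S) (i j k : Fin 3) (u : Fin 2 → ℤ) : S := e k i ^ u 0 * e k j ^ u 1

-- The block `SL(2, ℤ)` normalises the column group and acts on it linearly. The property passes to
-- products and inverses, so only `T` and `L` need the Steinberg relations; likewise for the row
-- group below.
include hS hij hjk hik in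
theorem α_col (A : SL2) : ∀ u : Fin 2 → ℤ,
    α e i j A * colE e i j k u = colE e i j k (A.1.mulVec u) * α e i j A := by
  have hc : Commute (e i k) (e j k) := hS.comm i k j k hik hjk hjk.symm hik
  induction A using SL2_induction with
  | hT =>
    intro u
    have h0 := hS.col_T hij hjk hik (u 1)
    have h1 : Commute (e i j) (e i k ^ u 0) :=
      (show Commute (e i j) (e i k) from hS.comm i j i k hij hik hij.symm hik).zpow_right _
    simp only [colE, hS.α_T hij]
    rw [← mul_assoc, h1.eq, mul_assoc, h0]
    simp [SL2Pres.T, zpow_add, mul_assoc, Matrix.vecHead, Matrix.vecTail]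
  | hL =>
    intro u
    have h0 := hS.col_T hij.symm hik hjk (u 0)
    have h1 : Commute (e j i) (e j k ^ u 1) :=
      (show Commute (e j i) (e j k) from hS.comm j i j k hij.symm hjk hij hjk).zpow_right _
    have h2 : Commute (e i k ^ u 0) (e j k ^ u 0) := hc.zpow_zpow _ _
    simp only [colE, hS.α_L hij]
    rw [← mul_assoc, h0, mul_assoc, h1.eq, ← h2.eq]
    simp [SL2Pres.L, zpow_add, mul_assoc, Matrix.vecHead, Matrix.vecTail]
  | one => intro u; simp
  | mul a b ha hb =>
    intro u
    rw [map_mul, mul_assoc, hb, ← mul_assoc, ha, mul_assoc, Matrix.SpecialLinearGroup.coe_mul,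
      Matrix.mulVec_mulVec]
  | inv a ha =>
    intro u
    have h := ha ((a⁻¹).1.mulVec u)
    rw [Matrix.mulVec_mulVec, ← Matrix.SpecialLinearGroup.coe_mul, mul_inv_cancel,
      Matrix.SpecialLinearGroup.coe_one, Matrix.one_mulVec] at h
    rw [map_inv, inv_mul_eq_iff_eq_mul, ← mul_assoc, h, mul_inv_cancel_right]

include hS hij hjk hik in
theorem α_row (A : SL2) : ∀ u : Fin 2 → ℤ,
    rowE e i j k u * α e i j A = α e i j A * rowE e i j k (Matrix.vecMul u A.1) := by
  have hc : Commute (e k i) (e k j) := hS.comm k i k j hik.symm hjk.symm hik hjk.symm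
  induction A using SL2_induction with
  | hT =>
    intro u
    have h0 : Commute (e k j ^ u 1) (e i j) :=
      (show Commute (e k j) (e i j) from hS.comm k j i j hjk.symm hij hij.symm hjk.symm).zpow_left _
    have h1 : e k i ^ u 0 * e i j = e i j * e k i ^ u 0 * e k j ^ u 0 := by
      have h2 : (e i j)⁻¹ * e k i * e i j = e k i * e k j := by
        have := hS.tri k i j hik.symm hij hjk.symm
        have hc2 := hS.comm i j k j hij hjk.symm hjk hij
        rw [mul_assoc, inv_mul_eq_iff_eq_mul, this, ← hc2, mul_assoc, hc.eq]
      have h3 := conj_zpow (i := u 0) (a := (e i j)⁻¹) (b := e k i)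
      rw [inv_inv, h2, hc.mul_zpow] at h3
      rw [mul_assoc, h3]; group
    simp only [rowE, hS.α_T hij]
    rw [mul_assoc, h0.eq, ← mul_assoc, h1]
    simp [SL2Pres.T, zpow_add, mul_assoc, Matrix.vecMul, dotProduct]
  | hL =>
    intro u
    have h0 : Commute (e k i ^ u 0) (e j i) :=
      (show Commute (e k i) (e j i) from hS.comm k i j i hik.symm hij.symm hij hik.symm).zpow_left _
    have h1 : e k j ^ u 1 * e j i = e j i * e k j ^ u 1 * e k i ^ u 1 := by
      have h2 : (e j i)⁻¹ * e k j * e j i = e k j * e k i := by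
        have := hS.tri k j i hjk.symm hij.symm hik.symm
        have hc2 := hS.comm j i k i hij.symm hik.symm hik hij.symm
        rw [mul_assoc, inv_mul_eq_iff_eq_mul, this, ← hc2, mul_assoc, hc.eq]
      have h3 := conj_zpow (i := u 1) (a := (e j i)⁻¹) (b := e k j)
      rw [inv_inv, h2, hc.symm.mul_zpow] at h3
      rw [mul_assoc, h3]; group
    have h2 : Commute (e k i ^ u 1) (e k j ^ u 1) := hc.zpow_zpow _ _
    simp only [rowE, hS.α_L hij]
    rw [mul_assoc, h1, ← mul_assoc, ← mul_assoc, h0.eq, mul_assoc, ← h2.eq]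
    simp [SL2Pres.L, zpow_add, mul_assoc, Matrix.vecMul, dotProduct]
  | one => intro u; simp
  | mul a b ha hb =>
    intro u
    rw [map_mul, ← mul_assoc, ha, mul_assoc, hb, mul_assoc, Matrix.SpecialLinearGroup.coe_mul,
      Matrix.vecMul_vecMul]
  | inv a ha =>
    intro u
    have h := ha (Matrix.vecMul u (a⁻¹).1)
    rw [Matrix.vecMul_vecMul, ← Matrix.SpecialLinearGroup.coe_mul, inv_mul_cancel,
      Matrix.SpecialLinearGroup.coe_one, Matrix.vecMul_one] at h
    rw [map_inv, mul_inv_eq_iff_eq_mul, mul_assoc, h, inv_mul_cancel_left]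

end

/-- The subgroup corresponding to the stabiliser of the first basis vector. -/
def P (e : Fin 3 → Fin 3 → S) : Subgroup S := Subgroup.closure {e 0 1, e 0 2, e 1 2, e 2 1}

theorem e0_mem {j : Fin 3} (hj : 0 ≠ j) : e 0 j ∈ P e := by
  fin_cases j
  · exact absurd rfl hj
  · exact Subgroup.subset_closure (by simp)
  · exact Subgroup.subset_closure (by simp)

theorem e_mem {j k : Fin 3} (hj : 0 ≠ j) (hk : 0 ≠ k) (hjk : j ≠ k) : e j k ∈ P e := by
  fin_cases j <;> fin_cases k <;> first
    | exact absurd rfl hj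
    | exact absurd rfl hk
    | exact absurd rfl hjk
    | exact Subgroup.subset_closure (by simp)

include hS in
theorem α_mem {j k : Fin 3} (hj : 0 ≠ j) (hk : 0 ≠ k) (hjk : j ≠ k) (A : SL2) :
    α e j k A ∈ P e := by
  induction A using SL2_induction with
  | hT => rw [hS.α_T hjk]; exact e_mem hj hk hjk
  | hL => rw [hS.α_L hjk]; exact e_mem hk hj hjk.symm
  | one => rw [map_one]; exact one_mem _
  | mul a b ha hb => rw [map_mul]; exact mul_mem ha hb
  | inv a ha => rw [map_inv]; exact inv_mem ha

/-- A coset whose image is the vector `v`: first the coordinates `0, j`, then `0, k`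
are reduced. -/
def Cos (e : Fin 3 → Fin 3 → S) (j k : Fin 3) (v : Fin 3 → ℤ) (κ : S ⧸ P e) : Prop :=
  ∃ A B : SL2, 0 ≤ B.1 0 0 ∧ v 0 = A.1 0 0 * B.1 0 0 ∧ v j = A.1 1 0 * B.1 0 0 ∧
    v k = B.1 1 0 ∧ κ = (α e 0 j A * α e 0 k B : S)

section
variable {j k : Fin 3} (hj : 0 ≠ j) (hk : 0 ≠ k) (hjk : j ≠ k)

-- Conjugation by the block for `(0, k)` keeps the group generated by `e 0 j` and `e k j`, and this
-- group lies in the stabiliser.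
include hS hj hk hjk in
theorem conj_col_mem (B : SL2) (m n : ℤ) :
    (α e 0 k B)⁻¹ * (e 0 j ^ m * e k j ^ n) * α e 0 k B ∈ P e := by
  have h := hS.α_col hk hjk.symm hj B⁻¹ ![m, n]
  rw [map_inv] at h
  have h2 : e 0 j ^ m * e k j ^ n = colE e 0 k j ![m, n] := by simp [colE]
  rw [h2, h, inv_mul_cancel_right]
  exact mul_mem (zpow_mem (e0_mem hj) _) (zpow_mem (e_mem hk hj hjk.symm) _)

-- The condition `0 ≤ B₀₀` forces `B₀₀` to be the gcd of `v 0` and `v j`. Hence the first column of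
-- `B` is determined, and `B` is determined up to a power of `T`, which contributes a power of `e 0
-- k` in `P`. The first column of `A` is determined in the same way if the gcd is non-zero.
include hS hj hk hjk in
theorem cos_unique {v : Fin 3 → ℤ} {κ κ' : S ⧸ P e} (h : Cos e j k v κ) (h' : Cos e j k v κ') :
    κ = κ' := by
  obtain ⟨A, B, hg, h0, h1, h2, rfl⟩ := h
  obtain ⟨A', B', hg', h0', h1', h2', rfl⟩ := h'
  have hB0 : B'.1 0 0 = B.1 0 0 := by
    have key : ∀ (A : SL2) (g : ℤ), 0 ≤ g → v 0 = A.1 0 0 * g → v j = A.1 1 0 * g →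
        g = (Int.gcd (v 0) (v j) : ℤ) := by
      intro A g hg h0 h1
      rw [h0, h1, Int.gcd_mul_right, (Int.isCoprime_iff_gcd_eq_one.1 (SL2_coprime A)), one_mul,
        Int.natAbs_of_nonneg hg]
    rw [key A _ hg h0 h1, ← key A' _ hg' h0' h1']
  obtain ⟨m, rfl⟩ := SL2_eq_mul_T_zpow hB0 (h2'.symm.trans h2)
  rw [QuotientGroup.eq, map_mul, map_zpow, hS.α_T hk]
  have hm : e 0 k ^ m ∈ P e := zpow_mem (e0_mem hk) m
  suffices h : (α e 0 k B)⁻¹ * α e 0 j (A⁻¹ * A') * α e 0 k B ∈ P e by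
    have := mul_mem h hm
    rw [map_mul, map_inv] at this
    convert this using 1
    group
  -- If `v 0 = v j = 0`, the matrix `A` is arbitrary. But then the first row of `B` is `(0, *)`, and
  -- conjugation by the block element of `B` carries both `e 0 j` and `e j 0` into `P`.
  by_cases hz : B.1 0 0 = 0
  · generalize A⁻¹ * A' = C
    induction C using SL2_induction with
    | hT =>
      have := hS.conj_col_mem hj hk hjk B 1 0
      rw [hS.α_T hj]
      simpa using this
    | hL =>
      have h := hS.α_row hk hjk.symm hj B ![1, 0]
      simp only [rowE, Matrix.vecMul, dotProduct, Fin.sum_univ_two, Matrix.cons_val_zero,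
        Matrix.cons_val_one, one_mul, zero_mul, add_zero, zpow_one, zpow_zero, mul_one, hz] at h
      rw [hS.α_L hj, mul_assoc, h, inv_mul_cancel_left]
      exact zpow_mem (e_mem hj hk hjk) _
    | one => simp [one_mem]
    | mul a b ha hb =>
      have := mul_mem ha hb
      rw [map_mul]
      convert this using 1
      group
    | inv a ha =>
      have := inv_mem ha
      rw [map_inv]
      convert this using 1
      group
  · rw [hB0] at h0' h1'
    obtain ⟨n, rfl⟩ := SL2_eq_mul_T_zpow (mul_right_cancel₀ hz (h0'.symm.trans h0))
      (mul_right_cancel₀ hz (h1'.symm.trans h1))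
    rw [inv_mul_cancel_left, map_zpow, hS.α_T hj]
    simpa using hS.conj_col_mem hj hk hjk B n 0

theorem cos_α (X : SL2) {v v' : Fin 3 → ℤ} {κ : S ⧸ P e} (h : Cos e j k v κ)
    (h0 : v' 0 = X.1 0 0 * v 0 + X.1 0 1 * v j) (h1 : v' j = X.1 1 0 * v 0 + X.1 1 1 * v j)
    (h2 : v' k = v k) : Cos e j k v' (α e 0 j X • κ) := by
  obtain ⟨A, B, hg, hA, hA', hB, rfl⟩ := h
  refine ⟨X * A, B, hg, ?_, ?_, h2.trans hB, ?_⟩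
  · rw [h0, hA, hA', Matrix.SpecialLinearGroup.coe_mul, Matrix.mul_apply, Fin.sum_univ_two]; ring
  · rw [h1, hA, hA', Matrix.SpecialLinearGroup.coe_mul, Matrix.mul_apply, Fin.sum_univ_two]; ring
  · rw [MulAction.Quotient.smul_coe, smul_eq_mul, map_mul, mul_assoc]

include hS hj hk hjk in
theorem cos_0j (n : ℤ) {v : Fin 3 → ℤ} {κ : S ⧸ P e} (h : Cos e j k v κ) :
    Cos e j k (tv 0 j n v) (e 0 j ^ n • κ) := by
  rw [← hS.α_T hj, ← map_zpow]
  have hT := SL2Pres.T_zpow n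
  refine cos_α _ h ?_ ?_ ?_
  · simp [tv, hT]
  · simp [tv, hT, hj.symm]
  · simp [tv, hk.symm]

theorem L_zpow (n : ℤ) : (SL2Pres.L ^ n).1 = !![1, 0; n, 1] := by
  have h : SL2Pres.L = ModularGroup.S * SL2Pres.T⁻¹ * ModularGroup.S⁻¹ := by
    apply Subtype.ext; decide
  rw [h, conj_zpow, inv_zpow', Matrix.SpecialLinearGroup.coe_mul,
    Matrix.SpecialLinearGroup.coe_mul, SL2Pres.T_zpow,
    show (ModularGroup.S⁻¹).1 = !![0, 1; -1, 0] by decide]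
  ext i j
  fin_cases i <;> fin_cases j <;> simp [ModularGroup.S]

include hS hj hk hjk in
theorem cos_j0 (n : ℤ) {v : Fin 3 → ℤ} {κ : S ⧸ P e} (h : Cos e j k v κ) :
    Cos e j k (tv j 0 n v) (e j 0 ^ n • κ) := by
  rw [← hS.α_L hj, ← map_zpow]
  have hT := L_zpow n
  refine cos_α _ h ?_ ?_ ?_
  · simp [tv, hT, hj]
  · simp [tv, hT]; ring
  · simp [tv, hjk.symm]

-- Moving the row operation `(m, n)` past the block of `A` turns it into `(m, n) A`. The first entry
-- is absorbed by `B` as a power of `L`; the second gives a power of `e k j` that conjugates into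
-- `P`. Together with the operations absorbed by `A`, the order `(j, k)` is thus equivariant for `e
-- 0 j`, `e j 0`, `e k 0` and `e k j`; the remaining `e 0 k` and `e j k` are covered by the order
-- `(k, j)`.
include hS hj hk hjk in
theorem cos_k (m n : ℤ) {v v' : Fin 3 → ℤ} {κ : S ⧸ P e} (h : Cos e j k v κ)
    (h0 : v' 0 = v 0) (h1 : v' j = v j) (h2 : v' k = v k + m * v 0 + n * v j) :
    Cos e j k v' ((e k 0 ^ m * e k j ^ n) • κ) := by
  obtain ⟨A, B, hg, hA, hA', hB, rfl⟩ := h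
  have hrow := hS.α_row hj hjk hk A ![m, n]
  have e1 : e k 0 ^ m * e k j ^ n = rowE e 0 j k ![m, n] := by simp [rowE]
  set u := Matrix.vecMul ![m, n] A.1 with hu
  have hu0 : u 0 = m * A.1 0 0 + n * A.1 1 0 := by
    simp [hu, Matrix.vecMul, dotProduct, Fin.sum_univ_two]
  refine ⟨A, SL2Pres.L ^ (u 0) * B, ?_, ?_, ?_, ?_, ?_⟩
  · simpa [Matrix.mul_apply, Fin.sum_univ_two, L_zpow] using hg
  · simpa [Matrix.mul_apply, Fin.sum_univ_two, L_zpow] using h0.trans hA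
  · simpa [Matrix.mul_apply, Fin.sum_univ_two, L_zpow] using h1.trans hA'
  · simp only [Matrix.SpecialLinearGroup.coe_mul, Matrix.mul_apply, Fin.sum_univ_two, L_zpow, hu0]
    simp
    rw [h2, hA, hA', hB]; ring
  · rw [MulAction.Quotient.smul_coe, smul_eq_mul, ← mul_assoc, e1, hrow, map_mul, map_zpow,
      hS.α_L hk, QuotientGroup.eq, rowE]
    have h3 := inv_mem (hS.conj_col_mem hj hk hjk B 0 (u 1))
    convert h3 using 1
    simp only [zpow_zero, one_mul]
    group

include hS hj hk hjk in
theorem cos_k0 (n : ℤ) {v : Fin 3 → ℤ} {κ : S ⧸ P e} (h : Cos e j k v κ) :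
    Cos e j k (tv k 0 n v) (e k 0 ^ n • κ) := by
  have := hS.cos_k hj hk hjk n 0 (v' := tv k 0 n v) h (by simp [tv, hk]) (by simp [tv, hjk])
    (by simp [tv])
  simpa using this

include hS hj hk hjk in
theorem cos_kj (n : ℤ) {v : Fin 3 → ℤ} {κ : S ⧸ P e} (h : Cos e j k v κ) :
    Cos e j k (tv k j n v) (e k j ^ n • κ) := by
  have := hS.cos_k hj hk hjk 0 n (v' := tv k j n v) h (by simp [tv, hk]) (by simp [tv, hjk])
    (by simp [tv])
  simpa using this

include hj hk hjk in
theorem cos_exists {v : Fin 3 → ℤ} (hv : ∀ d : ℤ, (∀ i, d ∣ v i) → IsUnit d) :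
    ∃ κ, Cos e j k v κ := by
  have hcov : ∀ i : Fin 3, i = 0 ∨ i = j ∨ i = k := by
    clear hv
    revert j k; decide
  set g : ℤ := (Int.gcd (v 0) (v j) : ℤ) with hg
  have hgk : IsCoprime g (v k) := by
    rw [Int.isCoprime_iff_gcd_eq_one]
    have := hv (Int.gcd g (v k) : ℤ) (by
      intro i
      rcases hcov i with rfl | rfl | rfl
      · exact (Int.gcd_dvd_left ..).trans (Int.gcd_dvd_left ..)
      · exact (Int.gcd_dvd_left ..).trans (Int.gcd_dvd_right ..)
      · exact Int.gcd_dvd_right ..)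
    rw [Int.isUnit_iff_natAbs_eq] at this
    simpa using this
  obtain ⟨B, hB0, hB1⟩ := exists_SL2_col hgk
  obtain ⟨A, hA0, hA1⟩ : ∃ A : SL2, v 0 = A.1 0 0 * g ∧ v j = A.1 1 0 * g := by
    -- For gcd zero both coordinates vanish and any `A` will do.
    by_cases h0 : Int.gcd (v 0) (v j) = 0
    · obtain ⟨a, b⟩ := Int.gcd_eq_zero_iff.1 h0
      exact ⟨1, by rw [hg, h0]; simp [a], by rw [hg, h0]; simp [b]⟩
    · obtain ⟨a, b, hab, ha, hb⟩ := Int.exists_gcd_one (m := v 0) (n := v j) (by omega)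
      obtain ⟨A, h1, h2⟩ := exists_SL2_col (Int.isCoprime_iff_gcd_eq_one.2 hab)
      exact ⟨A, by rw [h1]; exact ha, by rw [h2]; exact hb⟩
  exact ⟨_, A, B, by rw [hB0]; omega, by rw [hB0, hA0], by rw [hB0, hA1], by rw [hB1], rfl⟩

end

end IsSteinberg
end
end EllipticGamma

/-! ### Independence of the coset from the order of reduction. -/

namespace EllipticGamma
noncomputable section
namespace IsSteinberg

variable {S : Type*} [Group S] {e : Fin 3 → Fin 3 → S} (hS : IsSteinberg e)

section
variable {j k : Fin 3} (hj : 0 ≠ j) (hk : 0 ≠ k) (hjk : j ≠ k)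

include hS hj hk hjk in
/-- The product of the squares of the Weyl elements for `(0, j)` and `(0, k)` is the square of the
Weyl element for `(j, k)`. -/
theorem α_neg_one_mul : α e 0 j (-1) * α e 0 k (-1) ∈ P e := by
  have hw2 : ModularGroup.S ^ 2 = -1 := by apply Subtype.ext; decide
  set w := α e 0 j ModularGroup.S with hw
  -- conjugation by `w` maps the pair `(j, k)` to `(0, k)`
  have c1 : w * e j k * w⁻¹ = (e 0 k)⁻¹ := by
    have h := hS.α_col hj hjk hk ModularGroup.S ![0, 1]
    rw [← hw] at h
    simp [colE, ModularGroup.S] at h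
    rw [h, mul_inv_cancel_right]
  have c2 : w * e k j * w⁻¹ = (e k 0)⁻¹ := by
    have h := hS.α_row hj hjk hk ModularGroup.S ![-1, 0]
    rw [← hw] at h
    simp [rowE, ModularGroup.S] at h
    rw [← h, mul_inv_cancel_right]
  -- conjugation by `α e j k (-1)` inverts `e 0 j` and `e j 0`
  set c := α e j k (-1) with hc
  have d1 : c * e 0 j * c⁻¹ = (e 0 j)⁻¹ := by
    have h := hS.α_row hjk hk.symm hj.symm (-1) ![-1, 0]
    rw [← hc] at h
    simp [rowE, Matrix.vecMul_neg] at h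
    rw [← h, mul_inv_cancel_right]
  have d2 : c * e j 0 * c⁻¹ = (e j 0)⁻¹ := by
    have h := hS.α_col hjk hk.symm hj.symm (-1) ![1, 0]
    rw [← hc] at h
    simp [colE] at h
    rw [h, mul_inv_cancel_right]
  have hSw : ModularGroup.S = SL2Pres.T⁻¹ * SL2Pres.L * SL2Pres.T⁻¹ := by decide
  have hmc : w * c * w⁻¹ = α e 0 k (-1) := by
    have h1 : c = (e j k)⁻¹ * e k j * (e j k)⁻¹ * ((e j k)⁻¹ * e k j * (e j k)⁻¹) := by
      rw [hc, ← hw2, hSw]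
      simp only [map_mul, map_inv, hS.α_T hjk, hS.α_L hjk, pow_two]
    have hneg : (-1 : SL2) = (SL2Pres.T⁻¹ * SL2Pres.L * SL2Pres.T⁻¹)⁻¹ ^ 2 := by
      apply Subtype.ext; decide
    have h2 : α e 0 k (-1) = (e 0 k) * (e k 0)⁻¹ * (e 0 k) * ((e 0 k) * (e k 0)⁻¹ * (e 0 k)) := by
      rw [hneg]
      simp only [map_mul, map_inv, hS.α_T hk, hS.α_L hk, pow_two]
      group
    rw [h1, h2]
    calc w * ((e j k)⁻¹ * e k j * (e j k)⁻¹ * ((e j k)⁻¹ * e k j * (e j k)⁻¹)) * w⁻¹ =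
        (w * e j k * w⁻¹)⁻¹ * (w * e k j * w⁻¹) * (w * e j k * w⁻¹)⁻¹ *
        ((w * e j k * w⁻¹)⁻¹ * (w * e k j * w⁻¹) * (w * e j k * w⁻¹)⁻¹) := by group
      _ = _ := by rw [c1, c2, inv_inv]
  have hwc : c * w⁻¹ * c⁻¹ = w := by
    have h1 : w = (e 0 j)⁻¹ * e j 0 * (e 0 j)⁻¹ := by
      rw [hw, hSw]
      simp only [map_mul, map_inv, hS.α_T hj, hS.α_L hj]
    rw [h1]
    calc c * ((e 0 j)⁻¹ * e j 0 * (e 0 j)⁻¹)⁻¹ * c⁻¹ =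
        (c * e 0 j * c⁻¹) * (c * e j 0 * c⁻¹)⁻¹ * (c * e 0 j * c⁻¹) := by group
      _ = _ := by rw [d1, d2, inv_inv]
  have hcm : c ∈ P e := hS.α_mem hj hk hjk _
  have h4 : w * w * (w * w) = 1 := by
    rw [← pow_two w, hw, ← map_pow, hw2, ← map_mul]
    simp
  -- The product is `w² · w c w⁻¹`; since `c w⁻¹ = w c`, it equals `w⁴ c = c`.
  have : α e 0 j (-1) * α e 0 k (-1) = c := by
    rw [← hmc, ← hw2, map_pow, ← hw, pow_two]
    have h5 : c * w⁻¹ = w * c := by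
      nth_rw 2 [← hwc]
      rw [inv_mul_cancel_right]
    rw [mul_assoc w c, h5]
    simp only [← mul_assoc] at h4 ⊢
    rw [h4, one_mul]
  rw [this]
  exact hcm

include hS hj hk hjk in
theorem α_neg_one_coset : ((α e 0 j (-1) : S) : S ⧸ P e) = (α e 0 k (-1) : S) := by
  rw [QuotientGroup.eq, ← map_inv, show (-1 : SL2)⁻¹ = -1 by apply Subtype.ext; decide]
  exact hS.α_neg_one_mul hj hk hjk

-- On the block for `(0, k)`, conjugation by the element of `-1` for `(0, j)` acts like conjugation
-- by the diagonal matrix with entries `-1, 1`: the off-diagonal entries change sign.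
include hS hj hk hjk in
theorem exists_flip (B : SL2) : ∃ B' : SL2, B'.1 0 0 = B.1 0 0 ∧ B'.1 0 1 = - B.1 0 1 ∧
    B'.1 1 0 = -B.1 1 0 ∧ B'.1 1 1 = B.1 1 1 ∧
    α e 0 j (-1) * α e 0 k B = α e 0 k B' * α e 0 j (-1) := by
  induction B using SL2_induction with
  | hT =>
    refine ⟨SL2Pres.T⁻¹, ?_, ?_, ?_, ?_, ?_⟩
    iterate 4 decide
    have h := hS.α_col hj hjk hk (-1) ![1, 0]
    simp [colE] at h
    rw [map_inv, hS.α_T hk, h]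
  | hL =>
    refine ⟨SL2Pres.L⁻¹, ?_, ?_, ?_, ?_, ?_⟩
    iterate 4 decide
    have h := hS.α_row hj hjk hk (-1) ![-1, 0]
    simp [rowE, Matrix.vecMul_neg] at h
    rw [map_inv, hS.α_L hk, h]
  | one => exact ⟨1, by simp⟩
  | mul a b ha hb =>
    obtain ⟨a', h1, h2, h3, h4, h5⟩ := ha
    obtain ⟨b', g1, g2, g3, g4, g5⟩ := hb
    refine ⟨a' * b', ?_, ?_, ?_, ?_, ?_⟩
    iterate 4
      simp only [Matrix.SpecialLinearGroup.coe_mul, Matrix.mul_apply, Fin.sum_univ_two]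
      simp only [h1, h2, h3, h4, g1, g2, g3, g4]
      ring
    rw [map_mul, ← mul_assoc, h5, mul_assoc, g5, map_mul, mul_assoc]
  | inv a ha =>
    obtain ⟨a', h1, h2, h3, h4, h5⟩ := ha
    refine ⟨a'⁻¹, ?_, ?_, ?_, ?_, ?_⟩
    iterate 4
      simp [Matrix.SpecialLinearGroup.coe_inv, Matrix.adjugate_fin_two, h1, h2, h3, h4]
    rw [map_inv, map_inv, eq_inv_mul_iff_mul_eq, ← mul_assoc, ← h5, mul_inv_cancel_right]

-- When `v j = 0`, the vector lives in the block `(0, k)`, and one matrix `A` with first column `(v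
-- 0, v k)` serves both orders. Only the sign condition of the order `(j, k)` can fail.
include hS hj hk hjk in
theorem cos_base {v : Fin 3 → ℤ} (hv : ∀ d : ℤ, (∀ i, d ∣ v i) → IsUnit d) (h0 : v j = 0) :
    ∃ κ, Cos e j k v κ ∧ Cos e k j v κ := by
  have hco : IsCoprime (v 0) (v k) := by
    have hcov : ∀ i : Fin 3, i = 0 ∨ i = j ∨ i = k := by
      clear hv h0
      revert j k; decide
    rw [Int.isCoprime_iff_gcd_eq_one]
    have := hv (Int.gcd (v 0) (v k) : ℤ) (by
      intro i
      rcases hcov i with rfl | rfl | rfl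
      · exact Int.gcd_dvd_left ..
      · rw [h0]; exact dvd_zero _
      · exact Int.gcd_dvd_right ..)
    rw [Int.isUnit_iff_natAbs_eq] at this
    simpa using this
  obtain ⟨A, hA0, hA1⟩ := exists_SL2_col hco
  have h2 : Cos e k j v (α e 0 k A : S) :=
    ⟨A, 1, by simp, by simp [hA0], by simp [hA1], by simp [h0], by simp⟩
  refine ⟨_, ?_, h2⟩
  rcases le_or_gt 0 (v 0) with h | h
  · exact ⟨1, A, by rw [hA0]; exact h, by simp [hA0], by simp [h0], hA1.symm, by simp⟩
  -- For `v 0 < 0` the pair `(-1, B)` is used, with `B` the sign flip of `-A`, so that `B` has first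
  -- column `(-v 0, v k)`. Flipping back moves the factor `-1` to the right, where `α_neg_one_coset`
  -- transfers it to the block `(0, k)` and it cancels the sign of `-A`.
  · obtain ⟨B, h1, -, h3, -, h5⟩ := hS.exists_flip hj hk hjk (-A)
    refine ⟨-1, B, by rw [h1]; simp [hA0]; omega, by rw [h1]; simp [hA0], by simp [h0],
      by rw [h3]; simp [hA1], ?_⟩
    obtain ⟨C, g1, -, g3, -, g5⟩ := hS.exists_flip hj hk hjk B
    obtain ⟨m, hm⟩ := SL2_eq_mul_T_zpow (A := -A) (A' := C) (by rw [g1, h1]) (by rw [g3, h3, neg_neg])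
    have h6 : ((α e 0 j (-1) * α e 0 k B : S) : S ⧸ P e) = ((α e 0 k C * α e 0 k (-1) : S) : S ⧸ P e) := by
      rw [g5]
      exact congrArg (α e 0 k C • ·) (hS.α_neg_one_coset hj hk hjk)
    rw [h6, ← map_mul, mul_neg_one, QuotientGroup.eq, ← map_inv, ← map_mul]
    have : A⁻¹ * -C = SL2Pres.T ^ m := by rw [hm]; simp
    rw [this, map_zpow, hS.α_T hk]
    exact zpow_mem (e0_mem hk) _

end

/-- Primitive vectors. -/
def IsPrim (v : Fin 3 → ℤ) : Prop := ∀ d : ℤ, (∀ i, d ∣ v i) → IsUnit d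

theorem IsPrim.tv {v : Fin 3 → ℤ} (hv : IsPrim v) {i j : Fin 3} (hij : i ≠ j) (n : ℤ) :
    IsPrim (tv i j n v) := by
  intro d hd
  apply hv
  have hj : d ∣ v j := by have := hd j; simpa [EllipticGamma.tv, hij.symm] using this
  intro l
  by_cases hl : l = i
  · subst hl
    have := hd l
    simp only [EllipticGamma.tv, Function.update_self] at this
    exact (dvd_add_left (hj.mul_left n)).1 this
  · have := hd l
    simpa [EllipticGamma.tv, hl] using this

/-- The two ways of reducing `v` lead to the same coset. -/
def Agree (e : Fin 3 → Fin 3 → S) (v : Fin 3 → ℤ) : Prop := ∃ κ, Cos e 1 2 v κ ∧ Cos e 2 1 v κ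

include hS in
theorem agree_10 {v : Fin 3 → ℤ} (n : ℤ) (h : Agree e v) : Agree e (tv 1 0 n v) := by
  obtain ⟨κ, h1, h2⟩ := h
  exact ⟨_, hS.cos_j0 (by decide) (by decide) (by decide) n h1,
    hS.cos_k0 (by decide) (by decide) (by decide) n h2⟩

include hS in
theorem agree_20 {v : Fin 3 → ℤ} (n : ℤ) (h : Agree e v) : Agree e (tv 2 0 n v) := by
  obtain ⟨κ, h1, h2⟩ := h
  exact ⟨_, hS.cos_k0 (by decide) (by decide) (by decide) n h1,
    hS.cos_j0 (by decide) (by decide) (by decide) n h2⟩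

-- Let `κ₁`, `κ₂` be the cosets of `v` for the two orders. The first order is equivariant for `e 0
-- 1`, the second for `e 0 2`. Agreement at the two adjacent corners and at the opposite corner
-- gives `e₀₁^m e₀₂^n κ₂ = e₀₂^n e₀₁^m κ₁`; as the two elements commute, `κ₁ = κ₂`.
include hS in
theorem agree_square {v : Fin 3 → ℤ} (hv : IsPrim v) (m n : ℤ) (h1 : Agree e (tv 0 1 m v))
    (h2 : Agree e (tv 0 2 n v)) (h3 : Agree e (tv 0 1 m (tv 0 2 n v))) : Agree e v := by
  obtain ⟨κ₁, hκ₁⟩ := cos_exists (e := e) (j := 1) (k := 2) (by decide) (by decide) (by decide) hv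
  obtain ⟨κ₂, hκ₂⟩ := cos_exists (e := e) (j := 2) (k := 1) (by decide) (by decide) (by decide) hv
  have hcomm : tv 0 1 m (tv 0 2 n v) = tv 0 2 n (tv 0 1 m v) := by
    ext l; fin_cases l <;> simp [tv]; ring
  have u1 := fun {v κ κ'} => hS.cos_unique (v := v) (κ := κ) (κ' := κ') (j := 1) (k := 2) (by decide) (by decide) (by decide)
  have u2 := fun {v κ κ'} => hS.cos_unique (v := v) (κ := κ) (κ' := κ') (j := 2) (k := 1) (by decide) (by decide) (by decide)
  obtain ⟨a, ha, ha'⟩ := h1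
  obtain ⟨b, hb, hb'⟩ := h2
  obtain ⟨c, hc, hc'⟩ := h3
  obtain rfl := u1 ha (hS.cos_0j (by decide) (by decide) (by decide) m hκ₁)
  obtain rfl := u2 hb' (hS.cos_0j (by decide) (by decide) (by decide) n hκ₂)
  obtain rfl := u1 hc (hS.cos_0j (by decide) (by decide) (by decide) m hb)
  have h4 := u2 hc' (hcomm ▸ (hS.cos_0j (by decide) (by decide) (by decide) n ha'))
  have hc : e 0 1 ^ m * e 0 2 ^ n = e 0 2 ^ n * e 0 1 ^ m :=
    (show Commute (e 0 1) (e 0 2) from hS.comm 0 1 0 2 (by decide) (by decide) (by decide) (by decide)).zpow_zpow m n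
  rw [smul_smul, smul_smul, hc, smul_left_cancel_iff] at h4
  subst h4
  exact ⟨_, hκ₁, hκ₂⟩

-- The one vector that the descent cannot reach. The two cosets are those of `e₂₁ α₀₁(S)` and `e₁₂
-- α₀₂(S)`. With `c = α₁₂(S)` in `P` one has `α₀₂(S) = c α₀₁(S) c⁻¹` and `e₁₂ c = e₂₁ e₁₂⁻¹`, and
-- `e₁₂⁻¹` conjugated by `α₀₁(S)` lies in `P`.
include hS in
theorem agree_zero_one_one : Agree e ![0, 1, 1] := by
  have h01 : (0 : Fin 3) ≠ 1 := by decide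
  have h02 : (0 : Fin 3) ≠ 2 := by decide
  have h12 : (1 : Fin 3) ≠ 2 := by decide
  have k1 : Cos e 1 2 ![0, 1, 1] (α e 0 1 ModularGroup.S * α e 0 2 SL2Pres.L : S) :=
    ⟨_, _, by decide, by decide, by decide, by decide, rfl⟩
  have k2 : Cos e 2 1 ![0, 1, 1] (α e 0 2 ModularGroup.S * α e 0 1 SL2Pres.L : S) :=
    ⟨_, _, by decide, by decide, by decide, by decide, rfl⟩
  refine ⟨_, k1, ?_⟩
  convert k2 using 1
  have e1 : α e 0 1 ModularGroup.S * α e 0 2 SL2Pres.L = e 2 1 * α e 0 1 ModularGroup.S := by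
    have h := hS.α_row h01 h12 h02 ModularGroup.S ![0, 1]
    simp [rowE, ModularGroup.S] at h
    rw [hS.α_L h02]
    exact h.symm
  have e2 : α e 0 2 ModularGroup.S * α e 0 1 SL2Pres.L = e 1 2 * α e 0 2 ModularGroup.S := by
    have h := hS.α_row h02 h12.symm h01 ModularGroup.S ![0, 1]
    simp [rowE, ModularGroup.S] at h
    rw [hS.α_L h01]
    exact h.symm
  have c1 : α e 1 2 ModularGroup.S * e 0 1 = e 0 2 * α e 1 2 ModularGroup.S := by
    have h := hS.α_row h12 h02.symm h01.symm ModularGroup.S ![0, 1]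
    simp [rowE, ModularGroup.S] at h
    exact h.symm
  have c2 : α e 1 2 ModularGroup.S * e 1 0 = e 2 0 * α e 1 2 ModularGroup.S := by
    have h := hS.α_col h12 h02.symm h01.symm ModularGroup.S ![1, 0]
    simp [colE, ModularGroup.S] at h
    exact h
  have hSw : ModularGroup.S = SL2Pres.T⁻¹ * SL2Pres.L * SL2Pres.T⁻¹ := by decide
  have e3 : α e 0 2 ModularGroup.S =
      α e 1 2 ModularGroup.S * α e 0 1 ModularGroup.S * (α e 1 2 ModularGroup.S)⁻¹ := by
    rw [← mul_inv_eq_iff_eq_mul] at c1 c2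
    have : ∀ c : S, c * α e 0 1 ModularGroup.S * c⁻¹ =
        (c * e 0 1 * c⁻¹)⁻¹ * (c * e 1 0 * c⁻¹) * (c * e 0 1 * c⁻¹)⁻¹ := by
      intro c
      rw [hSw]
      simp only [map_mul, map_inv, hS.α_T h01, hS.α_L h01]
      group
    rw [this, c1, c2, hSw]
    simp only [map_mul, map_inv, hS.α_T h02, hS.α_L h02]
  have hm : α e 1 2 ModularGroup.S ∈ P e := hS.α_mem h01 h02 h12 _
  have e4 : (e 2 1)⁻¹ * (e 1 2 * α e 1 2 ModularGroup.S) = (e 1 2)⁻¹ := by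
    rw [← hS.α_T h12, ← hS.α_L h12, ← map_inv, ← map_mul, ← map_mul, ← map_inv]
    congr 1
    decide
  have e5 := hS.conj_col_mem h02 h01 h12.symm ModularGroup.S 0 (-1)
  rw [QuotientGroup.eq, e1, e2, e3]
  have := mul_mem e5 (inv_mem hm)
  rw [zpow_zero, one_mul, zpow_neg_one, ← e4] at this
  convert this using 1
  group

-- Induction on `|v 0|`. The operations `e 1 0` and `e 2 0` are available in both orders, so the
-- other coordinates can be reduced modulo `v 0`. If neither becomes zero, a square with the vector
-- at one corner has first coordinates of smaller absolute value at the other three.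
include hS in
theorem agree_of_ne_zero (n : ℕ) : ∀ v : Fin 3 → ℤ, IsPrim v → v 0 ≠ 0 → (v 0).natAbs ≤ n → Agree e v := by
  induction n with
  | zero => intro v _ h h'; omega
  | succ n ih =>
    intro v hv h0 hn
    -- reduce the other coordinates
    set u := tv 2 0 (-(v 2 / v 0)) (tv 1 0 (-(v 1 / v 0)) v) with hu
    have hup : IsPrim u := (hv.tv (by decide) _).tv (by decide) _
    have hvu : v = tv 1 0 (v 1 / v 0) (tv 2 0 (v 2 / v 0) u) := by
      ext l; fin_cases l <;> simp [hu, tv]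
    have hu0 : u 0 = v 0 := by simp [hu, tv]
    have hu1 : u 1 = v 1 % v 0 := by simp [hu, tv, Int.emod_def]; ring
    have hu2 : u 2 = v 2 % v 0 := by simp [hu, tv, Int.emod_def]; ring
    suffices h : Agree e u by
      rw [hvu]; exact hS.agree_10 _ (hS.agree_20 _ h)
    have a1 := Int.emod_nonneg (v 1) h0
    have a2 := Int.emod_nonneg (v 2) h0
    have b1 := Int.emod_lt_abs (v 1) h0
    have b2 := Int.emod_lt_abs (v 2) h0
    rw [← hu1] at a1
    rw [← hu2] at a2
    rw [← hu1, ← hu0, Int.abs_eq_natAbs] at b1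
    rw [← hu2, ← hu0, Int.abs_eq_natAbs] at b2
    rw [← hu0] at h0 hn
    clear_value u
    clear hu1 hu2
    by_cases z1 : u 1 = 0
    · exact hS.cos_base (by decide) (by decide) (by decide) hup z1
    by_cases z2 : u 2 = 0
    · obtain ⟨κ, h1, h2⟩ := hS.cos_base (j := 2) (k := 1) (by decide) (by decide) (by decide) hup z2
      exact ⟨κ, h2, h1⟩
    -- The sign opposite to that of `u 0`: adding `s u₁`, `s u₂` or both to `u 0` decreases its
    -- absolute value. Only the corner with both additions can have first coordinate zero, namely
    -- when `u₁ + u₂ = |u 0|`.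
    obtain ⟨s, hs⟩ : ∃ s : ℤ, (s = 1 ∧ u 0 < 0) ∨ (s = -1 ∧ 0 < u 0) := by
      rcases lt_or_gt_of_ne h0 with h | h
      · exact ⟨1, Or.inl ⟨rfl, h⟩⟩
      · exact ⟨-1, Or.inr ⟨rfl, h⟩⟩
    have key : ∀ w : Fin 3 → ℤ, IsPrim w → (w 0).natAbs < (u 0).natAbs → w 1 = u 1 → w 2 = u 2 →
        (w 0 = 0 → u 1 + u 2 = (u 0).natAbs) → Agree e w := by
      intro w hw h1 h2 h3 h4
      by_cases hw0 : w 0 = 0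
      · specialize h4 hw0
        -- At a corner `(0, u₁, u₂)`: if the coordinates are equal, primitivity makes the vector
        -- `(0, 1, 1)`. Otherwise a second square has first coordinates `u₁`, `-u₂`, `u₁ - u₂`,
        -- non-zero and smaller than `|u 0|` in absolute value.
        by_cases h12 : u 1 = u 2
        · have hu1 : IsUnit (u 1) := by
            refine hw _ fun l => ?_
            fin_cases l
            · simp [hw0]
            · simp [h2]
            · simp [h3, h12]
          have : u 1 = 1 := by
            rcases Int.isUnit_iff.1 hu1 with h | h <;> omega
          convert hS.agree_zero_one_one
          ext l; fin_cases l <;> simp [hw0, h2, h3, ← h12, this]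
        · have q1 := hw.tv (i := 0) (j := 1) (by decide) 1
          have q2 := hw.tv (i := 0) (j := 2) (by decide) (-1)
          have q3 := q2.tv (i := 0) (j := 1) (by decide) 1
          refine hS.agree_square hw 1 (-1) (ih _ q1 ?_ ?_) (ih _ q2 ?_ ?_) (ih _ q3 ?_ ?_) <;>
            simp only [tv, ne_eq, Fin.isValue, Function.update_self, one_ne_zero, not_false_eq_true,
              Function.update_of_ne, hw0, h2, h3] <;> omega
      · exact ih w hw hw0 (by omega)
    have p1 := hup.tv (i := 0) (j := 1) (by decide) s
    have p2 := hup.tv (i := 0) (j := 2) (by decide) s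
    have p3 := p2.tv (i := 0) (j := 1) (by decide) s
    refine hS.agree_square hup s s (key _ p1 ?_ ?_ ?_ ?_) (key _ p2 ?_ ?_ ?_ ?_)
      (key _ p3 ?_ ?_ ?_ ?_) <;> simp only [tv, ne_eq, Fin.isValue, Function.update_self,
        one_ne_zero, not_false_eq_true, Function.update_of_ne, Fin.reduceEq] <;>
      rcases hs with ⟨rfl, h⟩ | ⟨rfl, h⟩ <;> omega

include hS in
theorem agree {v : Fin 3 → ℤ} (hv : IsPrim v) : Agree e v := by
  by_cases h0 : v 0 = 0
  · by_cases z1 : v 1 = 0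
    · exact hS.cos_base (by decide) (by decide) (by decide) hv z1
    by_cases z2 : v 2 = 0
    · obtain ⟨κ, h1, h2⟩ := hS.cos_base (j := 2) (k := 1) (by decide) (by decide) (by decide) hv z2
      exact ⟨κ, h2, h1⟩
    -- The sign `n` makes the first coordinates `v 1`, `n v 2` and `v 1 + n v 2` of the other
    -- corners of the square all non-zero.
    obtain ⟨n, hn, hn'⟩ : ∃ n : ℤ, (n = 1 ∨ n = -1) ∧ v 1 + n * v 2 ≠ 0 := by
      by_cases h : v 1 + v 2 = 0
      · exact ⟨-1, by simp, by omega⟩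
      · exact ⟨1, by simp, by omega⟩
    have q1 := hv.tv (i := 0) (j := 1) (by decide) 1
    have q2 := hv.tv (i := 0) (j := 2) (by decide) n
    have q3 := q2.tv (i := 0) (j := 1) (by decide) 1
    refine hS.agree_square hv 1 n (hS.agree_of_ne_zero _ _ q1 ?_ le_rfl)
      (hS.agree_of_ne_zero _ _ q2 ?_ le_rfl) (hS.agree_of_ne_zero _ _ q3 ?_ le_rfl) <;>
      simp [tv, h0] <;> rcases hn with rfl | rfl <;> omega
  · exact hS.agree_of_ne_zero _ _ hv h0 le_rfl

include hS in
/-- The coset of `S` belonging to `v` transforms like `v`. -/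
theorem cos_e {i j : Fin 3} (hij : i ≠ j) (n : ℤ) {v : Fin 3 → ℤ} (hv : IsPrim v) {κ : S ⧸ P e}
    (h : Cos e 1 2 v κ) : Cos e 1 2 (tv i j n v) (e i j ^ n • κ) := by
  -- Agreement allows passage to the order in which the given elementary operation is equivariant.
  have sw : ∀ {v}, IsPrim v → ∀ {κ}, Cos e 2 1 v κ → Cos e 1 2 v κ := by
    intro v hv κ h
    obtain ⟨κ', h1, h2⟩ := hS.agree hv
    rwa [hS.cos_unique (by decide) (by decide) (by decide) h h2]
  have sw' : ∀ {v}, IsPrim v → ∀ {κ}, Cos e 1 2 v κ → Cos e 2 1 v κ := by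
    intro v hv κ h
    obtain ⟨κ', h1, h2⟩ := hS.agree hv
    rwa [hS.cos_unique (by decide) (by decide) (by decide) h h1]
  fin_cases i <;> fin_cases j
  · exact absurd rfl hij
  · exact hS.cos_0j (by decide) (by decide) (by decide) n h
  · exact sw (hv.tv hij n) (hS.cos_0j (by decide) (by decide) (by decide) n (sw' hv h))
  · exact hS.cos_j0 (by decide) (by decide) (by decide) n h
  · exact absurd rfl hij
  · exact sw (hv.tv hij n) (hS.cos_kj (by decide) (by decide) (by decide) n (sw' hv h))
  · exact hS.cos_k0 (by decide) (by decide) (by decide) n h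
  · exact hS.cos_kj (by decide) (by decide) (by decide) n h
  · exact absurd rfl hij

end IsSteinberg
end
end EllipticGamma

/-! ### Faithfulness of the matrix representation and the presentation of `SL(3, ℤ)`. -/

namespace EllipticGamma
noncomputable section

/-- `SL(3, ℤ)`. -/
abbrev SL3Z : Type := Matrix.SpecialLinearGroup (Fin 3) ℤ

/-- The elementary matrices; `el i i = 1`. -/
def el (i j : Fin 3) : SL3Z :=
  if h : i ≠ j then ⟨Matrix.transvection i j 1, Matrix.det_transvection_of_ne i j h 1⟩ else 1

theorem el_mulVec {i j : Fin 3} (h : i ≠ j) (v : Fin 3 → ℤ) : (el i j).1.mulVec v = tv i j 1 v := by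
  have h1 : el i j = ⟨Matrix.transvection i j 1, Matrix.det_transvection_of_ne i j h 1⟩ := dif_pos h
  rw [h1]
  ext l
  simp only [Matrix.transvection, Matrix.add_mulVec, Matrix.one_mulVec, Pi.add_apply, tv]
  rw [Matrix.single_mulVec]
  by_cases hl : l = i
  · subst hl; simp
  · simp [hl]

theorem SL3_ext_mulVec {A B : SL3Z} (h : ∀ v, A.1.mulVec v = B.1.mulVec v) : A = B :=
  Subtype.ext (Matrix.mulVec_injective (funext h))

theorem isSteinberg_el : IsSteinberg el where
  comm i j k l hij hkl hjk hil := by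
    apply Subtype.ext
    revert i j k l
    decide +kernel
  tri i j k hij hjk hik := by
    apply Subtype.ext
    revert i j k
    decide +kernel
  w4 := by
    apply Subtype.ext
    decide +kernel

namespace IsSteinberg

variable {S : Type*} [Group S] {e : Fin 3 → Fin 3 → S} (hS : IsSteinberg e)

theorem α_mem_closure (hS : IsSteinberg e) {i j : Fin 3} (hij : i ≠ j) {K : Subgroup S} (h1 : e i j ∈ K)
    (h2 : e j i ∈ K) (A : SL2) : α e i j A ∈ K := by
  induction A using SL2_induction with
  | hT => rw [hS.α_T hij]; exact h1
  | hL => rw [hS.α_L hij]; exact h2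
  | one => rw [map_one]; exact one_mem _
  | mul a b ha hb => rw [map_mul]; exact mul_mem ha hb
  | inv a ha => rw [map_inv]; exact inv_mem ha

section
variable (π : S →* SL3Z) (hπ : ∀ i j, i ≠ j → π (e i j) = el i j)

theorem mulVec_inv_mulVec (A : SL3Z) (v : Fin 3 → ℤ) : A.1.mulVec ((A⁻¹).1.mulVec v) = v := by
  rw [Matrix.mulVec_mulVec, ← Matrix.SpecialLinearGroup.coe_mul, mul_inv_cancel,
    Matrix.SpecialLinearGroup.coe_one, Matrix.one_mulVec]

theorem inv_mulVec_mulVec (A : SL3Z) (v : Fin 3 → ℤ) : (A⁻¹).1.mulVec (A.1.mulVec v) = v := by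
  simpa using mulVec_inv_mulVec A⁻¹ v

include hπ in
theorem π_zpow {i j : Fin 3} (hij : i ≠ j) (n : ℤ) (v : Fin 3 → ℤ) :
    (π (e i j ^ n)).1.mulVec v = tv i j n v := by
  have key : ∀ m n : ℤ, ∀ v, tv i j m (tv i j n v) = tv i j (m + n) v := by
    intro m n v
    ext l
    by_cases hl : l = i
    · subst hl; simp [tv, hij.symm]; ring
    · simp [tv, hl]
  have hinv : ∀ v, (π (e i j)⁻¹).1.mulVec v = tv i j (-1) v := by
    intro v
    have h1 := key 1 (-1) v
    rw [← el_mulVec hij, ← hπ _ _ hij, add_neg_cancel] at h1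
    have h2 : tv i j 0 v = v := by simp [tv]
    have h3 := inv_mulVec_mulVec (π (e i j)) (tv i j (-1) v)
    rw [h1, h2, ← map_inv] at h3
    exact h3
  induction n using Int.induction_on generalizing v with
  | zero => simp [tv]
  | succ n ih =>
    rw [zpow_add_one, map_mul, Matrix.SpecialLinearGroup.coe_mul, ← Matrix.mulVec_mulVec,
      hπ _ _ hij, el_mulVec hij, ih, key]
  | pred n ih =>
    rw [zpow_sub_one, map_mul, Matrix.SpecialLinearGroup.coe_mul, ← Matrix.mulVec_mulVec,
      hinv, ih, key, sub_eq_add_neg]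

/-- The block matrix action. -/
theorem π_α (hS : IsSteinberg e) (hπ : ∀ i j, i ≠ j → π (e i j) = el i j) {i j : Fin 3} (hij : i ≠ j) (A : SL2) : ∀ v : Fin 3 → ℤ, (π (α e i j A)).1.mulVec v =
    fun l => if l = i then A.1 0 0 * v i + A.1 0 1 * v j else
      if l = j then A.1 1 0 * v i + A.1 1 1 * v j else v l := by
  set F : SL2 → (Fin 3 → ℤ) → Fin 3 → ℤ := fun A v l => if l = i then A.1 0 0 * v i + A.1 0 1 * v j else
      if l = j then A.1 1 0 * v i + A.1 1 1 * v j else v l with hF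
  have hmul : ∀ A B v, F A (F B v) = F (A * B) v := by
    intro A B v
    ext l
    simp only [hF, if_true, hij.symm, if_false, Matrix.SpecialLinearGroup.coe_mul, Matrix.mul_apply,
      Fin.sum_univ_two]
    split_ifs <;> ring
  have hone : ∀ v, F 1 v = v := by
    intro v
    ext l
    simp only [hF]
    split_ifs with h1 h2
    · simp [h1]
    · simp [h2]
    · rfl
  change ∀ v, _ = F A v
  induction A using SL2_induction with
  | hT =>
    intro v
    rw [hS.α_T hij, hπ _ _ hij, el_mulVec hij]
    ext l
    simp only [hF, tv, Function.update_apply, SL2Pres.T]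
    split_ifs with h1 h2
    · simp
    · simp [h2]
    · rfl
  | hL =>
    intro v
    rw [hS.α_L hij, hπ _ _ hij.symm, el_mulVec hij.symm]
    ext l
    simp only [hF, tv, Function.update_apply, SL2Pres.L]
    split_ifs with h1 h2
    · exact absurd (h1.symm.trans h2).symm hij
    · simp; ring
    · simp [*]
    · rfl
  | one => intro v; rw [hone]; simp
  | mul a b ha hb =>
    intro v
    rw [map_mul, map_mul, Matrix.SpecialLinearGroup.coe_mul, ← Matrix.mulVec_mulVec, hb, ha, hmul]
  | inv a ha =>
    intro v
    have := ha (F a⁻¹ v)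
    rw [hmul, mul_inv_cancel, hone] at this
    rw [map_inv, map_inv, ← this, inv_mulVec_mulVec, this]

-- Equivariance on generators extends to the whole group. The statement is carried for `s` and `s⁻¹`
-- together, so that the inverse step only exchanges the two halves.
include hS hπ in
theorem cos_smul (hgen : Subgroup.closure {s | ∃ i j, i ≠ j ∧ s = e i j} = ⊤) (s : S) :
    ∀ {v : Fin 3 → ℤ} {κ : S ⧸ P e}, IsPrim v → Cos e 1 2 v κ →
      (IsPrim ((π s).1.mulVec v) ∧ Cos e 1 2 ((π s).1.mulVec v) (s • κ)) ∧
      (IsPrim ((π s⁻¹).1.mulVec v) ∧ Cos e 1 2 ((π s⁻¹).1.mulVec v) (s⁻¹ • κ)) := by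
  have hs : s ∈ Subgroup.closure {s | ∃ i j, i ≠ j ∧ s = e i j} := by rw [hgen]; trivial
  induction hs using Subgroup.closure_induction with
  | mem s hs =>
    obtain ⟨i, j, hij, rfl⟩ := hs
    intro v κ hv h
    have h1 := π_zpow π hπ hij 1 v
    have h2 := π_zpow π hπ hij (-1) v
    rw [zpow_one] at h1
    rw [zpow_neg_one] at h2
    have h3 := hS.cos_e hij 1 hv h
    have h4 := hS.cos_e hij (-1) hv h
    rw [zpow_one] at h3
    rw [zpow_neg_one] at h4
    rw [h1, h2]
    exact ⟨⟨hv.tv hij 1, h3⟩, hv.tv hij (-1), h4⟩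
  | one => intro v κ hv h; simpa using ⟨hv, h⟩
  | mul a b _ _ ha hb =>
    intro v κ hv h
    have h1 := (hb hv h).1
    have h2 := (ha h1.1 h1.2).1
    have h3 := (ha hv h).2
    have h4 := (hb h3.1 h3.2).2
    rw [mul_inv_rev, map_mul, map_mul, Matrix.SpecialLinearGroup.coe_mul,
      Matrix.SpecialLinearGroup.coe_mul, ← Matrix.mulVec_mulVec, ← Matrix.mulVec_mulVec, mul_smul,
      mul_smul]
    exact ⟨h2, h4⟩
  | inv a _ ha =>
    intro v κ hv h
    rw [inv_inv]
    exact (ha hv h).symm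

-- The abstract stabiliser is a quotient of a semidirect product of `SL(2, ℤ)` with `ℤ²`: by `α_row`
-- a row element can be moved to the right of a block element, so products and inverses keep this
-- shape.
include hS in
theorem exists_normal_form {s : S} (hs : s ∈ P e) :
    ∃ (A : SL2) (u : Fin 2 → ℤ), s = α e 1 2 A * rowE e 1 2 0 u := by
  have hadd : ∀ u u', rowE e 1 2 0 u * rowE e 1 2 0 u' = rowE e 1 2 0 (u + u') := by
    intro u u'
    have hc : Commute (e 0 2 ^ u 1) (e 0 1 ^ u' 0) :=
      (show Commute (e 0 2) (e 0 1) from hS.comm 0 2 0 1 (by decide) (by decide) (by decide)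
        (by decide)).zpow_zpow _ _
    simp only [rowE, Pi.add_apply, zpow_add, mul_assoc]
    rw [← mul_assoc (e 0 2 ^ u 1), hc.eq, mul_assoc]
  have hzero : rowE e 1 2 0 0 = 1 := by simp [rowE]
  have hrow := hS.α_row (i := 1) (j := 2) (k := 0) (by decide) (by decide) (by decide)
  induction hs using Subgroup.closure_induction with
  | mem s hs =>
    simp only [Set.mem_insert_iff, Set.mem_singleton_iff] at hs
    rcases hs with rfl | rfl | rfl | rfl
    · exact ⟨1, ![1, 0], by simp [rowE]⟩
    · exact ⟨1, ![0, 1], by simp [rowE]⟩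
    · exact ⟨SL2Pres.T, 0, by rw [hzero, hS.α_T (by decide), mul_one]⟩
    · exact ⟨SL2Pres.L, 0, by rw [hzero, hS.α_L (by decide), mul_one]⟩
  | one => exact ⟨1, 0, by rw [hzero, map_one, mul_one]⟩
  | mul a b _ _ ha hb =>
    obtain ⟨A, u, rfl⟩ := ha
    obtain ⟨B, v, rfl⟩ := hb
    refine ⟨A * B, Matrix.vecMul u B.1 + v, ?_⟩
    rw [← hadd, map_mul, mul_assoc, mul_assoc, ← mul_assoc (rowE e 1 2 0 u), hrow, mul_assoc]
  | inv a _ ha =>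
    obtain ⟨A, u, rfl⟩ := ha
    refine ⟨A⁻¹, Matrix.vecMul (-u) (A⁻¹).1, ?_⟩
    rw [← hrow, map_inv, mul_inv_rev]
    congr 1
    rw [inv_eq_iff_mul_eq_one, hadd, add_neg_cancel, hzero]

include hπ in
theorem π_rowE (u : Fin 2 → ℤ) (v : Fin 3 → ℤ) :
    (π (rowE e 1 2 0 u)).1.mulVec v = ![v 0 + u 0 * v 1 + u 1 * v 2, v 1, v 2] := by
  rw [rowE, map_mul, Matrix.SpecialLinearGroup.coe_mul, ← Matrix.mulVec_mulVec,
    π_zpow π hπ (by decide), π_zpow π hπ (by decide)]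
  ext l
  fin_cases l <;> simp [tv]
  ring

-- An element of the kernel fixes the coset of 1, which belongs to the first basis vector, and hence
-- lies in `P`. The matrix of its normal form is the identity, so the block is 1 and both row
-- exponents vanish.
include hS hπ in
theorem injective (hgen : Subgroup.closure {s | ∃ i j, i ≠ j ∧ s = e i j} = ⊤) :
    Function.Injective π := by
  rw [injective_iff_map_eq_one]
  intro s hs
  have hprim : IsPrim ![1, 0, 0] := fun d hd => isUnit_of_dvd_one (hd 0)
  have h0 : Cos e 1 2 ![1, 0, 0] ((1 : S) : S ⧸ P e) := ⟨1, 1, by simp⟩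
  have h1 := (hS.cos_smul π hπ hgen s hprim h0).1.2
  rw [hs, Matrix.SpecialLinearGroup.coe_one, Matrix.one_mulVec] at h1
  have h2 := hS.cos_unique (by decide) (by decide) (by decide) h1 h0
  rw [MulAction.Quotient.smul_coe, smul_eq_mul, mul_one, eq_comm, QuotientGroup.eq, inv_one,
    one_mul] at h2
  obtain ⟨A, u, rfl⟩ := hS.exists_normal_form h2
  have hv : ∀ v : Fin 3 → ℤ, v = fun l => if l = 1 then A.1 0 0 * v 1 + A.1 0 1 * v 2 else
      if l = 2 then A.1 1 0 * v 1 + A.1 1 1 * v 2 else ![v 0 + u 0 * v 1 + u 1 * v 2, v 1, v 2] l := by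
    intro v
    have h3 : (π (α e 1 2 A * rowE e 1 2 0 u)).1.mulVec v = v := by
      rw [hs, Matrix.SpecialLinearGroup.coe_one, Matrix.one_mulVec]
    rw [map_mul, Matrix.SpecialLinearGroup.coe_mul, ← Matrix.mulVec_mulVec,
      π_α π hS hπ (by decide), π_rowE π hπ] at h3
    exact h3.symm
  have e1 := hv ![0, 1, 0]
  have e2 := hv ![0, 0, 1]
  have a1 := congrFun e1 0
  have a2 := congrFun e1 1
  have a3 := congrFun e1 2
  have b1 := congrFun e2 0
  have b2 := congrFun e2 1
  have b3 := congrFun e2 2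
  simp at a1 a2 a3 b1 b2 b3
  have hA : A = 1 := by
    apply Subtype.ext
    ext i j
    fin_cases i <;> fin_cases j <;> simp [← a2, ← a3, ← b2, ← b3]
  rw [hA, map_one, one_mul, rowE, ← a1, ← b1]
  simp
end

end IsSteinberg

/-- The reduction of `cos_exists`, applied to the first column of a matrix, gives a product `g` of
block elements with the same first column. Then `g⁻¹ M` fixes the first basis vector and is a block
matrix times a row element. -/
theorem closure_el : Subgroup.closure {s | ∃ i j, i ≠ j ∧ s = el i j} = ⊤ := by
  rw [eq_top_iff]
  intro M _
  set K := Subgroup.closure {s | ∃ i j, i ≠ j ∧ s = el i j}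
  have hel : ∀ i j, i ≠ j → el i j ∈ K := fun i j h => Subgroup.subset_closure ⟨i, j, h, rfl⟩
  have hα : ∀ i j, i ≠ j → ∀ A, IsSteinberg.α el i j A ∈ K := fun i j h A =>
    isSteinberg_el.α_mem_closure h (hel i j h) (hel j i h.symm) A
  have hid : ∀ i j, i ≠ j → MonoidHom.id SL3Z (el i j) = el i j := fun _ _ _ => rfl
  have hact := fun {i j} => IsSteinberg.π_α (MonoidHom.id SL3Z) isSteinberg_el hid (i := i) (j := j)
  simp only [MonoidHom.id_apply] at hact
  have hprim : IsSteinberg.IsPrim (M.1.mulVec ![1, 0, 0]) := by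
    intro d hd
    have : ∀ i, d ∣ ((M⁻¹).1.mulVec (M.1.mulVec ![1, 0, 0])) i := by
      intro i
      change d ∣ ∑ j, (M⁻¹).1 i j * (M.1.mulVec ![1, 0, 0]) j
      exact Finset.dvd_sum fun j _ => (hd j).mul_left _
    rw [IsSteinberg.inv_mulVec_mulVec] at this
    exact isUnit_of_dvd_one (this 0)
  obtain ⟨κ, A, B, -, h0, h1, h2, -⟩ := IsSteinberg.cos_exists (e := el) (j := 1) (k := 2)
    (by decide) (by decide) (by decide) hprim
  set g := IsSteinberg.α el 0 1 A * IsSteinberg.α el 0 2 B with hg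
  have hgK : g ∈ K := mul_mem (hα _ _ (by decide) _) (hα _ _ (by decide) _)
  have hg0 : g.1.mulVec ![1, 0, 0] = M.1.mulVec ![1, 0, 0] := by
    rw [hg, Matrix.SpecialLinearGroup.coe_mul, ← Matrix.mulVec_mulVec, hact (by decide),
      hact (by decide)]
    ext l
    fin_cases l
    · rw [show (⟨0, by omega⟩ : Fin 3) = 0 from rfl, h0]; simp
    · rw [show (⟨1, by omega⟩ : Fin 3) = 1 from rfl, h1]; simp
    · rw [show (⟨2, by omega⟩ : Fin 3) = 2 from rfl, h2]; simp
  obtain ⟨R, hR⟩ : ∃ R, R = g⁻¹ * M := ⟨_, rfl⟩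
  have hR0 : R.1.mulVec ![1, 0, 0] = ![1, 0, 0] := by
    rw [hR, Matrix.SpecialLinearGroup.coe_mul, ← Matrix.mulVec_mulVec, ← hg0,
      IsSteinberg.inv_mulVec_mulVec]
  have r0 : R.1 0 0 = 1 := by simpa [Matrix.mulVec, dotProduct, Fin.sum_univ_three] using congrFun hR0 0
  have r1 : R.1 1 0 = 0 := by simpa [Matrix.mulVec, dotProduct, Fin.sum_univ_three] using congrFun hR0 1
  have r2 : R.1 2 0 = 0 := by simpa [Matrix.mulVec, dotProduct, Fin.sum_univ_three] using congrFun hR0 2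
  have hdet := R.2
  rw [Matrix.det_fin_three, r0, r1, r2] at hdet
  let C : SL2 := ⟨!![R.1 1 1, R.1 1 2; R.1 2 1, R.1 2 2], by rw [Matrix.det_fin_two_of]; linarith⟩
  have hRC : R = IsSteinberg.α el 1 2 C * IsSteinberg.rowE el 1 2 0 ![R.1 0 1, R.1 0 2] := by
    apply SL3_ext_mulVec
    intro v
    have hrow := IsSteinberg.π_rowE (MonoidHom.id SL3Z) hid ![R.1 0 1, R.1 0 2] v
    simp only [MonoidHom.id_apply] at hrow
    rw [Matrix.SpecialLinearGroup.coe_mul, ← Matrix.mulVec_mulVec,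
      hact (show (1 : Fin 3) ≠ 2 by decide), hrow]
    ext l
    fin_cases l <;> simp [Matrix.mulVec, dotProduct, Fin.sum_univ_three, r0, r1, r2, C]
  have hM : M = g * R := by rw [hR, mul_inv_cancel_left]
  rw [hM, hRC]
  exact mul_mem hgK (mul_mem (hα _ _ (by decide) _)
    (mul_mem (zpow_mem (hel _ _ (by decide)) _) (zpow_mem (hel _ _ (by decide)) _)))

/-- The presentation of `SL(3, ℤ)` by the Steinberg relations and `w₁₃⁴ = 1`. -/
theorem exists_SL3_hom {H : Type*} [Group H] (ε : Fin 3 → Fin 3 → H) (hε : IsSteinberg ε) :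
    ∃ f : SL3Z →* H, ∀ i j, i ≠ j → f (el i j) = ε i j := by
  obtain ⟨f, hf⟩ := exists_hom_of_graph (ι := {p : Fin 3 × Fin 3 // p.1 ≠ p.2})
    (fun p => el p.1.1 p.1.2) (fun p => ε p.1.1 p.1.2)
    (by
      rw [← closure_el]
      congr 1
      ext s
      constructor
      · rintro ⟨⟨⟨i, j⟩, h⟩, rfl⟩; exact ⟨i, j, h, rfl⟩
      · rintro ⟨i, j, h, rfl⟩; exact ⟨⟨⟨i, j⟩, h⟩, rfl⟩)
    (by
      have hcl := closure_range_subtype_eq_top (fun p : {p : Fin 3 × Fin 3 // p.1 ≠ p.2} =>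
        (el p.1.1 p.1.2, ε p.1.1 p.1.2))
      set K := Subgroup.closure (Set.range fun p : {p : Fin 3 × Fin 3 // p.1 ≠ p.2} =>
        (el p.1.1 p.1.2, ε p.1.1 p.1.2))
      let e : Fin 3 → Fin 3 → K := fun i j => if h : i ≠ j then
        ⟨(el i j, ε i j), Subgroup.subset_closure ⟨⟨⟨i, j⟩, h⟩, rfl⟩⟩ else 1
      have he : ∀ {i j}, i ≠ j → (e i j : SL3Z × H) = (el i j, ε i j) := by
        intro i j h
        simp only [e, dif_pos h]
      -- The graph group inherits the relations from its two components.
      have hS : IsSteinberg e :=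
        { comm := fun i j k l hij hkl hjk hil => Subtype.ext (by
            rw [Subgroup.coe_mul, Subgroup.coe_mul, he hij, he hkl]
            exact Prod.ext (isSteinberg_el.comm i j k l hij hkl hjk hil)
              (hε.comm i j k l hij hkl hjk hil))
          tri := fun i j k hij hjk hik => Subtype.ext (by
            rw [Subgroup.coe_mul, Subgroup.coe_mul, Subgroup.coe_mul, he hij, he hjk, he hik]
            exact Prod.ext (isSteinberg_el.tri i j k hij hjk hik) (hε.tri i j k hij hjk hik))
          w4 := Subtype.ext (by
            rw [Subgroup.coe_pow, Subgroup.coe_mul, Subgroup.coe_mul, Subgroup.coe_inv,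
              he (by decide), he (by decide)]
            exact Prod.ext isSteinberg_el.w4 hε.w4) }
      refine hS.injective _ (fun i j h => ?_) ?_
      · change (e i j : SL3Z × H).1 = _
        rw [he h]
      · rw [← hcl]
        congr 1
        ext s
        constructor
        · rintro ⟨i, j, h, rfl⟩
          exact ⟨⟨⟨i, j⟩, h⟩, Subtype.ext (he h).symm⟩
        · rintro ⟨⟨⟨i, j⟩, h⟩, rfl⟩
          exact ⟨i, j, h, Subtype.ext (he h).symm⟩)
  exact ⟨f, fun i j h => hf ⟨⟨i, j⟩, h⟩⟩

end
end EllipticGamma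

namespace EllipticGamma
noncomputable section

/-! ### A presentation of `G` -/

theorem el_eq {i j : Fin 3} (h : i ≠ j) : G.ofSL (el i j) = G.e i j h := by
  have h1 : el i j = ⟨Matrix.transvection i j 1, Matrix.det_transvection_of_ne i j h 1⟩ := dif_pos h
  rw [h1]
  rfl

section GHom

variable {H : Type*} [Group H]

/-- The product of powers of three elements. -/
def tpow (τ : Fin 3 → H) (n : Fin 3 → ℤ) : H := τ 0 ^ n 0 * τ 1 ^ n 1 * τ 2 ^ n 2

variable {τ : Fin 3 → H} (hτ : ∀ i j, τ i * τ j = τ j * τ i)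

include hτ in
theorem tpow_add (m n : Fin 3 → ℤ) : tpow τ (m + n) = tpow τ m * tpow τ n := by
  have hc : ∀ i j (a b : ℤ), τ i ^ a * τ j ^ b = τ j ^ b * τ i ^ a := fun i j a b =>
    (show Commute (τ i) (τ j) from hτ i j).zpow_zpow a b
  simp only [tpow, Pi.add_apply, zpow_add]
  calc τ 0 ^ m 0 * τ 0 ^ n 0 * (τ 1 ^ m 1 * τ 1 ^ n 1) * (τ 2 ^ m 2 * τ 2 ^ n 2)
      = τ 0 ^ m 0 * (τ 0 ^ n 0 * τ 1 ^ m 1) * (τ 1 ^ n 1 * τ 2 ^ m 2) * τ 2 ^ n 2 := by group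
    _ = τ 0 ^ m 0 * τ 1 ^ m 1 * (τ 0 ^ n 0 * τ 2 ^ m 2) * τ 1 ^ n 1 * τ 2 ^ n 2 := by
      rw [hc 0 1, hc 1 2]; group
    _ = _ := by rw [hc 0 2]; group

theorem tpow_single (i : Fin 3) (m : ℤ) : tpow τ (Pi.single i m) = τ i ^ m := by
  fin_cases i <;> simp [tpow]

theorem tpow_zero : tpow τ 0 = 1 := by simp [tpow]

variable {ε : Fin 3 → Fin 3 → H} (h1 : ∀ i j k, i ≠ j → i ≠ k → ε i j * τ k = τ k * ε i j)
  (h2 : ∀ i j, i ≠ j → τ j * ε i j * τ i = τ i * ε i j)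

include hτ h1 h2 in
theorem tpow_mul_e {i j : Fin 3} (hij : i ≠ j) (n : Fin 3 → ℤ) :
    tpow τ n * ε i j = ε i j * tpow τ (Matrix.vecMul n (el i j).1) := by
  have hadd : ∀ a b, tpow τ a * ε i j = ε i j * tpow τ (Matrix.vecMul a (el i j).1) →
      tpow τ b * ε i j = ε i j * tpow τ (Matrix.vecMul b (el i j).1) →
      tpow τ (a + b) * ε i j = ε i j * tpow τ (Matrix.vecMul (a + b) (el i j).1) := by
    intro a b ha hb
    rw [tpow_add hτ, mul_assoc, hb, ← mul_assoc, ha, Matrix.add_vecMul, tpow_add hτ, mul_assoc]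
  have hel : el i j = ⟨Matrix.transvection i j 1, Matrix.det_transvection_of_ne i j hij 1⟩ := dif_pos hij
  have hsingle : ∀ k m, tpow τ (Pi.single k m) * ε i j =
      ε i j * tpow τ (Matrix.vecMul (Pi.single k m) (el i j).1) := by
    intro k m
    by_cases hk : i = k
    · subst hk
      have e1 : Matrix.vecMul (Pi.single i m) (el i j).1 = Pi.single i m + Pi.single j m := by
        rw [hel]
        change Matrix.vecMul (Pi.single i m) (Matrix.transvection i j 1) = _
        ext l
        simp only [Matrix.transvection, Matrix.single_vecMul, Pi.smul_apply, Matrix.row_apply,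
          Matrix.add_apply, Matrix.one_apply, Matrix.single_apply, Pi.add_apply, Pi.single_apply,
          smul_eq_mul]
        simp only [true_and, eq_comm (a := l)]
        split_ifs <;> ring
      have e2 : (ε i j)⁻¹ * τ i * ε i j = τ j * τ i := by
        have a1 := h2 i j hij
        rw [← h1 i j j hij hij, mul_assoc] at a1
        rw [mul_assoc, ← a1, inv_mul_cancel_left]
      have e3 := conj_zpow (i := m) (a := (ε i j)⁻¹) (b := τ i)
      rw [inv_inv, e2, (show Commute (τ j) (τ i) from hτ j i).mul_zpow] at e3
      rw [e1, tpow_add hτ, tpow_single, tpow_single,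
        ((show Commute (τ i) (τ j) from hτ i j).zpow_zpow m m).eq, e3]
      group
    · have e1 : Matrix.vecMul (Pi.single k m) (el i j).1 = Pi.single k m := by
        rw [hel]
        change Matrix.vecMul (Pi.single k m) (Matrix.transvection i j 1) = _
        ext l
        simp only [Matrix.transvection, Matrix.single_vecMul, Pi.smul_apply, Matrix.row_apply,
          Matrix.add_apply, Matrix.one_apply, Matrix.single_apply, Pi.single_apply,
          smul_eq_mul, hk, false_and, if_false, eq_comm (a := l)]
        split_ifs <;> simp
      rw [e1, tpow_single]
      exact ((show Commute (ε i j) (τ k) from h1 i j k hij hk).zpow_right m).symm.eq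
  have hn : n = Pi.single 0 (n 0) + Pi.single 1 (n 1) + Pi.single 2 (n 2) := by
    ext l; fin_cases l <;> simp
  rw [hn]
  exact hadd _ _ (hadd _ _ (hsingle _ _) (hsingle _ _)) (hsingle _ _)

include hτ h1 h2 in
/-- The presentation of `SL(3, ℤ) ⋉ ℤ³`. -/
theorem exists_G_hom (hε : IsSteinberg ε) :
    ∃ F : G →* H, (∀ i j h, F (G.e i j h) = ε i j) ∧ ∀ i, F (G.t i) = τ i := by
  obtain ⟨f, hf⟩ := exists_SL3_hom ε hε
  have key : ∀ (A : SL3Z) (n : Fin 3 → ℤ), tpow τ n * f A = f A * tpow τ (Matrix.vecMul n A.1) := by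
    intro A
    have hA : A ∈ Subgroup.closure {s | ∃ i j, i ≠ j ∧ s = el i j} := by rw [closure_el]; trivial
    induction hA using Subgroup.closure_induction with
    | mem s hs =>
      obtain ⟨i, j, hij, rfl⟩ := hs
      intro n
      rw [hf i j hij, tpow_mul_e hτ h1 h2 hij]
    | one => intro n; simp
    | mul a b _ _ ha hb =>
      intro n
      rw [map_mul, ← mul_assoc, ha, mul_assoc, hb, mul_assoc, Matrix.SpecialLinearGroup.coe_mul,
        Matrix.vecMul_vecMul]
    | inv a _ ha =>
      intro n
      have h := ha (Matrix.vecMul n (a⁻¹).1)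
      rw [Matrix.vecMul_vecMul, ← Matrix.SpecialLinearGroup.coe_mul, inv_mul_cancel,
        Matrix.SpecialLinearGroup.coe_one, Matrix.vecMul_one] at h
      rw [map_inv, mul_inv_eq_iff_eq_mul, mul_assoc, h, inv_mul_cancel_left]
  -- In the convention for the product of `G`, the element `(A, n)` is `A` followed on the right by
  -- the translation `n`; `key` is the rule for moving a translation past a matrix.
  refine ⟨⟨⟨fun g => f g.A * tpow τ g.n, ?_⟩, ?_⟩, ?_, ?_⟩
  · simp [G.one_def, tpow_zero]
  · intro g h
    simp only [G.mul_def, map_mul]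
    rw [add_comm, tpow_add hτ, mul_assoc, ← mul_assoc (f h.A), ← key]
    group
  · intro i j h
    rw [← el_eq h]
    change f (el i j) * tpow τ 0 = _
    rw [tpow_zero, mul_one, hf i j h]
  · intro i
    change f 1 * tpow τ (Pi.single i 1) = _
    rw [tpow_single, map_one, one_mul, zpow_one]

end GHom

theorem G.eq_ofSL_mul (g : G) : g = G.ofSL g.A * tpow G.t g.n := by
  have ht : ∀ (n : Fin 3 → ℤ), (⟨1, n⟩ : G) = tpow G.t n := by
    have hadd : ∀ m n : Fin 3 → ℤ, (⟨1, m + n⟩ : G) = ⟨1, m⟩ * ⟨1, n⟩ := by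
      intro m n
      ext1
      · simp [G.mul_def]
      · simp [G.mul_def, add_comm]
    let T (i : Fin 3) : Multiplicative ℤ →* G :=
      { toFun := fun m => ⟨1, Pi.single i m.toAdd⟩
        map_one' := by simp [G.one_def]
        map_mul' := fun a b => by rw [toAdd_mul, Pi.single_add, hadd] }
    have hs : ∀ i (m : ℤ), (⟨1, Pi.single i m⟩ : G) = G.t i ^ m := by
      intro i m
      have := map_zpow (T i) (Multiplicative.ofAdd 1) m
      rw [← ofAdd_zsmul] at this
      simpa [T, G.t] using this
    intro n
    have hn : n = Pi.single 0 (n 0) + Pi.single 1 (n 1) + Pi.single 2 (n 2) := by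
      ext l; fin_cases l <;> simp
    rw [hn, hadd, hadd, hs, hs, hs, ← hn, tpow]
  rw [← ht]
  ext1
  · simp [G.mul_def, G.ofSL]
  · simp [G.mul_def, G.ofSL]

/-- `G` is generated by the elementary matrices and the translations `t_i`. -/
theorem G.closure_eq_top :
    Subgroup.closure ({g | ∃ i j h, g = G.e i j h} ∪ Set.range G.t) = ⊤ := by
  rw [eq_top_iff]
  intro g _
  set K := Subgroup.closure ({g | ∃ i j h, g = G.e i j h} ∪ Set.range G.t)
  have ht : ∀ i, G.t i ∈ K := fun i => Subgroup.subset_closure (Or.inr ⟨i, rfl⟩)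
  rw [G.eq_ofSL_mul g]
  refine mul_mem ?_ (mul_mem (mul_mem (zpow_mem (ht _) _) (zpow_mem (ht _) _)) (zpow_mem (ht _) _))
  have : g.A ∈ K.comap G.ofSL := by
    have hle : Subgroup.closure {s | ∃ i j, i ≠ j ∧ s = el i j} ≤ K.comap G.ofSL := by
      rw [Subgroup.closure_le]
      rintro _ ⟨i, j, h, rfl⟩
      change G.ofSL (el i j) ∈ K
      rw [el_eq h]
      exact Subgroup.subset_closure (Or.inl ⟨i, j, h, rfl⟩)
    exact hle (by rw [closure_el]; trivial)
  exact this

end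
end EllipticGamma

namespace EllipticGamma
noncomputable section

/-! ### Holomorphic infinite products -/

-- Cauchy's estimate of the derivative in one variable, applied on complex lines through `y`.
open Filter Topology Metric in
theorem norm_fderiv_le_div {V : Type*} [NormedAddCommGroup V] [NormedSpace ℂ V] {g : V → ℂ}
    {p y : V} {ρ C : ℝ} (hρ : 0 < ρ) (hg : DifferentiableOn ℂ g (ball p (2 * ρ)))
    (hC : ∀ v ∈ closedBall p (2 * ρ), ‖g v‖ ≤ C) (hy : y ∈ ball p ρ) :
    ‖fderiv ℂ g y‖ ≤ C / ρ := by
  have hC0 : 0 ≤ C := (norm_nonneg _).trans (hC p (mem_closedBall_self (by positivity)))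
  refine ContinuousLinearMap.opNorm_le_bound _ (by positivity) fun v => ?_
  rcases eq_or_ne v 0 with rfl | hv
  · simp
  have hv' : 0 < ‖v‖ := norm_pos_iff.2 hv
  have hmem : ∀ t : ℂ, ‖t‖ ≤ ρ / ‖v‖ → y + t • v ∈ ball p (2 * ρ) := by
    intro t ht
    rw [mem_ball, dist_eq_norm] at hy ⊢
    have h1 : ‖t • v‖ ≤ ρ := by
      rw [norm_smul]
      exact (le_div_iff₀ hv').1 ht
    have h2 : y + t • v - p = (y - p) + t • v := by abel
    rw [h2]
    linarith [norm_add_le (y - p) (t • v)]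
  have hd : ∀ t : ℂ, ‖t‖ ≤ ρ / ‖v‖ → DifferentiableAt ℂ (fun t : ℂ => g (y + t • v)) t := by
    intro t ht
    have h1 : DifferentiableAt ℂ g (y + t • v) :=
      hg.differentiableAt (isOpen_ball.mem_nhds (hmem t ht))
    exact h1.comp t (by fun_prop)
  have hderiv : deriv (fun t : ℂ => g (y + t • v)) 0 = fderiv ℂ g y v := by
    have h1 : HasFDerivAt g (fderiv ℂ g y) (y + (0 : ℂ) • v) := by
      rw [zero_smul, add_zero]
      have := hmem 0 (by rw [norm_zero]; positivity)
      rw [zero_smul, add_zero] at this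
      exact (hg.differentiableAt (isOpen_ball.mem_nhds this)).hasFDerivAt
    have h2 : HasDerivAt (fun t : ℂ => y + t • v) v 0 := by
      simpa using ((hasDerivAt_id (0 : ℂ)).smul_const v).const_add y
    exact (h1.comp_hasDerivAt 0 h2).deriv
  have := Complex.norm_deriv_le_of_forall_mem_sphere_norm_le (c := (0 : ℂ)) (R := ρ / ‖v‖) (C := C)
    (f := fun t : ℂ => g (y + t • v)) (by positivity) ?_ ?_
  · rw [hderiv] at this
    calc _ ≤ C / (ρ / ‖v‖) := this
      _ = C / ρ * ‖v‖ := by field_simp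
  · refine DifferentiableOn.diffContOnCl fun t ht => (hd t ?_).differentiableWithinAt
    have := closure_ball_subset_closedBall ht
    simpa using this
  · intro t ht
    exact hC _ (ball_subset_closedBall (hmem t (by simpa using ht.le)))

open Filter Topology Metric in
/-- Locally uniform limits of holomorphic functions on an open subset of a finite-dimensional space
are holomorphic. -/
theorem differentiableOn_of_tendstoLocallyUniformlyOn {V ι : Type*} [NormedAddCommGroup V]
    [NormedSpace ℂ V] [ProperSpace V] {φ : Filter ι} [NeBot φ] {F : ι → V → ℂ} {f : V → ℂ}
    {U : Set V} (hU : IsOpen U) (hf : TendstoLocallyUniformlyOn F f φ U)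
    (hF : ∀ n, DifferentiableOn ℂ (F n) U) : DifferentiableOn ℂ f U := by
  intro p hp
  obtain ⟨ε, hε, hεU⟩ := Metric.isOpen_iff.1 hU p hp
  set ρ := ε / 4 with hρ
  have hρ0 : 0 < ρ := by positivity
  have hsub : closedBall p (2 * ρ) ⊆ U :=
    (closedBall_subset_ball (by rw [hρ]; linarith)).trans hεU
  have hunif : TendstoUniformlyOn F f φ (closedBall p (2 * ρ)) :=
    (tendstoLocallyUniformlyOn_iff_forall_isCompact hU).1 hf _ hsub (isCompact_closedBall _ _)
  have hcau := hunif.uniformCauchySeqOn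
  have hsub' : ball p ρ ⊆ U :=
    (ball_subset_ball (by linarith)).trans (ball_subset_closedBall.trans hsub)
  have hd : ∀ n, ∀ y ∈ ball p ρ, DifferentiableAt ℂ (F n) y := fun n y hy =>
    (hF n).differentiableAt (hU.mem_nhds (hsub' hy))
  -- By Cauchy's estimate for the differences `F m - F n`, uniform convergence on the larger ball
  -- makes the derivatives uniformly Cauchy on the smaller one.
  have hcau' : UniformCauchySeqOn (fun n => fderiv ℂ (F n)) φ (ball p ρ) := by
    intro u hu
    obtain ⟨δ, hδ, hδu⟩ := Metric.mem_uniformity_dist.1 hu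
    have := hcau {q | dist q.1 q.2 < δ / 2 * ρ} (Metric.dist_mem_uniformity (by positivity))
    filter_upwards [this] with m hm y hy
    apply hδu
    rw [dist_eq_norm, ← fderiv_sub (hd _ _ hy) (hd _ _ hy)]
    refine (norm_fderiv_le_div hρ0 (C := δ / 2 * ρ) ?_ ?_ hy).trans_lt ?_
    · exact (((hF m.1).sub (hF m.2)).mono (ball_subset_closedBall.trans hsub))
    · intro v hv
      rw [Pi.sub_apply, ← dist_eq_norm]
      exact (hm v hv).le
    · rw [mul_div_assoc, div_self hρ0.ne']
      linarith
  have hlim : ∀ y ∈ ball p ρ, ∃ l, Tendsto (fun n => fderiv ℂ (F n) y) φ (𝓝 l) := fun y hy =>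
    CompleteSpace.complete (hcau'.cauchy_map hy)
  choose! g' hg' using hlim
  refine (hasFDerivAt_of_tendstoUniformlyOn (f := F) (g := f) (g' := g') isOpen_ball
    (hcau'.tendstoUniformlyOn_of_tendsto fun y hy => hg' y hy)
    (fun n y hy => (hd n y hy).hasFDerivAt) (fun y hy => ?_)
    (mem_ball_self hρ0)).differentiableAt.differentiableWithinAt
  exact hf.tendsto_at (hsub' hy)

open Filter Topology in
theorem differentiableOn_tprod {V ι : Type*} [NormedAddCommGroup V] [NormedSpace ℂ V]
    [ProperSpace V] {f : ι → V → ℂ} {u : ι → ℝ} {U : Set V} (hU : IsOpen U) (hu : Summable u)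
    (hf : ∀ i, DifferentiableOn ℂ (f i) U) (hfu : ∀ i, ∀ p ∈ U, ‖f i p‖ ≤ u i) :
    DifferentiableOn ℂ (fun p => ∏' i, (1 + f i p)) U := by
  have h : TendstoLocallyUniformlyOn (fun (s : Finset ι) p => ∏ i ∈ s, (1 + f i p))
      (fun p => ∏' i, (1 + f i p)) atTop U :=
    Summable.hasProdLocallyUniformlyOn_one_add hU hu (Eventually.of_forall hfu)
      fun i => (hf i).continuousOn
  refine differentiableOn_of_tendstoLocallyUniformlyOn hU h fun s => ?_
  induction s using Finset.cons_induction with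
  | empty => simp
  | cons i s hi ih =>
    simp only [Finset.prod_cons]
    exact ((hf i).const_add _).mul ih

/-! ### The double product -/

theorem summable_pow_mul_pow {a b : ℝ} (ha : 0 ≤ a) (hb : 0 ≤ b) (ha1 : a < 1) (hb1 : b < 1) (c : ℝ) :
    Summable fun jk : ℕ × ℕ => c * a ^ jk.1 * b ^ jk.2 := by
  have h := ((summable_geometric_of_lt_one ha ha1).mul_of_nonneg
    (summable_geometric_of_lt_one hb hb1) (fun _ => by positivity) (fun _ => by positivity)).mul_left c
  simpa only [mul_assoc] using h

theorem summable_doubleProd (x : ℂ) {q r : ℂ} (hq : ‖q‖ < 1) (hr : ‖r‖ < 1) :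
    Summable fun jk : ℕ × ℕ => ‖-(x * q ^ jk.1 * r ^ jk.2)‖ := by
  simpa only [norm_neg, norm_mul, norm_pow] using
    summable_pow_mul_pow (norm_nonneg q) (norm_nonneg r) hq hr ‖x‖

theorem multipliable_doubleProd (x : ℂ) {q r : ℂ} (hq : ‖q‖ < 1) (hr : ‖r‖ < 1) :
    Multipliable fun jk : ℕ × ℕ => 1 - x * q ^ jk.1 * r ^ jk.2 := by
  simpa only [sub_eq_add_neg] using multipliable_one_add_of_summable (summable_doubleProd x hq hr)

theorem doubleProd_ne_zero {x q r : ℂ} (hq : ‖q‖ < 1) (hr : ‖r‖ < 1)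
    (h : ∀ j k : ℕ, x * q ^ j * r ^ k ≠ 1) : doubleProd x q r ≠ 0 := by
  have := tprod_one_add_ne_zero_of_summable (f := fun jk : ℕ × ℕ => -(x * q ^ jk.1 * r ^ jk.2))
    (fun jk h0 => h jk.1 jk.2 (by linear_combination -h0)) (summable_doubleProd x hq hr)
  simpa only [doubleProd, sub_eq_add_neg] using this

theorem differentiableAt_doubleProd {x q r : ℂ} (hq : ‖q‖ < 1) (hr : ‖r‖ < 1) :
    DifferentiableAt ℂ (fun t : ℂ × ℂ × ℂ => doubleProd t.1 t.2.1 t.2.2) (x, q, r) := by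
  obtain ⟨a, ha, ha1⟩ := exists_between hq
  obtain ⟨b, hb, hb1⟩ := exists_between hr
  have ha0 : 0 ≤ a := (norm_nonneg q).trans ha.le
  have hb0 : 0 ≤ b := (norm_nonneg r).trans hb.le
  set U : Set (ℂ × ℂ × ℂ) := {t | ‖t.1‖ < ‖x‖ + 1} ∩ ({t | ‖t.2.1‖ < a} ∩ {t | ‖t.2.2‖ < b})
  have hU : IsOpen U := by
    refine (isOpen_lt (by fun_prop) (by fun_prop)).inter
      ((isOpen_lt (by fun_prop) (by fun_prop)).inter (isOpen_lt (by fun_prop) (by fun_prop)))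
  have h := differentiableOn_tprod (V := ℂ × ℂ × ℂ) (ι := ℕ × ℕ) hU
    (f := fun jk t => -(t.1 * t.2.1 ^ jk.1 * t.2.2 ^ jk.2))
    (summable_pow_mul_pow ha0 hb0 ha1 hb1 (‖x‖ + 1))
    (fun jk => by fun_prop) (fun jk t ht => by
      rw [norm_neg, norm_mul, norm_mul, norm_pow, norm_pow]
      have h1 : ‖t.1‖ ≤ ‖x‖ + 1 := le_of_lt ht.1
      have h2 : ‖t.2.1‖ ≤ a := le_of_lt ht.2.1
      have h3 : ‖t.2.2‖ ≤ b := le_of_lt ht.2.2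
      gcongr)
  simp only [doubleProd, sub_eq_add_neg]
  exact h.differentiableAt (hU.mem_nhds ⟨by simp, ha, hb⟩)

theorem doubleProd_symm (x q r : ℂ) : doubleProd x q r = doubleProd x r q := by
  unfold doubleProd
  rw [← (Equiv.prodComm ℕ ℕ).tprod_eq]
  refine tprod_congr fun jk => ?_
  simp only [Equiv.prodComm_apply, Prod.fst_swap, Prod.snd_swap]
  ring

/-- The product `∏_j (1 - x q^j)`. -/
def poch (x q : ℂ) : ℂ := ∏' j : ℕ, (1 - x * q ^ j)

theorem summable_poch (x : ℂ) {q : ℂ} (hq : ‖q‖ < 1) : Summable fun j : ℕ => ‖-(x * q ^ j)‖ := by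
  simpa only [norm_neg, norm_mul, norm_pow] using
    (summable_geometric_of_lt_one (norm_nonneg q) hq).mul_left ‖x‖

theorem multipliable_poch (x : ℂ) {q : ℂ} (hq : ‖q‖ < 1) :
    Multipliable fun j : ℕ => 1 - x * q ^ j := by
  simpa only [sub_eq_add_neg] using multipliable_one_add_of_summable (summable_poch x hq)

theorem doubleProd_eq_poch_mul (x : ℂ) {q r : ℂ} (hq : ‖q‖ < 1) (hr : ‖r‖ < 1) :
    doubleProd x q r = poch x r * doubleProd (q * x) q r := by
  have h1 : ∀ y : ℂ, doubleProd y q r = ∏' j : ℕ, poch (y * q ^ j) r := by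
    intro y
    have h := (multipliable_doubleProd y hq hr).tprod_prod' fun j => multipliable_poch (y * q ^ j) hr
    unfold doubleProd poch
    exact h
  have h2 : Multipliable fun j : ℕ => poch (x * q ^ (j + 1)) r := by
    have := (multipliable_doubleProd (q * x) hq hr).hasProd.prod_fiberwise
      (fun j => (multipliable_poch (q * x * q ^ j) hr).hasProd)
    refine this.multipliable.congr fun j => ?_
    rw [pow_succ']
    exact congrArg (fun y => poch y r) (by ring)
  rw [h1, h1, tprod_eq_zero_mul' (f := fun j : ℕ => poch (x * q ^ j) r) h2, pow_zero, mul_one]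
  refine congrArg (poch x r * ·) (tprod_congr fun j => ?_)
  rw [pow_succ']
  exact congrArg (fun y => poch y r) (by ring)

/-- With second base 0 only the factors with `k = 0` differ from 1, because `0 ^ 0 = 1`. So
holomorphy of the simple product follows from that of the double product. -/
theorem poch_eq_doubleProd (x q : ℂ) : poch x q = doubleProd x q 0 := by
  unfold poch doubleProd
  have hi : Function.Injective (fun j : ℕ => ((j, 0) : ℕ × ℕ)) := fun _ _ h => (Prod.ext_iff.1 h).1
  have h := hi.tprod_eq (f := fun jk : ℕ × ℕ => 1 - x * q ^ jk.1 * (0 : ℂ) ^ jk.2) fun jk hjk => by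
    obtain ⟨j, k⟩ := jk
    rcases k with _ | k
    · exact ⟨j, rfl⟩
    · exact absurd (by simp) hjk
  have h' : ∏' j : ℕ, (1 - x * q ^ j) = ∏' j : ℕ, (1 - x * q ^ j * (0 : ℂ) ^ 0) :=
    tprod_congr fun j => by simp
  exact h'.trans h

theorem poch_eq (x : ℂ) {q : ℂ} (hq : ‖q‖ < 1) : poch x q = (1 - x) * poch (q * x) q := by
  have h : Multipliable fun j : ℕ => 1 - x * q ^ (j + 1) :=
    (multipliable_poch (q * x) hq).congr fun j => by ring
  unfold poch
  rw [tprod_eq_zero_mul' (f := fun j : ℕ => 1 - x * q ^ j) h, pow_zero, mul_one]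
  exact congrArg ((1 - x) * ·) (tprod_congr fun j => by ring)

theorem poch_ne_zero {x q : ℂ} (hq : ‖q‖ < 1) (h : ∀ j : ℕ, x * q ^ j ≠ 1) : poch x q ≠ 0 := by
  have := tprod_one_add_ne_zero_of_summable (f := fun j : ℕ => -(x * q ^ j))
    (fun j h0 => h j (by linear_combination -h0)) (summable_poch x hq)
  simpa only [poch, sub_eq_add_neg] using this

theorem differentiableAt_poch {x q : ℂ} (hq : ‖q‖ < 1) :
    DifferentiableAt ℂ (fun t : ℂ × ℂ => poch t.1 t.2) (x, q) := by
  simp only [poch_eq_doubleProd]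
  exact (differentiableAt_doubleProd (x := x) hq (r := 0) (by simp)).comp
    (f := fun t : ℂ × ℂ => (t.1, t.2, (0 : ℂ))) (x, q) (by fun_prop)

theorem poch_eq_mul_sq (x : ℂ) {q : ℂ} (hq : ‖q‖ < 1) :
    poch x q = poch x (q ^ 2) * poch (x * q) (q ^ 2) := by
  have hq2 : ‖q ^ 2‖ < 1 := by rw [norm_pow]; exact pow_lt_one₀ (norm_nonneg _) hq two_ne_zero
  unfold poch
  rw [← tprod_even_mul_odd]
  · exact congrArg₂ (· * ·) (tprod_congr fun j => by ring) (tprod_congr fun j => by ring)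
  · exact (multipliable_poch x hq2).congr fun j => by ring
  · exact (multipliable_poch (x * q) hq2).congr fun j => by ring

theorem poch_mul_poch_neg (x : ℂ) {q : ℂ} (hq : ‖q‖ < 1) :
    poch x q * poch (-x) q = poch (x ^ 2) (q ^ 2) := by
  unfold poch
  rw [← (multipliable_poch x hq).tprod_mul (multipliable_poch (-x) hq)]
  exact tprod_congr fun j => by ring

/-- The identity of Euler. -/
theorem poch_neg_mul_poch {q : ℂ} (hq : ‖q‖ < 1) : poch (-q) q * poch q (q ^ 2) = 1 := by
  have h1 := poch_eq_mul_sq q hq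
  have h2 := poch_mul_poch_neg q hq
  rw [← sq, ← h2] at h1
  have h0 : poch q q ≠ 0 := poch_ne_zero hq fun j h => by
    have : ‖q * q ^ j‖ < 1 := by
      rw [← pow_succ', norm_pow]
      exact pow_lt_one₀ (norm_nonneg _) hq (Nat.succ_ne_zero j)
    rw [h, norm_one] at this
    exact lt_irrefl _ this
  apply mul_left_cancel₀ h0
  linear_combination -h1

end
end EllipticGamma

namespace EllipticGamma
noncomputable section

/-! ### The exponential `e^{2πit}` -/

theorem cexp2_add (s t : ℂ) : cexp2 (s + t) = cexp2 s * cexp2 t := by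
  simp only [cexp2, mul_add, Complex.exp_add]

theorem cexp2_ne_zero (t : ℂ) : cexp2 t ≠ 0 := Complex.exp_ne_zero _

theorem cexp2_zero : cexp2 0 = 1 := by simp [cexp2]

theorem cexp2_neg (t : ℂ) : cexp2 (-t) = (cexp2 t)⁻¹ := by
  simp only [cexp2, mul_neg, Complex.exp_neg]

theorem cexp2_sub (s t : ℂ) : cexp2 (s - t) = cexp2 s / cexp2 t := by
  rw [sub_eq_add_neg, cexp2_add, cexp2_neg, div_eq_mul_inv]

theorem cexp2_int_mul (n : ℤ) (t : ℂ) : cexp2 (n * t) = cexp2 t ^ n := by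
  rw [cexp2, cexp2, ← Complex.exp_int_mul]
  congr 1
  ring

theorem cexp2_eq_one_iff {t : ℂ} : cexp2 t = 1 ↔ ∃ n : ℤ, t = n := by
  rw [cexp2, Complex.exp_eq_one_iff]
  refine exists_congr fun n => ?_
  have h : (2 * Real.pi * Complex.I : ℂ) ≠ 0 := Complex.two_pi_I_ne_zero
  rw [mul_comm (n : ℂ), mul_right_inj' h]

theorem cexp2_int (n : ℤ) : cexp2 n = 1 := cexp2_eq_one_iff.2 ⟨n, rfl⟩

theorem cexp2_one : cexp2 1 = 1 := by simpa using cexp2_int 1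

theorem cexp2_half : cexp2 (1 / 2) = -1 := by
  rw [cexp2, ← Complex.exp_pi_mul_I]
  congr 1
  ring

theorem norm_cexp2 (t : ℂ) : ‖cexp2 t‖ = Real.exp (-(2 * Real.pi * t.im)) := by
  rw [cexp2, Complex.norm_exp]
  congr 1
  simp [Complex.mul_re, Complex.mul_im]

theorem norm_cexp2_lt_one_iff {t : ℂ} : ‖cexp2 t‖ < 1 ↔ 0 < t.im := by
  rw [norm_cexp2, Real.exp_lt_one_iff, neg_lt_zero]
  exact mul_pos_iff_of_pos_left (by positivity)

theorem norm_cexp2_ne_one {t : ℂ} (h : t.im ≠ 0) : ‖cexp2 t‖ ≠ 1 := by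
  rw [norm_cexp2, Ne, Real.exp_eq_one_iff, neg_eq_zero]
  exact mul_ne_zero (by positivity) h

theorem differentiable_cexp2 : Differentiable ℂ cexp2 := by
  unfold cexp2
  fun_prop

/-! ### The products in all regimes -/

theorem norm_inv_lt_one {q : ℂ} (h1 : ‖q‖ ≠ 1) (h : ¬‖q‖ < 1) : ‖q⁻¹‖ < 1 := by
  rw [norm_inv]
  exact inv_lt_one_of_one_lt₀ (lt_of_le_of_ne (not_lt.1 h) h1.symm)

theorem not_norm_inv_lt_one {q : ℂ} (h0 : q ≠ 0) (h : ‖q‖ < 1) : ¬‖q⁻¹‖ < 1 := by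
  rw [norm_inv, not_lt]
  exact one_le_inv_iff₀.2 ⟨norm_pos_iff.2 h0, h.le⟩

theorem qPoch_of_lt (x : ℂ) {q : ℂ} (h : ‖q‖ < 1) : qPoch x q = poch x q := if_pos h

theorem qPoch_of_not_lt (x : ℂ) {q : ℂ} (h : ¬‖q‖ < 1) : qPoch x q = (poch (q⁻¹ * x) q⁻¹)⁻¹ :=
  if_neg h

theorem qPoch_inv (x : ℂ) {q : ℂ} (h0 : q ≠ 0) (h1 : ‖q‖ ≠ 1) :
    qPoch x q⁻¹ = (qPoch (q * x) q)⁻¹ := by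
  by_cases h : ‖q‖ < 1
  · rw [qPoch_of_lt _ h, qPoch_of_not_lt _ (not_norm_inv_lt_one h0 h), inv_inv]
  · rw [qPoch_of_not_lt _ h, qPoch_of_lt _ (norm_inv_lt_one h1 h), inv_inv, inv_mul_cancel_left₀ h0]

theorem qPoch₂_inv_right (x q : ℂ) {r : ℂ} (h0 : r ≠ 0) (h1 : ‖r‖ ≠ 1) :
    qPoch₂ x q r⁻¹ = (qPoch₂ (r * x) q r)⁻¹ := by
  unfold qPoch₂
  by_cases h : ‖r‖ < 1
  · simp only [h, not_norm_inv_lt_one h0 h, if_true, if_false, inv_inv]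
    split_ifs <;> simp
  · simp only [h, norm_inv_lt_one h1 h, if_true, if_false, inv_mul_cancel_left₀ h0]
    split_ifs <;> simp

theorem qPoch₂_symm (x q r : ℂ) : qPoch₂ x q r = qPoch₂ x r q := by
  unfold qPoch₂
  by_cases hq : ‖q‖ < 1 <;> by_cases hr : ‖r‖ < 1 <;>
    simp only [hq, hr, if_true, if_false]
  · exact doubleProd_symm _ _ _
  · rw [doubleProd_symm]
  · rw [doubleProd_symm]
  · rw [doubleProd_symm, mul_left_comm]

/-- The exclusion of `x = 1` matters for `|q| > 1`: there the factor `1 - x` stands in a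
denominator, and the inverse of zero is zero. The non-vanishing hypothesis of the next lemma has the
same origin. -/
theorem qPoch_eq {x q : ℂ} (h0 : q ≠ 0) (h1 : ‖q‖ ≠ 1) (hx : x ≠ 1) :
    qPoch x q = (1 - x) * qPoch (q * x) q := by
  by_cases h : ‖q‖ < 1
  · rw [qPoch_of_lt _ h, qPoch_of_lt _ h, poch_eq x h]
  · have hx' : 1 - x ≠ 0 := sub_ne_zero.2 hx.symm
    rw [qPoch_of_not_lt _ h, qPoch_of_not_lt _ h, inv_mul_cancel_left₀ h0,
      poch_eq x (norm_inv_lt_one h1 h), mul_inv, mul_inv_cancel_left₀ hx']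

theorem qPoch₂_eq {x q r : ℂ} (hq0 : q ≠ 0) (hq : ‖q‖ ≠ 1) (hr : ‖r‖ ≠ 1)
    (h : qPoch x r ≠ 0) : qPoch₂ x q r = qPoch x r * qPoch₂ (q * x) q r := by
  have main : ∀ {q x : ℂ}, ‖q‖ < 1 → qPoch₂ x q r = qPoch x r * qPoch₂ (q * x) q r := by
    intro q x hq
    unfold qPoch₂
    by_cases hr' : ‖r‖ < 1
    · simp only [hq, hr', if_true, qPoch_of_lt _ hr']
      exact doubleProd_eq_poch_mul x hq hr'
    · simp only [hq, hr', if_true, if_false, qPoch_of_not_lt _ hr']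
      rw [doubleProd_eq_poch_mul _ hq (norm_inv_lt_one hr hr'), mul_inv, mul_left_comm q]
  by_cases hq' : ‖q‖ < 1
  · exact main hq'
  · have h1 := main (x := x) (norm_inv_lt_one hq hq')
    have h2 : ∀ y, qPoch₂ y q r = (qPoch₂ (q⁻¹ * y) q⁻¹ r)⁻¹ := by
      intro y
      rw [qPoch₂_symm y, qPoch₂_symm (q⁻¹ * y)]
      conv_lhs => rw [← inv_inv q]
      exact qPoch₂_inv_right y r (inv_ne_zero hq0) (by rw [norm_inv]; simpa using hq)
    rw [h2, h2, inv_mul_cancel_left₀ hq0, h1, mul_inv, mul_inv_cancel_left₀ h]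

theorem qPoch_ne_zero {x q : ℂ} (h1 : ‖q‖ ≠ 1) (h : ∀ j : ℤ, x * q ^ j ≠ 1) : qPoch x q ≠ 0 := by
  by_cases hq : ‖q‖ < 1
  · rw [qPoch_of_lt _ hq]
    exact poch_ne_zero hq fun j => by simpa using h j
  · rw [qPoch_of_not_lt _ hq]
    refine inv_ne_zero (poch_ne_zero (norm_inv_lt_one h1 hq) fun j h2 => h (-(j + 1 : ℕ)) ?_)
    rw [zpow_neg, zpow_natCast, ← inv_pow, pow_succ, ← h2]
    ring

theorem qPoch₂_ne_zero {x q r : ℂ} (hq1 : ‖q‖ ≠ 1) (hr1 : ‖r‖ ≠ 1)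
    (h : ∀ j k : ℤ, x * q ^ j * r ^ k ≠ 1) : qPoch₂ x q r ≠ 0 := by
  unfold qPoch₂
  by_cases hq : ‖q‖ < 1 <;> by_cases hr : ‖r‖ < 1 <;>
    simp only [hq, hr, if_true, if_false]
  · exact doubleProd_ne_zero hq hr fun j k => by simpa using h j k
  · refine inv_ne_zero (doubleProd_ne_zero hq (norm_inv_lt_one hr1 hr) fun j k h2 =>
      h j (-(k + 1 : ℕ)) ?_)
    rw [zpow_neg, zpow_natCast, zpow_natCast, ← inv_pow r, pow_succ, ← h2]
    ring
  · refine inv_ne_zero (doubleProd_ne_zero (norm_inv_lt_one hq1 hq) hr fun j k h2 =>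
      h (-(j + 1 : ℕ)) k ?_)
    rw [zpow_neg, zpow_natCast, zpow_natCast, ← inv_pow q, pow_succ, ← h2]
    ring
  · refine doubleProd_ne_zero (norm_inv_lt_one hq1 hq) (norm_inv_lt_one hr1 hr) fun j k h2 =>
      h (-(j + 1 : ℕ)) (-(k + 1 : ℕ)) ?_
    rw [zpow_neg, zpow_natCast, zpow_neg, zpow_natCast, ← inv_pow q, ← inv_pow r, pow_succ,
      pow_succ, ← h2]
    ring

-- A pole has the default value 0, so a non-zero value excludes poles as well as zeros; elsewhere
-- the four regimes are open conditions and reduce to the convergent double product by inversion of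
-- `q` or `r`.
open Filter Topology in
theorem differentiableAt_qPoch₂ {x q r : ℂ} (hq0 : q ≠ 0) (hr0 : r ≠ 0) (hq1 : ‖q‖ ≠ 1)
    (hr1 : ‖r‖ ≠ 1) (h : qPoch₂ x q r ≠ 0) :
    DifferentiableAt ℂ (fun t : ℂ × ℂ × ℂ => qPoch₂ t.1 t.2.1 t.2.2) (x, q, r) := by
  have main : ∀ {r : ℂ}, r ≠ 0 → ‖r‖ < 1 → ∀ {q x : ℂ}, q ≠ 0 → ‖q‖ ≠ 1 → qPoch₂ x q r ≠ 0 →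
      DifferentiableAt ℂ (fun t : ℂ × ℂ × ℂ => qPoch₂ t.1 t.2.1 t.2.2) (x, q, r) := by
    intro r hr0 hr q x hq0 hq1 h
    have er : ∀ᶠ t : ℂ × ℂ × ℂ in 𝓝 (x, q, r), ‖t.2.2‖ < 1 :=
      (isOpen_lt (by fun_prop : Continuous fun t : ℂ × ℂ × ℂ => ‖t.2.2‖) (by fun_prop)).mem_nhds hr
    by_cases hq : ‖q‖ < 1
    · have eq : ∀ᶠ t : ℂ × ℂ × ℂ in 𝓝 (x, q, r), ‖t.2.1‖ < 1 :=
        (isOpen_lt (by fun_prop : Continuous fun t : ℂ × ℂ × ℂ => ‖t.2.1‖) (by fun_prop)).mem_nhds hq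
      refine (differentiableAt_doubleProd (x := x) hq hr).congr_of_eventuallyEq ?_
      filter_upwards [er, eq] with t h1 h2
      simp only [qPoch₂, h1, h2, if_true]
    · have eq : ∀ᶠ t : ℂ × ℂ × ℂ in 𝓝 (x, q, r), 1 < ‖t.2.1‖ :=
        (isOpen_lt (by fun_prop) (by fun_prop : Continuous fun t : ℂ × ℂ × ℂ => ‖t.2.1‖)).mem_nhds
          (lt_of_le_of_ne (not_lt.1 hq) hq1.symm)
      have hne : doubleProd (q⁻¹ * x) q⁻¹ r ≠ 0 := by
        simpa only [qPoch₂, hq, hr, if_true, if_false, ne_eq, inv_eq_zero] using h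
      have hd : DifferentiableAt ℂ
          (fun t : ℂ × ℂ × ℂ => doubleProd (t.2.1⁻¹ * t.1) t.2.1⁻¹ t.2.2) (x, q, r) := by
        refine (differentiableAt_doubleProd (x := q⁻¹ * x) (norm_inv_lt_one hq1 hq) hr).comp
          (f := fun t : ℂ × ℂ × ℂ => (t.2.1⁻¹ * t.1, t.2.1⁻¹, t.2.2)) (x, q, r) ?_
        have : DifferentiableAt ℂ (fun t : ℂ × ℂ × ℂ => t.2.1⁻¹) (x, q, r) :=
          DifferentiableAt.inv (by fun_prop) hq0
        fun_prop
      refine (hd.inv hne).congr_of_eventuallyEq ?_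
      filter_upwards [er, eq] with t h1 h2
      simp only [qPoch₂, h1, h2.not_gt, if_true, if_false, Pi.inv_apply]
  by_cases hr : ‖r‖ < 1
  · exact main hr0 hr hq0 hq1 h
  · have e1 : ∀ᶠ t : ℂ × ℂ × ℂ in 𝓝 (x, q, r), 1 < ‖t.2.2‖ :=
      (isOpen_lt (by fun_prop) (by fun_prop : Continuous fun t : ℂ × ℂ × ℂ => ‖t.2.2‖)).mem_nhds
        (lt_of_le_of_ne (not_lt.1 hr) hr1.symm)
    have e2 : ∀ y s : ℂ, ∀ {r : ℂ}, 1 < ‖r‖ → qPoch₂ y s r = (qPoch₂ (r⁻¹ * y) s r⁻¹)⁻¹ := by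
      intro y s r hr
      have hr0 : r ≠ 0 := norm_pos_iff.1 (one_pos.trans hr)
      conv_lhs => rw [← inv_inv r]
      exact qPoch₂_inv_right y s (inv_ne_zero hr0) (by rw [norm_inv]; simpa using hr.ne')
    have hne : qPoch₂ (r⁻¹ * x) q r⁻¹ ≠ 0 := by
      rw [e2 x q (lt_of_le_of_ne (not_lt.1 hr) hr1.symm)] at h
      exact fun h0 => h (by rw [h0, inv_zero])
    have hd : DifferentiableAt ℂ
        (fun t : ℂ × ℂ × ℂ => qPoch₂ (t.2.2⁻¹ * t.1) t.2.1 t.2.2⁻¹) (x, q, r) := by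
      refine (main (inv_ne_zero hr0) (norm_inv_lt_one hr1 hr) (x := r⁻¹ * x) hq0 hq1 hne).comp
        (f := fun t : ℂ × ℂ × ℂ => (t.2.2⁻¹ * t.1, t.2.1, t.2.2⁻¹)) (x, q, r) ?_
      have : DifferentiableAt ℂ (fun t : ℂ × ℂ × ℂ => t.2.2⁻¹) (x, q, r) :=
        DifferentiableAt.inv (by fun_prop) hr0
      fun_prop
    refine (hd.inv hne).congr_of_eventuallyEq ?_
    filter_upwards [e1] with t h1
    rw [e2 t.1 t.2.1 h1, Pi.inv_apply]

open Filter Topology in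
theorem differentiableAt_qPoch {x q : ℂ} (hq0 : q ≠ 0) (hq1 : ‖q‖ ≠ 1) (h : qPoch x q ≠ 0) :
    DifferentiableAt ℂ (fun t : ℂ × ℂ => qPoch t.1 t.2) (x, q) := by
  by_cases hq : ‖q‖ < 1
  · have eq : ∀ᶠ t : ℂ × ℂ in 𝓝 (x, q), ‖t.2‖ < 1 :=
      (isOpen_lt (by fun_prop : Continuous fun t : ℂ × ℂ => ‖t.2‖) (by fun_prop)).mem_nhds hq
    refine (differentiableAt_poch (x := x) hq).congr_of_eventuallyEq ?_
    filter_upwards [eq] with t h1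
    exact qPoch_of_lt _ h1
  · have eq : ∀ᶠ t : ℂ × ℂ in 𝓝 (x, q), 1 < ‖t.2‖ :=
      (isOpen_lt (by fun_prop) (by fun_prop : Continuous fun t : ℂ × ℂ => ‖t.2‖)).mem_nhds
        (lt_of_le_of_ne (not_lt.1 hq) hq1.symm)
    have hne : poch (q⁻¹ * x) q⁻¹ ≠ 0 := by
      rw [qPoch_of_not_lt _ hq] at h
      exact fun h0 => h (by rw [h0, inv_zero])
    have hd : DifferentiableAt ℂ (fun t : ℂ × ℂ => poch (t.2⁻¹ * t.1) t.2⁻¹) (x, q) := by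
      refine (differentiableAt_poch (x := q⁻¹ * x) (norm_inv_lt_one hq1 hq)).comp
        (f := fun t : ℂ × ℂ => (t.2⁻¹ * t.1, t.2⁻¹)) (x, q) ?_
      have : DifferentiableAt ℂ (fun t : ℂ × ℂ => t.2⁻¹) (x, q) :=
        DifferentiableAt.inv (by fun_prop) hq0
      fun_prop
    refine (hd.inv hne).congr_of_eventuallyEq ?_
    filter_upwards [eq] with t h1
    rw [qPoch_of_not_lt _ h1.not_gt, Pi.inv_apply]

end
end EllipticGamma

namespace EllipticGamma
noncomputable section

theorem differentiableAt_div {V : Type*} [NormedAddCommGroup V] [NormedSpace ℂ V] {f g : V → ℂ}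
    {p : V} (hf : DifferentiableAt ℂ f p) (hg : DifferentiableAt ℂ g p) (h0 : g p ≠ 0) :
    DifferentiableAt ℂ (fun v => f v / g v) p := by
  simp only [div_eq_mul_inv]
  exact hf.mul (hg.inv h0)

/-! ### Functional equations of the theta function -/

theorem theta0_add_int (z τ : ℂ) (n : ℤ) : theta0 (z + n) τ = theta0 z τ := by
  simp only [theta0, cexp2_add, cexp2_int, mul_one]

theorem theta0_tau_add_int (z τ : ℂ) (n : ℤ) : theta0 z (τ + n) = theta0 z τ := by
  simp only [theta0, cexp2_add, cexp2_int, mul_one]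

theorem theta0_tau_sub (z τ : ℂ) : theta0 (τ - z) τ = theta0 z τ := by
  simp only [theta0, cexp2_sub]
  rw [mul_comm, div_div_cancel₀ (cexp2_ne_zero τ)]

theorem theta0_neg_tau (z : ℂ) {τ : ℂ} (h : τ.im ≠ 0) :
    theta0 z (-τ) = (theta0 (z + τ) τ)⁻¹ := by
  have h0 := cexp2_ne_zero τ
  have hz := cexp2_ne_zero z
  simp only [theta0, cexp2_neg, cexp2_add, qPoch_inv _ h0 (norm_cexp2_ne_one h), mul_inv]
  congr 3
  · rw [mul_comm]
  · field_simp

theorem theta0_neg_neg (z : ℂ) {τ : ℂ} (h : τ.im ≠ 0) :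
    theta0 (-z) (-τ) = (theta0 z τ)⁻¹ := by
  rw [theta0_neg_tau _ h, ← theta0_tau_sub z]
  congr 2
  ring

theorem theta0_ne_zero {z τ : ℂ} (h : τ.im ≠ 0) (hz : ∀ i j : ℤ, z ≠ i + j * τ) :
    theta0 z τ ≠ 0 := by
  refine mul_ne_zero (qPoch_ne_zero (norm_cexp2_ne_one h) fun j hj => ?_)
    (qPoch_ne_zero (norm_cexp2_ne_one h) fun j hj => ?_)
  · rw [← cexp2_int_mul, ← cexp2_add] at hj
    obtain ⟨n, hn⟩ := cexp2_eq_one_iff.1 hj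
    refine hz n (-j) ?_
    push_cast
    linear_combination hn
  · rw [← cexp2_int_mul, ← cexp2_sub, ← cexp2_add] at hj
    obtain ⟨n, hn⟩ := cexp2_eq_one_iff.1 hj
    refine hz (-n) (j + 1) ?_
    push_cast
    linear_combination -hn

theorem theta0_add_tau {z τ : ℂ} (h : τ.im ≠ 0) (hz : ∀ i : ℤ, z ≠ i) :
    theta0 (z + τ) τ = -cexp2 (-z) * theta0 z τ := by
  have h0 := cexp2_ne_zero τ
  have hx := cexp2_ne_zero z
  have hx1 : cexp2 z ≠ 1 := fun h1 => by
    obtain ⟨n, hn⟩ := cexp2_eq_one_iff.1 h1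
    exact hz n hn
  have hx2 : (cexp2 z)⁻¹ ≠ 1 := fun h1 => hx1 (by rw [← inv_inv (cexp2 z), h1, inv_one])
  simp only [theta0, cexp2_add, cexp2_neg]
  rw [qPoch_eq h0 (norm_cexp2_ne_one h) hx1]
  have : cexp2 τ / (cexp2 z * cexp2 τ) = (cexp2 z)⁻¹ := by field_simp
  rw [this, qPoch_eq h0 (norm_cexp2_ne_one h) hx2, mul_comm (cexp2 z) (cexp2 τ), div_eq_mul_inv]
  field_simp
  ring

theorem differentiableAt_theta0 {z τ : ℂ} (h : τ.im ≠ 0) (h0 : theta0 z τ ≠ 0) :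
    DifferentiableAt ℂ (fun t : ℂ × ℂ => theta0 t.1 t.2) (z, τ) := by
  have hn := norm_cexp2_ne_one h
  have d1 : DifferentiableAt ℂ (fun t : ℂ × ℂ => cexp2 t.1) (z, τ) :=
    differentiable_cexp2.differentiableAt.comp (z, τ) differentiableAt_fst
  have d2 : DifferentiableAt ℂ (fun t : ℂ × ℂ => cexp2 t.2) (z, τ) :=
    differentiable_cexp2.differentiableAt.comp (z, τ) differentiableAt_snd
  have d3 : DifferentiableAt ℂ (fun t : ℂ × ℂ => cexp2 t.2 / cexp2 t.1) (z, τ) :=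
    differentiableAt_div d2 d1 (cexp2_ne_zero z)
  unfold theta0
  refine DifferentiableAt.mul ?_ ?_
  · exact (differentiableAt_qPoch (cexp2_ne_zero τ) hn (left_ne_zero_of_mul h0)).comp
      (f := fun t : ℂ × ℂ => (cexp2 t.1, cexp2 t.2)) (z, τ) (d1.prodMk d2)
  · exact (differentiableAt_qPoch (cexp2_ne_zero τ) hn (right_ne_zero_of_mul h0)).comp
      (f := fun t : ℂ × ℂ => (cexp2 t.2 / cexp2 t.1, cexp2 t.2)) (z, τ) (d3.prodMk d2)

/-! ### Functional equations of the elliptic gamma function -/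

theorem ellGamma_add_int (z τ σ : ℂ) (n : ℤ) : ellGamma (z + n) τ σ = ellGamma z τ σ := by
  simp only [ellGamma, cexp2_add, cexp2_int, mul_one]

theorem ellGamma_tau_add_int (z τ σ : ℂ) (n : ℤ) : ellGamma z (τ + n) σ = ellGamma z τ σ := by
  simp only [ellGamma, cexp2_add, cexp2_int, mul_one]

theorem ellGamma_sigma_add_int (z τ σ : ℂ) (n : ℤ) : ellGamma z τ (σ + n) = ellGamma z τ σ := by
  simp only [ellGamma, cexp2_add, cexp2_int, mul_one]

theorem ellGamma_symm (z τ σ : ℂ) : ellGamma z τ σ = ellGamma z σ τ := by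
  simp only [ellGamma]
  rw [qPoch₂_symm, qPoch₂_symm (cexp2 z), mul_comm (cexp2 τ)]

theorem ellGamma_refl (z τ σ : ℂ) : ellGamma (τ + σ - z) τ σ = (ellGamma z τ σ)⁻¹ := by
  simp only [ellGamma, cexp2_sub, cexp2_add, inv_div]
  rw [div_div_cancel₀ (mul_ne_zero (cexp2_ne_zero τ) (cexp2_ne_zero σ))]

theorem ellGamma_neg_sigma (z τ : ℂ) {σ : ℂ} (h : σ.im ≠ 0) :
    ellGamma z τ (-σ) = (ellGamma (z + σ) τ σ)⁻¹ := by
  have h0 := cexp2_ne_zero σ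
  have hz := cexp2_ne_zero z
  simp only [ellGamma, cexp2_neg, cexp2_add, qPoch₂_inv_right _ _ h0 (norm_cexp2_ne_one h), inv_div,
    div_inv_eq_mul]
  rw [mul_comm, div_eq_mul_inv, mul_comm (cexp2 z)]
  congr 3
  field_simp

theorem ellGamma_ne_zero {z τ σ : ℂ} (hτ : τ.im ≠ 0) (hσ : σ.im ≠ 0)
    (hz : ∀ i j k : ℤ, z ≠ i + j * τ + k * σ) : ellGamma z τ σ ≠ 0 := by
  refine div_ne_zero (qPoch₂_ne_zero (norm_cexp2_ne_one hτ) (norm_cexp2_ne_one hσ) fun j k h => ?_)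
    (qPoch₂_ne_zero (norm_cexp2_ne_one hτ) (norm_cexp2_ne_one hσ) fun j k h => ?_)
  · rw [← cexp2_int_mul, ← cexp2_int_mul, ← cexp2_add, ← cexp2_sub, ← cexp2_add, ← cexp2_add] at h
    obtain ⟨n, hn⟩ := cexp2_eq_one_iff.1 h
    refine hz (-n) (j + 1) (k + 1) ?_
    push_cast
    linear_combination -hn
  · rw [← cexp2_int_mul, ← cexp2_int_mul, ← cexp2_add, ← cexp2_add] at h
    obtain ⟨n, hn⟩ := cexp2_eq_one_iff.1 h
    refine hz n (-j) (-k) ?_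
    push_cast
    linear_combination hn

/-- Numerator and denominator each lose one line of factors under the shift, and these two lines are
the two factors of `θ₀(z, σ)`. Non-vanishing of `θ₀` makes the cancellation legitimate in all
regimes. -/
theorem ellGamma_add_tau {z τ σ : ℂ} (hτ : τ.im ≠ 0) (hσ : σ.im ≠ 0) (h : theta0 z σ ≠ 0) :
    ellGamma (z + τ) τ σ = theta0 z σ * ellGamma z τ σ := by
  have h0 := cexp2_ne_zero τ
  have hx := cexp2_ne_zero z
  have h1 := left_ne_zero_of_mul h
  have h2 := right_ne_zero_of_mul h
  simp only [ellGamma, cexp2_add, theta0]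
  rw [qPoch₂_eq h0 (norm_cexp2_ne_one hτ) (norm_cexp2_ne_one hσ) h1]
  have : cexp2 τ * cexp2 σ / (cexp2 z * cexp2 τ) = cexp2 σ / cexp2 z := by field_simp
  rw [this, qPoch₂_eq h0 (norm_cexp2_ne_one hτ) (norm_cexp2_ne_one hσ) h2,
    mul_comm (cexp2 z) (cexp2 τ), mul_div_assoc (cexp2 τ)]
  have key : ∀ A B C D : ℂ, A ≠ 0 → B * C / D = A * B * (C / (A * D)) := fun A B C D hA => by
    rw [← mul_div_assoc, mul_assoc, mul_div_mul_left _ _ hA]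
  exact key _ _ _ _ h1

theorem differentiableAt_ellGamma {z τ σ : ℂ} (hτ : τ.im ≠ 0) (hσ : σ.im ≠ 0)
    (h0 : ellGamma z τ σ ≠ 0) :
    DifferentiableAt ℂ (fun t : ℂ × ℂ × ℂ => ellGamma t.1 t.2.1 t.2.2) (z, τ, σ) := by
  have hn := norm_cexp2_ne_one hτ
  have hm := norm_cexp2_ne_one hσ
  have d1 : DifferentiableAt ℂ (fun t : ℂ × ℂ × ℂ => cexp2 t.1) (z, τ, σ) :=
    differentiable_cexp2.differentiableAt.comp (z, τ, σ) (by fun_prop)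
  have d2 : DifferentiableAt ℂ (fun t : ℂ × ℂ × ℂ => cexp2 t.2.1) (z, τ, σ) :=
    differentiable_cexp2.differentiableAt.comp (f := fun t : ℂ × ℂ × ℂ => t.2.1) (z, τ, σ)
      (by fun_prop)
  have d3 : DifferentiableAt ℂ (fun t : ℂ × ℂ × ℂ => cexp2 t.2.2) (z, τ, σ) :=
    differentiable_cexp2.differentiableAt.comp (f := fun t : ℂ × ℂ × ℂ => t.2.2) (z, τ, σ)
      (by fun_prop)
  have d4 : DifferentiableAt ℂ (fun t : ℂ × ℂ × ℂ => cexp2 t.2.1 * cexp2 t.2.2 / cexp2 t.1)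
      (z, τ, σ) := differentiableAt_div (d2.mul d3) d1 (cexp2_ne_zero z)
  unfold ellGamma at h0 ⊢
  have h1 : qPoch₂ (cexp2 τ * cexp2 σ / cexp2 z) (cexp2 τ) (cexp2 σ) ≠ 0 :=
    fun h => h0 (by rw [h, zero_div])
  have h2 : qPoch₂ (cexp2 z) (cexp2 τ) (cexp2 σ) ≠ 0 := fun h => h0 (by rw [h, div_zero])
  have e1 : DifferentiableAt ℂ (fun t : ℂ × ℂ × ℂ =>
      qPoch₂ (cexp2 t.2.1 * cexp2 t.2.2 / cexp2 t.1) (cexp2 t.2.1) (cexp2 t.2.2)) (z, τ, σ) :=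
    (differentiableAt_qPoch₂ (cexp2_ne_zero τ) (cexp2_ne_zero σ) hn hm h1).comp
      (f := fun t : ℂ × ℂ × ℂ => (cexp2 t.2.1 * cexp2 t.2.2 / cexp2 t.1, cexp2 t.2.1, cexp2 t.2.2))
      (z, τ, σ) (d4.prodMk (d2.prodMk d3))
  have e2 : DifferentiableAt ℂ (fun t : ℂ × ℂ × ℂ =>
      qPoch₂ (cexp2 t.1) (cexp2 t.2.1) (cexp2 t.2.2)) (z, τ, σ) :=
    (differentiableAt_qPoch₂ (cexp2_ne_zero τ) (cexp2_ne_zero σ) hn hm h2).comp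
      (f := fun t : ℂ × ℂ × ℂ => (cexp2 t.1, cexp2 t.2.1, cexp2 t.2.2))
      (z, τ, σ) (d1.prodMk (d2.prodMk d3))
  exact differentiableAt_div e1 e2 h2

end
end EllipticGamma

namespace EllipticGamma
noncomputable section

/-! ### The modular property of the theta function -/

theorem exists_real_coords {τ : ℂ} (hτ : τ.im ≠ 0) (w : ℂ) : ∃ s t : ℝ, w = s + t * τ := by
  refine ⟨w.re - w.im / τ.im * τ.re, w.im / τ.im, ?_⟩
  apply Complex.ext
  · simp
  · simp [div_mul_cancel₀ _ hτ]

theorem periodic_add_lattice {g : ℂ → ℂ} {τ : ℂ} (h1 : ∀ w, g (w + 1) = g w)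
    (h2 : ∀ w, g (w + τ) = g w) (m n : ℤ) (w : ℂ) : g (w + (m + n * τ)) = g w := by
  have e1 : Function.Periodic g 1 := h1
  have e2 : Function.Periodic g τ := h2
  have e3 := e1.int_mul m (w + n * τ)
  rw [mul_one] at e3
  rw [← e2.int_mul n w, ← e3]
  congr 1
  ring

/-- Entire elliptic functions are constant. -/
theorem elliptic_apply_eq {g : ℂ → ℂ} (hg : Differentiable ℂ g) {τ : ℂ} (hτ : τ.im ≠ 0)
    (h1 : ∀ w, g (w + 1) = g w) (h2 : ∀ w, g (w + τ) = g w) (v w : ℂ) : g v = g w := by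
  refine hg.apply_eq_apply_of_bounded ?_ v w
  have hc : IsCompact ((fun p : ℝ × ℝ => g (p.1 + p.2 * τ)) '' (Set.Icc 0 1 ×ˢ Set.Icc 0 1)) :=
    (isCompact_Icc.prod isCompact_Icc).image (hg.continuous.comp (by fun_prop))
  refine hc.isBounded.subset ?_
  rintro _ ⟨w, rfl⟩
  obtain ⟨s, t, rfl⟩ := exists_real_coords hτ w
  refine ⟨(Int.fract s, Int.fract t), ⟨⟨Int.fract_nonneg _, (Int.fract_lt_one _).le⟩,
    ⟨Int.fract_nonneg _, (Int.fract_lt_one _).le⟩⟩, ?_⟩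
  have := periodic_add_lattice h1 h2 ⌊s⌋ ⌊t⌋ ((Int.fract s : ℝ) + (Int.fract t : ℝ) * τ)
  refine this.symm.trans (congrArg g ?_)
  have e1 : ((Int.fract s : ℝ) : ℂ) = s - (⌊s⌋ : ℤ) := by
    rw [Int.fract]; push_cast; ring
  have e2 : ((Int.fract t : ℝ) : ℂ) = t - (⌊t⌋ : ℤ) := by
    rw [Int.fract]; push_cast; ring
  rw [e1, e2]
  ring

theorem theta0_of_pos (z : ℂ) {τ : ℂ} (h : 0 < τ.im) :
    theta0 z τ = poch (cexp2 z) (cexp2 τ) * poch (cexp2 τ / cexp2 z) (cexp2 τ) := by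
  have hq := norm_cexp2_lt_one_iff.2 h
  rw [theta0, qPoch_of_lt _ hq, qPoch_of_lt _ hq]

theorem theta0_eq_mul (z : ℂ) {τ : ℂ} (h : 0 < τ.im) :
    theta0 z τ = (1 - cexp2 z) *
      (poch (cexp2 τ * cexp2 z) (cexp2 τ) * poch (cexp2 τ / cexp2 z) (cexp2 τ)) := by
  rw [theta0_of_pos z h, poch_eq (cexp2 z) (norm_cexp2_lt_one_iff.2 h), mul_assoc]

/-- In the upper half-plane `θ₀` is entire in `z`, and no point has to be excluded. -/
theorem theta0_add_tau_of_pos (z : ℂ) {τ : ℂ} (h : 0 < τ.im) :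
    theta0 (z + τ) τ = -cexp2 (-z) * theta0 z τ := by
  have h0 := cexp2_ne_zero τ
  have hx := cexp2_ne_zero z
  rw [theta0_eq_mul z h, theta0_of_pos _ h, cexp2_add, cexp2_neg]
  have : cexp2 τ / (cexp2 z * cexp2 τ) = (cexp2 z)⁻¹ := by field_simp
  rw [this, poch_eq (cexp2 z)⁻¹ (norm_cexp2_lt_one_iff.2 h), mul_comm (cexp2 z) (cexp2 τ),
    div_eq_mul_inv]
  field_simp
  ring

theorem differentiable_poch {q : ℂ} (hq : ‖q‖ < 1) : Differentiable ℂ fun x => poch x q := fun x =>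
  (differentiableAt_poch (x := x) hq).comp (f := fun t : ℂ => (t, q)) x (by fun_prop)

theorem differentiable_poch_mul_poch {τ : ℂ} (h : 0 < τ.im) : Differentiable ℂ fun z =>
    poch (cexp2 τ * cexp2 z) (cexp2 τ) * poch (cexp2 τ / cexp2 z) (cexp2 τ) := by
  have hp := differentiable_poch (norm_cexp2_lt_one_iff.2 h)
  refine Differentiable.mul ?_ ?_
  · exact hp.comp (differentiable_cexp2.const_mul _)
  · refine hp.comp fun z => ?_
    exact differentiableAt_div (differentiableAt_const _) (differentiable_cexp2 z) (cexp2_ne_zero z)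

theorem differentiable_theta0 {τ : ℂ} (h : 0 < τ.im) : Differentiable ℂ fun z => theta0 z τ := by
  simp only [theta0_eq_mul _ h]
  exact (differentiable_cexp2.const_sub _).mul (differentiable_poch_mul_poch h)

theorem theta0_zero {τ : ℂ} (h : 0 < τ.im) : theta0 0 τ = 0 := by
  rw [theta0_eq_mul _ h, cexp2_zero, sub_self, zero_mul]

/-- The zero at 0 is simple, which makes the singularity of the quotient in `exists_theta0_eq`
removable. -/
theorem deriv_theta0_zero_ne_zero {τ : ℂ} (h : 0 < τ.im) : deriv (fun z => theta0 z τ) 0 ≠ 0 := by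
  have h1 : HasDerivAt (fun z => 1 - cexp2 z) (-(2 * Real.pi * Complex.I)) 0 := by
    have : HasDerivAt cexp2 (2 * Real.pi * Complex.I) 0 := by
      unfold cexp2
      simpa using ((hasDerivAt_id (0 : ℂ)).const_mul (2 * Real.pi * Complex.I)).cexp
    simpa using this.const_sub 1
  have h2 := (differentiable_poch_mul_poch h 0).hasDerivAt
  have h3 := h1.mul h2
  simp only [theta0_eq_mul _ h]
  rw [show (fun z => (1 - cexp2 z) * (poch (cexp2 τ * cexp2 z) (cexp2 τ) *
    poch (cexp2 τ / cexp2 z) (cexp2 τ))) = (fun z => 1 - cexp2 z) * (fun z =>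
      poch (cexp2 τ * cexp2 z) (cexp2 τ) * poch (cexp2 τ / cexp2 z) (cexp2 τ)) from rfl, h3.deriv]
  have hq := norm_cexp2_lt_one_iff.2 h
  have h0 : poch (cexp2 τ) (cexp2 τ) ≠ 0 := poch_ne_zero hq fun j hj => by
    have : ‖cexp2 τ * cexp2 τ ^ j‖ < 1 := by
      rw [← pow_succ', norm_pow]
      exact pow_lt_one₀ (norm_nonneg _) hq (Nat.succ_ne_zero j)
    rw [hj, norm_one] at this
    exact lt_irrefl _ this
  simp only [cexp2_zero, mul_one, div_one, sub_self, zero_mul, add_zero]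
  exact mul_ne_zero (neg_ne_zero.2 Complex.two_pi_I_ne_zero) (mul_ne_zero h0 h0)

/-- The polynomial `B_{2,2}(z; 1, τ)/2`-type exponent of the modular property of `θ₀`. -/
def bern (z τ : ℂ) : ℂ := z ^ 2 / τ - z * (1 + τ) / τ + (1 + τ ^ 2 + 3 * τ) / (6 * τ)

theorem exp_pi_I_eq (t : ℂ) : Complex.exp (Real.pi * Complex.I * (2 * t - 1)) = -cexp2 t := by
  have : (Real.pi * Complex.I * (2 * t - 1) : ℂ) =
    2 * Real.pi * Complex.I * t - Real.pi * Complex.I := by ring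
  rw [this, Complex.exp_sub, Complex.exp_pi_mul_I, cexp2, div_neg, div_one]

theorem neg_inv_im_pos {τ : ℂ} (h : 0 < τ.im) : 0 < (-1 / τ).im := by
  have h0 : τ ≠ 0 := fun h0 => by simp [h0] at h
  rw [neg_div, one_div, Complex.neg_im, Complex.inv_im, neg_div, neg_neg]
  exact div_pos h (Complex.normSq_pos.2 h0)

-- The quotient of the left side by `θ₀((w - 1)/τ, -1/τ)` has periods 1 and `τ`: the multipliers of
-- the theta functions are compensated by those of the exponential. The denominator has zeros only
-- at lattice points, simple at the origin, where the numerator vanishes too; so the quotient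
-- extends to an entire elliptic function, which is constant.
open Filter Topology in
theorem exists_theta0_eq {τ : ℂ} (h : 0 < τ.im) : ∃ κ : ℂ, ∀ w,
    theta0 ((w - 1) / τ) (-1 / τ) ≠ 0 →
    theta0 w τ * Complex.exp (Real.pi * Complex.I * bern w τ) =
      κ * theta0 ((w - 1) / τ) (-1 / τ) := by
  have h0 : τ ≠ 0 := fun h0 => by simp [h0] at h
  have h' := neg_inv_im_pos h
  set A : ℂ → ℂ := fun w => theta0 w τ with hA
  set C : ℂ → ℂ := fun w => theta0 ((w - 1) / τ) (-1 / τ) with hC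
  set E : ℂ → ℂ := fun w => Complex.exp (Real.pi * Complex.I * bern w τ) with hE
  have dA : Differentiable ℂ A := differentiable_theta0 h
  have dC : Differentiable ℂ C := (differentiable_theta0 h').comp (by fun_prop)
  have dE : Differentiable ℂ E := by
    intro w
    simp only [hE, bern]
    fun_prop
  have A1 : ∀ w, A (w + 1) = A w := fun w => by simpa using theta0_add_int w τ 1
  have Aτ : ∀ w, A (w + τ) = -cexp2 (-w) * A w := fun w => theta0_add_tau_of_pos w h
  have Cτ : ∀ w, C (w + τ) = C w := fun w => by
    have := theta0_add_int ((w - 1) / τ) (-1 / τ) 1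
    refine Eq.trans ?_ this
    simp only [hC]
    congr 1
    push_cast
    field_simp
    ring
  have C0 : ∀ w, C w = -cexp2 (-(w / τ)) * theta0 (w / τ) (-1 / τ) := fun w => by
    rw [← theta0_add_tau_of_pos _ h']
    simp only [hC]
    congr 1
    ring
  have C1 : ∀ w, C (w + 1) = -cexp2 (w / τ) * C w := fun w => by
    rw [C0 w]
    simp only [hC, add_sub_cancel_right, cexp2_neg]
    field_simp [cexp2_ne_zero]
  have E1 : ∀ w, E (w + 1) = -cexp2 (w / τ) * E w := fun w => by
    rw [← exp_pi_I_eq]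
    simp only [hE]
    rw [← Complex.exp_add]
    congr 1
    simp only [bern]
    field_simp
    ring
  have Eτ : ∀ w, E (w + τ) = -cexp2 w * E w := fun w => by
    rw [← exp_pi_I_eq]
    simp only [hE]
    rw [← Complex.exp_add]
    congr 1
    simp only [bern]
    field_simp
    ring
  have A00 : A 0 = 0 := theta0_zero h
  have C00 : C 0 = 0 := by rw [C0, zero_div, theta0_zero h', mul_zero]
  have dC0 : deriv C 0 ≠ 0 := by
    have e1 : HasDerivAt (fun w => theta0 (w / τ) (-1 / τ))
        (deriv (fun z => theta0 z (-1 / τ)) 0 * (1 / τ)) 0 := by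
      have e2 := (differentiable_theta0 h' (0 / τ)).hasDerivAt
      have e3 := e2.comp (0 : ℂ) ((hasDerivAt_id' (0 : ℂ)).div_const τ)
      rw [zero_div] at e3
      exact e3
    have e2 : DifferentiableAt ℂ (fun w => -cexp2 (-(w / τ))) 0 := by
      have := differentiable_cexp2
      fun_prop
    have e3 := e2.hasDerivAt.mul e1
    have e4 : C = (fun w => -cexp2 (-(w / τ))) * fun w => theta0 (w / τ) (-1 / τ) := funext C0
    rw [e4, e3.deriv, zero_div, theta0_zero h', mul_zero, zero_add, neg_zero, cexp2_zero]
    refine mul_ne_zero (by norm_num) (mul_ne_zero (deriv_theta0_zero_ne_zero h') ?_)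
    exact one_div_ne_zero h0
  have dsA : Differentiable ℂ (dslope A 0) := by
    rw [← differentiableOn_univ, Complex.differentiableOn_dslope Filter.univ_mem]
    exact dA.differentiableOn
  have dsC : Differentiable ℂ (dslope C 0) := by
    rw [← differentiableOn_univ, Complex.differentiableOn_dslope Filter.univ_mem]
    exact dC.differentiableOn
  set H : ℂ → ℂ := fun w => dslope A 0 w / dslope C 0 w * E w with hH
  -- `H` is the quotient after division of both functions by `w`. Its value at 0 is assigned at
  -- every zero of `C`, which respects both periods; holomorphy at the zeros then reduces to
  -- holomorphy at 0.
  set g : ℂ → ℂ := fun w => if C w = 0 then H 0 else A w / C w * E w with hg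
  have gdef : ∀ w, C w ≠ 0 → g w = A w / C w * E w := fun w hw => if_neg hw
  have gzero : ∀ w, C w = 0 → g w = H 0 := fun w hw => if_pos hw
  have g1 : ∀ w, g (w + 1) = g w := fun w => by
    by_cases hw : C w = 0
    · rw [gzero w hw, gzero _ (by rw [C1, hw, mul_zero])]
    · have hne : -cexp2 (w / τ) ≠ 0 := neg_ne_zero.2 (cexp2_ne_zero _)
      rw [gdef w hw, gdef _ (by rw [C1]; exact mul_ne_zero hne hw), A1, C1, E1]
      have hne' := cexp2_ne_zero (w / τ)
      field_simp
  have gτ : ∀ w, g (w + τ) = g w := fun w => by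
    by_cases hw : C w = 0
    · rw [gzero w hw, gzero _ (by rw [Cτ, hw])]
    · rw [gdef w hw, gdef _ (by rwa [Cτ]), Aτ, Cτ, Eτ, cexp2_neg]
      field_simp [cexp2_ne_zero]
  have dg0 : DifferentiableAt ℂ g 0 := by
    have hs : dslope C 0 0 ≠ 0 := by rwa [dslope_same]
    have dH : DifferentiableAt ℂ H 0 := (differentiableAt_div (dsA 0) (dsC 0) hs).mul (dE 0)
    refine dH.congr_of_eventuallyEq ?_
    filter_upwards [(dsC 0).continuousAt.eventually_ne hs] with w hw
    rcases eq_or_ne w 0 with rfl | hw0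
    · exact gzero 0 C00
    · have e1 : A w = w * dslope A 0 w := by
        have := sub_smul_dslope A 0 w
        rw [A00, sub_zero, sub_zero, smul_eq_mul] at this
        exact this.symm
      have e2 : C w = w * dslope C 0 w := by
        have := sub_smul_dslope C 0 w
        rw [C00, sub_zero, sub_zero, smul_eq_mul] at this
        exact this.symm
      rw [gdef w (by rw [e2]; exact mul_ne_zero hw0 hw), e1, e2, mul_div_mul_left _ _ hw0]
  have dg : Differentiable ℂ g := by
    intro w
    by_cases hw : C w = 0
    · have : ∃ i j : ℤ, (w - 1) / τ = i + j * (-1 / τ) := by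
        by_contra! hne
        exact theta0_ne_zero h'.ne' hne hw
      obtain ⟨i, j, hij⟩ := this
      have hw' : w = ((1 - j : ℤ) : ℂ) + (i : ℤ) * τ := by
        field_simp at hij
        push_cast
        linear_combination hij
      have e : g = fun v => g (v - w) := by
        funext v
        have := periodic_add_lattice g1 gτ (1 - j) i (v - w)
        rw [← hw', sub_add_cancel] at this
        exact this
      rw [e]
      refine DifferentiableAt.comp (g := g) (f := fun v => v - w) w ?_ (by fun_prop)
      rwa [sub_self]
    · have : DifferentiableAt ℂ (fun w => A w / C w * E w) w :=
        (differentiableAt_div (dA w) (dC w) hw).mul (dE w)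
      refine this.congr_of_eventuallyEq ?_
      filter_upwards [(dC w).continuousAt.eventually_ne hw] with v hv
      exact gdef v hv
  refine ⟨g 0, fun w hw => ?_⟩
  rw [elliptic_apply_eq dg h.ne' g1 gτ 0 w, gdef w hw]
  have hw' : C w ≠ 0 := hw
  change A w * E w = A w / C w * E w * C w
  field_simp

/-- Written as products in `s = e^{πiτ}`, the three values combine by Euler's identity `(-q; q)(q;
q²) = 1`. The factor 2 comes from `1 - (-1)` at the half period 1/2. -/
theorem theta0_half_periods {τ : ℂ} (h : 0 < τ.im) :
    theta0 (1 / 2) τ * theta0 (τ / 2) τ * theta0 ((1 + τ) / 2) τ = 2 := by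
  have hq := norm_cexp2_lt_one_iff.2 h
  set q := cexp2 τ with hqd
  set s := cexp2 (τ / 2) with hs
  have hs2 : s ^ 2 = q := by
    rw [hs, hqd, sq, ← cexp2_add]
    congr 1
    ring
  have hs0 : s ≠ 0 := cexp2_ne_zero _
  have e1 : cexp2 ((1 + τ) / 2) = -s := by
    rw [add_div, cexp2_add, cexp2_half, neg_one_mul]
  have e2 : q / s = s := by rw [← hs2, sq, mul_div_cancel_right₀ _ hs0]
  rw [theta0_of_pos _ h, theta0_of_pos _ h, theta0_of_pos _ h, cexp2_half, e1, ← hs, ← hqd,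
    div_neg, e2, div_neg, div_one, e2, poch_eq (-1) hq, mul_neg_one]
  have e3 := poch_mul_poch_neg s hq
  rw [hs2] at e3
  have e4 := poch_neg_mul_poch hq
  rw [← e3] at e4
  linear_combination 2 * (poch (-q) q * (poch s q * poch (-s) q) + 1) * e4

-- The constant `κ(τ)` of `exists_theta0_eq` is evaluated. The substitution permutes the half
-- periods, so multiplying the three equations gives `κ³ = 1`. By continuity `κ` is constant on the
-- upper half-plane, and at `τ = i` it is 1.
open Filter Topology in
theorem theta0_mul_exp_bern {τ : ℂ} (h : 0 < τ.im) (w : ℂ)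
    (hw : theta0 ((w - 1) / τ) (-1 / τ) ≠ 0) :
    theta0 w τ * Complex.exp (Real.pi * Complex.I * bern w τ) = theta0 ((w - 1) / τ) (-1 / τ) := by
  have im0 : ∀ {τ : ℂ}, 0 < τ.im → τ ≠ 0 := fun h h0 => by simp [h0] at h
  choose! κ hκ using fun (τ : ℂ) (h : 0 < τ.im) => exists_theta0_eq h
  have half : ∀ {τ : ℂ}, 0 < τ.im → theta0 (1 / 2) τ ≠ 0 ∧ theta0 (τ / 2) τ ≠ 0 ∧
      theta0 ((1 + τ) / 2) τ ≠ 0 := by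
    intro τ h
    have := theta0_half_periods h
    refine ⟨fun h0 => ?_, fun h0 => ?_, fun h0 => ?_⟩ <;> rw [h0] at this <;> simp at this
  have a1 : ∀ {τ : ℂ}, 0 < τ.im → (1 / 2 - 1) / τ = (-1 / τ) / 2 := fun h => by
    have := im0 h
    field_simp
    ring
  have a2 : ∀ {τ : ℂ}, 0 < τ.im →
      theta0 ((τ / 2 - 1) / τ) (-1 / τ) = theta0 (1 / 2) (-1 / τ) := fun {τ} h => by
    have h0 := im0 h
    have : (τ / 2 - 1) / τ = 1 / 2 + -1 / τ := by
      field_simp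
      ring
    rw [this, theta0_add_tau_of_pos _ (neg_inv_im_pos h), cexp2_neg, cexp2_half]
    norm_num
  have a3 : ∀ {τ : ℂ}, 0 < τ.im → ((1 + τ) / 2 - 1) / τ = (1 + -1 / τ) / 2 := fun h => by
    have := im0 h
    field_simp
    ring
  have cube : ∀ {τ : ℂ}, 0 < τ.im → κ τ ^ 3 = 1 := by
    intro τ h
    have h0 := im0 h
    obtain ⟨n1, n2, n3⟩ := half (neg_inv_im_pos h)
    have k1 := hκ τ h (1 / 2) (by rwa [a1 h])
    have k2 := hκ τ h (τ / 2) (by rwa [a2 h])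
    have k3 := hκ τ h ((1 + τ) / 2) (by rwa [a3 h])
    rw [a1 h] at k1
    rw [a2 h] at k2
    rw [a3 h] at k3
    have p1 := theta0_half_periods h
    have p2 := theta0_half_periods (neg_inv_im_pos h)
    have ex : Complex.exp (Real.pi * Complex.I * bern (1 / 2) τ) *
        Complex.exp (Real.pi * Complex.I * bern (τ / 2) τ) *
        Complex.exp (Real.pi * Complex.I * bern ((1 + τ) / 2) τ) = 1 := by
      have e0 : bern (1 / 2) τ + bern (τ / 2) τ + bern ((1 + τ) / 2) τ = 0 := by
        simp only [bern]
        field_simp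
        ring
      rw [← Complex.exp_add, ← Complex.exp_add, ← mul_add, ← mul_add, e0, mul_zero,
        Complex.exp_zero]
    have := congrArg₂ (· * ·) (congrArg₂ (· * ·) k1 k2) k3
    have e2 : κ τ ^ 3 * 2 = 2 := by
      linear_combination (-κ τ ^ 3) * p2 - this + Complex.exp (Real.pi * Complex.I * bern (1 / 2) τ) *
        Complex.exp (Real.pi * Complex.I * bern (τ / 2) τ) *
        Complex.exp (Real.pi * Complex.I * bern ((1 + τ) / 2) τ) * p1 + 2 * ex
    exact mul_right_cancel₀ two_ne_zero (e2.trans (one_mul 2).symm)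
  have formula : ∀ {τ : ℂ}, 0 < τ.im → κ τ = theta0 ((1 + τ) / 2) τ *
      Complex.exp (Real.pi * Complex.I * bern ((1 + τ) / 2) τ) /
        theta0 ((1 + -1 / τ) / 2) (-1 / τ) := by
    intro τ h
    obtain ⟨n1, n2, n3⟩ := half (neg_inv_im_pos h)
    have k3 := hκ τ h ((1 + τ) / 2) (by rwa [a3 h])
    rw [a3 h] at k3
    rw [k3, mul_div_cancel_right₀ _ n3]
  have cont : ContinuousOn κ {τ : ℂ | 0 < τ.im} := by
    have main : ∀ τ : ℂ, 0 < τ.im → ContinuousAt (fun τ => theta0 ((1 + τ) / 2) τ) τ := by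
      intro τ h
      have := (differentiableAt_theta0 h.ne' (half h).2.2).continuousAt
      exact this.comp (f := fun τ : ℂ => ((1 + τ) / 2, τ)) (by fun_prop)
    refine ContinuousOn.congr (f := fun τ => theta0 ((1 + τ) / 2) τ *
      Complex.exp (Real.pi * Complex.I * bern ((1 + τ) / 2) τ) /
        theta0 ((1 + -1 / τ) / 2) (-1 / τ)) (fun τ h => ?_) fun τ h => formula h
    have h0 := im0 h
    refine ContinuousAt.continuousWithinAt (((main τ h).mul ?_).div ?_
      (half (neg_inv_im_pos h)).2.2)
    · unfold bern
      have : (6 * τ) ≠ 0 := mul_ne_zero (by norm_num) h0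
      fun_prop (disch := assumption)
    · exact (main _ (neg_inv_im_pos h)).comp (f := fun τ : ℂ => -1 / τ)
        (by fun_prop (disch := assumption))
  have conn : IsPreconnected {τ : ℂ | 0 < τ.im} := (convex_halfSpace_im_gt 0).isPreconnected
  have hI : 0 < Complex.I.im := by simp
  have hfin : (κ '' {τ : ℂ | 0 < τ.im}).Countable := by
    refine Set.Countable.mono (s₂ := {x : ℂ | x ^ 3 = 1}) ?_ ?_
    · rintro _ ⟨τ, h, rfl⟩
      exact cube h
    · have : {x : ℂ | x ^ 3 = 1} ⊆ ↑(Polynomial.nthRootsFinset 3 (1 : ℂ)) := fun x hx =>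
        (Polynomial.mem_nthRootsFinset (by norm_num) 1).2 hx
      exact (Finset.countable_toSet _).mono this
  -- At `τ = i` the substitution fixes both the modulus and the point `(1 + i)/2`, and the exponent
  -- vanishes there.
  have hI1 : κ Complex.I = 1 := by
    have e : -1 / Complex.I = Complex.I := by simp
    rw [formula hI, e]
    have : bern ((1 + Complex.I) / 2) Complex.I = 0 := by
      simp only [bern]
      field_simp
      ring_nf
      simp
    rw [this, mul_zero, Complex.exp_zero, mul_one, div_self (half hI).2.2]
  have hκ1 : κ τ = 1 := by
    rw [← hI1]
    exact hfin.isTotallyDisconnected _ subset_rfl (conn.image κ cont)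
      (Set.mem_image_of_mem κ h) (Set.mem_image_of_mem κ hI)
  rw [hκ τ h w hw, hκ1, one_mul]

/-- The exponent `B_{2,2}(z; a, b)` of the modular property of `θ₀`. -/
def bern₂ (z a b : ℂ) : ℂ :=
  z ^ 2 / (a * b) - z * (a + b) / (a * b) + (a ^ 2 + b ^ 2 + 3 * a * b) / (6 * a * b)

/-- The modular property of the theta function. -/
theorem theta0_modular {z a b : ℂ} (ha : a ≠ 0) (hb : b ≠ 0) (hab : (b / a).im ≠ 0)
    (hz : ∀ i j : ℤ, z ≠ i * a + j * b) :
    theta0 (z / a) (b / a) * theta0 (z / b) (a / b) =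
      Complex.exp (-(Real.pi * Complex.I * bern₂ z a b)) := by
  -- Both sides are symmetric in `a` and `b`, and exchanging them changes the sign of the imaginary
  -- part.
  wlog h : 0 < (b / a).im generalizing a b
  · have hba : 0 < (a / b).im := by
      have : a / b = (b / a)⁻¹ := by rw [inv_div]
      have h2 : (b / a).im < 0 := lt_of_le_of_ne (not_lt.1 h) hab
      rw [this, Complex.inv_im]
      exact div_pos (neg_pos.2 h2) (Complex.normSq_pos.2 (div_ne_zero hb ha))
    rw [mul_comm, this hb ha hba.ne' (fun i j => by rw [add_comm]; exact hz j i) hba]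
    congr 3
    simp only [bern₂]
    ring
  have hτ' := neg_inv_im_pos h
  have e : -1 / (b / a) = -(a / b) := by field_simp
  have hne : theta0 ((z / a - 1) / (b / a)) (-1 / (b / a)) ≠ 0 := by
    refine theta0_ne_zero hτ'.ne' fun i j hij => hz (1 - j) i ?_
    rw [e] at hij
    field_simp at hij
    push_cast
    linear_combination hij
  have main := theta0_mul_exp_bern h (z / a) hne
  rw [e] at main hne
  have e2 : theta0 (z / b) (a / b) = (theta0 ((z / a - 1) / (b / a)) (-(a / b)))⁻¹ := by
    have h3 : (-(a / b)).im ≠ 0 := by rw [← e]; exact hτ'.ne'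
    have := theta0_neg_tau (z / b) h3
    rw [neg_neg] at this
    rw [this]
    congr 2
    field_simp
    ring
  have e3 : bern (z / a) (b / a) = bern₂ z a b := by
    simp only [bern, bern₂]
    field_simp
  rw [e2, ← main, e3, Complex.exp_neg]
  have hA : theta0 (z / a) (b / a) ≠ 0 := by
    refine theta0_ne_zero h.ne' fun i j hij => hz i j ?_
    field_simp at hij
    linear_combination hij
  field_simp

end
end EllipticGamma

namespace EllipticGamma
noncomputable section

/-! ### The modular property of the elliptic gamma function -/

/-- `ℤ`-linear combinations of three complex numbers that are independent over `ℤ` can be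
arbitrarily small. -/
theorem exists_small_combination {x₁ x₂ x₃ : ℂ}
    (hind : ∀ a b c : ℤ, a * x₁ + b * x₂ + c * x₃ = 0 → a = 0 ∧ b = 0 ∧ c = 0) {ε : ℝ} (hε : 0 < ε) :
    ∃ a b c : ℤ, a * x₁ + b * x₂ + c * x₃ ≠ 0 ∧ ‖a * x₁ + b * x₂ + c * x₃‖ < ε := by
  by_contra! hne
  set s : Set ℂ := Set.range ![x₁, x₂, x₃] with hs
  have hmem : ∀ v ∈ Submodule.span ℤ s, ∃ a b c : ℤ, v = a * x₁ + b * x₂ + c * x₃ := by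
    intro v hv
    rw [hs, Submodule.mem_span_range_iff_exists_fun] at hv
    obtain ⟨c, rfl⟩ := hv
    exact ⟨c 0, c 1, c 2, by simp [Fin.sum_univ_three]⟩
  -- Without small non-zero combinations the group spanned by the three numbers would be discrete of
  -- rank three, which is impossible in the real plane.
  have hdisc : DiscreteTopology (Submodule.span ℤ s) := by
    apply discreteTopology_of_isOpen_singleton_zero
    have : ({0} : Set (Submodule.span ℤ s)) = Subtype.val ⁻¹' Metric.ball (0 : ℂ) ε := by
      ext ⟨v, hv⟩
      simp only [Set.mem_singleton_iff, Set.mem_preimage, mem_ball_zero_iff]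
      constructor
      · intro h
        have : v = 0 := congrArg Subtype.val h
        rw [this, norm_zero]
        exact hε
      · intro h
        obtain ⟨a, b, c, rfl⟩ := hmem v hv
        by_contra h0
        exact absurd h (not_lt.2 (hne a b c fun h1 => h0 (Subtype.ext h1)))
    rw [this]
    exact Metric.isOpen_ball.preimage continuous_subtype_val
  have hli : LinearIndependent ℤ ![x₁, x₂, x₃] := by
    rw [Fintype.linearIndependent_iff]
    intro g hg
    have := hind (g 0) (g 1) (g 2) (by simpa [Fin.sum_univ_three] using hg)
    intro i
    fin_cases i
    · exact this.1
    · exact this.2.1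
    · exact this.2.2
  have h3 := Real.finrank_eq_int_finrank_of_discrete hdisc
  rw [hs, Set.finrank, Set.finrank, finrank_span_eq_card hli] at h3
  have := Submodule.finrank_le (Submodule.span ℝ (Set.range ![x₁, x₂, x₃]))
  rw [h3, Complex.finrank_real_complex] at this
  simp at this

/-- The exponent `B_{3,3}`-type polynomial of the modular property of the elliptic gamma
function. -/
def bern₃ (z x₁ x₂ x₃ : ℂ) : ℂ :=
  (z ^ 3 - 3 / 2 * (x₁ + x₂ + x₃) * z ^ 2
    + (x₁ ^ 2 + x₂ ^ 2 + x₃ ^ 2 + 3 * (x₁ * x₂ + x₁ * x₃ + x₂ * x₃)) / 2 * z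
    - (x₁ + x₂ + x₃) * (x₁ * x₂ + x₁ * x₃ + x₂ * x₃) / 4) / (x₁ * x₂ * x₃)

/-- At this point the arguments of numerator and denominator coincide. It provides the normalisation
in `gammaTriple_mul_exp`. -/
theorem ellGamma_half {z τ σ : ℂ} (hz : 2 * z = 1 + τ + σ) (h : ellGamma z τ σ ≠ 0) :
    ellGamma z τ σ = 1 := by
  have e : cexp2 τ * cexp2 σ / cexp2 z = cexp2 z := by
    rw [div_eq_iff (cexp2_ne_zero z), ← cexp2_add, ← cexp2_add, ← two_mul, hz, add_assoc,
      cexp2_add 1, cexp2_one, one_mul]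
  unfold ellGamma at h ⊢
  rw [e] at h ⊢
  exact div_self fun h0 => h (by rw [h0, div_zero])

/-- The triple product of elliptic gamma functions. -/
def gammaTriple (x₁ x₂ x₃ z : ℂ) : ℂ :=
  ellGamma (z / x₁) (x₂ / x₁) (x₃ / x₁) * ellGamma (z / x₂) (x₁ / x₂) (x₃ / x₂) *
    ellGamma (z / x₃) (x₁ / x₃) (x₂ / x₃)

/-- Three periods in general position. -/
structure GenTriple (x₁ x₂ x₃ : ℂ) : Prop where
  im12 : (x₁ / x₂).im ≠ 0
  im13 : (x₁ / x₃).im ≠ 0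
  im23 : (x₂ / x₃).im ≠ 0
  ind : ∀ a b c : ℤ, a * x₁ + b * x₂ + c * x₃ = 0 → a = 0 ∧ b = 0 ∧ c = 0

theorem im_div_comm {a b : ℂ} (h : (a / b).im ≠ 0) : (b / a).im ≠ 0 := by
  have h0 : a / b ≠ 0 := fun h0 => h (by rw [h0, Complex.zero_im])
  rw [← inv_div, Complex.inv_im]
  exact div_ne_zero (neg_ne_zero.2 h) (Complex.normSq_pos.2 h0).ne'

namespace GenTriple

variable {x₁ x₂ x₃ : ℂ} (hx : GenTriple x₁ x₂ x₃)

include hx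

theorem ne_zero : x₁ ≠ 0 ∧ x₂ ≠ 0 ∧ x₃ ≠ 0 := by
  refine ⟨fun h => hx.im12 ?_, fun h => hx.im12 ?_, fun h => hx.im13 ?_⟩ <;> simp [h]

theorem swap12 : GenTriple x₂ x₁ x₃ :=
  ⟨im_div_comm hx.im12, hx.im23, hx.im13, fun a b c h => by
    have := hx.ind b a c (by linear_combination h)
    tauto⟩

theorem swap23 : GenTriple x₁ x₃ x₂ :=
  ⟨hx.im13, hx.im12, im_div_comm hx.im23, fun a b c h => by
    have := hx.ind a c b (by linear_combination h)
    tauto⟩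

theorem ellGamma_ne {z : ℂ} (hz : ∀ a b c : ℤ, z ≠ a * x₁ + b * x₂ + c * x₃) :
    ellGamma (z / x₁) (x₂ / x₁) (x₃ / x₁) ≠ 0 := by
  obtain ⟨h1, h2, h3⟩ := hx.ne_zero
  refine ellGamma_ne_zero (im_div_comm hx.im12) (im_div_comm hx.im13) fun i j k h => hz i j k ?_
  field_simp at h
  linear_combination h

/-- The shift by `x₁` is an integer shift in the first factor. In the other two it produces theta
functions with periods `x₂`, `x₃`, whose product is an exponential by `theta0_modular`; the
increment `3 bern₂` of `bern₃` compensates it. -/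
theorem gammaTriple_add {z : ℂ} (hz : ∀ a b c : ℤ, z ≠ a * x₁ + b * x₂ + c * x₃) :
    gammaTriple x₁ x₂ x₃ (z + x₁) *
        Complex.exp (Real.pi * Complex.I / 3 * bern₃ (z + x₁) x₁ x₂ x₃) =
      gammaTriple x₁ x₂ x₃ z * Complex.exp (Real.pi * Complex.I / 3 * bern₃ z x₁ x₂ x₃) := by
  obtain ⟨h1, h2, h3⟩ := hx.ne_zero
  have e1 : ellGamma ((z + x₁) / x₁) (x₂ / x₁) (x₃ / x₁) =
      ellGamma (z / x₁) (x₂ / x₁) (x₃ / x₁) := by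
    have := ellGamma_add_int (z / x₁) (x₂ / x₁) (x₃ / x₁) 1
    rw [← this, add_div, div_self h1, Int.cast_one]
  have e2 : ellGamma ((z + x₁) / x₂) (x₁ / x₂) (x₃ / x₂) =
      theta0 (z / x₂) (x₃ / x₂) * ellGamma (z / x₂) (x₁ / x₂) (x₃ / x₂) := by
    rw [add_div]
    refine ellGamma_add_tau hx.im12 (im_div_comm hx.im23) (theta0_ne_zero (im_div_comm hx.im23) ?_)
    intro i j h
    refine hz 0 i j ?_
    field_simp at h
    push_cast
    linear_combination h
  have e3 : ellGamma ((z + x₁) / x₃) (x₁ / x₃) (x₂ / x₃) =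
      theta0 (z / x₃) (x₂ / x₃) * ellGamma (z / x₃) (x₁ / x₃) (x₂ / x₃) := by
    rw [add_div]
    refine ellGamma_add_tau hx.im13 hx.im23 (theta0_ne_zero hx.im23 ?_)
    intro i j h
    refine hz 0 j i ?_
    field_simp at h
    push_cast
    linear_combination h
  have e4 := theta0_modular h2 h3 (im_div_comm hx.im23) (z := z) fun i j h =>
    hz 0 i j (by push_cast; linear_combination h)
  have e5 : bern₃ (z + x₁) x₁ x₂ x₃ = bern₃ z x₁ x₂ x₃ + 3 * bern₂ z x₂ x₃ := by
    simp only [bern₃, bern₂]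
    field_simp
    ring
  have e6 : Complex.exp (Real.pi * Complex.I / 3 * bern₃ (z + x₁) x₁ x₂ x₃) *
      Complex.exp (-(Real.pi * Complex.I * bern₂ z x₂ x₃)) =
      Complex.exp (Real.pi * Complex.I / 3 * bern₃ z x₁ x₂ x₃) := by
    rw [← Complex.exp_add, e5]
    congr 1
    ring
  simp only [gammaTriple]
  rw [e1, e2, e3, ← e6, ← e4]
  ring

end GenTriple

theorem gammaTriple_swap12 (x₁ x₂ x₃ z : ℂ) : gammaTriple x₂ x₁ x₃ z = gammaTriple x₁ x₂ x₃ z := by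
  simp only [gammaTriple]
  rw [ellGamma_symm (z / x₃) (x₂ / x₃)]
  ring

theorem gammaTriple_swap23 (x₁ x₂ x₃ z : ℂ) : gammaTriple x₁ x₃ x₂ z = gammaTriple x₁ x₂ x₃ z := by
  simp only [gammaTriple]
  rw [ellGamma_symm (z / x₁) (x₃ / x₁)]
  ring

theorem bern₃_swap12 (z x₁ x₂ x₃ : ℂ) : bern₃ z x₂ x₁ x₃ = bern₃ z x₁ x₂ x₃ := by
  simp only [bern₃]
  congr 1 <;> ring

theorem bern₃_swap23 (z x₁ x₂ x₃ : ℂ) : bern₃ z x₁ x₃ x₂ = bern₃ z x₁ x₂ x₃ := by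
  simp only [bern₃]
  congr 1 <;> ring

namespace GenTriple

variable {x₁ x₂ x₃ : ℂ} (hx : GenTriple x₁ x₂ x₃)

include hx

theorem gammaTriple_add_combination {z : ℂ} (hz : ∀ a b c : ℤ, z ≠ a * x₁ + b * x₂ + c * x₃)
    (a b c : ℤ) :
    gammaTriple x₁ x₂ x₃ (z + (a * x₁ + b * x₂ + c * x₃)) * Complex.exp (Real.pi * Complex.I / 3 *
        bern₃ (z + (a * x₁ + b * x₂ + c * x₃)) x₁ x₂ x₃) =
      gammaTriple x₁ x₂ x₃ z * Complex.exp (Real.pi * Complex.I / 3 * bern₃ z x₁ x₂ x₃) := by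
  set F : ℂ → ℂ := fun z => gammaTriple x₁ x₂ x₃ z *
    Complex.exp (Real.pi * Complex.I / 3 * bern₃ z x₁ x₂ x₃) with hF
  have hz' : ∀ i j k : ℤ, ∀ a b c : ℤ,
      z + (i * x₁ + j * x₂ + k * x₃) ≠ a * x₁ + b * x₂ + c * x₃ := fun i j k a b c h =>
    hz (a - i) (b - j) (c - k) (by push_cast; linear_combination h)
  have s1 : ∀ i j k : ℤ, F (z + ((i + 1 : ℤ) * x₁ + j * x₂ + k * x₃)) =
      F (z + (i * x₁ + j * x₂ + k * x₃)) := fun i j k => by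
    have := hx.gammaTriple_add (hz' i j k)
    rw [← hF] at *
    refine Eq.trans (congrArg F ?_) this
    push_cast
    ring
  have s2 : ∀ i j k : ℤ, F (z + (i * x₁ + (j + 1 : ℤ) * x₂ + k * x₃)) =
      F (z + (i * x₁ + j * x₂ + k * x₃)) := fun i j k => by
    have := hx.swap12.gammaTriple_add (z := z + (i * x₁ + j * x₂ + k * x₃))
      (fun a b c h => hz' i j k b a c (by rw [h]; ring))
    simp only [gammaTriple_swap12, bern₃_swap12] at this
    refine Eq.trans (congrArg F ?_) this
    push_cast
    ring
  have s3 : ∀ i j k : ℤ, F (z + (i * x₁ + j * x₂ + (k + 1 : ℤ) * x₃)) =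
      F (z + (i * x₁ + j * x₂ + k * x₃)) := fun i j k => by
    have := hx.swap23.swap12.gammaTriple_add (z := z + (i * x₁ + j * x₂ + k * x₃))
      (fun a b c h => hz' i j k b c a (by rw [h]; ring))
    simp only [gammaTriple_swap12 x₁, bern₃_swap12 _ x₁, gammaTriple_swap23, bern₃_swap23] at this
    refine Eq.trans (congrArg F ?_) this
    push_cast
    ring
  have t1 : ∀ j k i : ℤ, F (z + (i * x₁ + j * x₂ + k * x₃)) =
      F (z + ((0 : ℤ) * x₁ + j * x₂ + k * x₃)) := by
    intro j k i
    induction i using Int.induction_on with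
    | zero => rfl
    | succ i ih => rw [s1, ih]
    | pred i ih => rw [← ih, ← s1 (-(i : ℤ) - 1), sub_add_cancel]
  have t2 : ∀ k j : ℤ, F (z + ((0 : ℤ) * x₁ + j * x₂ + k * x₃)) =
      F (z + ((0 : ℤ) * x₁ + (0 : ℤ) * x₂ + k * x₃)) := by
    intro k j
    induction j using Int.induction_on with
    | zero => rfl
    | succ i ih => rw [s2, ih]
    | pred i ih => rw [← ih, ← s2 _ (-(i : ℤ) - 1), sub_add_cancel]
  have t3 : ∀ k : ℤ, F (z + ((0 : ℤ) * x₁ + (0 : ℤ) * x₂ + k * x₃)) =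
      F (z + ((0 : ℤ) * x₁ + (0 : ℤ) * x₂ + (0 : ℤ) * x₃)) := by
    intro k
    induction k using Int.induction_on with
    | zero => rfl
    | succ i ih => rw [s3, ih]
    | pred i ih => rw [← ih, ← s3 _ _ (-(i : ℤ) - 1), sub_add_cancel]
  have := (t1 b c a).trans ((t2 c b).trans (t3 c))
  refine this.trans (congrArg F ?_)
  push_cast
  ring

-- The function is invariant under translation by all integer combinations of the periods, and these
-- accumulate at 0. It is holomorphic outside a countable set, whose complement is connected, so the
-- identity theorem makes it constant.
open Filter Topology in
theorem gammaTriple_mul_exp {z : ℂ} (hz : ∀ a b c : ℤ, z ≠ a * x₁ + b * x₂ + c * x₃) :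
    gammaTriple x₁ x₂ x₃ z * Complex.exp (Real.pi * Complex.I / 3 * bern₃ z x₁ x₂ x₃) = 1 := by
  obtain ⟨h1, h2, h3⟩ := hx.ne_zero
  set F : ℂ → ℂ := fun z => gammaTriple x₁ x₂ x₃ z *
    Complex.exp (Real.pi * Complex.I / 3 * bern₃ z x₁ x₂ x₃) with hF
  set U : Set ℂ := {w | gammaTriple x₁ x₂ x₃ w ≠ 0} with hU
  have hgen : ∀ w, (∀ a b c : ℤ, w ≠ a * x₁ + b * x₂ + c * x₃) → w ∈ U := fun w hw =>
    mul_ne_zero (mul_ne_zero (hx.ellGamma_ne hw)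
      (hx.swap12.ellGamma_ne fun a b c h => hw b a c (by rw [h]; ring)))
      (hx.swap23.swap12.ellGamma_ne fun a b c h => hw b c a (by rw [h]; ring))
  have main : ∀ {a τ σ : ℂ} (w : ℂ), τ.im ≠ 0 → σ.im ≠ 0 → ellGamma (w / a) τ σ ≠ 0 →
      DifferentiableAt ℂ (fun w => ellGamma (w / a) τ σ) w := fun w hτ hσ h0 =>
    (differentiableAt_ellGamma hτ hσ h0).comp (f := fun w => (w / _, _, _)) w (by fun_prop)
  have hd : ∀ w ∈ U, DifferentiableAt ℂ (gammaTriple x₁ x₂ x₃) w := by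
    intro w hw
    refine ((main w (im_div_comm hx.im12) (im_div_comm hx.im13) ?_).mul
      (main w hx.im12 (im_div_comm hx.im23) ?_)).mul (main w hx.im13 hx.im23 ?_)
    · exact left_ne_zero_of_mul (left_ne_zero_of_mul hw)
    · exact right_ne_zero_of_mul (left_ne_zero_of_mul hw)
    · exact right_ne_zero_of_mul hw
  have hopen : IsOpen U := isOpen_iff_mem_nhds.2 fun w hw =>
    (hd w hw).continuousAt.eventually_ne hw
  have hdF : DifferentiableOn ℂ F U := fun w hw =>
    ((hd w hw).mul (by unfold bern₃; fun_prop)).differentiableWithinAt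
  have hcount : (Uᶜ).Countable := by
    refine (Set.countable_range fun m : ℤ × ℤ × ℤ =>
      (m.1 * x₁ + m.2.1 * x₂ + m.2.2 * x₃ : ℂ)).mono fun w hw => ?_
    by_contra hne
    exact hw (hgen w fun a b c h => hne ⟨(a, b, c), h.symm⟩)
  have hconn : IsPreconnected U := by
    have := (hcount.isConnected_compl_of_one_lt_rank (by simp)).isPreconnected
    rwa [compl_compl] at this
  have hfreq : ∃ᶠ w in 𝓝[≠] z, F w = F z := by
    rw [frequently_iff]
    intro V hV
    obtain ⟨ε, hε, hεV⟩ := Metric.mem_nhdsWithin_iff.1 hV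
    obtain ⟨a, b, c, hne, hlt⟩ := exists_small_combination hx.ind hε
    refine ⟨z + (a * x₁ + b * x₂ + c * x₃), hεV ⟨?_, ?_⟩, hx.gammaTriple_add_combination hz a b c⟩
    · simpa using hlt
    · simpa using hne
  have hconst := (hdF.analyticOnNhd hopen).eqOn_of_preconnected_of_frequently_eq
    (analyticOnNhd_const (v := F z)) hconn (hgen z hz) hfreq
  -- The centre of symmetry: `bern₃` vanishes here and each of the three gamma functions is at its
  -- half point.
  set w := (x₁ + x₂ + x₃) / 2 with hw
  have hwgen : ∀ a b c : ℤ, w ≠ a * x₁ + b * x₂ + c * x₃ := fun a b c h => by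
    have := (hx.ind (2 * a - 1) (2 * b - 1) (2 * c - 1)
      (by push_cast; linear_combination -2 * h + 2 * hw)).1
    omega
  have hwU := hgen w hwgen
  have hFw : F w = 1 := by
    have e : bern₃ w x₁ x₂ x₃ = 0 := by
      simp only [bern₃, hw]
      field_simp
      ring
    simp only [hF, gammaTriple]
    rw [e, mul_zero, Complex.exp_zero, mul_one,
      ellGamma_half (by rw [hw]; field_simp) (left_ne_zero_of_mul (left_ne_zero_of_mul hwU)),
      ellGamma_half (by rw [hw]; field_simp; ring) (right_ne_zero_of_mul (left_ne_zero_of_mul hwU)),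
      ellGamma_half (by rw [hw]; field_simp; ring) (right_ne_zero_of_mul hwU)]
    ring
  exact (hconst hwU).symm.trans hFw

/-- The modular property of the elliptic gamma function. -/
theorem ellGamma_modular {z : ℂ} (hz : ∀ a b c : ℤ, z ≠ a * x₁ + b * x₂ + c * x₃) :
    ellGamma (z / x₁) (x₂ / x₁) (x₃ / x₁) * ellGamma (z / x₂) (x₁ / x₂) (x₃ / x₂) *
      ellGamma (z / x₃) (x₁ / x₃) (x₂ / x₃) =
      Complex.exp (-(Real.pi * Complex.I / 3 * bern₃ z x₁ x₂ x₃)) := by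
  rw [Complex.exp_neg]
  exact eq_inv_of_mul_eq_one_left (hx.gammaTriple_mul_exp hz)

end GenTriple

end
end EllipticGamma

namespace EllipticGamma
noncomputable section

/-! ### Generic points -/

/-- The value of an integer linear form. -/
def form (m : Fin 3 → ℤ) (x : Fin 3 → ℂ) : ℂ := ∑ i, (m i : ℂ) * x i

/-- Two integer linear forms are linearly independent. -/
def Indep (l m : Fin 3 → ℤ) : Prop := ∀ a b : ℤ, (∀ i, a * l i + b * m i = 0) → a = 0 ∧ b = 0

/-- The points `(z, x)` with `z` not in the span of the `x_i` and such that no ratio of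
independent integer combinations of the `x_i` is real. -/
structure Gen (p : X) : Prop where
  z_ne : ∀ m : Fin 3 → ℤ, p.1 ≠ form m p.2
  im_ne : ∀ l m : Fin 3 → ℤ, Indep l m → (form l p.2 / form m p.2).im ≠ 0

theorem Indep.exists_det {l m : Fin 3 → ℤ} (h : Indep l m) :
    ∃ i j, l i * m j - l j * m i ≠ 0 := by
  by_contra! hne
  by_cases hl : ∃ i, l i ≠ 0
  · obtain ⟨i, hi⟩ := hl
    exact hi (by simpa using (h (m i) (-l i) fun j => by linear_combination -(hne i j)).2)
  · push Not at hl
    exact one_ne_zero (h 1 0 fun i => by rw [hl i]; ring).1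

theorem form_smul (g : G) (m : Fin 3 → ℤ) (x : Fin 3 → ℂ) :
    form m (fun i => ∑ j, ((g.A.1 i j : ℤ) : ℂ) * x j) = form (Matrix.vecMul m g.A.1) x := by
  simp only [form, Fin.sum_univ_three, Matrix.vecMul, dotProduct]
  push_cast
  ring

theorem Indep.vecMul {l m : Fin 3 → ℤ} (h : Indep l m) (A : SL3Z) :
    Indep (Matrix.vecMul l A.1) (Matrix.vecMul m A.1) := by
  intro a b hab
  refine h a b fun i => ?_
  have h1 : Matrix.vecMul (a • l + b • m) A.1 = 0 := by
    rw [Matrix.add_vecMul, Matrix.smul_vecMul, Matrix.smul_vecMul]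
    funext i
    simpa using hab i
  have h2 : a • l + b • m = 0 := by
    have h3 := congrArg (fun v => Matrix.vecMul v (A⁻¹).1) h1
    simp only [Matrix.vecMul_vecMul, Matrix.zero_vecMul] at h3
    rwa [← Matrix.SpecialLinearGroup.coe_mul, mul_inv_cancel, Matrix.SpecialLinearGroup.coe_one,
      Matrix.vecMul_one] at h3
  simpa using congrFun h2 i

theorem Gen.smul {p : X} (hp : Gen p) (g : G) : Gen (g • p) := by
  constructor
  · intro m h
    refine hp.z_ne (Matrix.vecMul m g.A.1 - g.n) ?_
    rw [G.smul_def] at h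
    simp only [form_smul] at h
    have : form (Matrix.vecMul m g.A.1 - g.n) p.2 =
        form (Matrix.vecMul m g.A.1) p.2 - ∑ i, (g.n i : ℂ) * p.2 i := by
      simp [form, sub_mul]
    rw [this, ← h]
    ring
  · intro l m h
    rw [G.smul_def]
    simp only [form_smul]
    exact hp.im_ne _ _ (h.vecMul g.A)

theorem form_scale (c : ℂ) (m : Fin 3 → ℤ) (x : Fin 3 → ℂ) : form m (c • x) = c * form m x := by
  simp only [form, Finset.mul_sum, Pi.smul_apply, smul_eq_mul]
  exact Finset.sum_congr rfl fun i _ => by ring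

theorem Gen.scale {p : X} (hp : Gen p) (c : ℂˣ) : Gen (c • p) := by
  have h2 : (c • p).2 = (c : ℂ) • p.2 := rfl
  have h1 : (c • p).1 = (c : ℂ) * p.1 := rfl
  constructor
  · intro m h
    rw [h1, h2, form_scale] at h
    exact hp.z_ne m (mul_left_cancel₀ c.ne_zero h)
  · intro l m h
    rw [h2, form_scale, form_scale, mul_div_mul_left _ _ c.ne_zero]
    exact hp.im_ne l m h

theorem continuous_form (m : Fin 3 → ℤ) : Continuous (form m) := by
  unfold form
  fun_prop

open Filter Topology in
theorem dense_ne_form (m : Fin 3 → ℤ) : Dense {p : X | p.1 ≠ form m p.2} := by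
  intro p
  rw [Metric.mem_closure_iff]
  intro ε hε
  by_cases h : p.1 = form m p.2
  · refine ⟨(p.1 + (ε / 2 : ℝ), p.2), ?_, ?_⟩
    · simp only [Set.mem_ofPred_eq, ← h]
      simpa using hε.ne'
    · rw [Prod.dist_eq]
      simp only [dist_self, dist_self_add_right, Complex.norm_real, Real.norm_eq_abs]
      rw [abs_of_pos (by positivity)]
      simp [hε]
  · exact ⟨p, h, by simpa using hε⟩

theorem im_div_ne_zero_iff {a b : ℂ} :
    (a / b).im ≠ 0 ↔ (a * (starRingEnd ℂ) b).im ≠ 0 := by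
  rcases eq_or_ne b 0 with rfl | hb
  · simp
  · have : a / b = a * (starRingEnd ℂ) b * ((Complex.normSq b)⁻¹ : ℝ) := by
      rw [div_eq_mul_inv, Complex.inv_def, mul_assoc]
    rw [this, Complex.im_mul_ofReal]
    have : (Complex.normSq b)⁻¹ ≠ 0 := inv_ne_zero (Complex.normSq_pos.2 hb).ne'
    simp [this]

theorem isOpen_im_form_ne_zero (l m : Fin 3 → ℤ) :
    IsOpen {p : X | (form l p.2 / form m p.2).im ≠ 0} := by
  simp only [im_div_ne_zero_iff]
  refine isOpen_ne_fun ?_ continuous_const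
  have h1 := continuous_form l
  have h2 := continuous_form m
  exact Complex.continuous_im.comp ((h1.comp continuous_snd).mul
    (Complex.continuous_conj.comp (h2.comp continuous_snd)))

/-- On a real line in direction `v` with `l(v) = iD` and `m(v) = D`, the imaginary part of `l` times
the conjugate of `m` is a quadratic polynomial in `t` with leading coefficient `D²`. It cannot
vanish at the three points `0, δ, -δ`. -/
theorem dense_im_form_ne_zero {l m : Fin 3 → ℤ} (h : Indep l m) :
    Dense {p : X | (form l p.2 / form m p.2).im ≠ 0} := by
  obtain ⟨i, j, hD⟩ := h.exists_det
  have hij : i ≠ j := fun hij => hD (by rw [hij]; ring)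
  -- The solution by Cramer's rule in the coordinates `i`, `j` of a non-zero minor `D`, scaled by
  -- `D`.
  set v : Fin 3 → ℂ := Pi.single i (Complex.I * m j - l j) + Pi.single j (l i - Complex.I * m i)
    with hv
  set D : ℤ := l i * m j - l j * m i
  have hform : ∀ k : Fin 3 → ℤ, form k v =
      k i * (Complex.I * m j - l j) + k j * (l i - Complex.I * m i) := by
    intro k
    simp only [form, hv, Pi.add_apply, mul_add, Finset.sum_add_distrib]
    simp [Pi.single_apply]
  have hl : form l v = D * Complex.I := by
    rw [hform]
    simp only [D]
    push_cast
    ring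
  have hm : form m v = D := by
    rw [hform]
    simp only [D]
    push_cast
    ring
  have hadd : ∀ (k : Fin 3 → ℤ) (x : Fin 3 → ℂ) (t : ℝ),
      form k (x + (t : ℂ) • v) = form k x + t * form k v := by
    intro k x t
    rw [← form_scale]
    simp [form, mul_add, Finset.sum_add_distrib]
  intro p
  rw [Metric.mem_closure_iff]
  intro ε hε
  set δ : ℝ := ε / (2 * (‖v‖ + 1)) with hδ
  have hδ0 : 0 < δ := by positivity
  have hdist : ∀ t : ℝ, |t| ≤ δ → dist p (p.1, p.2 + (t : ℂ) • v) < ε := by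
    intro t ht
    rw [Prod.dist_eq]
    simp only [dist_self, dist_self_add_right, norm_smul, Complex.norm_real, Real.norm_eq_abs]
    refine max_lt hε ?_
    calc |t| * ‖v‖ ≤ δ * ‖v‖ := by gcongr
      _ < δ * (2 * (‖v‖ + 1)) := by
          refine mul_lt_mul_of_pos_left ?_ hδ0
          linarith [norm_nonneg v]
      _ = ε := by rw [hδ]; field_simp
  by_contra! hne
  have key : ∀ t : ℝ, |t| ≤ δ → ((form l p.2 + t * (D * Complex.I)) *
      (starRingEnd ℂ) (form m p.2 + t * D)).im = 0 := by
    intro t ht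
    by_contra h0
    refine absurd (hdist t ht) (not_lt.2 (hne (p.1, p.2 + (t : ℂ) • v) ?_))
    rw [Set.mem_ofPred_eq, im_div_ne_zero_iff, hadd, hadd, hl, hm]
    exact h0
  have k0 := key 0 (by simpa using hδ0.le)
  have k1 := key δ (abs_of_pos hδ0).le
  have k2 := key (-δ) (by rw [abs_neg]; exact (abs_of_pos hδ0).le)
  simp only [map_add, map_mul, Complex.conj_ofReal, map_intCast, Complex.mul_im, Complex.add_im,
    Complex.add_re, Complex.mul_re, Complex.ofReal_re, Complex.ofReal_im, Complex.intCast_re,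
    Complex.intCast_im, Complex.I_re, Complex.I_im, Complex.conj_re, Complex.conj_im] at k0 k1 k2
  have hD' : (D : ℝ) ≠ 0 := by exact_mod_cast hD
  have : δ ^ 2 * (D : ℝ) ^ 2 = 0 := by linear_combination (k1 + k2) / 2 - k0
  exact (mul_ne_zero (pow_ne_zero 2 hδ0.ne') (pow_ne_zero 2 hD')) this

/-- Countably many dense open conditions; Baire's theorem applies. The set itself need not be open.
-/
theorem dense_gen : Dense {p : X | Gen p} := by
  have h1 : Dense (⋂ m : Fin 3 → ℤ, {p : X | p.1 ≠ form m p.2}) :=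
    dense_iInter_of_isOpen (fun m => isOpen_ne_fun continuous_fst
      ((continuous_form m).comp continuous_snd)) dense_ne_form
  have h2 : Dense (⋂ k : {k : (Fin 3 → ℤ) × (Fin 3 → ℤ) // Indep k.1 k.2},
      {p : X | (form k.1.1 p.2 / form k.1.2 p.2).im ≠ 0}) :=
    dense_iInter_of_isOpen (fun k => isOpen_im_form_ne_zero _ _) fun k => dense_im_form_ne_zero k.2
  have g1 : IsGδ (⋂ m : Fin 3 → ℤ, {p : X | p.1 ≠ form m p.2}) :=
    .iInter_of_isOpen fun m => isOpen_ne_fun continuous_fst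
      ((continuous_form m).comp continuous_snd)
  have g2 : IsGδ (⋂ k : {k : (Fin 3 → ℤ) × (Fin 3 → ℤ) // Indep k.1 k.2},
      {p : X | (form k.1.1 p.2 / form k.1.2 p.2).im ≠ 0}) :=
    .iInter_of_isOpen fun k => isOpen_im_form_ne_zero _ _
  refine (h1.inter_of_Gδ g1 g2 h2).mono fun p hp => ⟨fun m => ?_, fun l m h => ?_⟩
  · exact Set.mem_iInter.1 hp.1 m
  · exact Set.mem_iInter.1 hp.2 ⟨(l, m), h⟩

/-! ### Invertible analytic functions given by formulas at generic points -/

/-- `n` is given by `F` at generic points. -/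
def Rep (n : InvFun) (F : X → ℂ) : Prop :=
  ∃ r : InvPair, InvFun.mk r = n ∧ ∀ p ∈ r.D, Gen p → r.f p = F p

theorem Represents.rep {n : InvFun} {F : X → ℂ} (h : Represents n F) : Rep n F := by
  obtain ⟨r, hr, hF⟩ := h
  exact ⟨r, hr, fun p hp _ => hF hp⟩

open Filter Topology in
theorem InvPair.eqOn_of_dense {r s : InvPair} {S : Set X} (hS : Dense S)
    (h : ∀ p ∈ r.D, p ∈ s.D → p ∈ S → r.f p = s.f p) : Set.EqOn r.f s.f (r.D ∩ s.D) := by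
  intro p hp
  have hU : IsOpen (r.D ∩ s.D) := r.isOpen.inter s.isOpen
  have hr : ContinuousAt r.f p := (r.holo.differentiableAt (r.isOpen.mem_nhds hp.1)).continuousAt
  have hs : ContinuousAt s.f p := (s.holo.differentiableAt (s.isOpen.mem_nhds hp.2)).continuousAt
  have hcl : p ∈ closure (r.D ∩ s.D ∩ S) := hS.open_subset_closure_inter hU hp
  have : (𝓝[r.D ∩ s.D ∩ S] p).NeBot := mem_closure_iff_nhdsWithin_neBot.1 hcl
  refine tendsto_nhds_unique (l := 𝓝[r.D ∩ s.D ∩ S] p) (hr.tendsto.mono_left nhdsWithin_le_nhds)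
    ((hs.tendsto.mono_left nhdsWithin_le_nhds).congr' ?_)
  filter_upwards [self_mem_nhdsWithin] with w hw
  exact (h w hw.1.1 hw.1.2 hw.2).symm

/-- The reason why all functional equations are needed at generic points only: density of these
points and continuity on the domains give equality of classes. -/
theorem Rep.eq {n m : InvFun} {F K : X → ℂ} (hn : Rep n F) (hm : Rep m K)
    (h : ∀ p, Gen p → F p = K p) : n = m := by
  obtain ⟨r, rfl, hr⟩ := hn
  obtain ⟨s, rfl, hs⟩ := hm
  exact InvFun.mk_eq.2 (InvPair.eqOn_of_dense dense_gen fun p h1 h2 h3 => by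
    rw [hr p h1 h3, hs p h2 h3, h p h3])

theorem Rep.eqOn {n : InvFun} {F K : X → ℂ} (hn : Rep n F) (h : ∀ p, Gen p → F p = K p) :
    Rep n K := by
  obtain ⟨r, hr, hF⟩ := hn
  exact ⟨r, hr, fun p hp hg => (hF p hp hg).trans (h p hg)⟩

theorem Rep.one : Rep 1 fun _ => 1 := ⟨InvPair.one, rfl, fun _ _ _ => rfl⟩

theorem Rep.mul {n m : InvFun} {F K : X → ℂ} (hn : Rep n F) (hm : Rep m K) :
    Rep (n * m) fun p => F p * K p := by
  obtain ⟨r, rfl, hr⟩ := hn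
  obtain ⟨s, rfl, hs⟩ := hm
  exact ⟨r.mul s, rfl, fun p hp hg => congrArg₂ (· * ·) (hr p hp.1 hg) (hs p hp.2 hg)⟩

theorem Rep.smul {n : InvFun} {F : X → ℂ} (hn : Rep n F) (g : G) :
    Rep (g • n) fun p => F (g⁻¹ • p) := by
  obtain ⟨r, rfl, hr⟩ := hn
  exact ⟨r.act g, rfl, fun p hp hg => hr _ hp (hg.smul g⁻¹)⟩

theorem Rep.scale {n : InvFun} {F : X → ℂ} (hn : Rep n F) (c : ℂˣ) :
    Rep (c • n) fun p => F (c⁻¹ • p) := by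
  obtain ⟨r, rfl, hr⟩ := hn
  exact ⟨r.act c, rfl, fun p hp hg => hr _ hp (hg.scale c⁻¹)⟩

/-- The domain is the part of `P` where `F` is non-zero. It is open because `F` is continuous at its
points, and dense because it contains the generic points; zeros and default values at poles are
removed together. -/
theorem exists_represents {F : X → ℂ} {P : Set X} (hP : IsOpen P) (hS : ∀ p, Gen p → p ∈ P)
    (hd : ∀ p ∈ P, F p ≠ 0 → DifferentiableAt ℂ F p) (h0 : ∀ p, Gen p → F p ≠ 0)
    (hsc : ∀ (c : ℂˣ) (p : X), F (c • p) = F p) : ∃ n : N, Represents n F := by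
  have hopen : IsOpen {p | p ∈ P ∧ F p ≠ 0} := by
    refine isOpen_iff_mem_nhds.2 fun p hp => ?_
    filter_upwards [hP.mem_nhds hp.1, (hd p hp.1 hp.2).continuousAt.eventually_ne hp.2] with q h1 h2
    exact ⟨h1, h2⟩
  let r : InvPair := ⟨F, {p | p ∈ P ∧ F p ≠ 0}, hopen,
    dense_gen.mono fun p hp => ⟨hS p hp, h0 p hp⟩,
    fun p hp => (hd p hp.1 hp.2).differentiableWithinAt, fun p hp => hp.2⟩
  have hr : Rep (InvFun.mk r) F := ⟨r, rfl, fun _ _ _ => rfl⟩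
  refine ⟨⟨InvFun.mk r, fun c => (hr.scale c).eq hr fun p _ => hsc _ _⟩, r, rfl, fun _ _ => rfl⟩

end
end EllipticGamma

namespace EllipticGamma
noncomputable section

/-! ### Phases -/

/-- `f` is given by a homogeneous rational polynomial of degree `d` in `z` and the `x_i`. -/
def HomP (d : ℕ) (f : X → ℂ) : Prop :=
  ∃ P : MvPolynomial (Option (Fin 3)) ℚ, P.IsHomogeneous d ∧
    ∀ p, f p = MvPolynomial.aeval (coord p) P

/-- `f` is given by a homogeneous rational polynomial of degree `d` in the `x_i`. -/
def HomQ (d : ℕ) (f : X → ℂ) : Prop :=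
  ∃ Q : MvPolynomial (Fin 3) ℚ, Q.IsHomogeneous d ∧ ∀ p, f p = MvPolynomial.aeval p.2 Q

namespace HomP

theorem z : HomP 1 fun p => p.1 :=
  ⟨.X none, MvPolynomial.isHomogeneous_X _ _, fun p => by simp [coord]⟩

theorem x (i : Fin 3) : HomP 1 fun p => p.2 i :=
  ⟨.X (some i), MvPolynomial.isHomogeneous_X _ _, fun p => by simp [coord]⟩

theorem add {d : ℕ} {f g : X → ℂ} : HomP d f → HomP d g → HomP d fun p => f p + g p := by
  rintro ⟨P, hP, h⟩ ⟨Q, hQ, k⟩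
  exact ⟨P + Q, hP.add hQ, fun p => by simp only [h, k, map_add]⟩

theorem neg {d : ℕ} {f : X → ℂ} : HomP d f → HomP d fun p => -f p := by
  rintro ⟨P, hP, h⟩
  exact ⟨-P, hP.neg, fun p => by simp only [h, map_neg]⟩

theorem sub {d : ℕ} {f g : X → ℂ} : HomP d f → HomP d g → HomP d fun p => f p - g p := by
  rintro ⟨P, hP, h⟩ ⟨Q, hQ, k⟩
  exact ⟨P - Q, hP.sub hQ, fun p => by simp only [h, k, map_sub]⟩

theorem mul {d e : ℕ} {f g : X → ℂ} : HomP d f → HomP e g → HomP (d + e) fun p => f p * g p := by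
  rintro ⟨P, hP, h⟩ ⟨Q, hQ, k⟩
  exact ⟨P * Q, hP.mul hQ, fun p => by simp only [h, k, map_mul]⟩

theorem const_mul {d : ℕ} {f : X → ℂ} (c : ℚ) : HomP d f → HomP d fun p => c * f p := by
  rintro ⟨P, hP, h⟩
  refine ⟨.C c * P, ?_, fun p => by simp [h]⟩
  simpa using (MvPolynomial.isHomogeneous_C _ c).mul hP

theorem num_mul {d : ℕ} {f : X → ℂ} (n : ℕ) [n.AtLeastTwo] (h : HomP d f) :
    HomP d fun p => (OfNat.ofNat n : ℂ) * f p := by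
  simpa using h.const_mul (OfNat.ofNat n : ℚ)

theorem sq {f : X → ℂ} (h : HomP 1 f) : HomP 2 fun p => f p ^ 2 := by
  simpa only [pow_two] using h.mul h

theorem mul11 {f g : X → ℂ} (h : HomP 1 f) (k : HomP 1 g) : HomP 2 fun p => f p * g p := h.mul k

theorem mul12 {f g : X → ℂ} (h : HomP 1 f) (k : HomP 2 g) : HomP 3 fun p => f p * g p := h.mul k

theorem mul22 {f g : X → ℂ} (h : HomP 2 f) (k : HomP 2 g) : HomP 4 fun p => f p * g p := h.mul k

end HomP

namespace HomQ

theorem x (i : Fin 3) : HomQ 1 fun p => p.2 i :=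
  ⟨.X i, MvPolynomial.isHomogeneous_X _ _, fun p => by simp⟩

theorem sub {d : ℕ} {f g : X → ℂ} : HomQ d f → HomQ d g → HomQ d fun p => f p - g p := by
  rintro ⟨P, hP, h⟩ ⟨Q, hQ, k⟩
  exact ⟨P - Q, hP.sub hQ, fun p => by simp only [h, k, map_sub]⟩

theorem mul {d e : ℕ} {f g : X → ℂ} : HomQ d f → HomQ e g → HomQ (d + e) fun p => f p * g p := by
  rintro ⟨P, hP, h⟩ ⟨Q, hQ, k⟩
  exact ⟨P * Q, hP.mul hQ, fun p => by simp only [h, k, map_mul]⟩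

theorem num_mul {d : ℕ} {f : X → ℂ} (n : ℕ) [n.AtLeastTwo] :
    HomQ d f → HomQ d fun p => (OfNat.ofNat n : ℂ) * f p := by
  rintro ⟨P, hP, h⟩
  refine ⟨.C (OfNat.ofNat n : ℚ) * P, ?_, fun p => by simp [h]⟩
  simpa using (MvPolynomial.isHomogeneous_C _ (OfNat.ofNat n : ℚ)).mul hP

theorem mul11 {f g : X → ℂ} (h : HomQ 1 f) (k : HomQ 1 g) : HomQ 2 fun p => f p * g p := h.mul k

theorem mul21 {f g : X → ℂ} (h : HomQ 2 f) (k : HomQ 1 g) : HomQ 3 fun p => f p * g p := h.mul k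

theorem mul31 {f g : X → ℂ} (h : HomQ 3 f) (k : HomQ 1 g) : HomQ 4 fun p => f p * g p := h.mul k

end HomQ

theorem differentiable_aeval {σ : Type} [Fintype σ] (R : MvPolynomial σ ℚ) :
    Differentiable ℂ fun v : σ → ℂ => MvPolynomial.aeval v R := by
  induction R using MvPolynomial.induction_on with
  | C a => simp
  | add p q hp hq =>
    simp only [map_add]
    exact hp.add hq
  | mul_X p i hp =>
    simp only [map_mul, MvPolynomial.aeval_X]
    exact hp.mul (by fun_prop)

theorem differentiable_coord : Differentiable ℂ coord := by
  refine differentiable_pi.2 fun o => ?_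
  cases o with
  | none => exact differentiable_fst
  | some i =>
    change Differentiable ℂ fun p : X => p.2 i
    fun_prop

/-- Homogeneity of equal degrees gives invariance under scaling, and the points with `g ≠ 0` form a
dense open set. The phases have to be exhibited because a relation of `E` is imposed only for an
element of `M` that represents the given formula. -/
theorem exists_phase {d : ℕ} {f g : X → ℂ} (hf : HomP d f) (hg : HomQ d g)
    (h0 : ∀ p, Gen p → g p ≠ 0) : ∃ φ : M, IsPhase φ fun p => f p / g p := by
  -- Phases are `exp(πi L)`, while `M` consists of exponentials `exp(2πi f)`.
  obtain ⟨P, hP, hfP⟩ := hf.const_mul (1 / 2)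
  obtain ⟨Q, hQ, hgQ⟩ := hg
  have hQ0 : Q ≠ 0 := by
    rintro rfl
    obtain ⟨p, hp⟩ := dense_gen.nonempty
    exact h0 p hp (by rw [hgQ, map_zero])
  have hdg : Differentiable ℂ g := by
    rw [funext hgQ]
    exact (differentiable_aeval Q).comp differentiable_snd
  have hdP := (differentiable_aeval P).comp differentiable_coord
  have hsc : ∀ (c : ℂˣ) (p : X), MvPolynomial.aeval (coord (c • p)) P / g (c • p) =
      MvPolynomial.aeval (coord p) P / g p := by
    intro c p
    have e1 : coord (c • p) = fun o => (c : ℂ) * coord p o := by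
      funext o
      cases o <;> rfl
    have e2 : (c • p).2 = fun i => (c : ℂ) * p.2 i := rfl
    rw [hgQ, hgQ, e1, e2]
    have hs : ∀ {σ : Type} (R : MvPolynomial σ ℚ), R.IsHomogeneous d → ∀ v : σ → ℂ,
        MvPolynomial.aeval (fun o => (c : ℂ) * v o) R = (c : ℂ) ^ d * MvPolynomial.aeval v R := by
      intro σ R hR v
      rw [MvPolynomial.aeval_def, MvPolynomial.aeval_def, MvPolynomial.eval₂_eq,
        MvPolynomial.eval₂_eq, Finset.mul_sum]
      refine Finset.sum_congr rfl fun m hm => ?_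
      have hd := hR (MvPolynomial.mem_support_iff.1 hm)
      have : ∏ i ∈ m.support, ((c : ℂ) * v i) ^ m i =
          (c : ℂ) ^ d * ∏ i ∈ m.support, v i ^ m i := by
        simp only [mul_pow, Finset.prod_mul_distrib, Finset.prod_pow_eq_pow_sum]
        congr 2
        rw [← hd, Finsupp.weight_apply, Finsupp.sum]
        simp
      rw [this]
      ring
    rw [hs _ hP, hs _ hQ, mul_div_mul_left _ _ (pow_ne_zero _ c.ne_zero)]
  have hopen : IsOpen {p | g p ≠ 0} := isOpen_ne_fun hdg.continuous continuous_const
  have hF : ∀ p, Complex.exp (Real.pi * Complex.I * (f p / g p)) =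
      cexp2 (MvPolynomial.aeval (coord p) P / g p) := by
    intro p
    rw [cexp2, ← hfP]
    congr 1
    push_cast
    ring
  let r : InvPair := ⟨fun p => cexp2 (MvPolynomial.aeval (coord p) P / g p), {p | g p ≠ 0}, hopen,
    dense_gen.mono h0, fun p hp => ((differentiable_cexp2 _).comp p
      (differentiableAt_div (hdP p) (hdg p) hp)).differentiableWithinAt, fun p _ => cexp2_ne_zero _⟩
  have hr : Rep (InvFun.mk r) fun p => cexp2 (MvPolynomial.aeval (coord p) P / g p) :=
    ⟨r, rfl, fun _ _ _ => rfl⟩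
  refine ⟨⟨⟨InvFun.mk r, fun c => (hr.scale c).eq hr fun p _ => congrArg cexp2 (hsc _ _)⟩,
    P, Q, d, r, hP, hQ, hQ0, rfl, fun p hp => ?_⟩, r, rfl, fun p _ => (hF p).symm⟩
  rw [← hgQ]
  exact ⟨hp, rfl⟩

theorem isPhase_one : IsPhase 1 fun _ => 0 :=
  ⟨InvPair.one, rfl, fun _ _ => by simp [InvPair.one]⟩

theorem IsPhase.rep {φ : M} {L : X → ℂ} (h : IsPhase φ L) :
    Rep (φ : N) fun p => Complex.exp (Real.pi * Complex.I * L p) := Represents.rep h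

theorem Gen.form_ne {p : X} (hp : Gen p) {m : Fin 3 → ℤ} (hm : m ≠ 0) : form m p.2 ≠ 0 := by
  obtain ⟨i, hi⟩ : ∃ i, m i ≠ 0 := by
    by_contra! h
    exact hm (funext h)
  intro h0
  obtain ⟨j, hj⟩ : ∃ j : Fin 3, j ≠ i := exists_ne i
  refine hp.im_ne (Pi.single j 1) m (fun a b h => ?_) (by rw [h0, div_zero, Complex.zero_im])
  have h1 := h i
  rw [Pi.single_eq_of_ne hj.symm, mul_zero, zero_add] at h1
  have hb : b = 0 := (mul_eq_zero.1 h1).resolve_right hi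
  have h2 := h j
  rw [hb, Pi.single_eq_same] at h2
  exact ⟨by simpa using h2, hb⟩

theorem Gen.x_ne {p : X} (hp : Gen p) (i : Fin 3) : p.2 i ≠ 0 := by
  have := hp.form_ne (m := Pi.single i 1) (by simp)
  simpa [form, Pi.single_apply] using this

theorem Gen.sub_ne {p : X} (hp : Gen p) {i j : Fin 3} (h : i ≠ j) : p.2 i - p.2 j ≠ 0 := by
  have := hp.form_ne (m := Pi.single i 1 - Pi.single j 1) fun h0 => by
    have := congrFun h0 i
    simp [h] at this
  simpa [form, Pi.single_apply, sub_mul, Finset.sum_sub_distrib] using this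

theorem exists_phase_L1232 : ∃ φ : M, IsPhase φ fun p => L1232 p.1 (p.2 0) (p.2 1) (p.2 2) := by
  refine exists_phase (d := 4)
    (f := fun p => p.2 1 * (2 * p.1 - p.2 1) *
      (2 * p.1 ^ 2 - 2 * p.1 * p.2 1 + p.2 1 * p.2 2 - p.2 2 ^ 2 - p.2 0 ^ 2 + p.2 1 * p.2 0))
    (g := fun p => 12 * p.2 0 * (p.2 1 - p.2 0) * p.2 2 * (p.2 1 - p.2 2)) ?_ ?_ fun p hp => ?_
  · solve_by_elim (maxDepth := 200) [HomP.z, HomP.x, HomP.add, HomP.sub, HomP.num_mul, HomP.sq,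
      HomP.mul11, HomP.mul12, HomP.mul22]
  · solve_by_elim (maxDepth := 200) [HomQ.x, HomQ.sub, HomQ.num_mul, HomQ.mul11, HomQ.mul21,
      HomQ.mul31]
  · simp [hp.x_ne, hp.sub_ne]

theorem IsPhase.inv {φ : M} {L : X → ℂ} (h : IsPhase φ L) : IsPhase φ⁻¹ fun p => -L p := by
  obtain ⟨r, hr, hL⟩ := h
  refine ⟨r.inv, ?_, fun p hp => ?_⟩
  · rw [← InvFun.mk_inv, hr]
    rfl
  · change (r.f p)⁻¹ = _
    rw [hL hp, ← Complex.exp_neg, ← mul_neg]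

theorem exists_phase_Lee (i j k l : Fin 3) : ∃ φ : M, IsPhase φ (Lee i j k l) := by
  unfold Lee
  split_ifs
  · refine exists_phase (d := 3)
      (f := fun p => (2 * p.1 - p.2 1) * (2 * p.1 ^ 2 - 2 * p.1 * p.2 1 - p.2 0 ^ 2 + p.2 0 * p.2 2
        - p.2 2 ^ 2 + p.2 1 * p.2 0))
      (g := fun p => 12 * (p.2 2 - p.2 0) * p.2 2 * (p.2 1 - p.2 0)) ?_ ?_ fun p hp => ?_
    · solve_by_elim (maxDepth := 200) [HomP.z, HomP.x, HomP.add, HomP.sub, HomP.num_mul, HomP.sq,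
        HomP.mul11, HomP.mul12]
    · solve_by_elim (maxDepth := 200) [HomQ.x, HomQ.sub, HomQ.num_mul, HomQ.mul11, HomQ.mul21]
    · simp [hp.x_ne, hp.sub_ne]
  · refine exists_phase (d := 3)
      (f := fun p => (2 * p.1 - p.2 1) * (2 * p.1 ^ 2 - 2 * p.1 * p.2 1 + p.2 1 * p.2 2 - p.2 0 ^ 2
        + p.2 0 * p.2 2 - p.2 2 ^ 2))
      (g := fun p => 12 * p.2 0 * (p.2 1 - p.2 2) * (p.2 2 - p.2 0)) ?_ ?_ fun p hp => ?_
    · solve_by_elim (maxDepth := 200) [HomP.z, HomP.x, HomP.add, HomP.sub, HomP.num_mul, HomP.sq,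
        HomP.mul11, HomP.mul12]
    · solve_by_elim (maxDepth := 200) [HomQ.x, HomQ.sub, HomQ.num_mul, HomQ.mul11, HomQ.mul21]
    · simp [hp.x_ne, hp.sub_ne]
  · exact exists_phase_L1232
  · obtain ⟨φ, hφ⟩ := exists_phase_L1232
    exact ⟨φ⁻¹, hφ.inv⟩
  · exact ⟨1, isPhase_one⟩

theorem exists_phase_Let (i j k : Fin 3) : ∃ φ : M, IsPhase φ (Let i j k) := by
  unfold Let
  split_ifs
  · refine exists_phase (d := 3)
      (f := fun p => p.2 1 * (6 * p.1 ^ 2 - 6 * (p.2 2 + 2 * p.2 1) * p.1 + p.2 1 * p.2 0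
        - p.2 0 ^ 2 + 6 * p.2 1 ^ 2 + 6 * p.2 1 * p.2 2 + p.2 2 ^ 2))
      (g := fun p => 6 * p.2 2 * p.2 0 * (p.2 1 - p.2 0)) ?_ ?_ fun p hp => ?_
    · solve_by_elim (maxDepth := 200) [HomP.z, HomP.x, HomP.add, HomP.sub, HomP.num_mul, HomP.sq,
        HomP.mul11, HomP.mul12]
    · solve_by_elim (maxDepth := 200) [HomQ.x, HomQ.sub, HomQ.num_mul, HomQ.mul11, HomQ.mul21]
    · simp [hp.x_ne, hp.sub_ne]
  · refine exists_phase (d := 2)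
      (f := fun p => (-6) * p.1 ^ 2 + 6 * (p.2 0 + p.2 2 + 2 * p.2 1) * p.1 - p.2 2 ^ 2
        - 6 * p.2 1 * p.2 0 - 3 * p.2 0 * p.2 2 - 6 * p.2 1 * p.2 2 - 6 * p.2 1 ^ 2 - p.2 0 ^ 2)
      (g := fun p => 6 * p.2 0 * p.2 2) ?_ ?_ fun p hp => ?_
    · simp only [neg_mul]
      solve_by_elim (maxDepth := 200) [HomP.z, HomP.x, HomP.add, HomP.sub, HomP.neg, HomP.num_mul,
        HomP.sq, HomP.mul11]
    · solve_by_elim (maxDepth := 200) [HomQ.x, HomQ.sub, HomQ.num_mul, HomQ.mul11]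
    · simp [hp.x_ne]
  · refine exists_phase (d := 2)
      (f := fun p => 6 * p.1 ^ 2 - 6 * (p.2 2 + 2 * p.2 1) * p.1 + 6 * p.2 1 * p.2 2 - p.2 0 ^ 2
        + 6 * p.2 1 ^ 2 + p.2 2 ^ 2 + p.2 0 * p.2 2)
      (g := fun p => 6 * (p.2 2 - p.2 0) * p.2 0) ?_ ?_ fun p hp => ?_
    · solve_by_elim (maxDepth := 200) [HomP.z, HomP.x, HomP.add, HomP.sub, HomP.num_mul, HomP.sq,
        HomP.mul11]
    · solve_by_elim (maxDepth := 200) [HomQ.x, HomQ.sub, HomQ.num_mul, HomQ.mul11]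
    · simp [hp.x_ne, hp.sub_ne]
  · exact ⟨1, isPhase_one⟩

theorem exists_phase_Ltt (i j : Fin 3) : ∃ φ : M, IsPhase φ (Ltt i j) := by
  have h : ∃ φ : M, IsPhase φ fun p =>
      (2 * p.1 - 2 * p.2 1 - 2 * p.2 2 + p.2 0) / p.2 0 := by
    refine exists_phase (d := 1) (f := fun p => 2 * p.1 - 2 * p.2 1 - 2 * p.2 2 + p.2 0)
      (g := fun p => p.2 0) ?_ (HomQ.x 0) fun p hp => hp.x_ne 0
    solve_by_elim (maxDepth := 200) [HomP.z, HomP.x, HomP.add, HomP.sub, HomP.num_mul]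
  unfold Ltt
  split_ifs
  · exact h
  · obtain ⟨φ, hφ⟩ := h
    exact ⟨φ⁻¹, hφ.inv⟩
  · exact ⟨1, isPhase_one⟩

theorem exists_I : ∃ ι : M, Represents (ι : N) fun _ => Complex.I := by
  let r : InvPair := ⟨fun _ => Complex.I, Set.univ, isOpen_univ, dense_univ,
    differentiableOn_const _, fun _ _ => Complex.I_ne_zero⟩
  have hr : Rep (InvFun.mk r) fun _ => Complex.I := ⟨r, rfl, fun _ _ _ => rfl⟩
  refine ⟨⟨⟨InvFun.mk r, fun c => (hr.scale c).eq hr fun p _ => rfl⟩, .C (1 / 4), 1, 0, r,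
    MvPolynomial.isHomogeneous_C _ _, MvPolynomial.isHomogeneous_one _ _, one_ne_zero, rfl,
    fun p _ => ⟨by simp, ?_⟩⟩, r, rfl, fun _ _ => rfl⟩
  change Complex.I = _
  rw [cexp2, ← Complex.exp_pi_div_two_mul_I]
  congr 1
  simp
  ring

theorem exists_c : ∃ c : M, Represents (c : N) fun p => Complex.exp (Real.pi * Complex.I / 2 *
    (p.1 ^ 2 / (p.2 0 * p.2 2) - 2 * p.1 / p.2 2 + 1
      + p.2 0 / (6 * p.2 2) + p.2 2 / (6 * p.2 0))) := by
  obtain ⟨φ, r, hr, hφ⟩ := exists_phase (d := 2)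
    (f := fun p => 6 * p.1 ^ 2 - 12 * p.1 * p.2 0 + 6 * p.2 0 * p.2 2 + p.2 0 ^ 2 + p.2 2 ^ 2)
    (g := fun p => 12 * p.2 0 * p.2 2) (by
      solve_by_elim (maxDepth := 200) [HomP.z, HomP.x, HomP.add, HomP.sub, HomP.num_mul, HomP.sq,
        HomP.mul11]) (by
      solve_by_elim (maxDepth := 200) [HomQ.x, HomQ.sub, HomQ.num_mul, HomQ.mul11])
    fun p hp => by simp [hp.x_ne]
  have hopen : IsOpen {p : X | p.2 0 ≠ 0 ∧ p.2 2 ≠ 0} :=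
    (isOpen_ne_fun (by fun_prop) continuous_const).inter
      (isOpen_ne_fun (by fun_prop) continuous_const)
  have hdense : Dense {p : X | p.2 0 ≠ 0 ∧ p.2 2 ≠ 0} :=
    dense_gen.mono fun p hp => ⟨hp.x_ne 0, hp.x_ne 2⟩
  -- The domain is shrunk to `x₁ x₃ ≠ 0`: elsewhere the sum of fractions and the single fraction may
  -- have different default values.
  let s : InvPair := ⟨r.f, r.D ∩ {p : X | p.2 0 ≠ 0 ∧ p.2 2 ≠ 0}, r.isOpen.inter hopen,
    r.dense.inter_of_isOpen_left hdense r.isOpen, r.holo.mono Set.inter_subset_left,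
    fun p hp => r.ne_zero p hp.1⟩
  refine ⟨φ, s, ((InvFun.mk_eq (r := s) (s := r)).2 fun _ _ => rfl).trans hr, fun p hp => ?_⟩
  have h0 : p.2 0 ≠ 0 := hp.2.1
  have h2 : p.2 2 ≠ 0 := hp.2.2
  refine (hφ hp.1).trans (congrArg Complex.exp ?_)
  field_simp
  ring

/-! ### The kernel of `E → G` -/

namespace E

theorem rel {l r : FreeGroup EGen} (h : EGen.IsRel l r) :
    (PresentedGroup.mk EGen.rels l) = PresentedGroup.mk EGen.rels r :=
  PresentedGroup.mk_eq_mk_of_mul_inv_mem (rels := EGen.rels) ⟨l, r, h, rfl⟩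

theorem e_mul_ofM (i j : Fin 3) (h : i ≠ j) (φ : M) :
    e i j h * ofM φ = ofM (G.e i j h • φ) * e i j h := rel (.em i j h φ)

theorem t_mul_ofM (i : Fin 3) (φ : M) : t i * ofM φ = ofM (G.t i • φ) * t i := rel (.tm i φ)

theorem proj_e (i j : Fin 3) (h : i ≠ j) : proj (e i j h) = G.e i j h := PresentedGroup.toGroup.of _

theorem proj_t (i : Fin 3) : proj (t i) = G.t i := PresentedGroup.toGroup.of _

theorem induction {p : E → Prop} (he : ∀ i j h, p (e i j h)) (ht : ∀ i, p (t i))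
    (hm : ∀ φ, p (ofM φ)) (mul : ∀ a b, p a → p b → p (a * b)) (inv : ∀ a, p a → p a⁻¹) (x : E) :
    p x := by
  have hx : x ∈ Subgroup.closure (Set.range (PresentedGroup.of (rels := EGen.rels))) := by
    rw [PresentedGroup.closure_range_of]
    trivial
  induction hx using Subgroup.closure_induction with
  | mem x hx =>
    obtain ⟨g, rfl⟩ := hx
    cases g with
    | e i j h => exact he i j h
    | t i => exact ht i
    | m φ => exact hm φ
  | one => simpa using hm 1
  | mul a b _ _ ha hb => exact mul a b ha hb
  | inv a _ ha => exact inv a ha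

theorem conj_ofM (x : E) (φ : M) : x * ofM φ * x⁻¹ = ofM (proj x • φ) := by
  induction x using E.induction generalizing φ with
  | he i j h => rw [e_mul_ofM, mul_inv_cancel_right, proj_e]
  | ht i => rw [t_mul_ofM, mul_inv_cancel_right, proj_t]
  | hm ψ => rw [← map_mul, mul_comm, map_mul, mul_inv_cancel_right, proj_ofM, one_smul]
  | mul a b ha hb =>
    rw [map_mul, mul_smul, ← ha, ← hb]
    group
  | inv a ha =>
    have := ha (proj a⁻¹ • φ)
    rw [← mul_smul, ← map_mul, mul_inv_cancel, map_one, one_smul] at this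
    rw [← this]
    group

theorem range_ofM_normal : (ofM.range).Normal := by
  constructor
  rintro _ ⟨φ, rfl⟩ x
  exact ⟨_, (conj_ofM x φ).symm⟩

theorem proj_surjective : Function.Surjective proj := by
  rw [← MonoidHom.range_eq_top, eq_top_iff, ← G.closure_eq_top, Subgroup.closure_le]
  rintro _ (⟨i, j, h, rfl⟩ | ⟨i, rfl⟩)
  · exact ⟨_, proj_e i j h⟩
  · exact ⟨_, proj_t i⟩

/-- In the quotient of `E` by the image of `M` every phase becomes 1, so the generators satisfy the
defining relations of `G`. The presentation of `G` yields a homomorphism `F` from `G` to this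
quotient with `F ∘ proj` the quotient map, and `proj x = 1` therefore forces `x` into the image of
`M`. -/
theorem ker_proj : proj.ker = ofM.range := by
  have := range_ofM_normal
  apply le_antisymm
  · set π := QuotientGroup.mk' ofM.range with hπ
    have hm : ∀ φ, π (ofM φ) = 1 := fun φ => (QuotientGroup.eq_one_iff _).2 ⟨φ, rfl⟩
    have hee : ∀ (i j k l : Fin 3) (hij : i ≠ j) (hkl : k ≠ l), j ≠ k → i ≠ l →
        π (e i j hij) * π (e k l hkl) = π (e k l hkl) * π (e i j hij) := by
      intro i j k l hij hkl hjk hil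
      obtain ⟨φ, hφ⟩ := exists_phase_Lee i j k l
      have : e i j hij * e k l hkl = ofM φ * e k l hkl * e i j hij :=
        rel (.ee_comm i j k l hij hkl hjk hil φ hφ)
      rw [← map_mul, this, map_mul, map_mul, hm, one_mul]
    have hee' : ∀ (i j k : Fin 3) (hij : i ≠ j) (hjk : j ≠ k) (hik : i ≠ k),
        π (e i j hij) * π (e j k hjk) = π (e i k hik) * π (e j k hjk) * π (e i j hij) := by
      intro i j k hij hjk hik
      obtain ⟨φ, hφ⟩ := exists_phase_Lee i j j k
      have : e i j hij * e j k hjk = ofM φ * e i k hik * e j k hjk * e i j hij :=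
        rel (.ee i j k hij hjk hik φ hφ)
      rw [← map_mul, this, map_mul, map_mul, map_mul, hm, one_mul]
    have hw : (π (e 0 2 (by decide)) * (π (e 2 0 (by decide)))⁻¹ * π (e 0 2 (by decide))) ^ 4 = 1 := by
      have : (e 0 2 (by decide) * (e 2 0 (by decide))⁻¹ * e 0 2 (by decide)) ^ 4 = 1 := by
        have h := rel EGen.IsRel.w
        simp only [map_pow, map_mul, map_inv, map_one] at h
        exact h
      have h2 := congrArg π this
      simpa only [map_pow, map_mul, map_inv, map_one] using h2
    have htt : ∀ i j, π (t i) * π (t j) = π (t j) * π (t i) := by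
      intro i j
      obtain ⟨φ, hφ⟩ := exists_phase_Ltt i j
      have : t i * t j = ofM φ * t j * t i := rel (.tt i j φ hφ)
      rw [← map_mul, this, map_mul, map_mul, hm, one_mul]
    have het : ∀ (i j k : Fin 3) (hij : i ≠ j), i ≠ k →
        π (e i j hij) * π (t k) = π (t k) * π (e i j hij) := by
      intro i j k hij hik
      obtain ⟨φ, hφ⟩ := exists_phase_Let i j k
      have : e i j hij * t k = ofM φ * t k * e i j hij := rel (.et_comm i j k hij hik φ hφ)
      rw [← map_mul, this, map_mul, map_mul, hm, one_mul]
    have het' : ∀ (i j : Fin 3) (hij : i ≠ j),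
        π (t j) * π (e i j hij) * π (t i) = π (t i) * π (e i j hij) := by
      intro i j hij
      obtain ⟨φ, hφ⟩ := exists_phase_Let i j i
      have : t j * e i j hij * t i = ofM φ * t i * e i j hij := rel (.et i j hij φ hφ)
      rw [← map_mul, ← map_mul, this, map_mul, map_mul, hm, one_mul]
    obtain ⟨F, hF, hFt⟩ := exists_G_hom (H := E ⧸ ofM.range)
      (ε := fun i j => if h : i = j then 1 else π (e i j h)) (τ := fun i => π (t i)) htt
      (by
        intro i j k hij hik
        simp only [dif_neg hij]
        exact het i j k hij hik)
      (by
        intro i j hij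
        simp only [dif_neg hij]
        exact het' i j hij)
      (by
        constructor
        · intro i j k l hij hkl hjk hil
          simp only [dif_neg hij, dif_neg hkl]
          exact hee i j k l hij hkl hjk hil
        · intro i j k hij hjk hik
          simp only [dif_neg hij, dif_neg hjk, dif_neg hik]
          exact hee' i j k hij hjk hik
        · exact hw)
    have hcomp : ∀ x, F (proj x) = π x := by
      intro x
      induction x using E.induction with
      | he i j h => rw [proj_e, hF, dif_neg h]
      | ht i => rw [proj_t, hFt]
      | hm φ => rw [proj_ofM, map_one, hm]
      | mul a b ha hb => rw [map_mul, map_mul, ha, hb, map_mul]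
      | inv a ha => rw [map_inv, map_inv, ha, map_inv]
    intro x hx
    rw [← QuotientGroup.eq_one_iff, ← QuotientGroup.mk'_apply, ← hπ, ← hcomp, MonoidHom.mem_ker.1 hx,
      map_one]
  · rintro _ ⟨φ, rfl⟩
    exact proj_ofM φ

end E

end
end EllipticGamma

namespace EllipticGamma
noncomputable section

/-! ### The basic functions and their relations at generic points -/

theorem Indep.of_det {l m : Fin 3 → ℤ} (i j : Fin 3) (h : l i * m j - l j * m i ≠ 0) :
    Indep l m := by
  intro a b hab
  constructor
  · refine (mul_eq_zero.1 (?_ : a * (l i * m j - l j * m i) = 0)).resolve_right h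
    linear_combination m j * hab i - m i * hab j
  · refine (mul_eq_zero.1 (?_ : b * (l i * m j - l j * m i) = 0)).resolve_right h
    linear_combination l i * hab j - l j * hab i

theorem form_three (a b c : ℤ) (x : Fin 3 → ℂ) :
    form ![a, b, c] x = a * x 0 + b * x 1 + c * x 2 := by
  simp [form, Fin.sum_univ_three]

theorem Gen.im_div {p : X} (hp : Gen p) {l m : Fin 3 → ℤ} (h : Indep l m) {u v : ℂ}
    (hu : form l p.2 = u) (hv : form m p.2 = v) : (u / v).im ≠ 0 := by
  rw [← hu, ← hv]
  exact hp.im_ne l m h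

theorem Gen.genTriple {p : X} (hp : Gen p) {l m n : Fin 3 → ℤ} (hlm : Indep l m) (hln : Indep l n)
    (hmn : Indep m n)
    (hdet : l 0 * (m 1 * n 2 - m 2 * n 1) - l 1 * (m 0 * n 2 - m 2 * n 0)
      + l 2 * (m 0 * n 1 - m 1 * n 0) ≠ 0) {x₁ x₂ x₃ : ℂ}
    (h1 : form l p.2 = x₁) (h2 : form m p.2 = x₂) (h3 : form n p.2 = x₃) :
    GenTriple x₁ x₂ x₃ := by
  refine ⟨hp.im_div hlm h1 h2, hp.im_div hln h1 h3, hp.im_div hmn h2 h3, fun a b c h => ?_⟩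
  have h0 : a • l + b • m + c • n = 0 := by
    by_contra hne
    refine hp.form_ne hne ?_
    rw [← h, ← h1, ← h2, ← h3]
    simp only [form, Fin.sum_univ_three, Pi.add_apply, Pi.smul_apply, smul_eq_mul]
    push_cast
    ring
  have e0 := congrFun h0 0
  have e1 := congrFun h0 1
  have e2 := congrFun h0 2
  simp only [Pi.add_apply, Pi.smul_apply, smul_eq_mul, Pi.zero_apply] at e0 e1 e2
  set D := l 0 * (m 1 * n 2 - m 2 * n 1) - l 1 * (m 0 * n 2 - m 2 * n 0)
      + l 2 * (m 0 * n 1 - m 1 * n 0) with hD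
  refine ⟨(mul_eq_zero.1 (?_ : a * D = 0)).resolve_right hdet,
    (mul_eq_zero.1 (?_ : b * D = 0)).resolve_right hdet,
    (mul_eq_zero.1 (?_ : c * D = 0)).resolve_right hdet⟩
  · rw [hD]
    linear_combination (m 1 * n 2 - m 2 * n 1) * e0 - (m 0 * n 2 - m 2 * n 0) * e1
      + (m 0 * n 1 - m 1 * n 0) * e2
  · rw [hD]
    linear_combination -(l 1 * n 2 - l 2 * n 1) * e0 + (l 0 * n 2 - l 2 * n 0) * e1
      - (l 0 * n 1 - l 1 * n 0) * e2
  · rw [hD]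
    linear_combination (l 1 * m 2 - l 2 * m 1) * e0 - (l 0 * m 2 - l 2 * m 0) * e1
      + (l 0 * m 1 - l 1 * m 0) * e2

theorem Gen.z_ne_three {p : X} (hp : Gen p) (a b c : ℤ) :
    p.1 ≠ a * p.2 0 + b * p.2 1 + c * p.2 2 := by
  rw [← form_three]
  exact hp.z_ne _

/-- The formula for `u(e_{1,2})`. -/
def f12 (p : X) : ℂ :=
  (ellGamma ((p.1 - p.2 1) / p.2 2) ((p.2 0 - p.2 1) / p.2 2) (-(p.2 0) / p.2 2))⁻¹

/-- The formula for `u(e_{3,2})`. -/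
def f32 (p : X) : ℂ := ellGamma (p.1 / p.2 0) ((p.2 1 - p.2 2) / p.2 0) (p.2 2 / p.2 0)

/-- The formula for `u(t_2)`. -/
def f2 (p : X) : ℂ := theta0 ((p.1 - p.2 1) / p.2 0) (p.2 2 / p.2 0)

theorem e_inv_smul (i j : Fin 3) (h : i ≠ j) (p : X) :
    (G.e i j h)⁻¹ • p = (p.1, Function.update p.2 i (p.2 i - p.2 j)) := by
  rw [inv_smul_eq_iff, G.smul_def]
  refine Prod.ext (by simp [G.e, G.ofSL]) (funext fun k => ?_)
  have e : ∀ k l, (G.e i j h).A.1 k l = (1 : Matrix (Fin 3) (Fin 3) ℤ) k l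
      + Matrix.single i j (1 : ℤ) k l := fun k l => rfl
  simp only [e, Int.cast_add, add_mul, Finset.sum_add_distrib]
  by_cases hk : k = i
  · subst hk
    simp [Matrix.one_apply, Matrix.single_apply, Function.update_of_ne h.symm, ite_mul]
  · simp [Matrix.one_apply, Matrix.single_apply_of_row_ne (Ne.symm hk), hk, ite_mul]

theorem t_inv_smul (i : Fin 3) (p : X) : (G.t i)⁻¹ • p = (p.1 - p.2 i, p.2) := by
  rw [inv_smul_eq_iff, G.smul_def]
  refine Prod.ext ?_ (funext fun k => ?_)
  · simp [G.t, Pi.single_apply]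
  · simp [G.t, Matrix.one_apply]

section Generic

variable {p : X} (hp : Gen p)

include hp

theorem Gen.f2_ne : f2 p ≠ 0 := by
  refine theta0_ne_zero (hp.im_div (Indep.of_det (l := ![0, 0, 1]) (m := ![1, 0, 0]) 0 2 (by decide))
    (by simp [form_three]) (by simp [form_three])) fun i j h => ?_
  refine hp.z_ne_three i 1 j ?_
  have := hp.x_ne 0
  field_simp at h
  push_cast
  linear_combination h

theorem Gen.f32_ne : f32 p ≠ 0 := by
  refine ellGamma_ne_zero
    (hp.im_div (Indep.of_det (l := ![0, 1, -1]) (m := ![1, 0, 0]) 0 2 (by decide))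
      (by simp [form_three, sub_eq_add_neg]) (by simp [form_three]))
    (hp.im_div (Indep.of_det (l := ![0, 0, 1]) (m := ![1, 0, 0]) 0 2 (by decide))
      (by simp [form_three]) (by simp [form_three])) fun i j k h => ?_
  refine hp.z_ne_three i j (k - j) ?_
  have := hp.x_ne 0
  field_simp at h
  push_cast
  linear_combination h

theorem Gen.f12_ne : f12 p ≠ 0 := by
  refine inv_ne_zero (ellGamma_ne_zero
    (hp.im_div (Indep.of_det (l := ![1, -1, 0]) (m := ![0, 0, 1]) 0 2 (by decide))
      (by simp [form_three, sub_eq_add_neg]) (by simp [form_three]))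
    (hp.im_div (Indep.of_det (l := ![-1, 0, 0]) (m := ![0, 0, 1]) 0 2 (by decide))
      (by simp [form_three]) (by simp [form_three])) fun i j k h => ?_)
  refine hp.z_ne_three (j - k) (1 - j) i ?_
  have := hp.x_ne 2
  field_simp at h
  push_cast
  linear_combination h

end Generic

theorem exists_f2 : ∃ n : N, Represents n f2 := by
  refine exists_represents (P := {p | (p.2 2 / p.2 0).im ≠ 0}) ?_ (fun p hp => ?_) (fun p hp h0 => ?_)
    (fun p hp => hp.f2_ne) fun c p => ?_
  · simpa [form_three] using isOpen_im_form_ne_zero ![0, 0, 1] ![1, 0, 0]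
  · exact hp.im_div (Indep.of_det (l := ![0, 0, 1]) (m := ![1, 0, 0]) 0 2 (by decide))
      (by simp [form_three]) (by simp [form_three])
  · have hx : p.2 0 ≠ 0 := fun h => hp (by rw [h, div_zero, Complex.zero_im])
    refine (differentiableAt_theta0 hp h0).comp
      (f := fun p : X => ((p.1 - p.2 1) / p.2 0, p.2 2 / p.2 0)) p ?_
    exact (differentiableAt_div (f := fun p : X => p.1 - p.2 1) (g := fun p : X => p.2 0)
      (by fun_prop) (by fun_prop) hx).prodMk (differentiableAt_div (f := fun p : X => p.2 2)
      (g := fun p : X => p.2 0) (by fun_prop) (by fun_prop) hx)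
  · have hc := c.ne_zero
    simp only [f2, Units.smul_def, Prod.smul_fst, Prod.smul_snd, Pi.smul_apply, smul_eq_mul,
      ← mul_sub, mul_div_mul_left _ _ hc]

theorem exists_f32 : ∃ n : N, Represents n f32 := by
  refine exists_represents (P := {p | ((p.2 1 - p.2 2) / p.2 0).im ≠ 0} ∩
    {p | (p.2 2 / p.2 0).im ≠ 0}) (.inter ?_ ?_) (fun p hp => ⟨?_, ?_⟩) (fun p hp h0 => ?_)
    (fun p hp => hp.f32_ne) fun c p => ?_
  · simpa [form_three, ← sub_eq_add_neg] using isOpen_im_form_ne_zero ![0, 1, -1] ![1, 0, 0]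
  · simpa [form_three] using isOpen_im_form_ne_zero ![0, 0, 1] ![1, 0, 0]
  · exact hp.im_div (Indep.of_det (l := ![0, 1, -1]) (m := ![1, 0, 0]) 0 2 (by decide))
      (by simp [form_three, sub_eq_add_neg]) (by simp [form_three])
  · exact hp.im_div (Indep.of_det (l := ![0, 0, 1]) (m := ![1, 0, 0]) 0 2 (by decide))
      (by simp [form_three]) (by simp [form_three])
  · have hx : p.2 0 ≠ 0 := fun h => hp.2 (by rw [h, div_zero, Complex.zero_im])
    refine (differentiableAt_ellGamma hp.1 hp.2 h0).comp
      (f := fun p : X => (p.1 / p.2 0, (p.2 1 - p.2 2) / p.2 0, p.2 2 / p.2 0)) p ?_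
    have hd : ∀ f : X → ℂ, Differentiable ℂ f → DifferentiableAt ℂ (fun p : X => f p / p.2 0) p :=
      fun f hf => differentiableAt_div (g := fun p : X => p.2 0) (hf p) (by fun_prop) hx
    exact (hd (fun p => p.1) (by fun_prop)).prodMk ((hd (fun p => p.2 1 - p.2 2) (by fun_prop)).prodMk
      (hd (fun p => p.2 2) (by fun_prop)))
  · have hc := c.ne_zero
    simp only [f32, Units.smul_def, Prod.smul_fst, Prod.smul_snd, Pi.smul_apply, smul_eq_mul,
      ← mul_sub, mul_div_mul_left _ _ hc]

theorem exists_f12 : ∃ n : N, Represents n f12 := by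
  refine exists_represents (P := {p | ((p.2 0 - p.2 1) / p.2 2).im ≠ 0} ∩
    {p | (-(p.2 0) / p.2 2).im ≠ 0}) (.inter ?_ ?_) (fun p hp => ⟨?_, ?_⟩) (fun p hp h0 => ?_)
    (fun p hp => hp.f12_ne) fun c p => ?_
  · simpa [form_three, ← sub_eq_add_neg] using isOpen_im_form_ne_zero ![1, -1, 0] ![0, 0, 1]
  · simpa [form_three] using isOpen_im_form_ne_zero ![-1, 0, 0] ![0, 0, 1]
  · exact hp.im_div (Indep.of_det (l := ![1, -1, 0]) (m := ![0, 0, 1]) 0 2 (by decide))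
      (by simp [form_three, sub_eq_add_neg]) (by simp [form_three])
  · exact hp.im_div (Indep.of_det (l := ![-1, 0, 0]) (m := ![0, 0, 1]) 0 2 (by decide))
      (by simp [form_three]) (by simp [form_three])
  · have hx : p.2 2 ≠ 0 := fun h => hp.2 (by rw [h, div_zero, Complex.zero_im])
    have h0' : ellGamma ((p.1 - p.2 1) / p.2 2) ((p.2 0 - p.2 1) / p.2 2) (-(p.2 0) / p.2 2) ≠ 0 :=
      fun h => h0 (by rw [f12, h, inv_zero])
    refine DifferentiableAt.inv ?_ h0'
    refine (differentiableAt_ellGamma hp.1 hp.2 h0').comp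
      (f := fun p : X => ((p.1 - p.2 1) / p.2 2, (p.2 0 - p.2 1) / p.2 2, -(p.2 0) / p.2 2)) p ?_
    have hd : ∀ f : X → ℂ, Differentiable ℂ f → DifferentiableAt ℂ (fun p : X => f p / p.2 2) p :=
      fun f hf => differentiableAt_div (g := fun p : X => p.2 2) (hf p) (by fun_prop) hx
    exact (hd (fun p => p.1 - p.2 1) (by fun_prop)).prodMk ((hd (fun p => p.2 0 - p.2 1) (by fun_prop)).prodMk
      (hd (fun p => -(p.2 0)) (by fun_prop)))
  · have hc := c.ne_zero
    simp only [f12, Units.smul_def, Prod.smul_fst, Prod.smul_snd, Pi.smul_apply, smul_eq_mul,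
      ← mul_sub, ← mul_neg, mul_div_mul_left _ _ hc]

end
end EllipticGamma

namespace EllipticGamma
noncomputable section

/-! ### The relations among the values on the generators -/

/-- The formula for `u(e_{1,2})` in coordinates. -/
def g12 (z x₁ x₂ x₃ : ℂ) : ℂ := (ellGamma ((z - x₂) / x₃) ((x₁ - x₂) / x₃) (-x₁ / x₃))⁻¹

/-- The formula for `u(e_{3,2})` in coordinates. -/
def g32 (z x₁ x₂ x₃ : ℂ) : ℂ := ellGamma (z / x₁) ((x₂ - x₃) / x₁) (x₃ / x₁)

/-- The formula for `u(t_2)` in coordinates. -/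
def g2 (z x₁ x₂ x₃ : ℂ) : ℂ := theta0 ((z - x₂) / x₁) (x₃ / x₁)

theorem Gen.im {z x₁ x₂ x₃ : ℂ} (hp : Gen (z, ![x₁, x₂, x₃])) (l m : Fin 3 → ℤ) (i j : Fin 3)
    (h : l i * m j - l j * m i ≠ 0) :
    ((l 0 * x₁ + l 1 * x₂ + l 2 * x₃) / (m 0 * x₁ + m 1 * x₂ + m 2 * x₃)).im ≠ 0 := by
  have := hp.im_ne l m (.of_det i j h)
  simpa [form, Fin.sum_univ_three] using this

theorem Gen.z_ne_add {z x₁ x₂ x₃ : ℂ} (hp : Gen (z, ![x₁, x₂, x₃])) (a b c : ℤ) :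
    z ≠ a * x₁ + b * x₂ + c * x₃ := hp.z_ne_three a b c

section

variable {z x₁ x₂ x₃ : ℂ}

/-- This and the following invariances hold because the substitution changes the arguments of `Γ` or
`θ₀` by integers only. They account for most of the relations without phase. -/
theorem g12_sub_x₃ (h : x₃ ≠ 0) : g12 (z - x₃) x₁ x₂ x₃ = g12 z x₁ x₂ x₃ := by
  have e : (z - x₃ - x₂) / x₃ = (z - x₂) / x₃ + ((-1 : ℤ) : ℂ) := by
    push_cast
    field_simp
    ring
  rw [g12, e, ellGamma_add_int, g12]

theorem g12_e13 (h : x₃ ≠ 0) : g12 z (x₁ - x₃) x₂ x₃ = g12 z x₁ x₂ x₃ := by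
  have e : (x₁ - x₃ - x₂) / x₃ = (x₁ - x₂) / x₃ + ((-1 : ℤ) : ℂ) := by
    push_cast
    field_simp
    ring
  have e' : -(x₁ - x₃) / x₃ = -x₁ / x₃ + ((1 : ℤ) : ℂ) := by
    push_cast
    field_simp
    ring
  rw [g12, e, e', ellGamma_tau_add_int, ellGamma_sigma_add_int, g12]

theorem g12_e13_e23 (h : x₃ ≠ 0) : g12 z (x₁ - x₃) (x₂ - x₃) x₃ = g12 z x₁ x₂ x₃ := by
  have e0 : (z - (x₂ - x₃)) / x₃ = (z - x₂) / x₃ + ((1 : ℤ) : ℂ) := by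
    push_cast
    field_simp
    ring
  have e : (x₁ - x₃ - (x₂ - x₃)) / x₃ = (x₁ - x₂) / x₃ := by ring
  have e' : -(x₁ - x₃) / x₃ = -x₁ / x₃ + ((1 : ℤ) : ℂ) := by
    push_cast
    field_simp
    ring
  rw [g12, e0, e, e', ellGamma_add_int, ellGamma_sigma_add_int, g12]

theorem g32_sub_x₁ (h : x₁ ≠ 0) : g32 (z - x₁) x₁ x₂ x₃ = g32 z x₁ x₂ x₃ := by
  have e : (z - x₁) / x₁ = z / x₁ + ((-1 : ℤ) : ℂ) := by
    push_cast
    field_simp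
    ring
  rw [g32, e, ellGamma_add_int, g32]

theorem g32_e31 (h : x₁ ≠ 0) : g32 z x₁ x₂ (x₃ - x₁) = g32 z x₁ x₂ x₃ := by
  have e : (x₂ - (x₃ - x₁)) / x₁ = (x₂ - x₃) / x₁ + ((1 : ℤ) : ℂ) := by
    push_cast
    field_simp
    ring
  have e' : (x₃ - x₁) / x₁ = x₃ / x₁ + ((-1 : ℤ) : ℂ) := by
    push_cast
    field_simp
    ring
  rw [g32, e, e', ellGamma_tau_add_int, ellGamma_sigma_add_int, g32]

theorem g32_e31_e21 (h : x₁ ≠ 0) : g32 z x₁ (x₂ - x₁) (x₃ - x₁) = g32 z x₁ x₂ x₃ := by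
  have e : (x₂ - x₁ - (x₃ - x₁)) / x₁ = (x₂ - x₃) / x₁ := by ring
  have e' : (x₃ - x₁) / x₁ = x₃ / x₁ + ((-1 : ℤ) : ℂ) := by
    push_cast
    field_simp
    ring
  rw [g32, e, e', ellGamma_sigma_add_int, g32]

theorem g2_sub_x₁ (h : x₁ ≠ 0) : g2 (z - x₁) x₁ x₂ x₃ = g2 z x₁ x₂ x₃ := by
  have e : (z - x₁ - x₂) / x₁ = (z - x₂) / x₁ + ((-1 : ℤ) : ℂ) := by
    push_cast
    field_simp
    ring
  rw [g2, e, theta0_add_int, g2]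

theorem g2_e31 (h : x₁ ≠ 0) : g2 z x₁ x₂ (x₃ - x₁) = g2 z x₁ x₂ x₃ := by
  have e' : (x₃ - x₁) / x₁ = x₃ / x₁ + ((-1 : ℤ) : ℂ) := by
    push_cast
    field_simp
    ring
  rw [g2, e', theta0_tau_add_int, g2]

theorem g2_sub_sub (y : ℂ) : g2 (z - y) x₁ (x₂ - y) x₃ = g2 z x₁ x₂ x₃ := by
  rw [g2, g2, sub_sub_sub_cancel_right]

/-- By the reflection formula and integer shifts. Its role is to identify the left sides of the two
three-term relations `g32_e13` and `g12_e31`. -/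
theorem g32_e13_eq_g12_e31 (h : x₁ - x₃ ≠ 0) : g32 z (x₁ - x₃) x₂ x₃ = g12 z x₁ x₂ (x₃ - x₁) := by
  have h' : x₃ - x₁ ≠ 0 := by rwa [← neg_ne_zero, neg_sub]
  have e1 : (x₁ - x₂) / (x₃ - x₁) = (x₂ - x₃) / (x₁ - x₃) + ((-1 : ℤ) : ℂ) := by
    push_cast
    field_simp
    ring
  have e2 : -x₁ / (x₃ - x₁) = x₃ / (x₁ - x₃) + ((1 : ℤ) : ℂ) := by
    push_cast
    field_simp
    ring
  rw [g32, g12, e1, e2, ellGamma_tau_add_int, ellGamma_sigma_add_int, ← ellGamma_refl]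
  congr 1
  field_simp
  ring

theorem Gen.x₁_ne (hp : Gen (z, ![x₁, x₂, x₃])) : x₁ ≠ 0 := hp.x_ne 0
theorem Gen.x₃_ne (hp : Gen (z, ![x₁, x₂, x₃])) : x₃ ≠ 0 := hp.x_ne 2
theorem Gen.x₁₂_ne (hp : Gen (z, ![x₁, x₂, x₃])) : x₁ - x₂ ≠ 0 := hp.sub_ne (i := 0) (j := 1) (by decide)
theorem Gen.x₁₃_ne (hp : Gen (z, ![x₁, x₂, x₃])) : x₁ - x₃ ≠ 0 := hp.sub_ne (i := 0) (j := 2) (by decide)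
theorem Gen.x₂₃_ne (hp : Gen (z, ![x₁, x₂, x₃])) : x₂ - x₃ ≠ 0 := hp.sub_ne (i := 1) (j := 2) (by decide)

theorem Gen.im₃₁ (hp : Gen (z, ![x₁, x₂, x₃])) : (x₃ / x₁).im ≠ 0 := by
  simpa using hp.im ![0, 0, 1] ![1, 0, 0] 0 2 (by decide)

theorem Gen.im₁₃ (hp : Gen (z, ![x₁, x₂, x₃])) : (-x₁ / x₃).im ≠ 0 := by
  simpa using hp.im ![-1, 0, 0] ![0, 0, 1] 0 2 (by decide)

theorem Gen.im₁₂₃ (hp : Gen (z, ![x₁, x₂, x₃])) : ((x₁ - x₂) / x₃).im ≠ 0 := by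
  simpa [← sub_eq_add_neg] using hp.im ![1, -1, 0] ![0, 0, 1] 0 2 (by decide)

theorem Gen.im₂₃₁ (hp : Gen (z, ![x₁, x₂, x₃])) : ((x₂ - x₃) / x₁).im ≠ 0 := by
  simpa [← sub_eq_add_neg] using hp.im ![0, 1, -1] ![1, 0, 0] 0 2 (by decide)

/-- The quasi-periodicity of `θ₀`; the summand `x₁` in the phase encodes the sign as `e^{πi}`. -/
theorem g2_sub_x₃ (hp : Gen (z, ![x₁, x₂, x₃])) : g2 (z - x₃) x₁ x₂ x₃ =
    Complex.exp (Real.pi * Complex.I * ((2 * z - 2 * x₂ - 2 * x₃ + x₁) / x₁)) * g2 z x₁ x₂ x₃ := by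
  have h1 := hp.x₁_ne
  have key := theta0_add_tau (z := (z - x₃ - x₂) / x₁) hp.im₃₁ fun i hi => by
    refine hp.z_ne_add i 1 1 ?_
    field_simp at hi
    push_cast
    linear_combination hi
  have e : (z - x₃ - x₂) / x₁ + x₃ / x₁ = (z - x₂) / x₁ := by ring
  rw [e, cexp2] at key
  rw [g2, g2, key, ← mul_assoc, mul_neg, ← Complex.exp_add]
  have : Real.pi * Complex.I * ((2 * z - 2 * x₂ - 2 * x₃ + x₁) / x₁)
      + 2 * Real.pi * Complex.I * -((z - x₃ - x₂) / x₁) = Real.pi * Complex.I := by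
    field_simp
    ring
  rw [this, Complex.exp_pi_mul_I]
  ring

theorem g2_mul (hp : Gen (z, ![x₁, x₂, x₃])) : g2 z x₁ x₂ x₃ * theta0 ((z - x₂) / x₃) (x₁ / x₃) =
    Complex.exp (-(Real.pi * Complex.I * bern₂ (z - x₂) x₁ x₃)) :=
  theta0_modular hp.x₁_ne hp.x₃_ne hp.im₃₁ fun i j h => by
    refine hp.z_ne_add i 1 j ?_
    push_cast
    linear_combination h

theorem Gen.e12 (hp : Gen (z, ![x₁, x₂, x₃])) : Gen (z, ![x₁ - x₂, x₂, x₃]) := by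
  have := hp.smul (G.e 0 1 (by decide))⁻¹
  rw [e_inv_smul] at this
  convert this using 2
  funext i
  fin_cases i <;> rfl

theorem Gen.e13 (hp : Gen (z, ![x₁, x₂, x₃])) : Gen (z, ![x₁ - x₃, x₂, x₃]) := by
  have := hp.smul (G.e 0 2 (by decide))⁻¹
  rw [e_inv_smul] at this
  convert this using 2
  funext i
  fin_cases i <;> rfl

/-- In the modular property for the periods `x₁, x₃` and for `x₁ - x₃, x₃` the second theta factor
is the same, since its moduli differ by an integer. The quotient of the two exponentials is the
phase. -/
theorem g2_e13 (hp : Gen (z, ![x₁, x₂, x₃])) : g2 z (x₁ - x₃) x₂ x₃ =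
    Complex.exp (Real.pi * Complex.I * ((6 * z ^ 2 - 6 * (x₃ + 2 * x₂) * z + 6 * x₂ * x₃ - x₁ ^ 2
      + 6 * x₂ ^ 2 + x₃ ^ 2 + x₁ * x₃) / (6 * (x₃ - x₁) * x₁))) * g2 z x₁ x₂ x₃ := by
  have h1 := hp.x₁_ne
  have h3 := hp.x₃_ne
  have h13 := hp.x₁₃_ne
  have h13' : x₃ - x₁ ≠ 0 := by rwa [← neg_ne_zero, neg_sub]
  have k1 := g2_mul hp
  have k2 := g2_mul hp.e13
  have e : (x₁ - x₃) / x₃ = x₁ / x₃ + ((-1 : ℤ) : ℂ) := by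
    push_cast
    field_simp
    ring
  rw [e, theta0_tau_add_int] at k2
  have h0 : theta0 ((z - x₂) / x₃) (x₁ / x₃) ≠ 0 := fun h => by
    rw [h, mul_zero] at k1
    exact Complex.exp_ne_zero _ k1.symm
  refine mul_right_cancel₀ h0 ?_
  rw [k2, mul_assoc _ (g2 z x₁ x₂ x₃), k1, ← Complex.exp_add]
  congr 1
  simp only [bern₂]
  field_simp
  ring

theorem theta0_g12 (hp : Gen (z, ![x₁, x₂, x₃])) :
    theta0 ((z - x₂) / x₃ + -x₁ / x₃) (-x₁ / x₃) = (theta0 ((z - x₂) / x₃) (x₁ / x₃))⁻¹ := by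
  have h := theta0_neg_tau ((z - x₂) / x₃) (τ := -x₁ / x₃) hp.im₁₃
  rw [neg_div, neg_neg] at h
  rw [h, inv_inv, neg_div]

/-- The shift of `Γ` by `(x₁ - x₂)/x₃` produces a theta function with modulus `-x₁/x₃`, the inverse
of the factor that the modular property pairs with `g2`. -/
theorem g2_mul_g12 (hp : Gen (z, ![x₁, x₂, x₃])) :
    g2 z x₁ x₂ x₃ * g12 (z - x₂) x₁ x₂ x₃ =
    Complex.exp (-(Real.pi * Complex.I * bern₂ (z - x₂) x₁ x₃)) * g12 (z - x₁) x₁ x₂ x₃ := by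
  have h3 := hp.x₃_ne
  have k := g2_mul hp
  have h0 : theta0 ((z - x₂) / x₃) (x₁ / x₃) ≠ 0 := fun h => by
    rw [h, mul_zero] at k
    exact Complex.exp_ne_zero _ k.symm
  have hΓ := ellGamma_add_tau (z := (z - x₂) / x₃ + -x₁ / x₃) hp.im₁₂₃ hp.im₁₃
    (by rw [theta0_g12 hp]; exact inv_ne_zero h0)
  have e1 : (z - x₂) / x₃ + -x₁ / x₃ + (x₁ - x₂) / x₃ = (z - x₂ - x₂) / x₃ := by ring
  have e2 : (z - x₂) / x₃ + -x₁ / x₃ = (z - x₁ - x₂) / x₃ := by ring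
  rw [theta0_g12 hp, e1, e2] at hΓ
  rw [g12, hΓ, ← k, g12, mul_inv, inv_inv]
  ring

/-- The shift of `Γ` by the other period `-x₁/x₃` gives a theta function that is paired with `g2` at
`x₁ - x₂`. Comparison with `g2_mul_g12` leaves the quotient of two exponentials. -/
theorem g12_mul_g2_e12 (hp : Gen (z, ![x₁, x₂, x₃])) :
    g12 z x₁ x₂ x₃ * g2 z (x₁ - x₂) x₂ x₃ =
    Complex.exp (Real.pi * Complex.I * (x₂ * (6 * z ^ 2 - 6 * (x₃ + 2 * x₂) * z + x₂ * x₁ - x₁ ^ 2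
      + 6 * x₂ ^ 2 + 6 * x₂ * x₃ + x₃ ^ 2) / (6 * x₃ * x₁ * (x₂ - x₁)))) *
    (g2 z x₁ x₂ x₃ * g12 (z - x₂) x₁ x₂ x₃) := by
  have h1 := hp.x₁_ne
  have h3 := hp.x₃_ne
  have h12 := hp.x₁₂_ne
  have h12' : x₂ - x₁ ≠ 0 := by rwa [← neg_ne_zero, neg_sub]
  have k := g2_mul hp.e12
  have h0 : theta0 ((z - x₂) / x₃) ((x₁ - x₂) / x₃) ≠ 0 := fun h => by
    rw [h, mul_zero] at k
    exact Complex.exp_ne_zero _ k.symm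
  have hΓ := ellGamma_add_tau (z := (z - x₂) / x₃) hp.im₁₃ hp.im₁₂₃ h0
  rw [ellGamma_symm, ellGamma_symm _ (-x₁ / x₃)] at hΓ
  have e2 : (z - x₂) / x₃ + -x₁ / x₃ = (z - x₁ - x₂) / x₃ := by ring
  rw [e2] at hΓ
  rw [g2_mul_g12 hp, ← mul_assoc, ← Complex.exp_add]
  have : g12 z x₁ x₂ x₃ = theta0 ((z - x₂) / x₃) ((x₁ - x₂) / x₃) * g12 (z - x₁) x₁ x₂ x₃ := by
    rw [g12, g12, hΓ]
    field_simp
  rw [this, mul_right_comm, mul_comm (theta0 _ _), k]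
  congr 2
  simp only [bern₂]
  field_simp
  ring

theorem g2_ne (hp : Gen (z, ![x₁, x₂, x₃])) : g2 z x₁ x₂ x₃ ≠ 0 := hp.f2_ne

theorem g2_mul_g32 (hp : Gen (z, ![x₁, x₂, x₃])) :
    g2 z x₁ x₂ x₃ * g32 (z - x₂) x₁ x₂ x₃ = g32 (z - x₃) x₁ x₂ x₃ := by
  have hΓ := ellGamma_add_tau (z := (z - x₂) / x₁) hp.im₂₃₁ hp.im₃₁ (g2_ne hp)
  have e : (z - x₂) / x₁ + (x₂ - x₃) / x₁ = (z - x₃) / x₁ := by ring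
  rw [e] at hΓ
  exact hΓ.symm

theorem Gen.e32 (hp : Gen (z, ![x₁, x₂, x₃])) : Gen (z, ![x₁, x₂, x₃ - x₂]) := by
  have := hp.smul (G.e 2 1 (by decide))⁻¹
  rw [e_inv_smul] at this
  convert this using 2
  funext i
  fin_cases i <;> rfl

/-- Both sides equal `g32 (z - x₃) x₁ x₂ x₃`, once by the shift by `(x₂ - x₃)/x₁` and once by the
shift by `x₃/x₁`. No modular transformation is involved, and so there is no phase. -/
theorem g32_mul_g2_e32 (hp : Gen (z, ![x₁, x₂, x₃])) :
    g32 z x₁ x₂ x₃ * g2 z x₁ x₂ (x₃ - x₂) = g2 z x₁ x₂ x₃ * g32 (z - x₂) x₁ x₂ x₃ := by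
  have hn := g2_ne hp.e32
  have ht := theta0_neg_tau ((z - x₂) / x₁) (τ := (x₂ - x₃) / x₁) hp.im₂₃₁
  have e1 : -((x₂ - x₃) / x₁) = (x₃ - x₂) / x₁ := by ring
  have e2 : (z - x₂) / x₁ + (x₂ - x₃) / x₁ = (z - x₃) / x₁ := by ring
  have e3 : (z - x₃) / x₁ + x₃ / x₁ = z / x₁ := by ring
  rw [e1, e2, ← g2] at ht
  have h0 : theta0 ((z - x₃) / x₁) ((x₂ - x₃) / x₁) ≠ 0 := fun h => hn (by rw [ht, h, inv_zero])
  have hΓ := ellGamma_add_tau (z := (z - x₃) / x₁) hp.im₃₁ hp.im₂₃₁ h0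
  rw [e3, ellGamma_symm, ellGamma_symm _ (x₃ / x₁)] at hΓ
  rw [g2_mul_g32 hp, ht, g32, hΓ, g32]
  field_simp

theorem Gen.triple₁ (hp : Gen (z, ![x₁, x₂, x₃])) : GenTriple (x₁ - x₃) (x₁ - x₂) x₃ :=
  hp.genTriple (l := ![1, 0, -1]) (m := ![1, -1, 0]) (n := ![0, 0, 1]) (.of_det 0 1 (by decide))
    (.of_det 0 2 (by decide)) (.of_det 0 2 (by decide)) (by decide)
    (by simp [form_three, sub_eq_add_neg]) (by simp [form_three, sub_eq_add_neg])
    (by simp [form_three])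

theorem Gen.triple₂ (hp : Gen (z, ![x₁, x₂, x₃])) : GenTriple (x₁ - x₃) (x₂ - x₃) x₁ :=
  hp.genTriple (l := ![1, 0, -1]) (m := ![0, 1, -1]) (n := ![1, 0, 0]) (.of_det 0 1 (by decide))
    (.of_det 0 2 (by decide)) (.of_det 0 2 (by decide)) (by decide)
    (by simp [form_three, sub_eq_add_neg]) (by simp [form_three, sub_eq_add_neg])
    (by simp [form_three])

/-- The modular property of `Γ` with periods `x₁ - x₃`, `x₁ - x₂`, `x₃` at the point `z + x₁ - x₂`.
Integer shifts and reversal of a period turn its three factors into the inverse of the left side and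
the two factors on the right. -/
theorem g32_e13 (hp : Gen (z, ![x₁, x₂, x₃])) : g32 z (x₁ - x₃) x₂ x₃ =
    Complex.exp (Real.pi * Complex.I * ((2 * z - x₂) * (2 * z ^ 2 - 2 * z * x₂ - x₁ ^ 2 + x₁ * x₃
      - x₃ ^ 2 + x₂ * x₁) / (12 * (x₃ - x₁) * x₃ * (x₂ - x₁)))) *
    (g12 z x₁ x₂ x₃ * g32 z (x₁ - x₂) x₂ x₃) := by
  have h3 := hp.x₃_ne
  have h12 := hp.x₁₂_ne
  have h12' : x₂ - x₁ ≠ 0 := by rwa [← neg_ne_zero, neg_sub]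
  have h13 := hp.x₁₃_ne
  have h13' : x₃ - x₁ ≠ 0 := by rwa [← neg_ne_zero, neg_sub]
  have ht := hp.triple₁
  have key := ht.ellGamma_modular (z := z + x₁ - x₂) fun a b c h => by
    refine hp.z_ne_add (a + b - 1) (1 - b) (c - a) ?_
    push_cast
    linear_combination h
  have k1 : g32 z (x₁ - x₃) x₂ x₃ =
      (ellGamma ((z + x₁ - x₂) / (x₁ - x₃)) ((x₁ - x₂) / (x₁ - x₃)) (x₃ / (x₁ - x₃)))⁻¹ := by
    have e1 : (x₂ - x₃) / (x₁ - x₃) = -((x₁ - x₂) / (x₁ - x₃)) + ((1 : ℤ) : ℂ) := by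
      push_cast
      field_simp
      ring
    have e2 : z / (x₁ - x₃) + (x₁ - x₂) / (x₁ - x₃) = (z + x₁ - x₂) / (x₁ - x₃) := by ring
    rw [g32, e1, ellGamma_tau_add_int, ellGamma_symm, ellGamma_neg_sigma _ _ (by
      simpa [← sub_eq_add_neg] using hp.im ![1, -1, 0] ![1, 0, -1] 0 1 (by decide)), e2,
      ellGamma_symm]
  have k2 : g32 z (x₁ - x₂) x₂ x₃ =
      ellGamma ((z + x₁ - x₂) / (x₁ - x₂)) ((x₁ - x₃) / (x₁ - x₂)) (x₃ / (x₁ - x₂)) := by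
    have e1 : (z + x₁ - x₂) / (x₁ - x₂) = z / (x₁ - x₂) + ((1 : ℤ) : ℂ) := by
      push_cast
      field_simp
      ring
    have e2 : (x₁ - x₃) / (x₁ - x₂) = (x₂ - x₃) / (x₁ - x₂) + ((1 : ℤ) : ℂ) := by
      push_cast
      field_simp
      ring
    rw [e1, e2, ellGamma_add_int, ellGamma_tau_add_int, g32]
  have k3 : g12 z x₁ x₂ x₃ =
      ellGamma ((z + x₁ - x₂) / x₃) ((x₁ - x₃) / x₃) ((x₁ - x₂) / x₃) := by
    have e1 : -x₁ / x₃ = -((x₁ - x₃) / x₃) + ((-1 : ℤ) : ℂ) := by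
      push_cast
      field_simp
      ring
    have e2 : (z - x₂) / x₃ + (x₁ - x₃) / x₃ = (z + x₁ - x₂) / x₃ + ((-1 : ℤ) : ℂ) := by
      push_cast
      field_simp
      ring
    rw [g12, e1, ellGamma_sigma_add_int, ellGamma_neg_sigma _ _ (by
      simpa [← sub_eq_add_neg] using hp.im ![1, 0, -1] ![0, 0, 1] 0 2 (by decide)), e2,
      ellGamma_add_int, inv_inv, ellGamma_symm]
  rw [← k2, ← k3, ← inv_inv (ellGamma _ _ _), ← k1] at key
  have hn : g32 z (x₁ - x₃) x₂ x₃ ≠ 0 := fun h => by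
    rw [h, inv_zero, zero_mul, zero_mul] at key
    exact Complex.exp_ne_zero _ key.symm
  have key' : g12 z x₁ x₂ x₃ * g32 z (x₁ - x₂) x₂ x₃ = g32 z (x₁ - x₃) x₂ x₃ *
      Complex.exp (-(Real.pi * Complex.I / 3 * bern₃ (z + x₁ - x₂) (x₁ - x₃) (x₁ - x₂) x₃)) := by
    rw [← key]
    field_simp
  rw [key', mul_left_comm, ← Complex.exp_add]
  have : Real.pi * Complex.I * ((2 * z - x₂) * (2 * z ^ 2 - 2 * z * x₂ - x₁ ^ 2 + x₁ * x₃
      - x₃ ^ 2 + x₂ * x₁) / (12 * (x₃ - x₁) * x₃ * (x₂ - x₁))) +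
      -(Real.pi * Complex.I / 3 * bern₃ (z + x₁ - x₂) (x₁ - x₃) (x₁ - x₂) x₃) = 0 := by
    simp only [bern₃]
    field_simp
    ring
  rw [this, Complex.exp_zero, mul_one]

/-- The modular property with periods `x₁ - x₃`, `x₂ - x₃`, `x₁` at the point `x₂ - z + x₁ - x₃`.
The sign of `z` is reversed because the reflection formula enters. -/
theorem g12_e31 (hp : Gen (z, ![x₁, x₂, x₃])) : g12 z x₁ x₂ (x₃ - x₁) =
    Complex.exp (Real.pi * Complex.I * ((2 * z - x₂) * (2 * z ^ 2 - 2 * z * x₂ + x₂ * x₃ - x₁ ^ 2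
      + x₁ * x₃ - x₃ ^ 2) / (12 * x₁ * (x₂ - x₃) * (x₃ - x₁)))) *
    (g32 z x₁ x₂ x₃ * g12 z x₁ x₂ (x₃ - x₂)) := by
  have h1 := hp.x₁_ne
  have h23 := hp.x₂₃_ne
  have h23' : x₃ - x₂ ≠ 0 := by rwa [← neg_ne_zero, neg_sub]
  have h13 := hp.x₁₃_ne
  have h13' : x₃ - x₁ ≠ 0 := by rwa [← neg_ne_zero, neg_sub]
  have ht := hp.triple₂
  have key := ht.ellGamma_modular (z := x₂ - z + x₁ - x₃) fun a b c h => by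
    refine hp.z_ne_add (1 - a - c) (1 - b) (a + b - 1) ?_
    push_cast
    linear_combination -h
  have k1 : g12 z x₁ x₂ (x₃ - x₁) = (ellGamma ((x₂ - z + x₁ - x₃) / (x₁ - x₃))
      ((x₂ - x₃) / (x₁ - x₃)) (x₁ / (x₁ - x₃)))⁻¹ := by
    have e1 : (x₁ - x₂) / (x₃ - x₁) = (x₂ - x₃) / (x₁ - x₃) + ((-1 : ℤ) : ℂ) := by
      push_cast
      field_simp
      ring
    have e2 : (z - x₂) / (x₃ - x₁) = (x₂ - z + x₁ - x₃) / (x₁ - x₃) + ((-1 : ℤ) : ℂ) := by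
      push_cast
      field_simp
      ring
    have e3 : -x₁ / (x₃ - x₁) = x₁ / (x₁ - x₃) := by
      field_simp
      ring
    rw [g12, e1, e2, e3, ellGamma_add_int, ellGamma_tau_add_int]
  have k2 : g12 z x₁ x₂ (x₃ - x₂) =
      ellGamma ((x₂ - z + x₁ - x₃) / (x₂ - x₃)) ((x₁ - x₃) / (x₂ - x₃)) (x₁ / (x₂ - x₃)) := by
    have e1 : (x₁ - x₂) / (x₃ - x₂) = -((x₁ - x₃) / (x₂ - x₃)) + ((1 : ℤ) : ℂ) := by
      push_cast
      field_simp
      ring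
    have e2 : (z - x₂) / (x₃ - x₂) + (x₁ - x₃) / (x₂ - x₃) =
        (x₂ - z + x₁ - x₃) / (x₂ - x₃) := by
      field_simp
      ring
    have e3 : -x₁ / (x₃ - x₂) = x₁ / (x₂ - x₃) := by
      field_simp
      ring
    rw [g12, e1, e3, ellGamma_tau_add_int, ellGamma_symm, ellGamma_neg_sigma _ _ (by
      simpa [← sub_eq_add_neg] using hp.im ![1, 0, -1] ![0, 1, -1] 0 1 (by decide)), e2,
      ellGamma_symm, inv_inv]
  have k3 : g32 z x₁ x₂ x₃ =
      ellGamma ((x₂ - z + x₁ - x₃) / x₁) ((x₁ - x₃) / x₁) ((x₂ - x₃) / x₁) := by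
    have e1 : x₃ / x₁ = -((x₁ - x₃) / x₁) + ((1 : ℤ) : ℂ) := by
      push_cast
      field_simp
      ring
    have e2 : (x₂ - x₃) / x₁ + (x₁ - x₃) / x₁ - (z / x₁ + (x₁ - x₃) / x₁) =
        (x₂ - z + x₁ - x₃) / x₁ + ((-1 : ℤ) : ℂ) := by
      push_cast
      field_simp
      ring
    rw [g32, e1, ellGamma_sigma_add_int, ellGamma_neg_sigma _ _ (by
      simpa [← sub_eq_add_neg] using hp.im ![1, 0, -1] ![1, 0, 0] 0 2 (by decide)),
      ← ellGamma_refl, e2, ellGamma_add_int, ellGamma_symm]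
  rw [← k2, ← k3, ← inv_inv (ellGamma _ _ _), ← k1] at key
  have hn : g12 z x₁ x₂ (x₃ - x₁) ≠ 0 := fun h => by
    rw [h, inv_zero, zero_mul, zero_mul] at key
    exact Complex.exp_ne_zero _ key.symm
  have key' : g32 z x₁ x₂ x₃ * g12 z x₁ x₂ (x₃ - x₂) = g12 z x₁ x₂ (x₃ - x₁) *
      Complex.exp (-(Real.pi * Complex.I / 3 *
        bern₃ (x₂ - z + x₁ - x₃) (x₁ - x₃) (x₂ - x₃) x₁)) := by
    rw [← key]
    field_simp
  rw [key', mul_left_comm, ← Complex.exp_add]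
  have : Real.pi * Complex.I * ((2 * z - x₂) * (2 * z ^ 2 - 2 * z * x₂ + x₂ * x₃ - x₁ ^ 2
      + x₁ * x₃ - x₃ ^ 2) / (12 * x₁ * (x₂ - x₃) * (x₃ - x₁))) +
      -(Real.pi * Complex.I / 3 * bern₃ (x₂ - z + x₁ - x₃) (x₁ - x₃) (x₂ - x₃) x₁) = 0 := by
    simp only [bern₃]
    field_simp
    ring
  rw [this, Complex.exp_zero, mul_one]

/-- The two three-term relations have the same left side, so the products on their right sides
differ by the quotient of the two phases. -/
theorem g12_mul_g32_e12 (hp : Gen (z, ![x₁, x₂, x₃])) :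
    g12 z x₁ x₂ x₃ * g32 z (x₁ - x₂) x₂ x₃ =
    Complex.exp (Real.pi * Complex.I * L1232 z x₁ x₂ x₃) *
      (g32 z x₁ x₂ x₃ * g12 z x₁ x₂ (x₃ - x₂)) := by
  have h1 := hp.x₁_ne
  have h3 := hp.x₃_ne
  have h23 := hp.x₂₃_ne
  have h13 := hp.x₁₃_ne
  have h13' : x₃ - x₁ ≠ 0 := by rwa [← neg_ne_zero, neg_sub]
  have h12 := hp.x₁₂_ne
  have h12' : x₂ - x₁ ≠ 0 := by rwa [← neg_ne_zero, neg_sub]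
  have k1 := g32_e13 hp
  rw [g32_e13_eq_g12_e31 hp.x₁₃_ne, g12_e31 hp] at k1
  refine mul_left_cancel₀ (Complex.exp_ne_zero _) (k1.symm.trans ?_)
  rw [← mul_assoc (Complex.exp _) (Complex.exp _), ← Complex.exp_add]
  congr 2
  simp only [L1232]
  field_simp
  ring

end

end
end EllipticGamma

namespace EllipticGamma
noncomputable section

/-! ### The homomorphism `E → N ⋊ G` -/

/-- The formula for `u(e_{i,j})`. -/
def valE (i j : Fin 3) (p : X) : ℂ :=
  if (i, j) = (0, 1) then g12 p.1 (p.2 0) (p.2 1) (p.2 2)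
  else if (i, j) = (2, 1) then g32 p.1 (p.2 0) (p.2 1) (p.2 2)
  else 1

/-- The formula for `u(t_i)`. -/
def valT (i : Fin 3) (p : X) : ℂ := if i = 1 then g2 p.1 (p.2 0) (p.2 1) (p.2 2) else 1

theorem exists_valE (i j : Fin 3) : ∃ n : N, Represents n (valE i j) := by
  by_cases h1 : (i, j) = (0, 1)
  · rw [show valE i j = f12 from funext fun p => if_pos h1]
    exact exists_f12
  by_cases h2 : (i, j) = (2, 1)
  · rw [show valE i j = f32 from funext fun p => (if_neg h1).trans (if_pos h2)]
    exact exists_f32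
  · rw [show valE i j = fun _ => 1 from funext fun p => (if_neg h1).trans (if_neg h2)]
    exact ⟨1, InvPair.one, rfl, fun _ _ => rfl⟩

theorem exists_valT (i : Fin 3) : ∃ n : N, Represents n (valT i) := by
  by_cases h1 : i = 1
  · rw [show valT i = f2 from funext fun p => if_pos h1]
    exact exists_f2
  · rw [show valT i = fun _ => 1 from funext fun p => if_neg h1]
    exact ⟨1, InvPair.one, rfl, fun _ _ => rfl⟩

theorem update_zero_vec {a b c d : ℂ} : Function.update ![a, b, c] 0 d = ![d, b, c] := by
  funext i; fin_cases i <;> rfl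

theorem update_one_vec {a b c d : ℂ} : Function.update ![a, b, c] 1 d = ![a, d, c] := by
  funext i; fin_cases i <;> rfl

theorem update_two_vec {a b c d : ℂ} : Function.update ![a, b, c] 2 d = ![a, b, d] := by
  funext i; fin_cases i <;> rfl

theorem X.eta (p : X) : p = (p.1, ![p.2 0, p.2 1, p.2 2]) :=
  Prod.ext rfl (funext fun i => by fin_cases i <;> rfl)

/-- After the choice of indices, only the pair of `(0, 1)` and `(2, 1)`, in either order, involves a
genuine three-term relation. The other cases are trivial or follow from integer shifts. -/
theorem valE_ee_comm {p : X} (hp : Gen p) (i j k l : Fin 3) (hij : i ≠ j) (hkl : k ≠ l)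
    (hjk : j ≠ k) (hil : i ≠ l) : valE i j p * valE k l ((G.e i j hij)⁻¹ • p) =
      Complex.exp (Real.pi * Complex.I * Lee i j k l p) *
        (valE k l p * valE i j ((G.e k l hkl)⁻¹ • p)) := by
  rw [X.eta p] at hp ⊢
  generalize p.1 = z, p.2 0 = x₁, p.2 1 = x₂, p.2 2 = x₃ at hp ⊢
  have h1 := hp.x₁_ne
  have h3 := hp.x₃_ne
  have key := g12_mul_g32_e12 hp
  have key' : g32 z x₁ x₂ x₃ * g12 z x₁ x₂ (x₃ - x₂) =
      Complex.exp (-(Real.pi * Complex.I * L1232 z x₁ x₂ x₃)) *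
      (g12 z x₁ x₂ x₃ * g32 z (x₁ - x₂) x₂ x₃) := by
    rw [key, ← mul_assoc, ← Complex.exp_add, neg_add_cancel, Complex.exp_zero, one_mul]
  fin_cases i <;> fin_cases j <;> fin_cases k <;> fin_cases l <;>
    first
    | exact absurd rfl hij
    | exact absurd rfl hkl
    | exact absurd rfl hjk
    | exact absurd rfl hil
    | (simp [valE, Lee, e_inv_smul, update_zero_vec, update_two_vec, g12_e13 h3, g32_e31 h1]
       done)
    | (simp [valE, Lee, e_inv_smul, update_zero_vec, update_two_vec, key]
       done)
    | (simp [valE, Lee, e_inv_smul, update_zero_vec, update_two_vec, key'])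

theorem valE_ee {p : X} (hp : Gen p) (i j k : Fin 3) (hij : i ≠ j) (hjk : j ≠ k) (hik : i ≠ k) :
    valE i j p * valE j k ((G.e i j hij)⁻¹ • p) =
      Complex.exp (Real.pi * Complex.I * Lee i j j k p) *
        (valE i k p * valE j k ((G.e i k hik)⁻¹ • p) *
          valE i j ((G.e j k hjk)⁻¹ • (G.e i k hik)⁻¹ • p)) := by
  rw [X.eta p] at hp ⊢
  generalize p.1 = z, p.2 0 = x₁, p.2 1 = x₂, p.2 2 = x₃ at hp ⊢
  have h1 := hp.x₁_ne
  have h3 := hp.x₃_ne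
  have k1 := g12_e31 hp
  have k2 := g32_e13 hp
  fin_cases i <;> fin_cases j <;> fin_cases k <;>
    first
    | exact absurd rfl hij
    | exact absurd rfl hjk
    | exact absurd rfl hik
    | (simp [valE, Lee, e_inv_smul, update_zero_vec, update_one_vec, update_two_vec,
        g12_e13_e23 h3, g32_e31_e21 h1, k1, k2])

theorem valT_tt {p : X} (hp : Gen p) (i j : Fin 3) : valT i p * valT j ((G.t i)⁻¹ • p) =
      Complex.exp (Real.pi * Complex.I * Ltt i j p) * (valT j p * valT i ((G.t j)⁻¹ • p)) := by
  rw [X.eta p] at hp ⊢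
  generalize p.1 = z, p.2 0 = x₁, p.2 1 = x₂, p.2 2 = x₃ at hp ⊢
  have h1 := hp.x₁_ne
  have k1 := g2_sub_x₃ hp
  fin_cases i <;> fin_cases j <;>
    simp [valT, Ltt, t_inv_smul, g2_sub_x₁ h1, k1, ← mul_assoc, ← Complex.exp_add]

theorem valE_et_comm {p : X} (hp : Gen p) (i j k : Fin 3) (hij : i ≠ j) (hik : i ≠ k) :
    valE i j p * valT k ((G.e i j hij)⁻¹ • p) =
      Complex.exp (Real.pi * Complex.I * Let i j k p) *
        (valT k p * valE i j ((G.t k)⁻¹ • p)) := by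
  rw [X.eta p] at hp ⊢
  generalize p.1 = z, p.2 0 = x₁, p.2 1 = x₂, p.2 2 = x₃ at hp ⊢
  have h1 := hp.x₁_ne
  have h3 := hp.x₃_ne
  have k1 := g12_mul_g2_e12 hp
  have k2 := g2_e13 hp
  have k3 := g32_mul_g2_e32 hp
  fin_cases i <;> fin_cases j <;> fin_cases k <;>
    first
    | exact absurd rfl hij
    | exact absurd rfl hik
    | (simp [valE, valT, Let, e_inv_smul, t_inv_smul, update_zero_vec, update_two_vec,
        g12_sub_x₃ h3, g32_sub_x₁ h1, g2_e31 h1, k1, k2, k3])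

theorem valE_et {p : X} (hp : Gen p) (i j : Fin 3) (hij : i ≠ j) :
    valT j p * valE i j ((G.t j)⁻¹ • p) * valT i ((G.e i j hij)⁻¹ • (G.t j)⁻¹ • p) =
      Complex.exp (Real.pi * Complex.I * Let i j i p) *
        (valT i p * valE i j ((G.t i)⁻¹ • p)) := by
  rw [X.eta p] at hp ⊢
  generalize p.1 = z, p.2 0 = x₁, p.2 1 = x₂, p.2 2 = x₃ at hp ⊢
  have h1 := hp.x₁_ne
  have h3 := hp.x₃_ne
  have k1 := g2_mul_g12 hp
  have k3 := g2_mul_g32 hp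
  have k4 : -(Real.pi * Complex.I * bern₂ (z - x₂) x₁ x₃) = Real.pi * Complex.I *
    ((-6 * z ^ 2 + 6 * (x₁ + x₃ + 2 * x₂) * z - x₃ ^ 2 - 6 * x₂ * x₁ - 3 * x₁ * x₃ - 6 * x₂ * x₃
      - 6 * x₂ ^ 2 - x₁ ^ 2) / (6 * x₁ * x₃)) := by
    simp only [bern₂]
    field_simp
    ring
  rw [k4] at k1
  fin_cases i <;> fin_cases j <;>
    first
    | exact absurd rfl hij
    | (simp [valE, valT, Let, e_inv_smul, t_inv_smul, update_one_vec, g2_sub_sub, k3]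
       done)
    | (simp [valE, valT, Let, t_inv_smul]
       simpa using k1)

end
end EllipticGamma

/-! ### The component in `N` of an element of `E`. -/

namespace EllipticGamma
noncomputable section

/-- The semidirect product `N ⋊ G`. -/
abbrev NG : Type := N ⋊[MulDistribMulAction.toMulAut G N] G

theorem NG.mul_left (x y : NG) : (x * y).left = x.left * x.right • y.left := rfl

/-- The images in `N ⋊ G` of the generators of `E`. -/
def EGen.toNG : EGen → NG
  | e i j _ => ⟨(exists_valE i j).choose, G.e i j ‹_›⟩
  | t i => ⟨(exists_valT i).choose, G.t i⟩
  | m φ => ⟨φ, 1⟩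

namespace EGen

theorem rep_e (i j : Fin 3) (h : i ≠ j) : Rep (toNG (e i j h)).left (valE i j) :=
  Represents.rep (exists_valE i j).choose_spec

theorem rep_t (i : Fin 3) : Rep (toNG (t i)).left (valT i) :=
  Represents.rep (exists_valT i).choose_spec

theorem lift_toNG_right (x : FreeGroup EGen) :
    (FreeGroup.lift toNG x).right = FreeGroup.lift toG x := by
  have : (SemidirectProduct.rightHom.comp (FreeGroup.lift toNG) : FreeGroup EGen →* G) =
      FreeGroup.lift toG := by
    refine FreeGroup.ext_hom _ _ fun x => ?_
    cases x <;> simp [toNG, toG]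
  exact DFunLike.congr_fun this x

theorem toNG_e_left_eq_one {i j : Fin 3} (h : i ≠ j) (hj : j ≠ 1) : (toNG (e i j h)).left = 1 :=
  Subtype.ext <| (rep_e i j h).eq Rep.one fun p _ => by simp [valE, hj]

/-- The components in `G` agree by `toG_rel`. The components in `N` are compared at generic points,
where the required equations are those of the preceding section. -/
theorem toNG_rel {l r : FreeGroup EGen} (h : IsRel l r) :
    FreeGroup.lift toNG l = FreeGroup.lift toNG r := by
  refine SemidirectProduct.ext ?_ (by rw [lift_toNG_right, lift_toNG_right, toG_rel h])
  cases h with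
  | mul φ ψ => simp [toNG]
  | em i j h φ =>
    simp only [map_mul, FreeGroup.lift_apply_of, NG.mul_left]
    rw [mul_comm]
    simp [toNG, M.coe_smul]
  | tm i φ =>
    simp only [map_mul, FreeGroup.lift_apply_of, NG.mul_left]
    rw [mul_comm]
    simp [toNG, M.coe_smul]
  | ee_comm i j k l hij hkl hjk hil φ hφ =>
    simp only [map_mul, FreeGroup.lift_apply_of, NG.mul_left]
    refine Subtype.ext <| ((rep_e i j hij).mul ((rep_e k l hkl).smul _)).eq
      ((hφ.rep.mul ((rep_e k l hkl).smul 1)).mul ((rep_e i j hij).smul _)) fun p hp => ?_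
    have := valE_ee_comm hp i j k l hij hkl hjk hil
    simp only [SemidirectProduct.mul_right, toNG, one_mul, inv_one, one_smul, mul_assoc] at this ⊢
    exact this
  | ee i j k hij hjk hik φ hφ =>
    simp only [map_mul, FreeGroup.lift_apply_of, NG.mul_left]
    refine Subtype.ext <| ((rep_e i j hij).mul ((rep_e j k hjk).smul _)).eq
      (((hφ.rep.mul ((rep_e i k hik).smul 1)).mul ((rep_e j k hjk).smul _)).mul
        ((rep_e i j hij).smul _)) fun p hp => ?_
    have := valE_ee hp i j k hij hjk hik
    simp only [SemidirectProduct.mul_right, toNG, one_mul, inv_one, one_smul, mul_assoc,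
      mul_inv_rev, mul_smul] at this ⊢
    exact this
  | w =>
    -- Both generators in this relation have trivial component in `N`, so it reduces to the relation
    -- in `G`.
    have h1 : toNG (e 0 2 (by decide)) = SemidirectProduct.inr (G.e 0 2 (by decide)) :=
      SemidirectProduct.ext (toNG_e_left_eq_one _ (by decide)) rfl
    have h2 : toNG (e 2 0 (by decide)) = SemidirectProduct.inr (G.e 2 0 (by decide)) :=
      SemidirectProduct.ext (toNG_e_left_eq_one _ (by decide)) rfl
    simp only [map_pow, map_mul, map_inv, map_one, FreeGroup.lift_apply_of, h1, h2]
    simp only [← map_mul, ← map_inv, ← map_pow]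
    rfl
  | tt i j φ hφ =>
    simp only [map_mul, FreeGroup.lift_apply_of, NG.mul_left]
    refine Subtype.ext <| ((rep_t i).mul ((rep_t j).smul _)).eq
      ((hφ.rep.mul ((rep_t j).smul 1)).mul ((rep_t i).smul _)) fun p hp => ?_
    have := valT_tt hp i j
    simp only [SemidirectProduct.mul_right, toNG, one_mul, inv_one, one_smul, mul_assoc] at this ⊢
    exact this
  | et_comm i j k hij hik φ hφ =>
    simp only [map_mul, FreeGroup.lift_apply_of, NG.mul_left]
    refine Subtype.ext <| ((rep_e i j hij).mul ((rep_t k).smul _)).eq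
      ((hφ.rep.mul ((rep_t k).smul 1)).mul ((rep_e i j hij).smul _)) fun p hp => ?_
    have := valE_et_comm hp i j k hij hik
    simp only [SemidirectProduct.mul_right, toNG, one_mul, inv_one, one_smul, mul_assoc] at this ⊢
    exact this
  | et i j hij φ hφ =>
    simp only [map_mul, FreeGroup.lift_apply_of, NG.mul_left]
    refine Subtype.ext <| (((rep_t j).mul ((rep_e i j hij).smul _)).mul ((rep_t i).smul _)).eq
      ((hφ.rep.mul ((rep_t i).smul 1)).mul ((rep_e i j hij).smul _)) fun p hp => ?_
    have := valE_et hp i j hij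
    simp only [SemidirectProduct.mul_right, toNG, one_mul, inv_one, one_smul, mul_assoc,
      mul_inv_rev, mul_smul] at this ⊢
    exact this

theorem toNG_rels : ∀ x ∈ rels, FreeGroup.lift toNG x = 1 := by
  rintro _ ⟨l, r, h, rfl⟩
  rw [map_mul, map_inv, toNG_rel h, mul_inv_cancel]

end EGen

namespace E

/-- The homomorphism `E → N ⋊ G` that is the inclusion on `M` and the projection to `G`. -/
def toNG : E →* NG := PresentedGroup.toGroup (f := EGen.toNG) EGen.toNG_rels

theorem toNG_e (i j : Fin 3) (h : i ≠ j) : toNG (e i j h) = EGen.toNG (.e i j h) :=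
  PresentedGroup.toGroup.of _

theorem toNG_t (i : Fin 3) : toNG (t i) = EGen.toNG (.t i) := PresentedGroup.toGroup.of _

theorem toNG_ofM (φ : M) : toNG (ofM φ) = ⟨φ, 1⟩ := PresentedGroup.toGroup.of _

theorem toNG_right (x : E) : (toNG x).right = proj x := by
  induction x using E.induction with
  | he i j h => rw [toNG_e, proj_e]; rfl
  | ht i => rw [toNG_t, proj_t]; rfl
  | hm φ => rw [toNG_ofM, proj_ofM]
  | mul a b ha hb => rw [map_mul, map_mul, SemidirectProduct.mul_right, ha, hb]
  | inv a ha => rw [map_inv, map_inv, SemidirectProduct.inv_right, ha]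

/-- The component in `N` of the image of an element of `E`. -/
def val (x : E) : N := (toNG x).left

theorem val_mul (x y : E) : val (x * y) = val x * proj x • val y := by
  rw [val, map_mul, NG.mul_left, toNG_right]
  rfl

theorem val_ofM (φ : M) : val (ofM φ) = φ := by rw [val, toNG_ofM]

theorem val_one : val 1 = 1 := by rw [val, map_one]; rfl

theorem val_ofM_mul (φ : M) (x : E) : val (ofM φ * x) = φ * val x := by
  rw [val_mul, val_ofM, proj_ofM, one_smul]

theorem val_mul_inv (x : E) : proj x • val x⁻¹ = (val x)⁻¹ :=
  eq_inv_of_mul_eq_one_right (by rw [← val_mul, mul_inv_cancel, val_one])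

theorem rep_e (i j : Fin 3) (h : i ≠ j) : Rep (val (e i j h)) (valE i j) := by
  rw [val, toNG_e]
  exact EGen.rep_e i j h

theorem rep_t (i : Fin 3) : Rep (val (t i)) (valT i) := by
  rw [val, toNG_t]
  exact EGen.rep_t i

theorem ofM_injective : Function.Injective ofM := fun φ ψ h => by
  have := congrArg val h
  rw [val_ofM, val_ofM] at this
  exact Subtype.ext this

/-- Two elements over the same element of `G` differ by an element of `M`, and `val` sees it because
`val` is the inclusion on `M`. -/
theorem ext_val {x y : E} (hp : proj x = proj y) (hv : val x = val y) : x = y := by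
  have : x * y⁻¹ ∈ proj.ker := by rw [MonoidHom.mem_ker, map_mul, map_inv, hp, mul_inv_cancel]
  rw [ker_proj] at this
  obtain ⟨φ, hφ⟩ := this
  have hx : x = ofM φ * y := by rw [hφ, inv_mul_cancel_right]
  have h1 : (φ : N) = 1 := by
    rw [hx, val_ofM_mul] at hv
    exact mul_eq_right.1 hv
  rw [hx, show φ = 1 from Subtype.ext h1, map_one, one_mul]

end E

end
end EllipticGamma

namespace EllipticGamma
noncomputable section

/-! ### Classes of 2-cocycles -/

section Class

variable {H A : Type} [Group H] [CommGroup A] [MulDistribMulAction H A] {φ ψ : H × H → A}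

theorem classOf_eq_zero_iff (hφ : IsMulCocycle₂ φ) : classOf hφ = 0 ↔ IsMulCoboundary₂ φ := by
  refine (H2π_eq_zero_iff _).trans ⟨?_, ?_⟩
  · exact fun h => isMulCoboundary₂_of_mem_coboundaries₂ _ h
  · exact fun h => (coboundariesOfIsMulCoboundary₂ h).2

theorem classOf_eq_of_coboundary (hφ : IsMulCocycle₂ φ) (hψ : IsMulCocycle₂ ψ) (x : H → A)
    (h : ∀ g k, φ (g, k) = ψ (g, k) * (g • x k / x (g * k) * x g)) : classOf hφ = classOf hψ := by
  refine (H2π_eq_iff _ _).2 ?_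
  have : IsMulCoboundary₂ fun y => φ y / ψ y :=
    ⟨x, fun g k => (div_eq_of_eq_mul' (h g k)).symm⟩
  exact (coboundariesOfIsMulCoboundary₂ this).2

theorem IsMulCocycle₂.restrict (hφ : IsMulCocycle₂ φ) (K : Subgroup H) :
    IsMulCocycle₂ fun y : K × K => φ (y.1, y.2) := fun g h j => hφ g h j

theorem restrict_classOf (hφ : IsMulCocycle₂ φ) (K : Subgroup H) :
    restrict K (classOf hφ) = classOf (IsMulCocycle₂.restrict hφ K) := by
  have := H2π_comp_map_apply (A := Rep.ofMulDistribMulAction H A)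
    (B := Rep.ofMulDistribMulAction K A) K.subtype
    (CategoryTheory.CategoryStruct.id (Rep.res K.subtype (Rep.ofMulDistribMulAction H A)))
    (cocyclesOfIsMulCocycle₂ hφ)
  exact this

theorem restrict_ne_zero_of_le (hφ : IsMulCocycle₂ φ) {K L : Subgroup H} (hKL : K ≤ L)
    (h : restrict K (classOf hφ) ≠ 0) : restrict L (classOf hφ) ≠ 0 := by
  rw [restrict_classOf, Ne, classOf_eq_zero_iff] at h ⊢
  rintro ⟨x, hx⟩
  exact h ⟨fun g => x ⟨g, hKL g.2⟩, fun g k => hx ⟨g, hKL g.2⟩ ⟨k, hKL k.2⟩⟩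

end Class

/-! ### The cocycle `u` -/

/-- The cocycle `u`. -/
def gammaCocycle (g : G) : N ⧸ M := (E.val (Function.surjInv E.proj_surjective g) : N)

/-- The class of `val` modulo `M` does not depend on the preimage in `E`, since preimages differ by
elements of `M`. -/
theorem gammaCocycle_proj (x : E) : gammaCocycle (E.proj x) = (E.val x : N) := by
  set y := Function.surjInv E.proj_surjective (E.proj x) with hy
  have h : y⁻¹ * x ∈ E.proj.ker := by
    rw [MonoidHom.mem_ker, map_mul, map_inv, hy,
      Function.surjInv_eq E.proj_surjective, inv_mul_cancel]
  rw [E.ker_proj, ← E.range_ofM_normal.mem_comm_iff] at h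
  obtain ⟨φ, hφ⟩ := h
  have hx : x = E.ofM φ * y := by rw [hφ, inv_mul_cancel_right]
  change ((E.val y : N) : N ⧸ M) = _
  rw [hx, E.val_ofM_mul, QuotientGroup.mk_mul, (QuotientGroup.eq_one_iff _).2 φ.2, one_mul]

theorem isMulCocycle₁_gammaCocycle : IsMulCocycle₁ gammaCocycle := by
  intro g h
  obtain ⟨x, rfl⟩ := E.proj_surjective g
  obtain ⟨y, rfl⟩ := E.proj_surjective h
  rw [← map_mul, gammaCocycle_proj, gammaCocycle_proj, gammaCocycle_proj, E.val_mul,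
    QuotientGroup.mk_mul, smul_mk, mul_comm]

theorem E.represents_e (i j : Fin 3) (h : i ≠ j) : Represents (E.val (E.e i j h)) (valE i j) := by
  rw [E.val, E.toNG_e]
  exact (exists_valE i j).choose_spec

theorem E.represents_t (i : Fin 3) : Represents (E.val (E.t i)) (valT i) := by
  rw [E.val, E.toNG_t]
  exact (exists_valT i).choose_spec

theorem E.val_e_eq_one {i j : Fin 3} (h : i ≠ j) (hj : j ≠ 1) : E.val (E.e i j h) = 1 :=
  Subtype.ext <| (E.rep_e i j h).eq Rep.one fun p _ => by simp [valE, hj]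

theorem E.val_t_eq_one {i : Fin 3} (hi : i ≠ 1) : E.val (E.t i) = 1 :=
  Subtype.ext <| (E.rep_t i).eq Rep.one fun p _ => by simp [valT, hi]

theorem isGammaCocycle_gammaCocycle : IsGammaCocycle gammaCocycle where
  cocycle := isMulCocycle₁_gammaCocycle
  e12 := ⟨_, (congrArg gammaCocycle (E.proj_e _ _ _)).symm.trans (gammaCocycle_proj _), E.represents_e 0 1 (by decide)⟩
  e32 := ⟨_, (congrArg gammaCocycle (E.proj_e _ _ _)).symm.trans (gammaCocycle_proj _), E.represents_e 2 1 (by decide)⟩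
  e_eq_one i j h hj := by
    rw [← E.proj_e, gammaCocycle_proj, E.val_e_eq_one h hj]
    rfl
  t2 := ⟨_, by rw [← E.proj_t, gammaCocycle_proj], E.represents_t 1⟩
  t_eq_one j hj := by
    rw [← E.proj_t, gammaCocycle_proj, E.val_t_eq_one hj]
    rfl

/-- The cocycle rule determines the values on products; on an inverse it determines them because
each group element acts injectively on `N ⧸ M`. -/
theorem IsMulCocycle₁.eq_of_eqOn_closure {u v : G → N ⧸ M} (hu : IsMulCocycle₁ u)
    (hv : IsMulCocycle₁ v) {S : Set G} (hS : Subgroup.closure S = ⊤) (h : Set.EqOn u v S) :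
    u = v := by
  have h1 : u 1 = v 1 := by rw [map_one_of_isMulCocycle₁ hu, map_one_of_isMulCocycle₁ hv]
  funext g
  have hg : g ∈ Subgroup.closure S := hS ▸ Subgroup.mem_top g
  induction hg using Subgroup.closure_induction with
  | mem g hg => exact h hg
  | one => exact h1
  | mul a b _ _ ha hb => rw [hu, hv, ha, hb]
  | inv a _ ha =>
    have h2 := hu a a⁻¹
    have h3 := hv a a⁻¹
    rw [mul_inv_cancel, ha] at h2
    rw [mul_inv_cancel, ← h1, h2] at h3
    exact MulAction.injective a (mul_right_cancel h3)

theorem Represents.eq {n m : N} {F : X → ℂ} (hn : Represents n F) (hm : Represents m F) : n = m :=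
  Subtype.ext (hn.rep.eq hm.rep fun _ _ => rfl)

theorem IsGammaCocycle.unique {u v : G → N ⧸ M} (hu : IsGammaCocycle u) (hv : IsGammaCocycle v) :
    u = v := by
  refine IsMulCocycle₁.eq_of_eqOn_closure hu.cocycle hv.cocycle G.closure_eq_top ?_
  rintro _ (⟨i, j, h, rfl⟩ | ⟨i, rfl⟩)
  · by_cases hj : j = 1
    · subst hj
      obtain rfl | rfl : i = 0 ∨ i = 2 := by
        revert i
        decide
      · obtain ⟨n, hn, hr⟩ := hu.e12
        obtain ⟨m, hm, hs⟩ := hv.e12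
        rw [hn, hm, hr.eq hs]
      · obtain ⟨n, hn, hr⟩ := hu.e32
        obtain ⟨m, hm, hs⟩ := hv.e32
        rw [hn, hm, hr.eq hs]
    · rw [hu.e_eq_one i j h hj, hv.e_eq_one i j h hj]
  · by_cases hi : i = 1
    · subst hi
      obtain ⟨n, hn, hr⟩ := hu.t2
      obtain ⟨m, hm, hs⟩ := hv.t2
      rw [hn, hm, hr.eq hs]
    · rw [hu.t_eq_one i hi, hv.t_eq_one i hi]

/-! ### The extension `D̂₄` -/

namespace D4hat

theorem proj_surjective : Function.Surjective proj := by
  rintro ⟨g, hg⟩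
  obtain ⟨x, rfl⟩ := E.proj_surjective g
  exact ⟨⟨x, hg⟩, rfl⟩

/-- The extension `1 → M → D̂₄ → D₄ → 1`. -/
def extension : GroupExtension M D4hat G.D4 where
  inl := ofM
  rightHom := proj
  inl_injective φ ψ h := E.ofM_injective (congrArg Subtype.val h)
  range_inl_eq_ker_rightHom := by
    ext x
    have : x ∈ proj.ker ↔ (x : E) ∈ E.proj.ker := by
      rw [MonoidHom.mem_ker, MonoidHom.mem_ker, Subtype.ext_iff]
      rfl
    rw [this, E.ker_proj]
    exact exists_congr fun φ => Subtype.ext_iff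
  rightHom_surjective := proj_surjective

theorem isModuleExtension : IsModuleExtension extension := fun x m =>
  Subtype.ext (E.conj_ofM (x : E) m).symm

/-- Applying `val` to `s(g) s(h) = φ(g, h) s(gh)` exhibits the factor set as the coboundary of `val
∘ s`. The chosen lift of `u` differs from `val ∘ s` by a cochain `x` with values in `M`, so the two
cocycles differ by the coboundary of `x`. -/
theorem restrict_connecting {u : G → N ⧸ M} (hu : IsGammaCocycle u) :
    restrict G.D4 (connecting hu.cocycle) = charClass extension isModuleExtension := by
  obtain rfl : u = gammaCocycle := hu.unique isGammaCocycle_gammaCocycle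
  set s : G.D4 → E := fun g => ((extSection extension g : D4hat) : E) with hs
  have hps : ∀ g, E.proj (s g) = g := fun g =>
    congrArg Subtype.val (rightHom_extSection extension g)
  have hx : ∀ g : G.D4, ∃ m : M, lift gammaCocycle g = m * E.val (s g) := by
    intro g
    have h1 := mk_lift gammaCocycle g
    rw [← hps g, gammaCocycle_proj, hps g, eq_comm, QuotientGroup.eq] at h1
    exact ⟨⟨_, h1⟩, by simp [mul_comm]⟩
  choose x hx using hx
  rw [connecting, restrict_classOf, charClass]
  refine classOf_eq_of_coboundary _ _ x fun g h => Subtype.ext ?_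
  have hf := congrArg (fun y : D4hat => E.val (y : E)) (factorSet_spec extension g h)
  change E.val (s g * s h) = E.val (E.ofM _ * s (g * h)) at hf
  rw [E.val_mul, E.val_ofM_mul, hps] at hf
  change lift gammaCocycle g * (g : G) • lift gammaCocycle h *
    (lift gammaCocycle ((g * h : G.D4) : G))⁻¹ = _
  rw [hx g, hx h, hx (g * h), smul_mul', mul_mul_mul_comm, hf]
  simp only [Subgroup.coe_mul, div_eq_mul_inv, mul_inv]
  change _ = _ * ((g : G) • (x h : N) * _ * _)
  have : ∀ a b c d e : N, a * b * (d * e) * (c⁻¹ * e⁻¹) = d * (b * c⁻¹ * a) := by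
    intro a b c d e
    calc _ = (e * e⁻¹) * (d * (b * c⁻¹ * a)) := by
          simp only [mul_comm, mul_left_comm, mul_assoc]
      _ = _ := by rw [mul_inv_cancel, one_mul]
  exact this _ _ _ _ _

end D4hat

end
end EllipticGamma

namespace EllipticGamma
noncomputable section

/-! ### The lifts of `a` and `b` -/

namespace G

/-- `e₂₁⁻¹ e₁₂ e₂₁⁻¹`. -/
def s : G := (e 1 0 (by decide))⁻¹ * e 0 1 (by decide) * (e 1 0 (by decide))⁻¹

theorem s_eq : s = ⟨⟨!![0, 1, 0; -1, 0, 0; 0, 0, 1], by decide⟩, 0⟩ := by decide +kernel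
theorem a_eq : a = ⟨⟨!![-1, 0, 0; 0, -1, 0; 0, 0, 1], by decide⟩, 0⟩ := by decide +kernel
theorem b_eq : b = ⟨⟨!![0, 0, -1; 0, 1, 0; 1, 0, 0], by decide⟩, 0⟩ := by decide +kernel
theorem a_sq : a ^ 2 = 1 := by decide +kernel
theorem b_pow : b ^ 4 = 1 := by decide +kernel
theorem bab : b * a * b = a := by decide +kernel

theorem s_inv_smul (p : X) : s⁻¹ • p = (p.1, ![-(p.2 1), p.2 0, p.2 2]) := by
  rw [inv_smul_eq_iff, s_eq, smul_def]
  refine Prod.ext (by simp) (funext fun i => ?_)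
  fin_cases i <;> simp [Fin.sum_univ_three]

theorem a_inv_smul (p : X) : a⁻¹ • p = (p.1, ![-(p.2 0), -(p.2 1), p.2 2]) := by
  rw [inv_smul_eq_iff, a_eq, smul_def]
  refine Prod.ext (by simp) (funext fun i => ?_)
  fin_cases i <;> simp [Fin.sum_univ_three]

theorem b_inv_smul (p : X) : b⁻¹ • p = (p.1, ![p.2 2, p.2 1, -(p.2 0)]) := by
  rw [inv_smul_eq_iff, b_eq, smul_def]
  refine Prod.ext (by simp) (funext fun i => ?_)
  fin_cases i <;> simp [Fin.sum_univ_three]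

theorem e_smul (i j : Fin 3) (h : i ≠ j) (p : X) :
    e i j h • p = (p.1, Function.update p.2 i (p.2 i + p.2 j)) := by
  rw [← eq_inv_smul_iff, e_inv_smul]
  simp [h.symm]

end G

/-- The phase in the definition of `â`. -/
def phaseA (p : X) : ℂ := Complex.exp (Real.pi * Complex.I / 2 *
  (p.1 ^ 2 / (p.2 0 * p.2 2) - 2 * p.1 / p.2 2 + 1 + p.2 0 / (6 * p.2 2) + p.2 2 / (6 * p.2 0)))

theorem Gen.im_div₁₃ {p : X} (hp : Gen p) : (p.2 0 / p.2 2).im ≠ 0 := by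
  rw [X.eta p] at hp
  simpa using hp.im ![1, 0, 0] ![0, 0, 1] 0 2 (by decide)

theorem theta0_mul_theta0_neg {w τ : ℂ} (h : τ.im ≠ 0) (hz : ∀ i j : ℤ, w ≠ i + j * τ) :
    theta0 w τ * theta0 w (-τ) = -cexp2 w := by
  have h0 := theta0_ne_zero h hz
  rw [theta0_neg_tau w h, theta0_add_tau h fun i hi => hz i 0 (by simpa using hi), cexp2_neg]
  have := cexp2_ne_zero w
  field_simp

/-- As `a` reverses `x₁`, the two theta functions have opposite moduli and their product is
`-e^{2πiz/x₃}`. In the product of the phases the terms odd in `x₁` cancel; what remains is the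
inverse exponential, the constant 1 in the exponent accounting for the sign. -/
theorem phaseA_mul_theta0_a {p : X} (hp : Gen p) :
    phaseA p * theta0 (p.1 / p.2 2) (p.2 0 / p.2 2) *
      (phaseA (G.a⁻¹ • p) * theta0 ((G.a⁻¹ • p).1 / (G.a⁻¹ • p).2 2)
        ((G.a⁻¹ • p).2 0 / (G.a⁻¹ • p).2 2)) = 1 := by
  have h1 := hp.x_ne 0
  have h3 := hp.x_ne 2
  have key := theta0_mul_theta0_neg (w := p.1 / p.2 2) hp.im_div₁₃ fun i j hij => by
    refine hp.z_ne_three j 0 i ?_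
    field_simp at hij
    push_cast
    linear_combination hij
  rw [G.a_inv_smul, mul_mul_mul_comm]
  simp only [Matrix.cons_val]
  have e : -cexp2 (p.1 / p.2 2) = Complex.exp (2 * Real.pi * Complex.I * (p.1 / p.2 2)
      - Real.pi * Complex.I) := by
    rw [Complex.exp_sub, Complex.exp_pi_mul_I, cexp2, div_neg, div_one]
  rw [neg_div, key, phaseA, phaseA, ← Complex.exp_add, e, ← Complex.exp_add,
    Complex.exp_eq_one_iff]
  refine ⟨0, ?_⟩
  simp only [Matrix.cons_val]
  field_simp
  ring

/-- As `b` exchanges the two periods up to sign, the two theta functions are related by the modular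
property. The variable terms of `bern₂` are absorbed by the phases; its constant term 1/2 leaves
`e^{πi/2}`. -/
theorem phaseA_mul_theta0_b {p : X} (hp : Gen p) :
    phaseA (G.b⁻¹ • p) * theta0 ((G.b⁻¹ • p).1 / (G.b⁻¹ • p).2 2)
        ((G.b⁻¹ • p).2 0 / (G.b⁻¹ • p).2 2) =
      Complex.I * (phaseA p * theta0 (p.1 / p.2 2) (p.2 0 / p.2 2)) := by
  have h1 := hp.x_ne 0
  have h3 := hp.x_ne 2
  have hi := im_div_comm hp.im_div₁₃
  have key := theta0_modular h1 h3 hi (z := p.1) fun i j h => hp.z_ne_three i 0 j (by simpa using h)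
  have h0 : theta0 (p.1 / p.2 0) (p.2 2 / p.2 0) ≠ 0 := fun h => by
    rw [h, zero_mul] at key
    exact Complex.exp_ne_zero _ key.symm
  rw [G.b_inv_smul]
  simp only [Matrix.cons_val]
  rw [div_neg, div_neg, theta0_neg_neg _ hi, ← mul_right_inj' h0, mul_left_comm,
    mul_inv_cancel₀ h0, mul_left_comm _ Complex.I, mul_left_comm _ (phaseA p), key, phaseA, phaseA,
    ← Complex.exp_add, mul_one]
  have e : ∀ t : ℂ, Complex.I * Complex.exp t = Complex.exp (Real.pi / 2 * Complex.I + t) := by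
    intro t
    rw [Complex.exp_add, Complex.exp_pi_div_two_mul_I]
  rw [e]
  congr 1
  simp only [Matrix.cons_val, bern₂]
  field_simp
  ring

namespace E

/-- `ê₂₁⁻¹ ê₁₂ ê₂₁⁻¹`. -/
def s : E := (e 1 0 (by decide))⁻¹ * e 0 1 (by decide) * (e 1 0 (by decide))⁻¹

/-- `b̂`. -/
def b : E := e 2 0 (by decide) * (e 0 2 (by decide))⁻¹ * e 2 0 (by decide)

theorem proj_s : proj s = G.s := by simp only [s, map_mul, map_inv, proj_e, G.s]

theorem proj_b : proj b = G.b := by simp only [b, map_mul, map_inv, proj_e, G.b]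

theorem val_inv_eq_one {x : E} (h : val x = 1) : val x⁻¹ = 1 := by
  have := val_mul_inv x
  rw [h, inv_one, smul_eq_iff_eq_inv_smul, smul_one] at this
  exact this

theorem val_b : val b = 1 := by
  have h := val_e_eq_one (i := 2) (j := 0) (by decide) (by decide)
  have h' := val_inv_eq_one (val_e_eq_one (i := 0) (j := 2) (by decide) (by decide))
  simp only [b, val_mul, h, h', smul_one, mul_one]

theorem rep_s : Rep (val s) fun p => g12 p.1 (p.2 0) (p.2 1 + p.2 0) (p.2 2) := by
  have h := val_inv_eq_one (val_e_eq_one (i := 1) (j := 0) (by decide) (by decide))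
  have : val s = (G.e 1 0 (by decide))⁻¹ • val (e 0 1 (by decide)) := by
    simp only [s, val_mul, h, smul_one, mul_one, one_mul, map_inv, proj_e]
  rw [this]
  refine ((rep_e 0 1 (by decide)).smul _).eqOn fun p _ => ?_
  rw [inv_inv, G.e_smul]
  simp [valE]

/-- The value is a product of an inverse gamma function and a gamma function whose arguments differ
by the shift `-x₂/x₃`. Their quotient is a theta function, in which `x₂` no longer occurs. -/
theorem rep_s_sq : Rep (val (s ^ 2)) fun p => theta0 (p.1 / p.2 2) (p.2 0 / p.2 2) := by
  rw [pow_two, val_mul, proj_s]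
  refine (rep_s.mul (rep_s.smul G.s)).eqOn fun p hp => ?_
  rw [G.s_inv_smul]
  simp only [Matrix.cons_val]
  rw [X.eta p] at hp
  generalize p.1 = z, p.2 0 = x₁, p.2 1 = x₂, p.2 2 = x₃ at hp ⊢
  have h3 := hp.x₃_ne
  have hs := hp.im₁₃
  have ht : (x₂ / x₃).im ≠ 0 := by
    simpa using hp.im ![0, 1, 0] ![0, 0, 1] 1 2 (by decide)
  have hz : ∀ i j : ℤ, z / x₃ + -x₁ / x₃ ≠ i + j * (-x₁ / x₃) := fun i j h => by
    refine hp.z_ne_add (1 - j) 0 i ?_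
    field_simp at h
    push_cast
    linear_combination h
  have h0 := theta0_ne_zero hs hz
  have ht' : (-x₂ / x₃).im ≠ 0 := by simpa [neg_div] using ht
  have hΓ := ellGamma_add_tau (z := z / x₃ + -x₁ / x₃) ht' hs h0
  have hne : ellGamma (z / x₃ + -x₁ / x₃) (-x₂ / x₃) (-x₁ / x₃) ≠ 0 := by
    refine ellGamma_ne_zero ht' hs fun i j k h => ?_
    refine hp.z_ne_add (1 - k) (-j) i ?_
    field_simp at h
    push_cast
    linear_combination h
  have hθ := theta0_neg_tau (z / x₃) hs
  rw [neg_div, neg_neg] at hθ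
  have k1 : g12 z x₁ (x₂ + x₁) x₃ =
      (ellGamma (z / x₃ + -x₁ / x₃ + -x₂ / x₃) (-x₂ / x₃) (-x₁ / x₃))⁻¹ := by
    rw [g12]
    congr 2 <;> ring
  have k2 : g12 z (-x₂) (x₁ + -x₂) x₃ = ellGamma (z / x₃ + -x₁ / x₃) (-x₂ / x₃) (-x₁ / x₃) := by
    have e1 : (z - (x₁ + -x₂)) / x₃ = z / x₃ + -x₁ / x₃ + x₂ / x₃ := by ring
    have e2 : (-x₂ - (x₁ + -x₂)) / x₃ = -x₁ / x₃ := by ring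
    have e3 : z / x₃ + -x₁ / x₃ + x₂ / x₃ + -x₂ / x₃ = z / x₃ + -x₁ / x₃ := by ring
    have hk := ellGamma_neg_sigma (z / x₃ + -x₁ / x₃ + x₂ / x₃) (-x₁ / x₃) ht'
    rw [neg_div x₃ x₂, neg_neg, ← neg_div, e3] at hk
    rw [g12, e1, e2, neg_neg, hk, inv_inv, ellGamma_symm]
  rw [k1, k2, hΓ, hθ, neg_div, mul_inv, mul_assoc, inv_mul_cancel₀ (by rwa [neg_div] at hne),
    mul_one]

variable {c ι : M}

theorem rep_a (hc : Represents (c : N) phaseA) :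
    Rep (val (ofM c * s ^ 2)) fun p => phaseA p * theta0 (p.1 / p.2 2) (p.2 0 / p.2 2) := by
  rw [val_ofM_mul]
  exact (Represents.rep hc).mul rep_s_sq

theorem proj_a : proj (ofM c * s ^ 2) = G.a := by
  rw [map_mul, map_pow, proj_ofM, one_mul, proj_s]
  rfl

theorem a_sq (hc : Represents (c : N) phaseA) : (ofM c * s ^ 2) ^ 2 = 1 := by
  refine ext_val (by rw [map_pow, proj_a, G.a_sq, map_one]) ?_
  rw [pow_two, val_mul, proj_a, val_one]
  exact Subtype.ext <| ((rep_a hc).mul ((rep_a hc).smul G.a)).eq Rep.one fun p hp =>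
    phaseA_mul_theta0_a hp

theorem b_pow : b ^ 4 = 1 := by
  refine ext_val (by rw [map_pow, proj_b, G.b_pow, map_one]) ?_
  simp only [pow_succ, pow_zero, val_mul, val_b, val_one, smul_one, mul_one]

theorem bab (hc : Represents (c : N) phaseA) (hι : Represents (ι : N) fun _ => Complex.I) :
    b * (ofM c * s ^ 2) * b = ofM ι * (ofM c * s ^ 2) := by
  refine ext_val (by
    rw [map_mul, map_mul, proj_b, proj_a, G.bab, map_mul, proj_ofM, one_mul, proj_a]) ?_
  rw [val_mul, val_mul, val_b, smul_one, mul_one, one_mul, proj_b, val_ofM_mul ι]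
  exact Subtype.ext <| ((rep_a hc).smul G.b).eq ((Represents.rep hι).mul (rep_a hc)) fun p hp =>
    phaseA_mul_theta0_b hp

end E

end
end EllipticGamma

namespace EllipticGamma
noncomputable section

/-! ### The dihedral group -/

namespace G

/-- The elements `bⁱ` and `a bⁱ`. -/
def ofDihedral : DihedralGroup 4 → G
  | .r i => b ^ i.val
  | .sr i => a * b ^ i.val

theorem ofDihedral_mul : ∀ x y, ofDihedral (x * y) = ofDihedral x * ofDihedral y := by
  decide +kernel

theorem ofDihedral_injective : Function.Injective ofDihedral := by
  have : ∀ x y, ofDihedral x = ofDihedral y → x = y := by decide +kernel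
  exact fun x y => this x y

/-- The homomorphism from the dihedral group. -/
def dihedralHom : DihedralGroup 4 →* G := MonoidHom.mk' ofDihedral ofDihedral_mul

theorem a_mem : a ∈ D4 := Subgroup.subset_closure (Set.mem_insert _ _)

theorem b_mem : b ∈ D4 := Subgroup.subset_closure (Set.mem_insert_of_mem _ rfl)

theorem range_dihedralHom : dihedralHom.range = D4 := by
  apply le_antisymm
  · rintro _ ⟨i | i, rfl⟩
    · exact pow_mem b_mem _
    · exact mul_mem a_mem (pow_mem b_mem _)
  · rw [D4, Subgroup.closure_le]
    rintro _ (rfl | rfl)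
    · exact ⟨.sr 0, by decide +kernel⟩
    · exact ⟨.r 1, by decide +kernel⟩

theorem nonempty_D4_equiv : Nonempty (D4 ≃* DihedralGroup 4) :=
  ⟨((MonoidHom.ofInjective (f := dihedralHom) ofDihedral_injective).trans
    (MulEquiv.subgroupCongr range_dihedralHom)).symm⟩

theorem D4_le_SL3 : D4 ≤ SL3 := by
  rw [D4, Subgroup.closure_le]
  rintro _ (rfl | rfl)
  · exact ⟨_, a_eq.symm⟩
  · exact ⟨_, b_eq.symm⟩

theorem b_pow_eq_one {j : ℕ} (h : b ^ j = 1) : 4 ∣ j := by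
  rw [← Nat.div_add_mod j 4, pow_add, pow_mul, b_pow, one_pow, one_mul] at h
  have : ∀ i < 4, b ^ i = 1 → i = 0 := by decide +kernel
  exact Nat.dvd_of_mod_eq_zero (this _ (Nat.mod_lt _ (by norm_num)) h)

theorem a_mul_b_pow_ne (j : ℕ) : a * b ^ j ≠ 1 := by
  rw [← Nat.div_add_mod j 4, pow_add, pow_mul, b_pow, one_pow, one_mul]
  have : ∀ i < 4, a * b ^ i ≠ 1 := by decide +kernel
  exact this _ (Nat.mod_lt _ (by norm_num))

end G

/-! ### The presentation of `D̂₄` -/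

namespace DGen

variable {ι : M}

/-- The group with the generators `DGen` and the relations `DGen.rels`. -/
abbrev Pres (ι : M) : Type := PresentedGroup (rels ι)

theorem rel {l r : FreeGroup DGen} (h : IsRel ι l r) :
    PresentedGroup.mk (rels ι) l = PresentedGroup.mk (rels ι) r :=
  PresentedGroup.mk_eq_mk_of_mul_inv_mem (rels := rels ι) ⟨l, r, h, rfl⟩

/-- The generators in the presented group. -/
def pa (ι : M) : Pres ι := PresentedGroup.of .a
def pb (ι : M) : Pres ι := PresentedGroup.of .b
def pm (ι : M) (φ : M) : Pres ι := PresentedGroup.of (.m φ)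

theorem pm_mul (φ ψ : M) : pm ι φ * pm ι ψ = pm ι (φ * ψ) := rel (.mul φ ψ)

theorem pm_one : pm ι 1 = 1 := by
  have := pm_mul (ι := ι) 1 1
  rwa [mul_one, mul_eq_right] at this

theorem pm_inv (φ : M) : (pm ι φ)⁻¹ = pm ι φ⁻¹ :=
  inv_eq_of_mul_eq_one_right (by rw [pm_mul, mul_inv_cancel, pm_one])

theorem pa_pm (φ : M) : pa ι * pm ι φ = pm ι (G.a • φ) * pa ι := rel (.am φ)

theorem pb_pm (φ : M) : pb ι * pm ι φ = pm ι (G.b • φ) * pb ι := rel (.bm φ)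

theorem pa_sq : pa ι * pa ι = 1 := by
  have := rel (ι := ι) .a_sq
  rwa [map_pow, map_one, pow_two] at this

theorem pb_pow : pb ι ^ 4 = 1 := by
  have := rel (ι := ι) .b_pow
  rwa [map_pow, map_one] at this

theorem pb_pa_pb : pb ι * pa ι * pb ι = pm ι ι * pa ι := rel .bab

theorem pb_pa : pb ι * pa ι = pm ι ι * pa ι * pb ι ^ 3 := by
  rw [← pb_pa_pb, mul_assoc _ (pb ι), ← pow_succ', pb_pow, mul_one]

theorem pa_inv : (pa ι)⁻¹ = pa ι := inv_eq_of_mul_eq_one_right pa_sq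

theorem pb_inv : (pb ι)⁻¹ = pb ι ^ 3 :=
  inv_eq_of_mul_eq_one_right (by rw [← pow_succ', pb_pow])

/-- The set of these products contains 1 and is closed under left multiplication by the generators;
inverses of generators reduce to this by `a⁻¹ = a` and `b⁻¹ = b³`. -/
theorem normal_form (x : Pres ι) :
    ∃ φ j, x = pm ι φ * pb ι ^ j ∨ x = pm ι φ * (pa ι * pb ι ^ j) := by
  have hx : x ∈ Subgroup.closure (Set.range (PresentedGroup.of (rels := rels ι))) := by
    rw [PresentedGroup.closure_range_of]
    trivial
  have ha : ∀ y : Pres ι, (∃ φ j, y = pm ι φ * pb ι ^ j ∨ y = pm ι φ * (pa ι * pb ι ^ j)) →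
      ∃ φ j, pa ι * y = pm ι φ * pb ι ^ j ∨ pa ι * y = pm ι φ * (pa ι * pb ι ^ j) := by
    rintro _ ⟨φ, j, rfl | rfl⟩
    · exact ⟨G.a • φ, j, .inr (by rw [← mul_assoc, pa_pm, mul_assoc])⟩
    · refine ⟨G.a • φ, j, .inl ?_⟩
      rw [← mul_assoc, pa_pm, mul_assoc, ← mul_assoc (pa ι), pa_sq, one_mul]
  have hb : ∀ y : Pres ι, (∃ φ j, y = pm ι φ * pb ι ^ j ∨ y = pm ι φ * (pa ι * pb ι ^ j)) →
      ∃ φ j, pb ι * y = pm ι φ * pb ι ^ j ∨ pb ι * y = pm ι φ * (pa ι * pb ι ^ j) := by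
    rintro _ ⟨φ, j, rfl | rfl⟩
    · exact ⟨G.b • φ, j + 1, .inl (by rw [← mul_assoc, pb_pm, mul_assoc, ← pow_succ'])⟩
    · refine ⟨G.b • φ * ι, 3 + j, .inr ?_⟩
      rw [← mul_assoc, pb_pm, mul_assoc, ← mul_assoc (pb ι), pb_pa, ← pm_mul, pow_add]
      simp only [mul_assoc]
  have hm : ∀ (ψ : M) (y : Pres ι),
      (∃ φ j, y = pm ι φ * pb ι ^ j ∨ y = pm ι φ * (pa ι * pb ι ^ j)) →
      ∃ φ j, pm ι ψ * y = pm ι φ * pb ι ^ j ∨ pm ι ψ * y = pm ι φ * (pa ι * pb ι ^ j) := by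
    rintro ψ _ ⟨φ, j, rfl | rfl⟩
    · exact ⟨ψ * φ, j, .inl (by rw [← pm_mul, mul_assoc])⟩
    · exact ⟨ψ * φ, j, .inr (by rw [← pm_mul, mul_assoc])⟩
  induction hx using Subgroup.closure_induction_left with
  | one => exact ⟨1, 0, .inl (by rw [pm_one, pow_zero, mul_one])⟩
  | mul_left x hx y _ ih =>
    obtain ⟨g, rfl⟩ := hx
    cases g with
    | a => exact ha y ih
    | b => exact hb y ih
    | m φ => exact hm φ y ih
  | inv_mul_cancel x hx y _ ih =>
    obtain ⟨g, rfl⟩ := hx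
    cases g with
    | a =>
      change ∃ φ j, (pa ι)⁻¹ * y = _ ∨ (pa ι)⁻¹ * y = _
      rw [pa_inv]
      exact ha y ih
    | b =>
      change ∃ φ j, (pb ι)⁻¹ * y = _ ∨ (pb ι)⁻¹ * y = _
      rw [pb_inv, pow_succ, pow_succ, pow_one, mul_assoc, mul_assoc]
      exact hb _ (hb _ (hb _ ih))
    | m φ =>
      change ∃ ψ j, (pm ι φ)⁻¹ * y = _ ∨ (pm ι φ)⁻¹ * y = _
      rw [pm_inv]
      exact hm _ y ih

variable {α β : D4hat} (hα : (D4hat.proj α : G) = G.a) (hβ : (D4hat.proj β : G) = G.b)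

include hα hβ

theorem lift_surjective : Function.Surjective (FreeGroup.lift (toHat α β)) := by
  have h1 : ∀ g ∈ G.D4, ∃ y, (D4hat.proj (FreeGroup.lift (toHat α β) y) : G) = g := by
    intro g hg
    induction hg using Subgroup.closure_induction with
    | mem g hg =>
      obtain rfl | rfl := hg
      · exact ⟨fa, by rw [FreeGroup.lift_apply_of]; exact hα⟩
      · exact ⟨fb, by rw [FreeGroup.lift_apply_of]; exact hβ⟩
    | one => exact ⟨1, by simp⟩
    | mul x y _ _ hx hy =>
      obtain ⟨x', rfl⟩ := hx
      obtain ⟨y', rfl⟩ := hy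
      exact ⟨x' * y', by simp⟩
    | inv x _ hx =>
      obtain ⟨x', rfl⟩ := hx
      exact ⟨x'⁻¹, by simp⟩
  intro x
  obtain ⟨y, hy⟩ := h1 _ (D4hat.proj x).2
  have : x * (FreeGroup.lift (toHat α β) y)⁻¹ ∈ D4hat.proj.ker := by
    rw [MonoidHom.mem_ker, map_mul, map_inv, Subtype.ext hy, mul_inv_cancel]
  obtain ⟨φ, hφ⟩ := D4hat.extension.range_inl_eq_ker_rightHom.ge this
  refine ⟨fm φ * y, ?_⟩
  rw [map_mul, FreeGroup.lift_apply_of]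
  exact eq_mul_inv_iff_mul_eq.1 hφ

theorem lift_rel (ha : α ^ 2 = 1) (hb : β ^ 4 = 1) (hab : β * α * β = D4hat.ofM ι * α)
    {l r : FreeGroup DGen} (h : IsRel ι l r) :
    FreeGroup.lift (toHat α β) l = FreeGroup.lift (toHat α β) r := by
  have hconj : ∀ (x : D4hat) (φ : M),
      x * D4hat.ofM φ = D4hat.ofM ((D4hat.proj x : G) • φ) * x := fun x φ =>
    (eq_mul_inv_iff_mul_eq.1 (D4hat.isModuleExtension x φ)).symm
  cases h with
  | mul φ ψ => simp [toHat]
  | am φ =>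
    simp only [map_mul, FreeGroup.lift_apply_of, toHat]
    rw [hconj, hα]
  | bm φ =>
    simp only [map_mul, FreeGroup.lift_apply_of, toHat]
    rw [hconj, hβ]
  | a_sq => simpa [toHat] using ha
  | b_pow => simpa [toHat] using hb
  | bab => simpa [toHat] using hab

/-- An element of the kernel, in normal form, also has trivial image in `D₄`. This excludes `a bʲ`
and forces `4 ∣ j`, so that only an element of `M` remains, and `M` is embedded in `D̂₄`. -/
theorem ker_lift (ha : α ^ 2 = 1) (hb : β ^ 4 = 1) (hab : β * α * β = D4hat.ofM ι * α) :
    (FreeGroup.lift (toHat α β)).ker = Subgroup.normalClosure (rels ι) := by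
  have hrels : ∀ x ∈ rels ι, FreeGroup.lift (toHat α β) x = 1 := by
    rintro _ ⟨l, r, h, rfl⟩
    rw [map_mul, map_inv, lift_rel hα hβ ha hb hab h, mul_inv_cancel]
  apply le_antisymm
  · intro x hx
    set π : Pres ι →* D4hat := PresentedGroup.toGroup (f := toHat α β) hrels with hπ
    have hπx : π (PresentedGroup.mk (rels ι) x) = 1 := hx
    have hπa : π (pa ι) = α := PresentedGroup.toGroup.of _
    have hπb : π (pb ι) = β := PresentedGroup.toGroup.of _
    have hπm : ∀ φ, π (pm ι φ) = D4hat.ofM φ := fun φ => PresentedGroup.toGroup.of _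
    have hpm : ∀ φ, D4hat.proj (D4hat.ofM φ) = 1 := fun φ => Subtype.ext (E.proj_ofM φ)
    have hone : PresentedGroup.mk (rels ι) x = 1 := by
      obtain ⟨φ, j, h | h⟩ := normal_form (PresentedGroup.mk (rels ι) x)
      · rw [h, map_mul, map_pow, hπm, hπb] at hπx
        have h1 := congrArg (fun y => (D4hat.proj y : G)) hπx
        simp only [map_mul, map_pow, hpm, one_mul, map_one, Subgroup.coe_pow, hβ,
          Subgroup.coe_one] at h1
        obtain ⟨k, rfl⟩ := G.b_pow_eq_one h1
        rw [pow_mul, hb, one_pow, mul_one] at hπx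
        have h2 : φ = 1 := D4hat.extension.inl_injective (hπx.trans (map_one _).symm)
        rw [h, h2, pm_one, pow_mul, pb_pow, one_pow, mul_one]
      · rw [h, map_mul, map_mul, map_pow, hπm, hπb, hπa] at hπx
        have h1 := congrArg (fun y => (D4hat.proj y : G)) hπx
        simp only [map_mul, map_pow, hpm, one_mul, map_one, Subgroup.coe_mul, Subgroup.coe_pow, hα,
          hβ, Subgroup.coe_one] at h1
        exact absurd h1 (G.a_mul_b_pow_ne j)
    exact (QuotientGroup.eq_one_iff x).1 hone
  · exact Subgroup.normalClosure_le_normal fun x hx => hrels x hx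

end DGen

end
end EllipticGamma

namespace EllipticGamma
noncomputable section

/-! ### Quotients of holomorphic functions -/

/-- On the set `U`, the function `F` is a quotient of entire functions. -/
def IsQuot (U : Set X) (F : X → ℂ) : Prop :=
  ∃ P Q : X → ℂ, Differentiable ℂ P ∧ Differentiable ℂ Q ∧ ∀ p ∈ U, Q p ≠ 0 ∧ F p = P p / Q p

namespace IsQuot

variable {U : Set X} {F K : X → ℂ}

theorem const (c : ℂ) : IsQuot U fun _ => c :=
  ⟨fun _ => c, fun _ => 1, differentiable_const _, differentiable_const _, fun _ _ => by simp⟩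

theorem add (hF : IsQuot U F) (hK : IsQuot U K) : IsQuot U fun p => F p + K p := by
  obtain ⟨P, Q, hP, hQ, h⟩ := hF
  obtain ⟨P', Q', hP', hQ', h'⟩ := hK
  refine ⟨fun p => P p * Q' p + Q p * P' p, fun p => Q p * Q' p, (hP.mul hQ').add (hQ.mul hP'),
    hQ.mul hQ', fun p hp => ⟨mul_ne_zero (h p hp).1 (h' p hp).1, ?_⟩⟩
  change F p + K p = _
  rw [(h p hp).2, (h' p hp).2, div_add_div _ _ (h p hp).1 (h' p hp).1]

theorem neg (hF : IsQuot U F) : IsQuot U fun p => -F p := by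
  obtain ⟨P, Q, hP, hQ, h⟩ := hF
  exact ⟨fun p => -P p, Q, hP.neg, hQ, fun p hp =>
    ⟨(h p hp).1, (congrArg Neg.neg (h p hp).2).trans (neg_div _ _).symm⟩⟩

theorem smul (hF : IsQuot U F) (g : G) (hg : ∀ p ∈ U, g • p ∈ U) : IsQuot U fun p => F (g • p) := by
  obtain ⟨P, Q, hP, hQ, h⟩ := hF
  have hd := HolAction.differentiable g
  exact ⟨fun p => P (g • p), fun p => Q (g • p), hP.comp hd, hQ.comp hd,
    fun p hp => h _ (hg p hp)⟩

-- Near `p` the function is a constant integer `n`, so `P = nQ` there. As `P` and `Q` are entire,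
-- the identity holds on the complex line through `p` and `q`. Connectedness of `U` is not needed.
open Filter Topology in
theorem eq_of_forall_int (hF : IsQuot U F) (hU : IsOpen U) (hint : ∀ p ∈ U, ∃ n : ℤ, F p = n)
    {p q : X} (hp : p ∈ U) (hq : q ∈ U) : F p = F q := by
  obtain ⟨P, Q, hP, hQ, h⟩ := hF
  obtain ⟨n, hn⟩ := hint p hp
  have hcont : ContinuousAt F p := by
    have hdiv : ContinuousAt (fun p => P p / Q p) p :=
      hP.continuous.continuousAt.div hQ.continuous.continuousAt (h p hp).1
    refine hdiv.congr ?_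
    filter_upwards [hU.mem_nhds hp] with w hw
    exact (h w hw).2.symm
  have hev : ∀ᶠ w in 𝓝 p, P w = n * Q w := by
    have h1 : ∀ᶠ w in 𝓝 p, dist (F w) (F p) < 1 := Metric.continuousAt_iff'.1 hcont 1 one_pos
    filter_upwards [h1, hU.mem_nhds hp] with w hw hwU
    obtain ⟨m, hm⟩ := hint w hwU
    rw [hn, hm, Complex.dist_eq, ← Int.cast_sub, Complex.norm_intCast] at hw
    have hmn : m = n := by
      have : |m - n| < 1 := by exact_mod_cast hw
      rw [Int.abs_lt_one_iff] at this
      omega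
    obtain ⟨hQw, hFw⟩ := h w hwU
    rw [hm, hmn, eq_div_iff hQw] at hFw
    exact hFw.symm
  have hline : ∀ S : X → ℂ, Differentiable ℂ S →
      AnalyticOnNhd ℂ (fun t : ℂ => S (p + t • (q - p))) Set.univ := fun S hS =>
    DifferentiableOn.analyticOnNhd
      ((hS.comp ((differentiable_const p).add
        (differentiable_id.smul_const (q - p)))).differentiableOn) isOpen_univ
  have hl : Tendsto (fun t : ℂ => p + t • (q - p)) (𝓝 0) (𝓝 p) := by
    have : Continuous fun t : ℂ => p + t • (q - p) := by fun_prop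
    simpa using this.tendsto 0
  have key := (hline P hP).eqOn_of_preconnected_of_eventuallyEq
    (hline (fun w => n * Q w) (hQ.const_mul (n : ℂ))) isPreconnected_univ (Set.mem_univ 0)
    (hl.eventually hev) (Set.mem_univ 1)
  simp only [one_smul, add_sub_cancel] at key
  rw [hn, (h q hq).2, key, mul_div_cancel_right₀ _ (h q hq).1]

end IsQuot

theorem IsRatPhase.exists_isQuot {q : InvFun} (h : IsRatPhase q) :
    ∃ (r : InvPair) (F : X → ℂ), InvFun.mk r = q ∧ IsQuot r.D F ∧ ∀ p ∈ r.D, r.f p = cexp2 (F p) := by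
  obtain ⟨P, Q, d, r, -, -, -, hr, h⟩ := h
  exact ⟨r, fun p => MvPolynomial.aeval (coord p) P / MvPolynomial.aeval p.2 Q, hr,
    ⟨fun p => MvPolynomial.aeval (coord p) P, fun p => MvPolynomial.aeval p.2 Q,
      (differentiable_aeval P).comp differentiable_coord,
      (differentiable_aeval Q).comp differentiable_snd,
      fun p hp => ⟨(h p hp).1, rfl⟩⟩, fun p hp => (h p hp).2⟩

theorem IsQuot.mono {U V : Set X} {F : X → ℂ} (h : IsQuot V F) (hUV : U ⊆ V) : IsQuot U F := by
  obtain ⟨P, Q, hP, hQ, h⟩ := h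
  exact ⟨P, Q, hP, hQ, fun p hp => h p (hUV hp)⟩

/-! ### Non-triviality -/

theorem G.D4_finite : Finite G.D4 := by
  obtain ⟨e⟩ := G.nonempty_D4_equiv
  exact Finite.of_equiv _ e.symm.toEquiv

theorem G.b_inv_smul_four (p : X) : G.b⁻¹ • G.b⁻¹ • G.b⁻¹ • G.b⁻¹ • p = p := by
  have : G.b⁻¹ * (G.b⁻¹ * (G.b⁻¹ * G.b⁻¹)) = 1 := by decide +kernel
  simpa only [mul_smul, one_smul] using congrArg (· • p) this

theorem G.a_inv_b_inv_smul (p : X) :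
    G.a⁻¹ • G.b⁻¹ • p = G.b⁻¹ • G.b⁻¹ • G.b⁻¹ • G.a⁻¹ • p := by
  have : G.a⁻¹ * G.b⁻¹ = G.b⁻¹ * (G.b⁻¹ * (G.b⁻¹ * G.a⁻¹)) := by decide +kernel
  simpa only [mul_smul] using congrArg (· • p) this

theorem G.a_inv_b_inv_sq_smul (p : X) :
    G.a⁻¹ • G.b⁻¹ • G.b⁻¹ • p = G.b⁻¹ • G.b⁻¹ • G.a⁻¹ • p := by
  rw [G.a_inv_b_inv_smul, G.a_inv_b_inv_smul, G.b_inv_smul_four]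

theorem G.a_inv_b_inv_cube_smul (p : X) :
    G.a⁻¹ • G.b⁻¹ • G.b⁻¹ • G.b⁻¹ • p = G.b⁻¹ • G.a⁻¹ • p := by
  rw [G.a_inv_b_inv_smul, G.a_inv_b_inv_sq_smul, G.b_inv_smul_four]

/-- The obstruction. With `f = e^{2πiF}` and `h = e^{2πiH}`, the equations say that the sum `m` of
`H` over the powers of `b⁻¹`, and the function `k = H + F∘b⁻¹ + H∘(a⁻¹b⁻¹) + 1/4 - F`, are integer
valued. Both are quotients of entire functions, hence constant. -/
theorem no_phase_solution (f h ι : M) (hι : Represents (ι : N) fun _ => Complex.I)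
    (h1 : h * G.b • h * G.b • G.b • h * G.b • G.b • G.b • h = 1)
    (h2 : h * G.b • f * G.b • G.a • h * ι = f) : False := by
  obtain ⟨r, F, hr, hrF, hrf⟩ := IsRatPhase.exists_isQuot f.2
  obtain ⟨s, H, hs, hsH, hsf⟩ := IsRatPhase.exists_isQuot h.2
  obtain ⟨t, ht, htf⟩ := hι
  set D : Set X := r.D ∩ s.D ∩ t.D with hD
  have hDo : IsOpen D := (r.isOpen.inter s.isOpen).inter t.isOpen
  have hDd : Dense D := (r.dense.inter_of_isOpen_left s.dense r.isOpen).inter_of_isOpen_left t.dense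
    (r.isOpen.inter s.isOpen)
  have := G.D4_finite
  -- A dense open set stable under `D₄`, on which all translates of the logarithms are defined.
  set U : Set X := ⋂ g : G.D4, {p | (g : G) • p ∈ D} with hU
  have hact : ∀ g : G, Continuous fun p : X => g • p := fun g =>
    (HolAction.differentiable g).continuous
  have hUo : IsOpen U := isOpen_iInter_of_finite fun g => hDo.preimage (hact g)
  have hUd : Dense U := dense_iInter_of_isOpen (fun g => hDo.preimage (hact g)) fun g => by
    have := (MulAction.surjective (α := G) (β := X) (g : G)⁻¹).denseRange.dense_image (hact _) hDd
    refine this.mono ?_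
    rintro _ ⟨p, hp, rfl⟩
    simpa using hp
  have hUinv : ∀ g ∈ G.D4, ∀ p ∈ U, g • p ∈ U := by
    intro g hg p hp
    refine Set.mem_iInter.2 fun k => ?_
    have := Set.mem_iInter.1 hp (k * ⟨g, hg⟩)
    simpa [mul_smul] using this
  have hUD : ∀ p ∈ U, p ∈ D := fun p hp => by
    have := Set.mem_iInter.1 hp 1
    simpa using this
  have hB : ∀ p ∈ U, G.b⁻¹ • p ∈ U := hUinv _ (inv_mem G.b_mem)
  have hA : ∀ p ∈ U, G.a⁻¹ • p ∈ U := hUinv _ (inv_mem G.a_mem)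
  have hUr : ∀ p ∈ U, p ∈ r.D := fun p hp => (hUD p hp).1.1
  have hUs : ∀ p ∈ U, p ∈ s.D := fun p hp => (hUD p hp).1.2
  have hUt : ∀ p ∈ U, p ∈ t.D := fun p hp => (hUD p hp).2
  have hF : IsQuot U F := hrF.mono hUr
  have hH : IsQuot U H := hsH.mono hUs
  have hHB := hH.smul G.b⁻¹ hB
  have hHBB := hHB.smul G.b⁻¹ hB
  have hHBBB := hHBB.smul G.b⁻¹ hB
  have hFB := hF.smul G.b⁻¹ hB
  have hHAB := (hH.smul G.a⁻¹ hA).smul G.b⁻¹ hB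
  have e1 : InvFun.mk (((s.mul (s.act G.b)).mul ((s.act G.b).act G.b)).mul
      (((s.act G.b).act G.b).act G.b)) = InvFun.mk InvPair.one := by
    have := congrArg (fun φ : M => ((φ : N) : InvFun)) h1
    simp only [Subgroup.coe_mul, M.coe_smul, N.coe_smul, ← hs] at this
    exact this
  have e2 : InvFun.mk (((s.mul (r.act G.b)).mul ((s.act G.a).act G.b)).mul t) = InvFun.mk r := by
    have := congrArg (fun φ : M => ((φ : N) : InvFun)) h2
    simp only [Subgroup.coe_mul, M.coe_smul, N.coe_smul, ← hs, ← hr, ← ht] at this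
    exact this
  rw [InvFun.mk_eq] at e1 e2
  set m : X → ℂ := fun p => H p + H (G.b⁻¹ • p) + H (G.b⁻¹ • G.b⁻¹ • p)
    + H (G.b⁻¹ • G.b⁻¹ • G.b⁻¹ • p) with hm
  set k : X → ℂ := fun p => H p + F (G.b⁻¹ • p) + H (G.a⁻¹ • G.b⁻¹ • p) + 1 / 4 + -F p with hk
  have hmq : IsQuot U m := ((hH.add hHB).add hHBB).add hHBBB
  have hkq : IsQuot U k := (((hH.add hFB).add hHAB).add (.const (1 / 4))).add hF.neg
  have hmi : ∀ p ∈ U, ∃ n : ℤ, m p = n := by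
    intro p hp
    have hp1 := hB p hp
    have hp2 := hB _ hp1
    have hp3 := hB _ hp2
    have := e1 ⟨⟨⟨⟨hUs _ hp, hUs _ hp1⟩, hUs _ hp2⟩, hUs _ hp3⟩, trivial⟩
    change s.f p * s.f (G.b⁻¹ • p) * s.f (G.b⁻¹ • G.b⁻¹ • p) *
      s.f (G.b⁻¹ • G.b⁻¹ • G.b⁻¹ • p) = 1 at this
    rw [hsf _ (hUs _ hp), hsf _ (hUs _ hp1), hsf _ (hUs _ hp2), hsf _ (hUs _ hp3), ← cexp2_add,
      ← cexp2_add, ← cexp2_add, cexp2_eq_one_iff] at this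
    exact this
  have hki : ∀ p ∈ U, ∃ n : ℤ, k p = n := by
    intro p hp
    have hp1 := hB p hp
    have hp2 := hA _ hp1
    have := e2 ⟨⟨⟨⟨hUs _ hp, hUr _ hp1⟩, hUs _ hp2⟩, hUt _ hp⟩, hUr _ hp⟩
    change s.f p * r.f (G.b⁻¹ • p) * s.f (G.a⁻¹ • G.b⁻¹ • p) * t.f p = r.f p at this
    have hI : Complex.I = cexp2 (1 / 4) := by
      rw [cexp2, show 2 * Real.pi * Complex.I * (1 / 4) = Real.pi / 2 * Complex.I by ring,
        Complex.exp_pi_div_two_mul_I]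
    rw [hsf _ (hUs _ hp), hrf _ (hUr _ hp1), hsf _ (hUs _ hp2), htf (hUt _ hp), hrf _ (hUr _ hp),
      hI, ← cexp2_add, ← cexp2_add, ← cexp2_add, ← mul_inv_eq_one₀ (cexp2_ne_zero _), ← cexp2_neg,
      ← cexp2_add, cexp2_eq_one_iff] at this
    exact this
  obtain ⟨p, hp⟩ := hUd.nonempty
  have hp1 := hB p hp
  have hp2 := hB _ hp1
  have hp3 := hB _ hp2
  have hpA := hA p hp
  have kc : ∀ {q}, q ∈ U → k q = k p := fun hq => hkq.eq_of_forall_int hUo hki hq hp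
  have mc := hmq.eq_of_forall_int hUo hmi hpA hp
  have k1 := kc hp1
  have k2 := kc hp2
  have k3 := kc hp3
  obtain ⟨K, hK⟩ := hki p hp
  obtain ⟨L, hL⟩ := hmi p hp
  have hb4 := G.b_inv_smul_four p
  have c1 := G.a_inv_b_inv_smul p
  have c2 := G.a_inv_b_inv_sq_smul p
  have c3 := G.a_inv_b_inv_cube_smul p
  simp only [hk, hm, hb4, c1, c2, c3] at k1 k2 k3 mc hK hL
  -- The sum of `k` over the four points `b⁻ⁱ p`: `F` telescopes, the first terms in `H` give `m p`,
  -- the second give `m (a⁻¹ p)`, and the quarters add up to 1.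
  have key : (4 * K : ℂ) = 2 * L + 1 := by
    linear_combination -4 * hK + 2 * hL - k1 - k2 - k3 + mc
  have key' : 4 * K = 2 * L + 1 := by exact_mod_cast key
  omega

/-- If the class vanishes, correcting a section by the cochain `x` gives a homomorphism `σ` from
`D₄` to `E`. It has the form `σ(a) = f â`, `σ(b) = h b̂` with `f`, `h` in `M`, and the values of `b⁴
= 1` and `bab = a` under `σ` are the two equations excluded above. -/
theorem restrict_connecting_ne_zero {u : G → N ⧸ M} (hu : IsGammaCocycle u) :
    restrict G.D4 (connecting hu.cocycle) ≠ 0 := by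
  rw [D4hat.restrict_connecting hu, charClass, Ne, classOf_eq_zero_iff]
  rintro ⟨x, hx⟩
  obtain ⟨c, hc⟩ := exists_c
  obtain ⟨ι, hι⟩ := exists_I
  set σ : G.D4 → E := fun g => E.ofM (x g)⁻¹ * ((extSection D4hat.extension g : D4hat) : E) with hσ
  have hps : ∀ g, E.proj ((extSection D4hat.extension g : D4hat) : E) = g := fun g =>
    congrArg Subtype.val (rightHom_extSection D4hat.extension g)
  have hpσ : ∀ g, E.proj (σ g) = g := fun g => by
    rw [hσ, map_mul, E.proj_ofM, one_mul, hps]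
  have hmul : ∀ g h, σ g * σ h = σ (g * h) := by
    intro g h
    have hf := congrArg (fun y : D4hat => (y : E)) (factorSet_spec D4hat.extension g h)
    change _ * _ = E.ofM _ * _ at hf
    have hcj := E.conj_ofM ((extSection D4hat.extension g : D4hat) : E) (x h)⁻¹
    rw [hps, mul_inv_eq_iff_eq_mul] at hcj
    simp only [hσ]
    rw [mul_assoc, ← mul_assoc _ (E.ofM (x h)⁻¹), hcj, mul_assoc, hf, ← mul_assoc, ← mul_assoc,
      ← map_mul, ← map_mul, ← hx]
    congr 2
    change (x g)⁻¹ * ((g : G) • (x h)⁻¹) * ((g : G) • x h / x (g * h) * x g) = _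
    rw [smul_inv', ← mul_inv, div_eq_mul_inv, inv_mul_eq_iff_eq_mul, mul_right_comm,
      mul_comm (_ • _)]
  clear_value σ
  have hone : σ 1 = 1 := by
    have := hmul 1 1
    rwa [mul_one, mul_eq_right] at this
  set A : G.D4 := ⟨G.a, G.a_mem⟩
  set B : G.D4 := ⟨G.b, G.b_mem⟩
  have hex : ∀ (g : G.D4) (y : E), E.proj y = g → ∃ φ : M, σ g = E.ofM φ * y := by
    intro g y hy
    have : σ g * y⁻¹ ∈ E.proj.ker := by
      rw [MonoidHom.mem_ker, map_mul, map_inv, hpσ, hy, mul_inv_cancel]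
    rw [E.ker_proj] at this
    obtain ⟨φ, hφ⟩ := this
    exact ⟨φ, by rw [hφ, inv_mul_cancel_right]⟩
  obtain ⟨f, hf⟩ := hex A (E.ofM c * E.s ^ 2) E.proj_a
  obtain ⟨h, hh⟩ := hex B E.b E.proj_b
  have vB : E.val (σ B) = h := by rw [hh, E.val_ofM_mul, E.val_b, mul_one]
  have vA : E.val (σ A) = f * E.val (E.ofM c * E.s ^ 2) := by rw [hf, E.val_ofM_mul f]
  -- Since `b̂` has value 1, the relation `b̂âb̂ = iâ` says that the value of `â` is an
  -- eigenfunction of `b` with eigenvalue `i`; this brings `ι` into the second equation.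
  have hb : G.b • E.val (E.ofM c * E.s ^ 2) = ι * E.val (E.ofM c * E.s ^ 2) := by
    have := congrArg E.val (E.bab hc hι)
    rwa [E.val_mul, E.val_mul, E.val_b, smul_one, mul_one, one_mul, E.proj_b,
      E.val_ofM_mul ι] at this
  refine no_phase_solution f h ι hι (Subtype.ext ?_) (Subtype.ext ?_)
  · have hB4 : σ B * σ B * σ B * σ B = 1 := by
      rw [hmul, hmul, hmul, ← hone]
      congr 1
      refine Subtype.ext ((?_ : G.b * G.b * G.b * G.b = G.b ^ 4).trans G.b_pow)
      simp only [pow_succ, pow_zero, one_mul]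
    have := congrArg E.val hB4
    simp only [E.val_mul, E.val_one, map_mul, hpσ, vB, mul_smul] at this
    exact this
  · have hBAB : σ B * σ A * σ B = σ A := by
      rw [hmul, hmul]
      congr 1
      exact Subtype.ext G.bab
    have := congrArg E.val hBAB
    rw [E.val_mul, E.val_mul, map_mul, hpσ, hpσ, vB, vA, smul_mul', mul_smul] at this
    change (h : N) * (G.b • (f : N) * G.b • E.val (E.ofM c * E.s ^ 2)) * G.b • G.a • (h : N) =
      _ at this
    rw [hb] at this
    refine mul_right_cancel (b := E.val (E.ofM c * E.s ^ 2)) (Eq.trans ?_ this)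
    change ((h : N) * G.b • (f : N) * G.b • G.a • (h : N) * ι) * _ = _
    simp only [mul_comm, mul_left_comm, mul_assoc]

end
end EllipticGamma

theorem mainTheorem4 :
    (∃! u : G → N ⧸ M, IsGammaCocycle u) ∧
    ∀ (u : G → N ⧸ M) (hu : IsGammaCocycle u),
      (G.D4 ≤ G.SL3 ∧ Nonempty (G.D4 ≃* DihedralGroup 4) ∧
        G.a ^ 2 = 1 ∧ G.b ^ 4 = 1 ∧ G.b * G.a * G.b = G.a) ∧
      (∃ (S : GroupExtension M D4hat G.D4) (hS : IsModuleExtension S),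
        S.inl = D4hat.ofM ∧ S.rightHom = D4hat.proj ∧
        restrict G.D4 (connecting hu.cocycle) = charClass S hS) ∧
      (∃ (c ι : M) (α β : D4hat),
        Represents (c : N) (fun p => Complex.exp (Real.pi * Complex.I / 2 *
          (p.1 ^ 2 / (p.2 0 * p.2 2) - 2 * p.1 / p.2 2 + 1
            + p.2 0 / (6 * p.2 2) + p.2 2 / (6 * p.2 0)))) ∧
        Represents (ι : N) (fun _ => Complex.I) ∧
        (α : E) = E.ofM c * ((E.e 1 0 (by decide))⁻¹ * E.e 0 1 (by decide) *
          (E.e 1 0 (by decide))⁻¹) ^ 2 ∧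
        (β : E) = E.e 2 0 (by decide) * (E.e 0 2 (by decide))⁻¹ * E.e 2 0 (by decide) ∧
        (D4hat.proj α : G) = G.a ∧ (D4hat.proj β : G) = G.b ∧
        α ^ 2 = 1 ∧ β ^ 4 = 1 ∧ β * α * β = D4hat.ofM ι * α ∧
        Function.Surjective (FreeGroup.lift (DGen.toHat α β)) ∧
        (FreeGroup.lift (DGen.toHat α β)).ker = Subgroup.normalClosure (DGen.rels ι)) ∧
      restrict G.D4 (connecting hu.cocycle) ≠ 0 ∧
      restrict G.SL3 (connecting hu.cocycle) ≠ 0 := by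
  refine ⟨⟨gammaCocycle, isGammaCocycle_gammaCocycle,
    fun u hu => hu.unique isGammaCocycle_gammaCocycle⟩, fun u hu => ⟨⟨G.D4_le_SL3,
    G.nonempty_D4_equiv, G.a_sq, G.b_pow, G.bab⟩, ⟨D4hat.extension, D4hat.isModuleExtension, rfl,
    rfl, D4hat.restrict_connecting hu⟩, ?_, restrict_connecting_ne_zero hu,
    restrict_ne_zero_of_le (isMulCocycle₂_coboundaryOfLift hu.cocycle) G.D4_le_SL3
      (restrict_connecting_ne_zero hu)⟩⟩
  obtain ⟨c, hc⟩ := exists_c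
  obtain ⟨ι, hι⟩ := exists_I
  let α : D4hat := ⟨E.ofM c * E.s ^ 2, Subgroup.mem_comap.2 (E.proj_a (c := c) ▸ G.a_mem)⟩
  let β : D4hat := ⟨E.b, Subgroup.mem_comap.2 (E.proj_b ▸ G.b_mem)⟩
  have hα : (D4hat.proj α : G) = G.a := E.proj_a
  have hβ : (D4hat.proj β : G) = G.b := E.proj_b
  have ha : α ^ 2 = 1 := Subtype.ext (E.a_sq hc)
  have hb : β ^ 4 = 1 := Subtype.ext E.b_pow
  have hab : β * α * β = D4hat.ofM ι * α := Subtype.ext (E.bab hc hι)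
  exact ⟨c, ι, α, β, hc, hι, rfl, rfl, hα, hβ, ha, hb, hab, DGen.lift_surjective hα hβ,
    DGen.ker_lift hα hβ ha hb hab⟩
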